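/- **Setting.** Let $T,L,m>0$, $x_0<0$, $\beta\in(0,1)$ with $\beta T>\sup_{x\in(0,L)}|x-x_0|=L-x_0$. Put $\varphi(t,x)=|x-x_0|^2-\beta t^2$, $\mathcal O=\{(t,x)\in(0,T)\times(0,L):\beta t>|x-x_0|\}$, and let $\eta\in C^2(\mathbb R)$, $0\le\eta\le1$, $\eta=0$ on $(-\infty,0]$, $\eta=1$ on $[x_0^2,\infty)$. Let $W[Q]\in C^0([0,T];H^1(0,L))\cap C^1([0,T];L^2(0,L))$ solve $\partial_t^2W-\partial_x^2W+QW=f$ in $(0,T)\times(0,L)$, $W=f_\partial$ at $x\in\{0,L\}$, $(W,\partial_tW)(0)=(w_0,w_1)$, where $f\in L^1(0,T;L^2(0,L))$, $f_\partial(\cdot,0),f_\partial(\cdot,L)\in H^1(0,T)$, $w_0\in H^1(0,L)$, $w_1\in L^2(0,L)$ and $f_\partial(0,x)=w_0(x)$ at $x\in\{0,L\}$; let $M=\partial_nW[Q](\cdot,L)\in L^2(0,T)$ be the measured flux, and assume that $\eta(\varphi(t,L))\,\partial_tM\in L^2(0,T)$. For $N\in\mathbb N$ let $h=L/(N+1)$,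 $x_j=jh$ for $1\le j\le N+1$ (the index $j=0$ stands for the mesh point $0$; $x_0$ is the base point above), $(\partial_h^+v)_j=(v_{j+1}-v_j)/h$, $(\Delta_hv)_j=(v_{j+1}-2v_j+v_{j-1})/h^2$, $\int_{(0,L)_h}v=h\sum_{j=1}^Nv_j$, $\int_{[0,L)_h}v=h\sum_{j=0}^Nv_j$. For each $h$ let discrete data be given: $f_h\in L^1(0,T;\mathbb R^N)$, absolutely continuous boundary data $f_{\partial,h}(\cdot,0),f_{\partial,h}(\cdot,L)$ on $[0,T]$, and initial data $w_{0,h},w_{1,h}\in\mathbb R^N$ with $\sup_h\max_{(0,L)_h}|w_{0,h}|<\infty$. For $q_h\in\mathbb R^N$ let $w_h[q_h]$ be the solution on $[0,T]$ of $$\partial_t^2w_h-\Delta_hw_h+q_hw_h=f_h\ \text{in }(0,L)_h,\quad w_h(t,0)=f_{\partial,h}(t,0),\ w_h(t,L)=f_{\partial,h}(t,L),\quad (w_h,\partial_tw_h)(0)=(w_{0,h},w_{1,h})\ \text{in }(0,L)_h.$$ For a function $v$ on the mesh, $v_j$ or $v_{j,h}$ is its value at $x_j$ (only $w_{0,h},w_{1,h}$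 denote the initial data), and $(0,L)_h=\{x_1,\dots,x_N\}$, $[0,L)_h=\{0,x_1,\dots,x_N\}$. **Algorithm.** Let $\mathcal T_h$ be the set of $z_h\in H^2(0,T;\mathbb R^{N+2})$ with $z_{0,h}=z_{N+1,h}=0$ and $z_h(0)=0$, and for $s>0$ let $$\begin{aligned}J_{s,q_h,h}[\mu,g,\nu](z_h)={}&\tfrac12\int_0^T\!\!\int_{(0,L)_h}e^{2s\varphi}|\partial_t^2z_h-\Delta_hz_h+q_hz_h-g|^2dt+\tfrac s2\int_0^Te^{2s\varphi(t,L)}\Big|\tfrac{-z_{N,h}}h-\mu\Big|^2dt\\&+\tfrac{s^3}2\int_0^T\!\!\int_{(0,L)_h}\mathbf 1_{\mathcal O}e^{2s\varphi}|z_h|^2dt+\tfrac{sh^2}2\int_0^T\!\!\int_{[0,L)_h}e^{2s\varphi}|\partial_t\partial_h^+z_h-\nu|^2dt.\end{aligned}$$ Start from $q_h^0=0$. Given $q_h^k$, let $w_h^k=w_h[q_h^k]$, $$\tilde\mu_h^k(t)=\eta(\varphi(t,L))\,\partial_t\Big(\tfrac{w^k_{N+1,h}-w^k_{N,h}}h-M\Big)(t)\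 \text{ on }(0,T),\qquad \tilde\nu_h^k=\partial_t\partial_h^+(\eta(\varphi)\partial_tw_h^k)\ \text{ in }(0,T)\times[0,L)_h,$$ let $\tilde Z_h^k$ be the minimizer of $J_{s,q_h^k,h}[\tilde\mu_h^k,0,\tilde\nu_h^k]$ over $\mathcal T_h$, and set $q_h^{k+1}=T_m\big(q_h^k+\partial_t\tilde Z_h^k(0)/w_{0,h}\big)$ in $(0,L)_h$, where $T_m(q)=q$ if $|q|\le m$ and $T_m(q)=\operatorname{sign}(q)m$ otherwise. **Assumptions.** (i) $W[Q]\in H^1(0,T;L^\infty(0,L))$, $\|Q\|_{L^\infty(0,L)}\le m$, and $|w_0|\ge\alpha_0$ in $(0,L)$ for some $\alpha_0>0$. (ii) There is $\alpha>0$ independent of $h$ with $|w_{0,h}|\ge\alpha$ on $(0,L)_h$ for all $h$. (iii) There are discrete potentials $Q_h\in\mathbb R^N$ with $\max_{(0,L)_h}|Q_h|\le m$ for all $h$, whose piecewise constant extensions converge to $Q$ in $L^2(0,L)$ as $h\to0$, and such that, with $W_h=w_h[Q_h]$: $\sup_h\int_0^T\sup_{(0,L)_h}|\partial_tW_h|^2dt<\infty$;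 for each $h$, $\partial_h^+(\eta(\varphi)\partial_tW_h)\in H^1(0,T;\mathbb R^{N+1})$; and, as $h\to0$, $$\int_0^T\eta(\varphi(t,L))^2\Big|\tfrac{\partial_tW_{N+1,h}-\partial_tW_{N,h}}h-\partial_tM\Big|^2dt\to0,\qquad\int_0^T\!\!\int_{[0,L)_h}|h\,\partial_h^+\partial_t(\eta(\varphi)\partial_tW_h)|^2dt\to0.$$ For $s>0$ write $$E_h(s)=\int_0^T\!\!\int_{[0,L)_h}e^{2s\varphi}|h\,\partial_h^+\partial_t(\eta(\varphi)\partial_tW_h)|^2dt+\int_0^Te^{2s\varphi(t,L)}\eta(\varphi(t,L))^2\Big|\tfrac{\partial_tW_{N+1,h}-\partial_tW_{N,h}}h-\partial_tM\Big|^2dt.$$ **Theorem.** There are constants $C_0,C_1,s_0,\varepsilon_0,h_0>0$, independent of $s$, $h$ and $k$, such that the following hold. 1. For every $h\le h_0$ and every $s>0$ the algorithm is well-posed: for every $q_h$ with $\max_{(0,L)_h}|q_h|\le m$, the solution $w_h[q_h]$ exists and is unique, the data $\tilde\mu_h,\tilde\nu_h$ built from it are square integrable, and the functional $J_{s,q_h,h}[\tilde\mu_h,0,\tilde\nu_h]$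 has a unique minimizer over $\mathcal T_h$; so the algorithm produces exactly one sequence $(q_h^k)_{k\in\mathbb N}$. 2. For all $h\le h_0$, all $s\in[s_0,\varepsilon_0/h]$ and all $k\in\mathbb N$, $$\int_{(0,L)_h}e^{2s\varphi(0,\cdot)}|q_h^{k+1}-Q_h|^2\le\frac{C_0}{\sqrt s}\int_{(0,L)_h}e^{2s\varphi(0,\cdot)}|q_h^k-Q_h|^2+C_1s^{1/2}E_h(s).$$ 3. For all $h\le h_0$ and all $s\in[4C_0^2,\varepsilon_0/h]$, $$\int_{(0,L)_h}e^{2s\varphi(0,\cdot)}|q_h^k-Q_h|^2\le\frac1{2^k}\int_{(0,L)_h}e^{2s\varphi(0,\cdot)}|Q_h|^2+2C_1s^{1/2}E_h(s)\qquad(k\in\mathbb N),$$ so that for every $r>2C_1s^{1/2}E_h(s)$ the left-hand side is smaller than $r$ for all large $k$. 4. For each fixed $s>0$, the size $2C_1s^{1/2}E_h(s)$ of this neighborhood of $Q_h$ tends to $0$ as $h\to0$. -/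

import Mathlib

open MeasureTheory Set Filter Topology
open scoped ContDiff

noncomputable section

namespace WaveRecovery

/-! ### Functions of one variable on `[0, T]` -/

/-- Derivative of a function on the interval `[0, T]` (one-sided at the end points). -/
def dt (T : ℝ) (u : ℝ → ℝ) : ℝ → ℝ := derivWithin u (Icc 0 T)

/-- `L²(0, T)`. -/
def MemL2 (T : ℝ) (u : ℝ → ℝ) : Prop := MemLp u 2 (volume.restrict (Ioo 0 T))

/-- `H¹(0, T)`: absolutely continuous functions on `[0, T]` with square integrable derivative
(we always use the continuous representative). -/
def MemH1 (T : ℝ) (u : ℝ → ℝ) : Prop :=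
  AbsolutelyContinuousOnInterval u 0 T ∧ MemL2 T (dt T u)

/-- `H²(0, T)`. -/
def MemH2 (T : ℝ) (u : ℝ → ℝ) : Prop := MemH1 T u ∧ MemH1 T (dt T u)

/-! ### Parameters, weight function, cut-off -/

/-- Final time, length of the space interval, base point `x₀`, slope `β`, cut-off function. -/
structure Setup where
  T : ℝ
  L : ℝ
  x₀ : ℝ
  β : ℝ
  η : ℝ → ℝ

namespace Setup

/-- The multiplier conditions for `Ω = (0, L)`, `Γ₀ = {L}`, and the properties of the cut-off.
Here `sup_Ω |x - x₀| = L - x₀` and `d(x₀, Ω)² = x₀²`; since `β < 1`, the last inequality on `β`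
contains `T > sup_Ω |x - x₀|`. -/
structure Admissible (S : Setup) : Prop where
  T_pos : 0 < S.T
  L_pos : 0 < S.L
  x₀_neg : S.x₀ < 0
  β_pos : 0 < S.β
  β_lt_one : S.β < 1
  time_cond : S.L - S.x₀ < S.β * S.T
  η_smooth : ContDiff ℝ 2 S.η
  η_mem : ∀ τ, S.η τ ∈ Icc (0 : ℝ) 1
  η_zero : ∀ τ ≤ 0, S.η τ = 0
  η_one : ∀ τ, S.x₀ ^ 2 ≤ τ → S.η τ = 1

/-- The weight `φ(t, x) = |x - x₀|² - β t²`. -/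
def φ (S : Setup) (t x : ℝ) : ℝ := |x - S.x₀| ^ 2 - S.β * t ^ 2

/-- The set `𝒪 = {(t, x) ∈ (0, T) × (0, L) : β t > |x - x₀|}`. -/
def O (S : Setup) : Set (ℝ × ℝ) :=
  {p | p.1 ∈ Ioo 0 S.T ∧ p.2 ∈ Ioo 0 S.L ∧ |p.2 - S.x₀| < S.β * p.1}

end Setup

/-! ### The continuous wave equation on `(0, T) × (0, L)` -/

/-- Lebesgue measure on `(0, L)`. -/
abbrev μΩ (L : ℝ) : Measure ℝ := volume.restrict (Ioo 0 L)

/-- Potential, source, Dirichlet data at `0` and at `L`, initial data. -/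
structure ContData where
  Q : ℝ → ℝ
  f : ℝ → ℝ → ℝ
  g₀ : ℝ → ℝ
  gL : ℝ → ℝ
  w₀ : ℝ → ℝ
  w₁ : ℝ → ℝ

/-- `Q ∈ L^∞(0, L)` with `‖Q‖_∞ ≤ m`, `f ∈ L¹(0, T; L²(0, L))`, boundary data in `H¹(0, T)`,
`w₀ ∈ H¹(0, L)`, `w₁ ∈ L²(0, L)`, and compatibility of initial and boundary data. -/
structure ContData.Regular (S : Setup) (m : ℝ) (d : ContData) : Prop where
  Q_meas : AEStronglyMeasurable d.Q (μΩ S.L)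
  Q_bdd : ∀ᵐ x ∂(μΩ S.L), |d.Q x| ≤ m
  f_meas : AEStronglyMeasurable (Function.uncurry d.f)
    ((volume.restrict (Ioo 0 S.T)).prod (μΩ S.L))
  f_int : ∫⁻ t in Ioo 0 S.T, eLpNorm (d.f t) 2 (μΩ S.L) < ⊤
  g₀_mem : MemH1 S.T d.g₀
  gL_mem : MemH1 S.T d.gL
  w₀_mem : MemH1 S.L d.w₀
  w₁_mem : MemL2 S.L d.w₁
  compat₀ : d.g₀ 0 = d.w₀ 0
  compatL : d.gL 0 = d.w₀ S.L

/-- The defect of the weak formulation, with one integration by parts in `t` and in `x`, tested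
against `ψ`:
`∫₀ᵀ ∫₀ᴸ (- ∂ₜU ∂ₜψ + ∂ₓU ∂ₓψ + Q U ψ - f ψ) dx dt`. -/
def weakForm (S : Setup) (d : ContData) (U Ut Ux : ℝ → Lp ℝ 2 (μΩ S.L)) (ψ : ℝ × ℝ → ℝ) : ℝ :=
  ∫ t in Ioo 0 S.T, ∫ x in Ioo 0 S.L,
    (-(Ut t x * fderiv ℝ ψ (t, x) (1, 0)) + Ux t x * fderiv ℝ ψ (t, x) (0, 1)
      + d.Q x * U t x * ψ (t, x) - d.f t x * ψ (t, x))

/-- `U ∈ C⁰([0, T]; H¹(0, L)) ∩ C¹([0, T]; L²(0, L))`, with time derivative `Ut` and space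
derivative `Ux`, is the solution of `∂ₜ²U - ∂ₓ²U + Q U = f` with boundary values `g₀` at `0`, `gL`
at `L` and initial data `(w₀, w₁)`. The equation holds in the sense of distributions. -/
structure IsWaveSolution (S : Setup) (d : ContData) (U Ut Ux : ℝ → Lp ℝ 2 (μΩ S.L)) : Prop where
  cont_Ut : ContinuousOn Ut (Icc 0 S.T)
  cont_Ux : ContinuousOn Ux (Icc 0 S.T)
  hasDeriv : ∀ t ∈ Icc 0 S.T, HasDerivWithinAt U (Ut t) (Icc 0 S.T) t
  space : ∀ t ∈ Icc 0 S.T, ∀ᵐ x ∂(μΩ S.L), U t x = d.g₀ t + ∫ y in Ioo 0 x, Ux t y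
  boundary : ∀ t ∈ Icc 0 S.T, d.gL t = d.g₀ t + ∫ y in Ioo 0 S.L, Ux t y
  init₀ : ∀ᵐ x ∂(μΩ S.L), U 0 x = d.w₀ x
  init₁ : ∀ᵐ x ∂(μΩ S.L), Ut 0 x = d.w₁ x
  eqn : ∀ ψ : ℝ × ℝ → ℝ, ContDiff ℝ ∞ ψ → HasCompactSupport ψ →
    tsupport ψ ⊆ Ioo 0 S.T ×ˢ Ioo 0 S.L → weakForm S d U Ut Ux ψ = 0

/-- `M ∈ L²(0, T)` is the outward normal derivative of the solution at `x = L`, defined by Green's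
formula against test functions that need not vanish at `x = L`. -/
def IsFluxAtL (S : Setup) (d : ContData) (U Ut Ux : ℝ → Lp ℝ 2 (μΩ S.L)) (M : ℝ → ℝ) : Prop :=
  MemL2 S.T M ∧
  ∀ ψ : ℝ × ℝ → ℝ, ContDiff ℝ ∞ ψ → HasCompactSupport ψ →
    tsupport ψ ⊆ Ioo 0 S.T ×ˢ Ioi 0 →
    weakForm S d U Ut Ux ψ = ∫ t in Ioo 0 S.T, M t * ψ (t, S.L)

/-- `ηM' ∈ L²(0, T)` is the product of `η(φ(t, L))` with the distributional derivative of `M`: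
`⟨η(φ(·, L)) ∂ₜM, ψ⟩ = - ∫ M ∂ₜ(η(φ(·, L)) ψ)`. -/
def IsCutoffDeriv (S : Setup) (M ηM' : ℝ → ℝ) : Prop :=
  MemL2 S.T ηM' ∧
  ∀ ψ : ℝ → ℝ, ContDiff ℝ ∞ ψ → HasCompactSupport ψ → tsupport ψ ⊆ Ioo 0 S.T →
    ∫ t in Ioo 0 S.T, ηM' t * ψ t =
      -∫ t in Ioo 0 S.T, M t * deriv (fun τ => S.η (S.φ τ S.L) * ψ τ) t

/-! ### The mesh `x_j = j h`, `0 ≤ j ≤ N + 1`, `h = L / (N + 1)`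

A function on `[0, L]_h` is a map `Fin (N + 2) → ℝ`, a function on `[0, L)_h` is a map
`Fin (N + 1) → ℝ` (index `i` for `x_i`), and a function on `(0, L)_h` is a map `Fin N → ℝ`
(index `i` for `x_{i+1}`). -/

/-- Mesh size. -/
def mesh (S : Setup) (N : ℕ) : ℝ := S.L / (N + 1)

/-- Mesh point `x_j`. -/
def node (S : Setup) (N : ℕ) (j : Fin (N + 2)) : ℝ := (j : ℕ) * mesh S N

/-- The index in the full mesh of an interior point. -/
def innerIdx {N : ℕ} (i : Fin N) : Fin (N + 2) := i.castSucc.succ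

/-- Integral over `(0, L)_h`. -/
def sumInner (S : Setup) {N : ℕ} (F : Fin N → ℝ) : ℝ := mesh S N * ∑ i, F i

/-- Integral over `[0, L)_h`. -/
def sumLeft (S : Setup) {N : ℕ} (F : Fin (N + 1) → ℝ) : ℝ := mesh S N * ∑ i, F i

/-- Forward difference `∂_h^+`, on `[0, L)_h`. -/
def dPlus (S : Setup) {N : ℕ} (v : Fin (N + 2) → ℝ) (i : Fin (N + 1)) : ℝ :=
  (v i.succ - v i.castSucc) / mesh S N

/-- Discrete Laplacian `Δ_h`, on `(0, L)_h`. -/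
def lap (S : Setup) {N : ℕ} (v : Fin (N + 2) → ℝ) (i : Fin N) : ℝ :=
  (v i.succ.succ - 2 * v (innerIdx i) + v i.castSucc.castSucc) / mesh S N ^ 2

/-- Piecewise constant extension: the value on `[x_j, x_{j+1})` is the value at `x_j`,
`1 ≤ j ≤ N`. -/
def pcExt (S : Setup) {N : ℕ} (q : Fin N → ℝ) (x : ℝ) : ℝ :=
  ∑ i : Fin N, (Ico (node S N (innerIdx i)) (node S N (innerIdx i) + mesh S N)).indicator
    (fun _ => q i) x

/-- Discrete source, boundary data at `0` and `L`, and initial data. -/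
structure DiscData (N : ℕ) where
  f : Fin N → ℝ → ℝ
  g₀ : ℝ → ℝ
  gL : ℝ → ℝ
  w₀ : Fin N → ℝ
  w₁ : Fin N → ℝ

/-- Integrable source and absolutely continuous boundary data on `(0, T)`. -/
structure DiscData.Regular (S : Setup) {N : ℕ} (D : DiscData N) : Prop where
  f_int : ∀ i, IntegrableOn (D.f i) (Ioo 0 S.T)
  g₀_ac : AbsolutelyContinuousOnInterval D.g₀ 0 S.T
  gL_ac : AbsolutelyContinuousOnInterval D.gL 0 S.T

/-- `∂ₜ² z - Δ_h z + q z` on `(0, L)_h`. -/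
def waveOp (S : Setup) {N : ℕ} (q : Fin N → ℝ) (z : ℝ → Fin (N + 2) → ℝ) (t : ℝ) (i : Fin N) : ℝ :=
  dt S.T (dt S.T fun τ => z τ (innerIdx i)) t - lap S (z t) i + q i * z t (innerIdx i)

/-- `w` is the solution of the semi-discrete wave equation with potential `q` and data `D`
(a system of ordinary differential equations, solved in the sense of Carathéodory). -/
structure IsDiscSolution (S : Setup) {N : ℕ} (D : DiscData N) (q : Fin N → ℝ)
    (w : ℝ → Fin (N + 2) → ℝ) : Prop where
  left : ∀ t ∈ Icc 0 S.T, w t 0 = D.g₀ t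
  right : ∀ t ∈ Icc 0 S.T, w t (Fin.last (N + 1)) = D.gL t
  ac : ∀ i : Fin N, AbsolutelyContinuousOnInterval (fun t => w t (innerIdx i)) 0 S.T
  ac_deriv : ∀ i : Fin N,
    AbsolutelyContinuousOnInterval (dt S.T fun t => w t (innerIdx i)) 0 S.T
  eqn : ∀ i : Fin N, ∀ᵐ t ∂(volume.restrict (Ioo 0 S.T)), waveOp S q w t i = D.f i t
  init₀ : ∀ i : Fin N, w 0 (innerIdx i) = D.w₀ i
  init₁ : ∀ i : Fin N, dt S.T (fun t => w t (innerIdx i)) 0 = D.w₁ i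

/-! ### The functional -/

/-- The trajectory space `𝒯_h`. -/
structure MemTraj (S : Setup) {N : ℕ} (z : ℝ → Fin (N + 2) → ℝ) : Prop where
  h2 : ∀ j, MemH2 S.T fun t => z t j
  left : ∀ t ∈ Icc 0 S.T, z t 0 = 0
  right : ∀ t ∈ Icc 0 S.T, z t (Fin.last (N + 1)) = 0
  init : ∀ i : Fin N, z 0 (innerIdx i) = 0

/-- The functional `J_{s,q,h}[μ, g, ν]`. In the boundary term, the index
`(Fin.last N).castSucc` is that of the mesh point `x_N`, and the weight is taken at `x = L`. -/
def J (S : Setup) {N : ℕ} (s : ℝ) (q : Fin N → ℝ) (μ : ℝ → ℝ) (g : ℝ → Fin N → ℝ)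
    (ν : ℝ → Fin (N + 1) → ℝ) (z : ℝ → Fin (N + 2) → ℝ) : ℝ :=
  1 / 2 * (∫ t in Ioo 0 S.T, sumInner S fun i : Fin N =>
      Real.exp (2 * s * S.φ t (node S N (innerIdx i))) * (waveOp S q z t i - g t i) ^ 2)
  + s / 2 * (∫ t in Ioo 0 S.T,
      Real.exp (2 * s * S.φ t S.L) * (-z t (Fin.last N).castSucc / mesh S N - μ t) ^ 2)
  + s ^ 3 / 2 * (∫ t in Ioo 0 S.T, sumInner S fun i : Fin N =>
      S.O.indicator 1 (t, node S N (innerIdx i)) *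
        (Real.exp (2 * s * S.φ t (node S N (innerIdx i))) * z t (innerIdx i) ^ 2))
  + s * mesh S N ^ 2 / 2 * (∫ t in Ioo 0 S.T, sumLeft S fun i : Fin (N + 1) =>
      Real.exp (2 * s * S.φ t (node S N i.castSucc)) *
        (dt S.T (fun τ => dPlus S (z τ) i) t - ν t i) ^ 2)

/-- `Z` minimizes `J_{s,q,h}[μ, g, ν]` over `𝒯_h`. -/
def IsMinimizer (S : Setup) {N : ℕ} (s : ℝ) (q : Fin N → ℝ) (μ : ℝ → ℝ) (g : ℝ → Fin N → ℝ)
    (ν : ℝ → Fin (N + 1) → ℝ) (Z : ℝ → Fin (N + 2) → ℝ) : Prop :=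
  MemTraj S Z ∧ ∀ z, MemTraj S z → J S s q μ g ν Z ≤ J S s q μ g ν z

/-! ### The algorithm -/

/-- `∂_h^+ (η(φ) ∂ₜ w)` as a function of time, on `[0, L)_h`. -/
def cutoffGrad (S : Setup) {N : ℕ} (w : ℝ → Fin (N + 2) → ℝ) (i : Fin (N + 1)) (t : ℝ) : ℝ :=
  dPlus S (fun j => S.η (S.φ t (node S N j)) * dt S.T (fun τ => w τ j) t) i

/-- `∂ₜ ∂_h^+ (η(φ) ∂ₜ w)`. -/
def nuData (S : Setup) {N : ℕ} (w : ℝ → Fin (N + 2) → ℝ) (t : ℝ) (i : Fin (N + 1)) : ℝ :=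
  dt S.T (cutoffGrad S w i) t

/-- `η(φ(t, L)) ∂ₜ ((w_{N+1} - w_N) / h - M)`, where `ηM'` stands for `η(φ(·, L)) ∂ₜM`. -/
def muData (S : Setup) {N : ℕ} (ηM' : ℝ → ℝ) (w : ℝ → Fin (N + 2) → ℝ) (t : ℝ) : ℝ :=
  S.η (S.φ t S.L) * dt S.T (fun τ => dPlus S (w τ) (Fin.last N)) t - ηM' t

/-- The truncation `T_m`. -/
def trunc (m q : ℝ) : ℝ := if |q| ≤ m then q else Real.sign q * m

/-- One iteration of the algorithm, from `q` to `q'`. -/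
def IsStep (S : Setup) (m : ℝ) {N : ℕ} (D : DiscData N) (ηM' : ℝ → ℝ) (s : ℝ)
    (q q' : Fin N → ℝ) : Prop :=
  ∃ w Z : ℝ → Fin (N + 2) → ℝ, IsDiscSolution S D q w ∧
    IsMinimizer S s q (muData S ηM' w) 0 (nuData S w) Z ∧
    ∀ i, q' i = trunc m (q i + dt S.T (fun t => Z t (innerIdx i)) 0 / D.w₀ i)

/-- A sequence of discrete potentials produced by the algorithm. -/
def IsRun (S : Setup) (m : ℝ) {N : ℕ} (D : DiscData N) (ηM' : ℝ → ℝ) (s : ℝ)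
    (q : ℕ → Fin N → ℝ) : Prop :=
  q 0 = 0 ∧ ∀ k, IsStep S m D ηM' s (q k) (q (k + 1))

/-- Every object used in one iteration from `q` exists, lies in the required space, and is
unique (as a function on `[0, T]`). -/
structure StepWellPosed (S : Setup) {N : ℕ} (D : DiscData N) (ηM' : ℝ → ℝ) (s : ℝ)
    (q : Fin N → ℝ) : Prop where
  exists_sol : ∃ w, IsDiscSolution S D q w
  unique_sol : ∀ w w', IsDiscSolution S D q w → IsDiscSolution S D q w' →
    ∀ t ∈ Icc 0 S.T, w t = w' t
  mu_mem : ∀ w, IsDiscSolution S D q w → MemL2 S.T (muData S ηM' w)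
  nu_mem : ∀ w, IsDiscSolution S D q w → ∀ i, MemH1 S.T (cutoffGrad S w i)
  exists_min : ∀ w, IsDiscSolution S D q w →
    ∃ Z, IsMinimizer S s q (muData S ηM' w) 0 (nuData S w) Z
  unique_min : ∀ w, IsDiscSolution S D q w → ∀ Z Z',
    IsMinimizer S s q (muData S ηM' w) 0 (nuData S w) Z →
    IsMinimizer S s q (muData S ηM' w) 0 (nuData S w) Z' → ∀ t ∈ Icc 0 S.T, Z t = Z' t

/-! ### Weighted error and consistency terms -/

/-- `∫_{(0,L)_h} e^{2sφ(0,·)} |q|²`. -/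
def wNormSq (S : Setup) {N : ℕ} (s : ℝ) (q : Fin N → ℝ) : ℝ :=
  sumInner S fun i : Fin N => Real.exp (2 * s * S.φ 0 (node S N (innerIdx i))) * q i ^ 2

/-- `∫₀ᵀ ∫_{[0,L)_h} e^{2sφ} |h ∂_h^+ ∂ₜ (η(φ) ∂ₜ W)|² dt`. -/
def hfDefect (S : Setup) {N : ℕ} (s : ℝ) (W : ℝ → Fin (N + 2) → ℝ) : ℝ :=
  ∫ t in Ioo 0 S.T, sumLeft S fun i : Fin (N + 1) =>
    Real.exp (2 * s * S.φ t (node S N i.castSucc)) * (mesh S N * nuData S W t i) ^ 2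

/-- `∫₀ᵀ e^{2sφ(t,L)} η(φ(t,L))² |∂ₜ (W_{N+1} - W_N) / h - ∂ₜM|² dt`. -/
def fluxDefect (S : Setup) {N : ℕ} (s : ℝ) (ηM' : ℝ → ℝ) (W : ℝ → Fin (N + 2) → ℝ) : ℝ :=
  ∫ t in Ioo 0 S.T, Real.exp (2 * s * S.φ t S.L) * muData S ηM' W t ^ 2

end WaveRecovery

end

open WaveRecovery

/-!
Convergence of the reconstruction algorithm rests on a Carleman estimate for the semi-discrete wave
operator which is uniform in the mesh size (`carleman_initial_velocity`): for `s` large and `s h`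
small, depending on the geometry and on the bound `m` of the potentials only,
`√s ∫ e^{2sφ(0)} |∂ₜz(0)|² ≤ C J[0, 0, 0](z)` for every trajectory `z`.

*The Carleman estimate.* For `v = e^{sφ} z` the operator becomes, up to lower order terms, the sum
of a symmetric part `P₁` and a skew-symmetric part `P₂`. The weight is quadratic in `x`, so the
coefficients of the conjugated discrete Laplacian are explicit exponentials and hyperbolic functions
of `2 s h (x - x₀)`. Discrete summation by parts writes `∑ P₁ P₂` at a fixed time as the time
derivative of an energy plus a quadratic form (`sum_symm_mul_skew`), which is positive up to the
values in `𝒪`, the flux at `L`, and the term `h² |∂ₜ∂_h^+ z|²`. The last one is due to the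
discretization, and is the reason for the fourth term of the functional. Integration in time gives
the estimate: the energy vanishes at `t = 0` and is nonnegative at `t = T` since
`β T > L - x₀` (`carlG_final_nonneg`), and a second energy recovers the velocity at `t = 0`. All time
regularity is that of `H²(0, T)`, handled by the fundamental theorem of calculus for absolutely
continuous functions.

*Well-posedness.* The semi-discrete equation is a linear system of ordinary differential equations,
solved by variation of constants (`exists_discSolution`). The functional is half the square of the
norm of `R z - d` for a linear map `R` with closed range (`J_eq_norm_sq`, `isClosed_range_resMap`), so
minimizers exist and satisfy the identity of Pythagoras (`IsMinimizer.pythagoras`), which with the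
injectivity of `R` gives uniqueness.

*One step.* Let `w`, `W` be the solutions for the current potential `q` and for `Q`, and
`z = ∂ₜ(w - W)`. Then `z(0) = 0`, `∂ₜz(0) = (Q - q) w₀`, and `η(φ) z` is an admissible trajectory with
the same initial velocity as `z`, for which all terms of the functional are small (`J_cutTraj_le`):
the third vanishes because `η(φ) = 0` on `𝒪`, the second and the fourth are the consistency errors of
`W`, up to the variation of the cut-off over one mesh cell, and in the first only
`(Q - q) ∂ₜW` and the commutator with `η(φ)` remain. The commutator is supported where `φ` is at most
`x₀² + O(h)`, and `x₀²` is a lower bound of `φ(0, ·)`. As `s h` is bounded, the weight there is at most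
a constant times its values at `t = 0`, and the energy estimate `DiffSystem.energy_le` bounds the
commutator by `∫ e^{2sφ(0)} |Q - q|²`. The identity of Pythagoras bounds the
functional without data at `Z - η(φ) z`, where `Z` is the minimizer, and the Carleman estimate then
bounds `∂ₜZ(0) - (Q - q) w₀` with a gain of `1/√s` (`wNormSq_trunc_le`). The truncation does not
increase the error since `|Q| ≤ m`. The remaining assertions follow by iteration
(`le_geometric_add`) and from the boundedness of the weight (`hfDefect_le`, `fluxDefect_le`).
-/

namespace WaveRecovery

/-! ### Summation by parts -/

theorem sum_central_diff (B u : ℕ → ℝ) (N : ℕ) :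
    ∑ j ∈ Finset.range N, B (j + 1) * u (j + 1) * (u (j + 2) - u j) =
      -∑ j ∈ Finset.range (N + 1), (B (j + 1) - B j) * (u j * u (j + 1))
        + B (N + 1) * u N * u (N + 1) - B 0 * u 0 * u 1 := by
  induction N with
  | zero => simp; ring
  | succ n ih => rw [Finset.sum_range_succ, ih, Finset.sum_range_succ _ (n + 1)]; ring

theorem sum_second_diff (f v : ℕ → ℝ) (N : ℕ) :
    ∑ j ∈ Finset.range N, f (j + 1) * (v (j + 2) - 2 * v (j + 1) + v j) =
      -∑ j ∈ Finset.range (N + 1), (v (j + 1) - v j) * (f (j + 1) - f j)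
        + f (N + 1) * (v (N + 1) - v N) - f 0 * (v 1 - v 0) := by
  induction N with
  | zero => simp; ring
  | succ n ih => rw [Finset.sum_range_succ, ih, Finset.sum_range_succ _ (n + 1)]; ring

theorem sum_second_central_diff (M v : ℕ → ℝ) (N : ℕ) :
    ∑ j ∈ Finset.range N,
        M (j + 1) * ((v (j + 2) - 2 * v (j + 1) + v j) * (v (j + 2) - v j)) =
      -∑ j ∈ Finset.range (N + 1), (M (j + 1) - M j) * (v (j + 1) - v j) ^ 2
        + M (N + 1) * (v (N + 1) - v N) ^ 2 - M 0 * (v 1 - v 0) ^ 2 := by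
  induction N with
  | zero => simp; ring
  | succ n ih => rw [Finset.sum_range_succ, ih, Finset.sum_range_succ _ (n + 1)]; ring

/-- A sum over interior vertices as a sum over edges. -/
theorem sum_edges_eq (f : ℕ → ℝ) (N : ℕ) (h0 : f 0 = 0) (h1 : f (N + 1) = 0) :
    ∑ j ∈ Finset.range (N + 1), (f j + f (j + 1)) = 2 * ∑ j ∈ Finset.range N, f (j + 1) := by
  rw [Finset.sum_add_distrib, Finset.sum_range_succ' f, Finset.sum_range_succ (fun j => f (j + 1)),
    h0, h1]
  ring

/-! ### Elementary bounds for hyperbolic functions -/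

theorem cosh_le_one_add_sq {x : ℝ} (hx : |x| ≤ 1) : Real.cosh x ≤ 1 + x ^ 2 := by
  have h1 := Real.cosh_le_exp_half_sq x
  have hx2 : x ^ 2 ≤ 1 := by rw [← sq_abs]; nlinarith [abs_nonneg x]
  have h2 : Real.exp (x ^ 2 / 2) ≤ 1 + x ^ 2 / 2 + (x ^ 2 / 2) ^ 2 := by
    have := Real.abs_exp_sub_one_sub_id_le (x := x ^ 2 / 2)
      (by rw [abs_of_nonneg (by positivity)]; linarith)
    have := (abs_le.mp this).2
    linarith
  nlinarith [sq_nonneg x]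

theorem cosh_le_one_add_half_sq {x : ℝ} (hx : |x| ≤ 1) :
    Real.cosh x ≤ 1 + x ^ 2 / 2 * (1 + x ^ 2 / 2) := by
  have h1 := Real.cosh_le_exp_half_sq x
  have hx2 : x ^ 2 ≤ 1 := by rw [← sq_abs]; nlinarith [abs_nonneg x]
  have := Real.abs_exp_sub_one_sub_id_le (x := x ^ 2 / 2)
    (by rw [abs_of_nonneg (by positivity)]; linarith)
  have := (abs_le.mp this).2
  nlinarith

theorem one_add_half_sq_le_cosh (x : ℝ) : 1 + x ^ 2 / 2 ≤ Real.cosh x := by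
  have h := Real.cosh_two_mul (x / 2)
  rw [show 2 * (x / 2) = x by ring, Real.cosh_sq] at h
  have h2 : (x / 2) ^ 2 ≤ Real.sinh (x / 2) ^ 2 := by
    rcases le_total 0 x with hx | hx
    · have := Real.self_le_sinh_iff.mpr (show 0 ≤ x / 2 by linarith)
      have h0 : 0 ≤ x / 2 := by linarith
      nlinarith
    · have := Real.sinh_le_self_iff.mpr (show x / 2 ≤ 0 by linarith)
      have h0 : x / 2 ≤ 0 := by linarith
      nlinarith
  nlinarith

theorem sinh_le_mul_cosh {x : ℝ} (hx : 0 ≤ x) : Real.sinh x ≤ x * Real.cosh x := by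
  have hd : ∀ y, HasDerivAt (fun y => y * Real.cosh y - Real.sinh y) (y * Real.sinh y) y := by
    intro y
    have := ((hasDerivAt_id y).mul (Real.hasDerivAt_cosh y)).sub (Real.hasDerivAt_sinh y)
    exact this.congr_deriv (by simp)
  have hm : MonotoneOn (fun y => y * Real.cosh y - Real.sinh y) (Ici 0) := by
    apply monotoneOn_of_deriv_nonneg (convex_Ici 0)
    · exact fun y _ => (hd y).continuousAt.continuousWithinAt
    · exact fun y _ => (hd y).differentiableAt.differentiableWithinAt
    · intro y hy
      rw [interior_Ici] at hy
      rw [(hd y).deriv]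
      exact mul_nonneg (le_of_lt hy) (Real.sinh_nonneg_iff.mpr (le_of_lt hy))
  have := hm (show (0 : ℝ) ∈ Ici 0 by simp) hx hx
  simp at this
  linarith

theorem three_halves_sq_le_cosh_sub (x : ℝ) :
    3 / 2 * x ^ 2 ≤ Real.cosh (2 * x) - Real.cosh x := by
  have h1 := one_add_half_sq_le_cosh x
  rw [Real.cosh_two_mul, Real.sinh_sq]
  have : 0 ≤ (Real.cosh x - (1 + x ^ 2 / 2)) * (2 * Real.cosh x + 1) := by
    apply mul_nonneg <;> nlinarith [Real.cosh_pos x]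
  nlinarith [sq_nonneg x, Real.one_le_cosh x]

/-! ### Coefficients of the conjugated discrete Laplacian -/

/-- With `X_j = ξ + j h`, the weight `φ` satisfies `φ_{j ± 1} - φ_j = ± 2 h X_j + h²`, so that
`e^{sφ} Δ_h (e^{-sφ} v) = A Δ_h v - 2 B D v + c v` with `D` the centred difference. This is `A`. -/
noncomputable def coefA (s h ξ : ℝ) (j : ℕ) : ℝ :=
  Real.exp (-(s * h ^ 2)) * Real.cosh (2 * s * h * (ξ + j * h))

/-- The coefficient of the centred difference in the conjugated discrete Laplacian,
close to `2 s X_j`. -/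
noncomputable def coefB (s h ξ : ℝ) (j : ℕ) : ℝ :=
  Real.exp (-(s * h ^ 2)) * Real.sinh (2 * s * h * (ξ + j * h)) / h

/-- The zeroth order coefficient in the conjugated discrete Laplacian, close to `4 s² X_j²`. -/
noncomputable def coefC (s h ξ : ℝ) (j : ℕ) : ℝ := 2 / h ^ 2 * (coefA s h ξ j - 1)

/-- `1 - e^{-2 s h²}`, the common factor of the increments of the coefficients. -/
noncomputable def coefS (s h : ℝ) : ℝ := 1 - Real.exp (-(2 * (s * h ^ 2)))

/-- `2 s h` times the midpoint between `X_j` and `X_{j+1}`. -/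
noncomputable def midArg (s h ξ : ℝ) (j : ℕ) : ℝ := 2 * s * h * (ξ + (j + 1 / 2) * h)

section Increments

variable (s h ξ : ℝ) (j : ℕ)

theorem coefS_le : coefS s h ≤ 2 * (s * h ^ 2) := by
  have := Real.add_one_le_exp (-(2 * (s * h ^ 2)))
  unfold coefS; linarith

theorem le_coefS (hs : 0 ≤ s) (h1 : s * h ^ 2 ≤ 1 / 2) :
    2 * (s * h ^ 2) - 2 * (s * h ^ 2) ^ 2 ≤ coefS s h := by
  set d := s * h ^ 2 with hd
  have hd0 : 0 ≤ d := by positivity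
  have h2 := Real.quadratic_le_exp_of_nonneg (x := 2 * d) (by positivity)
  have h3 : Real.exp (-(2 * d)) * Real.exp (2 * d) = 1 := by
    rw [← Real.exp_add]; simp
  have h4 := Real.exp_pos (-(2 * d))
  have h5 : (1 - 2 * d + 2 * d ^ 2) * (1 + 2 * d + 2 * d ^ 2) ≥ 1 := by nlinarith [pow_nonneg hd0 4]
  have h6 : Real.exp (-(2 * d)) ≤ 1 - 2 * d + 2 * d ^ 2 := by
    have : 0 ≤ 1 - 2 * d + 2 * d ^ 2 := by nlinarith [sq_nonneg d]
    have h7 : (1 - 2 * d + 2 * d ^ 2) * Real.exp (2 * d) ≥ 1 := by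
      have : 1 + 2 * d + 2 * d ^ 2 ≤ Real.exp (2 * d) := by nlinarith
      nlinarith
    by_contra hcon
    push Not at hcon
    nlinarith [Real.exp_pos (2 * d)]
  unfold coefS; rw [← hd]; linarith

theorem coefS_nonneg (hs : 0 ≤ s) : 0 ≤ coefS s h := by
  have : Real.exp (-(2 * (s * h ^ 2))) ≤ 1 := Real.exp_le_one_iff.mpr (by
    have : 0 ≤ s * h ^ 2 := by positivity
    linarith)
  unfold coefS; linarith

theorem exp_mul_sinh_eq_coefS : Real.exp (-(s * h ^ 2)) * (2 * Real.sinh (s * h ^ 2)) = coefS s h := by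
  rw [Real.sinh_eq]
  unfold coefS
  have h1 : Real.exp (-(s * h ^ 2)) * Real.exp (s * h ^ 2) = 1 := by rw [← Real.exp_add]; simp
  have h2 : Real.exp (-(s * h ^ 2)) * Real.exp (-(s * h ^ 2)) = Real.exp (-(2 * (s * h ^ 2))) := by
    rw [← Real.exp_add]; ring_nf
  linear_combination h1 - h2

theorem coefB_succ_sub :
    coefB s h ξ (j + 1) - coefB s h ξ j = coefS s h * Real.cosh (midArg s h ξ j) / h := by
  have e1 : 2 * s * h * (ξ + ((j + 1 : ℕ) : ℝ) * h) = midArg s h ξ j + s * h ^ 2 := by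
    unfold midArg; push_cast; ring
  have e2 : 2 * s * h * (ξ + (j : ℝ) * h) = midArg s h ξ j - s * h ^ 2 := by
    unfold midArg; ring
  unfold coefB
  rw [e1, e2, Real.sinh_add, Real.sinh_sub, ← exp_mul_sinh_eq_coefS]
  ring

theorem coefA_succ_sub :
    coefA s h ξ (j + 1) - coefA s h ξ j = coefS s h * Real.sinh (midArg s h ξ j) := by
  have e1 : 2 * s * h * (ξ + ((j + 1 : ℕ) : ℝ) * h) = midArg s h ξ j + s * h ^ 2 := by
    unfold midArg; push_cast; ring
  have e2 : 2 * s * h * (ξ + (j : ℝ) * h) = midArg s h ξ j - s * h ^ 2 := by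
    unfold midArg; ring
  unfold coefA
  rw [e1, e2, Real.cosh_add, Real.cosh_sub, ← exp_mul_sinh_eq_coefS]
  ring

theorem coefAB_succ_sub :
    coefA s h ξ (j + 1) * coefB s h ξ (j + 1) - coefA s h ξ j * coefB s h ξ j =
      coefS s h * (1 - coefS s h / 2) * Real.cosh (2 * midArg s h ξ j) / h := by
  have e1 : 2 * s * h * (ξ + ((j + 1 : ℕ) : ℝ) * h) = midArg s h ξ j + s * h ^ 2 := by
    unfold midArg; push_cast; ring
  have e2 : 2 * s * h * (ξ + (j : ℝ) * h) = midArg s h ξ j - s * h ^ 2 := by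
    unfold midArg; ring
  have h1 : ∀ x : ℝ, Real.cosh x * Real.sinh x = Real.sinh (2 * x) / 2 := by
    intro x; rw [Real.sinh_two_mul]; ring
  have hE : 1 - coefS s h / 2 = Real.exp (-(s * h ^ 2)) * Real.cosh (s * h ^ 2) := by
    rw [Real.cosh_eq]
    unfold coefS
    have h1 : Real.exp (-(s * h ^ 2)) * Real.exp (s * h ^ 2) = 1 := by rw [← Real.exp_add]; simp
    have h2 : Real.exp (-(s * h ^ 2)) * Real.exp (-(s * h ^ 2)) = Real.exp (-(2 * (s * h ^ 2))) := by
      rw [← Real.exp_add]; ring_nf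
    linear_combination -(1 / 2) * h1 - (1 / 2) * h2
  rw [hE, ← exp_mul_sinh_eq_coefS]
  unfold coefA coefB
  rw [e1, e2]
  have h2 : ∀ x : ℝ, Real.exp (-(s * h ^ 2)) * Real.cosh x *
      (Real.exp (-(s * h ^ 2)) * Real.sinh x / h) =
      Real.exp (-(s * h ^ 2)) ^ 2 * (Real.sinh (2 * x) / 2) / h := by
    intro x; rw [← h1]; ring
  rw [h2, h2, mul_add, mul_sub, Real.sinh_add, Real.sinh_sub, Real.sinh_two_mul (s * h ^ 2)]
  ring

theorem coefCB_succ_sub :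
    coefC s h ξ (j + 1) * coefB s h ξ (j + 1) - coefC s h ξ j * coefB s h ξ j =
      2 / h ^ 2 * (coefS s h * ((1 - coefS s h / 2) * Real.cosh (2 * midArg s h ξ j)
        - Real.cosh (midArg s h ξ j)) / h) := by
  have h1 := coefB_succ_sub s h ξ j
  have h2 := coefAB_succ_sub s h ξ j
  unfold coefC
  linear_combination (2 / h ^ 2) * h2 - (2 / h ^ 2) * h1

end Increments

section Bounds

variable {s h ξ R : ℝ} {j : ℕ}

theorem midArg_bounds (hs : 1 ≤ s) (hh : 0 < h) (hξ : 0 < ξ)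
    (hR : ξ + (j + 1) * h ≤ R) (hρR : 2 * (s * h) * R ≤ 1) :
    0 ≤ midArg s h ξ j ∧ midArg s h ξ j ≤ 2 * (s * h) * R ∧ midArg s h ξ j ≤ 1 := by
  have h1 : midArg s h ξ j ≤ 2 * (s * h) * R := by
    unfold midArg
    have : 0 < s * h := by positivity
    have h2 : ξ + (j + 1 / 2) * h ≤ R := by nlinarith
    nlinarith
  refine ⟨?_, h1, h1.trans hρR⟩
  unfold midArg; positivity

theorem mul_sq_le_half (hs : 1 ≤ s) (hh : 0 < h) (hρ : s * h ≤ 1 / 2) : s * h ^ 2 ≤ 1 / 2 := by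
  have : h ≤ 1 := by nlinarith
  nlinarith [mul_pos (by linarith : 0 < s) hh]

theorem coefB_succ_sub_bounds (hs : 1 ≤ s) (hh : 0 < h) (hξ : 0 < ξ) (hρ : s * h ≤ 1 / 2)
    (hR : ξ + (j + 1) * h ≤ R) (hρR : 2 * (s * h) * R ≤ 1) :
    (2 * s - 2 * (s * h) ^ 2) * h ≤ coefB s h ξ (j + 1) - coefB s h ξ j ∧
      coefB s h ξ (j + 1) - coefB s h ξ j ≤ 2 * s * (1 + 4 * (s * h) ^ 2 * R ^ 2) * h := by
  obtain ⟨a0, a1, a2⟩ := midArg_bounds hs hh hξ hR hρR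
  have hS1 := coefS_le s h
  have hS2 := le_coefS s h (by linarith) (mul_sq_le_half hs hh hρ)
  have hS0 := coefS_nonneg s h (by linarith)
  have hc1 := Real.one_le_cosh (midArg s h ξ j)
  have hc2 := cosh_le_one_add_sq (x := midArg s h ξ j) (by rwa [abs_of_nonneg a0])
  have hc3 : midArg s h ξ j ^ 2 ≤ 4 * (s * h) ^ 2 * R ^ 2 := by
    calc _ ≤ (2 * (s * h) * R) ^ 2 := by gcongr
      _ = _ := by ring
  rw [coefB_succ_sub s h ξ j, le_div_iff₀ hh, div_le_iff₀ hh]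
  constructor
  · nlinarith
  · calc _ ≤ 2 * (s * h ^ 2) * (1 + 4 * (s * h) ^ 2 * R ^ 2) := by
          apply mul_le_mul hS1 (by linarith) (by linarith) (by positivity)
      _ = _ := by ring

theorem coefA_succ_sub_bounds (hs : 1 ≤ s) (hh : 0 < h) (hξ : 0 < ξ)
    (hR : ξ + (j + 1) * h ≤ R) (hρR : 2 * (s * h) * R ≤ 1) :
    0 ≤ coefA s h ξ (j + 1) - coefA s h ξ j ∧
      coefA s h ξ (j + 1) - coefA s h ξ j ≤ 8 * (s * h) ^ 2 * R * h := by
  obtain ⟨a0, a1, a2⟩ := midArg_bounds hs hh hξ hR hρR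
  have hS1 := coefS_le s h
  have hS0 := coefS_nonneg s h (by linarith)
  have hc2 := cosh_le_one_add_sq (x := midArg s h ξ j) (by rwa [abs_of_nonneg a0])
  have hsh := sinh_le_mul_cosh a0
  have h0 := Real.sinh_nonneg_iff.mpr a0
  have h3 : Real.sinh (midArg s h ξ j) ≤ 4 * (s * h) * R := by nlinarith
  rw [coefA_succ_sub]
  refine ⟨by positivity, ?_⟩
  calc _ ≤ 2 * (s * h ^ 2) * (4 * (s * h) * R) := by
          apply mul_le_mul hS1 h3 h0 (by positivity)
      _ = _ := by ring

theorem le_coefAB_succ_sub (hs : 1 ≤ s) (hh : 0 < h) (hρ : s * h ≤ 1 / 2) :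
    (2 * s - 4 * (s * h) ^ 2) * h ≤
      coefA s h ξ (j + 1) * coefB s h ξ (j + 1) - coefA s h ξ j * coefB s h ξ j := by
  have hd := mul_sq_le_half hs hh hρ
  have hS1 := coefS_le s h
  have hS2 := le_coefS s h (by linarith) hd
  have hS0 := coefS_nonneg s h (by linarith)
  have hc1 := Real.one_le_cosh (2 * midArg s h ξ j)
  rw [coefAB_succ_sub s h ξ j, le_div_iff₀ hh]
  have h1 : 2 * (s * h ^ 2) - 4 * (s * h ^ 2) ^ 2 ≤ coefS s h * (1 - coefS s h / 2) := by
    nlinarith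
  have h2 : 0 ≤ coefS s h * (1 - coefS s h / 2) := by
    apply mul_nonneg hS0; linarith
  nlinarith

theorem coefCB_succ_sub_bounds (hs : 1 ≤ s) (hh : 0 < h) (hξ : 0 < ξ) (hρ : s * h ≤ 1 / 2)
    (hR : ξ + (j + 1) * h ≤ R) (hρR : 2 * (s * h) * R ≤ 1) :
    (24 * s ^ 3 * (ξ + (j + 1 / 2) * h) ^ 2 - 24 * s ^ 2 * (s * h) ^ 2 * R ^ 2 - 32 * s ^ 2) * h ≤
        coefC s h ξ (j + 1) * coefB s h ξ (j + 1) - coefC s h ξ j * coefB s h ξ j ∧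
      coefC s h ξ (j + 1) * coefB s h ξ (j + 1) - coefC s h ξ j * coefB s h ξ j ≤
        128 * s ^ 3 * R ^ 2 * h := by
  obtain ⟨a0, a1, a2⟩ := midArg_bounds hs hh hξ hR hρR
  have hd := mul_sq_le_half hs hh hρ
  have hS1 := coefS_le s h
  have hS2 := le_coefS s h (by linarith) hd
  have hS0 := coefS_nonneg s h (by linarith)
  have hc2 := cosh_le_one_add_sq (x := midArg s h ξ j) (by rwa [abs_of_nonneg a0])
  have hc1 := Real.one_le_cosh (midArg s h ξ j)
  have hc3 : midArg s h ξ j ^ 2 ≤ 4 * (s * h) ^ 2 * R ^ 2 := by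
    calc _ ≤ (2 * (s * h) * R) ^ 2 := by gcongr
      _ = _ := by ring
  have hsh := sinh_le_mul_cosh a0
  have h0 := Real.sinh_nonneg_iff.mpr a0
  have h4 := three_halves_sq_le_cosh_sub (midArg s h ξ j)
  have h5 : Real.cosh (2 * midArg s h ξ j) ≤ 1 + 8 * midArg s h ξ j ^ 2 := by
    rw [Real.cosh_two_mul, Real.cosh_sq]
    have : Real.sinh (midArg s h ξ j) ≤ 2 * midArg s h ξ j := by nlinarith
    nlinarith
  have h5' : Real.cosh (2 * midArg s h ξ j) ≤ 8 := by
    rw [Real.cosh_two_mul, Real.sinh_sq]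
    nlinarith
  rw [coefCB_succ_sub s h ξ j]
  have hα : midArg s h ξ j = 2 * (s * h) * (ξ + (j + 1 / 2) * h) := by unfold midArg; ring
  have hc10 := Real.one_le_cosh (2 * midArg s h ξ j)
  generalize Real.cosh (2 * midArg s h ξ j) = C2 at *
  generalize Real.cosh (midArg s h ξ j) = C1 at *
  set S := coefS s h
  constructor
  · have h6 : 3 / 2 * midArg s h ξ j ^ 2 - 8 * (s * h ^ 2) ≤ (1 - S / 2) * C2 - C1 := by
      nlinarith
    have h7 : 3 * (s * h ^ 2) * midArg s h ξ j ^ 2 - 3 * (s * h ^ 2) ^ 2 * midArg s h ξ j ^ 2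
        - 16 * (s * h ^ 2) ^ 2 ≤ S * ((1 - S / 2) * C2 - C1) := by
      calc _ ≤ S * (3 / 2 * midArg s h ξ j ^ 2 - 8 * (s * h ^ 2)) := by
            have : 0 ≤ s * h ^ 2 := by positivity
            nlinarith [sq_nonneg (midArg s h ξ j)]
        _ ≤ _ := by gcongr
    calc _ ≤ 2 / h ^ 2 * ((3 * (s * h ^ 2) * midArg s h ξ j ^ 2
          - 3 * (s * h ^ 2) ^ 2 * (4 * (s * h) ^ 2 * R ^ 2)
          - 16 * (s * h ^ 2) ^ 2) / h) := by
          rw [hα]; apply le_of_eq; field_simp; ring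
      _ ≤ _ := by
          gcongr
          refine le_trans ?_ h7
          gcongr
  · have h6 : (1 - S / 2) * C2 - C1 ≤ 32 * (s * h) ^ 2 * R ^ 2 := by nlinarith
    calc _ ≤ 2 / h ^ 2 * (2 * (s * h ^ 2) * (32 * (s * h) ^ 2 * R ^ 2) / h) := by
          have h7 : S * ((1 - S / 2) * C2 - C1) ≤ 2 * (s * h ^ 2) * (32 * (s * h) ^ 2 * R ^ 2) :=
            (mul_le_mul_of_nonneg_left h6 hS0).trans
              (mul_le_mul_of_nonneg_right hS1 (by positivity))
          exact mul_le_mul_of_nonneg_left (div_le_div_of_nonneg_right h7 hh.le) (by positivity)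
      _ = _ := by field_simp; ring

theorem coefA_bounds (hs : 1 ≤ s) (hh : 0 < h) (hξ : 0 < ξ)
    (hR : ξ + j * h ≤ R) (hρR : 2 * (s * h) * R ≤ 1) :
    1 - (s * h) ^ 2 ≤ coefA s h ξ j ∧ coefA s h ξ j ≤ 1 + 4 * (s * h) ^ 2 * R ^ 2 := by
  have ha0 : 0 ≤ 2 * s * h * (ξ + j * h) := by positivity
  have ha1 : 2 * s * h * (ξ + j * h) ≤ 2 * (s * h) * R := by
    have : 0 < s * h := by positivity
    nlinarith
  have hc1 := Real.one_le_cosh (2 * s * h * (ξ + j * h))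
  have hc2 := cosh_le_one_add_sq (x := 2 * s * h * (ξ + j * h))
    (by rw [abs_of_nonneg ha0]; linarith)
  have hc3 : (2 * s * h * (ξ + j * h)) ^ 2 ≤ 4 * (s * h) ^ 2 * R ^ 2 := by
    calc _ ≤ (2 * (s * h) * R) ^ 2 := by gcongr
      _ = _ := by ring
  have he1 := Real.add_one_le_exp (-(s * h ^ 2))
  have he2 : Real.exp (-(s * h ^ 2)) ≤ 1 := Real.exp_le_one_iff.mpr (by
    have : 0 ≤ s * h ^ 2 := by positivity
    linarith)
  have h1 : s * h ^ 2 ≤ (s * h) ^ 2 := by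
    have : 0 < h ^ 2 := by positivity
    nlinarith
  unfold coefA
  have := Real.exp_pos (-(s * h ^ 2))
  constructor <;> nlinarith

theorem coefC_bounds (hs : 1 ≤ s) (hh : 0 < h) (hξ : 0 < ξ)
    (hR : ξ + j * h ≤ R) (hρR : 2 * (s * h) * R ≤ 1) :
    4 * s ^ 2 * (ξ + j * h) ^ 2 - 4 * s ≤ coefC s h ξ j ∧
      coefC s h ξ j ≤ 4 * s ^ 2 * R ^ 2 * (1 + 2 * (s * h) ^ 2 * R ^ 2) := by
  have ha0 : 0 ≤ 2 * s * h * (ξ + j * h) := by positivity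
  have ha1 : 2 * s * h * (ξ + j * h) ≤ 2 * (s * h) * R := by
    have : 0 < s * h := by positivity
    nlinarith
  have hc1 := one_add_half_sq_le_cosh (2 * s * h * (ξ + j * h))
  have hc2 := cosh_le_one_add_half_sq (x := 2 * s * h * (ξ + j * h))
    (by rw [abs_of_nonneg ha0]; linarith)
  have hc3 : (2 * s * h * (ξ + j * h)) ^ 2 ≤ 4 * (s * h) ^ 2 * R ^ 2 := by
    calc _ ≤ (2 * (s * h) * R) ^ 2 := by gcongr
      _ = _ := by ring
  have hc4 : (2 * s * h * (ξ + j * h)) ^ 2 ≤ 1 := by nlinarith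
  have he1 := Real.add_one_le_exp (-(s * h ^ 2))
  have hd0 : 0 ≤ s * h ^ 2 := by positivity
  have he2 : Real.exp (-(s * h ^ 2)) ≤ 1 := Real.exp_le_one_iff.mpr (by linarith)
  have he0 := Real.exp_pos (-(s * h ^ 2))
  have hk : (2 * s * h * (ξ + j * h)) ^ 2 = h ^ 2 * (4 * s ^ 2 * (ξ + j * h) ^ 2) := by ring
  unfold coefC coefA
  generalize Real.cosh (2 * s * h * (ξ + j * h)) = C at *
  generalize hq : (2 * s * h * (ξ + j * h)) ^ 2 = q at *
  have hq0 : 0 ≤ q := by rw [← hq]; positivity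
  constructor
  · have h1 : q / 2 - 2 * (s * h ^ 2) ≤ Real.exp (-(s * h ^ 2)) * C - 1 := by nlinarith
    calc _ = 2 / h ^ 2 * (q / 2 - 2 * (s * h ^ 2)) := by rw [hk]; field_simp; ring
      _ ≤ _ := by gcongr
  · have h1 : Real.exp (-(s * h ^ 2)) * C - 1 ≤
        (4 * (s * h) ^ 2 * R ^ 2) / 2 * (1 + (4 * (s * h) ^ 2 * R ^ 2) / 2) := by
      have h2 : Real.exp (-(s * h ^ 2)) * C ≤ C := by nlinarith
      have h3 : q / 2 * (1 + q / 2) ≤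
        (4 * (s * h) ^ 2 * R ^ 2) / 2 * (1 + (4 * (s * h) ^ 2 * R ^ 2) / 2) := by gcongr
      linarith
    calc _ ≤ 2 / h ^ 2 * ((4 * (s * h) ^ 2 * R ^ 2) / 2 * (1 + (4 * (s * h) ^ 2 * R ^ 2) / 2)) := by
          gcongr
      _ = _ := by field_simp; ring

theorem coefB_bounds (hs : 1 ≤ s) (hh : 0 < h) (hξ : 0 < ξ)
    (hR : ξ + j * h ≤ R) (hρR : 2 * (s * h) * R ≤ 1) :
    0 ≤ coefB s h ξ j ∧ coefB s h ξ j ≤ 2 * s * R * (1 + 4 * (s * h) ^ 2 * R ^ 2) := by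
  have ha0 : 0 ≤ 2 * s * h * (ξ + j * h) := by positivity
  have ha1 : 2 * s * h * (ξ + j * h) ≤ 2 * (s * h) * R := by
    have : 0 < s * h := by positivity
    nlinarith
  have hR0 : 0 ≤ R := le_trans (by positivity) hR
  have hc2 := cosh_le_one_add_sq (x := 2 * s * h * (ξ + j * h))
    (by rw [abs_of_nonneg ha0]; linarith)
  have hc3 : (2 * s * h * (ξ + j * h)) ^ 2 ≤ 4 * (s * h) ^ 2 * R ^ 2 := by
    calc _ ≤ (2 * (s * h) * R) ^ 2 := by gcongr
      _ = _ := by ring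
  have hsh := sinh_le_mul_cosh ha0
  have h0 := Real.sinh_nonneg_iff.mpr ha0
  have he2 : Real.exp (-(s * h ^ 2)) ≤ 1 := Real.exp_le_one_iff.mpr (by
    have : 0 ≤ s * h ^ 2 := by positivity
    linarith)
  unfold coefB
  refine ⟨by positivity, ?_⟩
  rw [div_le_iff₀ hh]
  calc _ ≤ 1 * Real.sinh (2 * s * h * (ξ + j * h)) := by gcongr
    _ ≤ 2 * (s * h) * R * (1 + 4 * (s * h) ^ 2 * R ^ 2) := by
      rw [one_mul]
      refine hsh.trans ?_
      apply mul_le_mul ha1 (by linarith) (by positivity) (by positivity)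
    _ = _ := by ring

end Bounds

/-! ### The weighted identity at a fixed time -/

/-- The symmetric part of the conjugated operator at the interior mesh point `j + 1`. The arguments
`K, v, y` stand for `4 s² β² t²`, `v(t)` and `∂ₜ²v(t)`. -/
noncomputable def conjSymm (A C : ℕ → ℝ) (h K : ℝ) (v y : ℕ → ℝ) (j : ℕ) : ℝ :=
  y (j + 1) - A (j + 1) * (v (j + 2) - 2 * v (j + 1) + v j) / h ^ 2 - (C (j + 1) - K) * v (j + 1)

/-- The skew-symmetric part of the conjugated operator, up to lower order terms, at the interior
mesh point `j + 1`; `τ, v, u` stand for `4 s β t`, `v(t)` and `∂ₜv(t)`. -/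
noncomputable def conjSkew (B : ℕ → ℝ) (h τ : ℝ) (v u : ℕ → ℝ) (j : ℕ) : ℝ :=
  τ * u (j + 1) + B (j + 1) * (v (j + 2) - v j) / h

/-- The energy whose time derivative is extracted from the product of the symmetric and
skew-symmetric parts; `τ` is the factor `4 s β t` of the velocity in the latter. -/
noncomputable def carlG (A B C : ℕ → ℝ) (h τ K : ℝ) (N : ℕ) (v u : ℕ → ℝ) : ℝ :=
  h * ∑ j ∈ Finset.range N, (τ / 2 * u (j + 1) ^ 2 + B (j + 1) * u (j + 1) * ((v (j + 2) - v j) / h)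
      - τ / 2 * ((C (j + 1) - K) * v (j + 1) ^ 2))
    + h * ∑ j ∈ Finset.range (N + 1), τ / 2 * ((A j + A (j + 1)) / 2 * ((v (j + 1) - v j) / h) ^ 2)

/-- The time derivative of `carlG` along `v' = u`, `u' = y`; `τ', K'` are the time derivatives of
`τ, K`. -/
noncomputable def carlGDeriv (A B C : ℕ → ℝ) (h τ K τ' K' : ℝ) (N : ℕ) (v u y : ℕ → ℝ) : ℝ :=
  h * ∑ j ∈ Finset.range N, ((τ' / 2 * u (j + 1) ^ 2 + τ / 2 * (2 * u (j + 1) * y (j + 1)))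
      + (B (j + 1) * y (j + 1) * ((v (j + 2) - v j) / h)
        + B (j + 1) * u (j + 1) * ((u (j + 2) - u j) / h))
      - (τ' / 2 * ((C (j + 1) - K) * v (j + 1) ^ 2)
        + τ / 2 * (-K' * v (j + 1) ^ 2 + (C (j + 1) - K) * (2 * v (j + 1) * u (j + 1)))))
    + h * ∑ j ∈ Finset.range (N + 1),
      (τ' / 2 * ((A j + A (j + 1)) / 2 * ((v (j + 1) - v j) / h) ^ 2)
      + τ / 2 * ((A j + A (j + 1)) / 2 * (2 * ((v (j + 1) - v j) / h) * ((u (j + 1) - u j) / h))))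

/-- The energy used to recover the initial velocity. The factor `θ` decreases from `1` at `t = 0` to
`0` at `t = T`, so that only the initial time contributes. -/
noncomputable def carlH (A C : ℕ → ℝ) (h θ K : ℝ) (N : ℕ) (v u : ℕ → ℝ) : ℝ :=
  θ / 2 * (h * ∑ j ∈ Finset.range N, (u (j + 1) ^ 2 - (C (j + 1) - K) * v (j + 1) ^ 2)
    + h * ∑ j ∈ Finset.range (N + 1), (A j + A (j + 1)) / 2 * ((v (j + 1) - v j) / h) ^ 2)

/-- The time derivative of `carlH` along `v' = u`, `u' = y`; `θ', K'` are the time derivatives of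
`θ, K`. -/
noncomputable def carlHDeriv (A C : ℕ → ℝ) (h θ K θ' K' : ℝ) (N : ℕ) (v u y : ℕ → ℝ) : ℝ :=
  θ' / 2 * (h * ∑ j ∈ Finset.range N, (u (j + 1) ^ 2 - (C (j + 1) - K) * v (j + 1) ^ 2)
    + h * ∑ j ∈ Finset.range (N + 1), (A j + A (j + 1)) / 2 * ((v (j + 1) - v j) / h) ^ 2)
  + θ / 2 * (h * ∑ j ∈ Finset.range N, (2 * u (j + 1) * y (j + 1)
        - (-K' * v (j + 1) ^ 2 + (C (j + 1) - K) * (2 * v (j + 1) * u (j + 1))))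
    + h * ∑ j ∈ Finset.range (N + 1),
      (A j + A (j + 1)) / 2 * (2 * ((v (j + 1) - v j) / h) * ((u (j + 1) - u j) / h)))

/-- The quadratic form produced by summation by parts in `∑ P₁ P₂`, as a density on the edges
`[x_j, x_{j+1}]` of the mesh. -/
noncomputable def edgeDensity (A B C : ℕ → ℝ) (h τ K τ' : ℝ) (v u : ℕ → ℝ) (j : ℕ) : ℝ :=
  (B (j + 1) - B j) / h * (u j * u (j + 1))
  + τ * ((v (j + 1) - v j) / h) * ((A (j + 1) - A j) / h) * ((u j + u (j + 1)) / 2)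
  + (A (j + 1) * B (j + 1) - A j * B j) / h * ((v (j + 1) - v j) / h) ^ 2
  - τ' / 2 * ((A j + A (j + 1)) / 2) * ((v (j + 1) - v j) / h) ^ 2
  + ((C (j + 1) * B (j + 1) - C j * B j) / h - K * ((B (j + 1) - B j) / h)) * (v j * v (j + 1))

/-- Discrete counterpart of the multiplication of `P₁ v` by `P₂ v`, with `P₁` the symmetric and `P₂`
the skew-symmetric part: a time derivative, a quadratic form, and boundary terms. -/
theorem sum_symm_mul_skew (A B C : ℕ → ℝ) {h : ℝ} (hh : h ≠ 0) (τ K τ' K' : ℝ) (N : ℕ)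
    (v u y : ℕ → ℝ) (hv0 : v 0 = 0) (hv1 : v (N + 1) = 0) (hu0 : u 0 = 0) (hu1 : u (N + 1) = 0) :
    h * ∑ j ∈ Finset.range N, conjSymm A C h K v y j * conjSkew B h τ v u j =
      carlGDeriv A B C h τ K τ' K' N v u y
        + h * ∑ j ∈ Finset.range (N + 1), edgeDensity A B C h τ K τ' v u j
        - h * ∑ j ∈ Finset.range N, (τ' / 2 * u (j + 1) ^ 2
            - τ' / 2 * (C (j + 1) - K) * v (j + 1) ^ 2 + τ / 2 * K' * v (j + 1) ^ 2)
        + A 0 * B 0 * ((v 1 - v 0) / h) ^ 2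
        - A (N + 1) * B (N + 1) * ((v (N + 1) - v N) / h) ^ 2 := by
  have e1 := sum_central_diff B u N
  have e2 := sum_second_diff (fun j => A j * u j) v N
  have e3 := sum_second_central_diff (fun j => A j * B j) v N
  have e4 := sum_central_diff (fun j => (C j - K) * B j) v N
  simp only [hu0, hu1, hv0, hv1, mul_zero, zero_mul, add_zero, sub_zero] at e1 e2 e3 e4
  have hL : h * ∑ j ∈ Finset.range N, conjSymm A C h K v y j * conjSkew B h τ v u j =
      h * ∑ j ∈ Finset.range N, (τ * (y (j + 1) * u (j + 1))
          + B (j + 1) * y (j + 1) * ((v (j + 2) - v j) / h)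
          - τ * ((C (j + 1) - K) * v (j + 1) * u (j + 1)))
        - τ / h * ∑ j ∈ Finset.range N,
            A (j + 1) * u (j + 1) * (v (j + 2) - 2 * v (j + 1) + v j)
        - 1 / h ^ 2 * ∑ j ∈ Finset.range N,
            A (j + 1) * B (j + 1) * ((v (j + 2) - 2 * v (j + 1) + v j) * (v (j + 2) - v j))
        - ∑ j ∈ Finset.range N, (C (j + 1) - K) * B (j + 1) * v (j + 1) * (v (j + 2) - v j) := by
    simp only [Finset.mul_sum, ← Finset.sum_sub_distrib]
    refine Finset.sum_congr rfl fun j _ => ?_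
    unfold conjSymm conjSkew
    field_simp
    ring
  have hG : carlGDeriv A B C h τ K τ' K' N v u y - h * ∑ j ∈ Finset.range N, (τ' / 2 * u (j + 1) ^ 2
            - τ' / 2 * (C (j + 1) - K) * v (j + 1) ^ 2 + τ / 2 * K' * v (j + 1) ^ 2) =
      h * ∑ j ∈ Finset.range N, (τ * (y (j + 1) * u (j + 1))
          + B (j + 1) * y (j + 1) * ((v (j + 2) - v j) / h)
          - τ * ((C (j + 1) - K) * v (j + 1) * u (j + 1)))
        + ∑ j ∈ Finset.range N, B (j + 1) * u (j + 1) * (u (j + 2) - u j)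
        + h * ∑ j ∈ Finset.range (N + 1),
      (τ' / 2 * ((A j + A (j + 1)) / 2 * ((v (j + 1) - v j) / h) ^ 2)
      + τ / 2 * ((A j + A (j + 1)) / 2 * (2 * ((v (j + 1) - v j) / h) * ((u (j + 1) - u j) / h))))
      := by
    unfold carlGDeriv
    rw [add_sub_right_comm]
    congr 1
    simp only [Finset.mul_sum, ← Finset.sum_add_distrib, ← Finset.sum_sub_distrib]
    refine Finset.sum_congr rfl fun j _ => ?_
    field_simp
    ring
  have hE : h * ∑ j ∈ Finset.range (N + 1), edgeDensity A B C h τ K τ' v u j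
      + h * ∑ j ∈ Finset.range (N + 1),
      (τ' / 2 * ((A j + A (j + 1)) / 2 * ((v (j + 1) - v j) / h) ^ 2)
      + τ / 2 * ((A j + A (j + 1)) / 2 * (2 * ((v (j + 1) - v j) / h) * ((u (j + 1) - u j) / h))))
      = ∑ j ∈ Finset.range (N + 1), (B (j + 1) - B j) * (u j * u (j + 1))
      + τ / h * ∑ j ∈ Finset.range (N + 1), (v (j + 1) - v j) * (A (j + 1) * u (j + 1) - A j * u j)
      + 1 / h ^ 2 * ∑ j ∈ Finset.range (N + 1),
        (A (j + 1) * B (j + 1) - A j * B j) * (v (j + 1) - v j) ^ 2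
      + ∑ j ∈ Finset.range (N + 1),
        ((C (j + 1) - K) * B (j + 1) - (C j - K) * B j) * (v j * v (j + 1)) := by
    simp only [Finset.mul_sum, ← Finset.sum_add_distrib]
    refine Finset.sum_congr rfl fun j _ => ?_
    unfold edgeDensity
    field_simp
    ring
  rw [hL, e2, e3, e4]
  simp only [hv0, hv1, sub_zero, zero_sub] at *
  rw [e1] at hG
  have hb : A 0 * B 0 * (v 1 / h) ^ 2 - A (N + 1) * B (N + 1) * (-v N / h) ^ 2 =
    1 / h ^ 2 * (A 0 * B 0 * v 1 ^ 2) - 1 / h ^ 2 * (A (N + 1) * B (N + 1) * (-v N) ^ 2) := by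
    field_simp
  linear_combination -hG - hE - hb

/-- Multiplication of the symmetric part by the velocity. -/
theorem sum_symm_mul_velocity (A C : ℕ → ℝ) {h : ℝ} (hh : h ≠ 0) (θ K θ' K' : ℝ) (N : ℕ)
    (v u y : ℕ → ℝ) (hu0 : u 0 = 0) (hu1 : u (N + 1) = 0) :
    carlHDeriv A C h θ K θ' K' N v u y =
      θ' / 2 * (h * ∑ j ∈ Finset.range N, (u (j + 1) ^ 2 - (C (j + 1) - K) * v (j + 1) ^ 2)
        + h * ∑ j ∈ Finset.range (N + 1), (A j + A (j + 1)) / 2 * ((v (j + 1) - v j) / h) ^ 2)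
      + θ * (h * ∑ j ∈ Finset.range N, conjSymm A C h K v y j * u (j + 1)
        - h * ∑ j ∈ Finset.range (N + 1),
          ((v (j + 1) - v j) / h) * ((A (j + 1) - A j) / h) * ((u j + u (j + 1)) / 2)
        + h * ∑ j ∈ Finset.range N, K' / 2 * v (j + 1) ^ 2) := by
  have e2 := sum_second_diff (fun j => A j * u j) v N
  simp only [hu0, hu1, mul_zero, zero_mul, add_zero, sub_zero] at e2
  have hL : h * ∑ j ∈ Finset.range N, conjSymm A C h K v y j * u (j + 1)
        + h * ∑ j ∈ Finset.range N, K' / 2 * v (j + 1) ^ 2 =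
      1 / 2 * (h * ∑ j ∈ Finset.range N, (2 * u (j + 1) * y (j + 1)
        - (-K' * v (j + 1) ^ 2 + (C (j + 1) - K) * (2 * v (j + 1) * u (j + 1)))))
        - 1 / h * ∑ j ∈ Finset.range N,
            A (j + 1) * u (j + 1) * (v (j + 2) - 2 * v (j + 1) + v j) := by
    simp only [Finset.mul_sum, ← Finset.sum_add_distrib, ← Finset.sum_sub_distrib]
    refine Finset.sum_congr rfl fun j _ => ?_
    unfold conjSymm
    field_simp
    ring
  have hE : h * ∑ j ∈ Finset.range (N + 1),
          ((v (j + 1) - v j) / h) * ((A (j + 1) - A j) / h) * ((u j + u (j + 1)) / 2)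
        + 1 / 2 * (h * ∑ j ∈ Finset.range (N + 1),
      (A j + A (j + 1)) / 2 * (2 * ((v (j + 1) - v j) / h) * ((u (j + 1) - u j) / h)))
      = 1 / h * ∑ j ∈ Finset.range (N + 1),
        (v (j + 1) - v j) * (A (j + 1) * u (j + 1) - A j * u j) := by
    simp only [Finset.mul_sum, ← Finset.sum_add_distrib]
    refine Finset.sum_congr rfl fun j _ => ?_
    field_simp
    ring
  unfold carlHDeriv
  rw [e2] at hL
  linear_combination -θ * hL + θ * hE

/-! ### The pointwise Carleman inequality -/

/-- Lower bound for the coefficient of `v²` at a mesh point, where `x` is the distance to the base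
point. -/
noncomputable def potCoef (s ρ R T β t x : ℝ) : ℝ :=
  4 * s ^ 3 * ((3 + β) * x ^ 2 - (1 + 3 * β) * β ^ 2 * t ^ 2) - 29 * s ^ 2
    - 16 * s ^ 3 * T ^ 2 * R ^ 2 * ρ ^ 2

/-- Product of neighbouring values against the sum of squares. -/
theorem mul_neighbours_lower {k lo hi a b : ℝ} (h1 : lo ≤ k) (h2 : k ≤ hi) :
    lo / 2 * (a ^ 2 + b ^ 2) - hi / 2 * (b - a) ^ 2 ≤ k * (a * b) := by
  have e : k * (a * b) = k / 2 * (a ^ 2 + b ^ 2) - k / 2 * (b - a) ^ 2 := by ring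
  rw [e]
  have := mul_le_mul_of_nonneg_right h1 (add_nonneg (sq_nonneg a) (sq_nonneg b))
  have := mul_le_mul_of_nonneg_right h2 (sq_nonneg (b - a))
  linarith

/-- Contribution of the velocity to the edge density. -/
theorem velocity_edge_bound {s h ρ dB u0 u1 r : ℝ} (b1 : 2 * s - 2 * ρ ^ 2 ≤ dB) (hb : dB ≤ 4 * s)
    (hr : u1 - u0 = h * r) :
    (s - ρ ^ 2) * (u0 ^ 2 + u1 ^ 2) - 2 * s * h ^ 2 * r ^ 2 ≤ dB * (u0 * u1) := by
  have := mul_neighbours_lower (a := u0) (b := u1) b1 hb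
  rw [hr] at this
  linarith

/-- Contribution of the mixed term to the edge density. -/
theorem mixed_edge_bound {s β t T R ρ dA p u0 u1 : ℝ} (hs : 0 ≤ s) (hβt0 : 0 ≤ β * t)
    (hβt : β * t ≤ T) (a1 : 0 ≤ dA) (a2 : dA ≤ 8 * ρ ^ 2 * R) :
    -(8 * s * T * R * ρ ^ 2 * (2 * p ^ 2 + (u0 ^ 2 + u1 ^ 2))) ≤
      4 * s * β * t * p * dA * ((u0 + u1) / 2) := by
  have hT : 0 ≤ T := hβt0.trans hβt
  have e0 : 0 ≤ 4 * s * (β * t) * dA := by positivity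
  have e2 : -((2 * p ^ 2 + (u0 ^ 2 + u1 ^ 2)) / 4) ≤ p * ((u0 + u1) / 2) := by
    nlinarith [sq_nonneg (u0 - u1), sq_nonneg (p + (u0 + u1) / 2)]
  have e3 : 4 * s * (β * t) * dA ≤ 4 * s * T * (8 * ρ ^ 2 * R) := by gcongr
  have e4 := mul_le_mul_of_nonneg_left e2 e0
  have e5 := mul_le_mul_of_nonneg_right e3
    (show 0 ≤ (2 * p ^ 2 + (u0 ^ 2 + u1 ^ 2)) / 4 by positivity)
  linarith

/-- Contribution of `Δ_h v D v` and `v D v` to the zeroth order part of the edge density. -/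
theorem potential_edge_bound {s h ρ R x dK v0 v1 p : ℝ} (hs : 1 ≤ s) (hh : 0 < h) (hx : 0 ≤ x)
    (hxR : x + h ≤ R) (hρ : ρ = s * h) (hρR : 2 * ρ * R ≤ 1) (hρ2R : ρ ^ 2 * (4 * R ^ 2) ≤ 1)
    (k1 : 24 * s ^ 3 * (x + h / 2) ^ 2 - 24 * s ^ 2 * ρ ^ 2 * R ^ 2 - 32 * s ^ 2 ≤ dK)
    (k2 : dK ≤ 128 * s ^ 3 * R ^ 2) (hp : v1 - v0 = h * p) :
    (12 * s ^ 3 * x ^ 2 - 25 * s ^ 2) * v0 ^ 2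
      + (12 * s ^ 3 * (x + h) ^ 2 - 25 * s ^ 2) * v1 ^ 2 - 64 * s * ρ ^ 2 * R ^ 2 * p ^ 2
      ≤ dK * (v0 * v1) := by
  have hlo := mul_neighbours_lower (a := v0) (b := v1) k1 k2
  rw [hp] at hlo
  have h3 : s ^ 2 * (ρ ^ 2 * (4 * R ^ 2)) ≤ s ^ 2 * 1 := by gcongr
  have e0 : 12 * s ^ 3 * x ^ 2 - 25 * s ^ 2 ≤
      (24 * s ^ 3 * (x + h / 2) ^ 2 - 24 * s ^ 2 * ρ ^ 2 * R ^ 2 - 32 * s ^ 2) / 2 := by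
    have h2 : s ^ 3 * x ^ 2 ≤ s ^ 3 * (x + h / 2) ^ 2 := by gcongr; linarith
    nlinarith only [h2, h3, sq_nonneg s]
  have e1 : 12 * s ^ 3 * (x + h) ^ 2 - 25 * s ^ 2 ≤
      (24 * s ^ 3 * (x + h / 2) ^ 2 - 24 * s ^ 2 * ρ ^ 2 * R ^ 2 - 32 * s ^ 2) / 2 := by
    have h1 : (x + h) ^ 2 ≤ (x + h / 2) ^ 2 + h * R := by nlinarith only [hh, hx, hxR]
    have h2 : s ^ 3 * (x + h) ^ 2 ≤ s ^ 3 * ((x + h / 2) ^ 2 + h * R) := by gcongr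
    have h4 : s ^ 3 * (h * R) = s ^ 2 * (ρ * R) := by rw [hρ]; ring
    have h5 : s ^ 2 * (2 * ρ * R) ≤ s ^ 2 * 1 := by gcongr
    nlinarith only [h2, h3, h4, h5, sq_nonneg s]
  have e2 := mul_le_mul_of_nonneg_right e0 (sq_nonneg v0)
  have e3 := mul_le_mul_of_nonneg_right e1 (sq_nonneg v1)
  have e4 : 128 * s ^ 3 * R ^ 2 / 2 * (h * p) ^ 2 = 64 * s * ρ ^ 2 * R ^ 2 * p ^ 2 := by
    rw [hρ]; ring
  linarith

/-- Contribution of the time derivative of the weight to the zeroth order part of the edge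
density. -/
theorem time_weight_edge_bound {s ρ R T β t dB v0 v1 : ℝ} (hs : 0 ≤ s) (hβt0 : 0 ≤ β * t)
    (hβt : β * t ≤ T) (hdB : 0 ≤ dB) (b2 : dB ≤ 2 * s * (1 + 4 * ρ ^ 2 * R ^ 2)) :
    4 * s ^ 2 * β ^ 2 * t ^ 2 * dB * (v0 * v1) ≤
      (4 * s ^ 3 * β ^ 2 * t ^ 2 + 16 * s ^ 3 * T ^ 2 * R ^ 2 * ρ ^ 2) * (v0 ^ 2 + v1 ^ 2) := by
  have h1 : v0 * v1 ≤ (v0 ^ 2 + v1 ^ 2) / 2 := by nlinarith [sq_nonneg (v0 - v1)]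
  have hβt : β ^ 2 * t ^ 2 ≤ T ^ 2 := by
    rw [← mul_pow]; gcongr
  calc _ ≤ 4 * s ^ 2 * β ^ 2 * t ^ 2 * dB * ((v0 ^ 2 + v1 ^ 2) / 2) := by gcongr
    _ ≤ 4 * s ^ 2 * β ^ 2 * t ^ 2 * (2 * s * (1 + 4 * ρ ^ 2 * R ^ 2)) * ((v0 ^ 2 + v1 ^ 2) / 2) := by
      gcongr
    _ = (4 * s ^ 3 * β ^ 2 * t ^ 2 + 16 * s ^ 3 * (β ^ 2 * t ^ 2) * R ^ 2 * ρ ^ 2)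
        * (v0 ^ 2 + v1 ^ 2) := by ring
    _ ≤ _ := by gcongr

theorem coef_vertex_bound {s β c y w : ℝ} (hs : 0 ≤ s) (hβ0 : 0 ≤ β) (hβ1 : β ≤ 1)
    (hcy : 4 * s ^ 2 * y ^ 2 - 4 * s ≤ c) :
    (4 * s ^ 3 * β * y ^ 2 - 4 * s ^ 2) * w ^ 2 ≤ s * β * (c * w ^ 2) := by
  rw [← mul_assoc]
  apply mul_le_mul_of_nonneg_right _ (sq_nonneg w)
  have := mul_le_mul_of_nonneg_left hcy (show 0 ≤ s * β by positivity)
  have h2 : s * s * β ≤ s * s * 1 := by gcongr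
  linarith

/-- Lower bound of the quadratic form on one edge. The contributions that live on vertices in
`sum_symm_mul_skew` are split equally between the adjacent edges; with them, the coefficients of `u²` and
of `v²` at each end point become `s (1 - β) / 2` and `potCoef`. -/
theorem edge_lower_bound {s h ξ β R T t : ℝ} {j : ℕ} (hs : 1 ≤ s) (hh : 0 < h) (hξ : 0 < ξ)
    (hβ0 : 0 < β) (hβ1 : β < 1) (hρ : s * h ≤ 1 / 2)
    (hR : ξ + (j + 1) * h ≤ R) (hρR : 2 * (s * h) * R ≤ 1) (ht0 : 0 ≤ t) (htT : t ≤ T)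
    (hsm : (s * h) ^ 2 * (4 + 72 * R ^ 2 + 16 * T * R) ≤ (1 - β) / 2) (v u : ℕ → ℝ) :
    s * (1 - β) / 2 * (u j ^ 2 + u (j + 1) ^ 2) + s * (1 - β) * ((v (j + 1) - v j) / h) ^ 2
      - 2 * s * h ^ 2 * ((u (j + 1) - u j) / h) ^ 2
      + potCoef s (s * h) R T β t (ξ + j * h) * v j ^ 2
      + potCoef s (s * h) R T β t (ξ + (j + 1 : ℕ) * h) * v (j + 1) ^ 2 ≤
    edgeDensity (coefA s h ξ) (coefB s h ξ) (coefC s h ξ) h (4 * s * β * t) (4 * s ^ 2 * β ^ 2 * t ^ 2)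
        (4 * s * β) v u j
      - s * β * (u j ^ 2 + u (j + 1) ^ 2)
      + s * β * (coefC s h ξ j * v j ^ 2 + coefC s h ξ (j + 1) * v (j + 1) ^ 2)
      - 12 * s ^ 3 * β ^ 3 * t ^ 2 * (v j ^ 2 + v (j + 1) ^ 2) := by
  have hR' : ξ + ((j + 1 : ℕ) : ℝ) * h ≤ R := by push_cast; exact hR
  have hR0 : ξ + (j : ℝ) * h ≤ R := by linarith
  have hRpos : 0 ≤ R := le_trans (by positivity) hR0
  obtain ⟨b1, b2⟩ := coefB_succ_sub_bounds hs hh hξ hρ hR hρR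
  obtain ⟨a1, a2⟩ := coefA_succ_sub_bounds hs hh hξ hR hρR
  have m1 := le_coefAB_succ_sub (ξ := ξ) (j := j) hs hh hρ
  obtain ⟨k1, k2⟩ := coefCB_succ_sub_bounds hs hh hξ hρ hR hρR
  obtain ⟨-, aa1⟩ := coefA_bounds hs hh hξ hR0 hρR
  obtain ⟨-, aa2⟩ := coefA_bounds hs hh hξ hR' hρR
  obtain ⟨c1, -⟩ := coefC_bounds hs hh hξ hR0 hρR
  obtain ⟨c2, -⟩ := coefC_bounds hs hh hξ hR' hρR
  have hx' : ξ + ((j + 1 : ℕ) : ℝ) * h = (ξ + (j : ℝ) * h) + h := by push_cast; ring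
  rw [hx'] at c2 ⊢
  have hxm : ξ + ((j : ℝ) + 1 / 2) * h = (ξ + (j : ℝ) * h) + h / 2 := by ring
  rw [hxm] at k1
  have hx0 : 0 ≤ ξ + (j : ℝ) * h := by positivity
  have hxR : ξ + (j : ℝ) * h + h ≤ R := by rw [← hx']; exact hR'
  unfold edgeDensity
  rw [← le_div_iff₀ hh] at b1 m1 k1
  rw [← div_le_iff₀ hh] at a2 b2 k2
  have a1' := div_nonneg a1 hh.le
  generalize (coefB s h ξ (j + 1) - coefB s h ξ j) / h = dB at *
  generalize (coefA s h ξ (j + 1) - coefA s h ξ j) / h = dA at *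
  generalize (coefA s h ξ (j + 1) * coefB s h ξ (j + 1) - coefA s h ξ j * coefB s h ξ j) / h
    = dM at *
  generalize (coefC s h ξ (j + 1) * coefB s h ξ (j + 1) - coefC s h ξ j * coefB s h ξ j) / h
    = dK at *
  generalize coefA s h ξ (j + 1) = A1 at *
  generalize coefA s h ξ j = A0 at *
  generalize coefC s h ξ (j + 1) = C1 at *
  generalize coefC s h ξ j = C0 at *
  generalize ξ + (j : ℝ) * h = x at *
  have hp : v (j + 1) - v j = h * ((v (j + 1) - v j) / h) := by field_simp
  have hr : u (j + 1) - u j = h * ((u (j + 1) - u j) / h) := by field_simp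
  generalize (v (j + 1) - v j) / h = p at *
  generalize (u (j + 1) - u j) / h = r at *
  generalize v (j + 1) = v1 at *
  generalize v j = v0 at *
  generalize u (j + 1) = u1 at *
  generalize u j = u0 at *
  set ρ := s * h with hρdef
  have hρ0 : 0 < ρ := by positivity
  have hρ2R : ρ ^ 2 * (4 * R ^ 2) ≤ 1 := by
    have : 0 ≤ 2 * ρ * R := by positivity
    nlinarith only [this, hρR]
  have hT : 0 ≤ T := ht0.trans htT
  have hβt0 : 0 ≤ β * t := by positivity
  have hβt : β * t ≤ T := by nlinarith only [hβ1, htT, ht0]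
  have hb : dB ≤ 4 * s := by nlinarith only [b2, hρ2R, hs]
  have hρs : ρ ^ 2 ≤ s := by nlinarith only [hρ, hs, hρ0]
  have hu := velocity_edge_bound b1 hb hr
  have hpu := mixed_edge_bound (p := p) (u0 := u0) (u1 := u1) (by linarith : 0 ≤ s) hβt0 hβt a1' a2
  have hpA : 4 * s * β / 2 * ((A0 + A1) / 2) * p ^ 2 ≤
      2 * s * β * (1 + 4 * ρ ^ 2 * R ^ 2) * p ^ 2 := by
    apply mul_le_mul_of_nonneg_right _ (sq_nonneg p)
    have : (A0 + A1) / 2 ≤ 1 + 4 * ρ ^ 2 * R ^ 2 := by linarith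
    calc _ ≤ 4 * s * β / 2 * (1 + 4 * ρ ^ 2 * R ^ 2) := by gcongr
      _ = _ := by ring
  have hpM : (2 * s - 4 * ρ ^ 2) * p ^ 2 ≤ dM * p ^ 2 :=
    mul_le_mul_of_nonneg_right m1 (sq_nonneg p)
  have hv1 := potential_edge_bound hs hh hx0 hxR hρdef hρR hρ2R k1 k2 hp
  have hv2 := time_weight_edge_bound (v0 := v0) (v1 := v1) (by linarith : 0 ≤ s) hβt0 hβt
    (by linarith) b2
  have hc0 := coef_vertex_bound (w := v0) (by linarith : 0 ≤ s) hβ0.le hβ1.le c1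
  have hc1 := coef_vertex_bound (w := v1) (by linarith : 0 ≤ s) hβ0.le hβ1.le c2
  have h1 : s * (ρ ^ 2 * (4 + 72 * R ^ 2 + 16 * T * R)) ≤ s * ((1 - β) / 2) := by gcongr
  have h2 : ρ ^ 2 ≤ s * ρ ^ 2 := by nlinarith only [sq_nonneg ρ, hs]
  have h3 : 0 ≤ s * ρ ^ 2 * R ^ 2 := by positivity
  have h4 : 0 ≤ s * ρ ^ 2 * (T * R) := by positivity
  have hU : s * (1 - β) / 2 * (u0 ^ 2 + u1 ^ 2) ≤
      (s - ρ ^ 2 - s * β - 8 * s * T * R * ρ ^ 2) * (u0 ^ 2 + u1 ^ 2) := by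
    apply mul_le_mul_of_nonneg_right _ (by positivity)
    linarith
  have hP : s * (1 - β) * p ^ 2 ≤ (2 * s - 4 * ρ ^ 2 - 2 * s * β * (1 + 4 * ρ ^ 2 * R ^ 2)
      - 16 * s * T * R * ρ ^ 2 - 64 * s * ρ ^ 2 * R ^ 2) * p ^ 2 := by
    apply mul_le_mul_of_nonneg_right _ (sq_nonneg p)
    have h3 : s * ρ ^ 2 * R ^ 2 * β ≤ s * ρ ^ 2 * R ^ 2 * 1 := by gcongr
    have h5 : 0 ≤ s * (1 - β) := mul_nonneg (by linarith) (by linarith)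
    linarith
  unfold potCoef
  linarith

/-- The range of parameters in which the Carleman inequality is proved: `s` large and `s h` small,
depending on the geometry and on the bound `m` of the potentials only. Here `ξ = -x₀`, so that
`ξ + L = sup |x - x₀|`. -/
structure Regime (ξ L β T m s h : ℝ) : Prop where
  one_le_s : 1 ≤ s
  h_pos : 0 < h
  ξ_pos : 0 < ξ
  L_pos : 0 < L
  β_pos : 0 < β
  β_lt_one : β < 1
  T_pos : 0 < T
  mesh_le : s * h ≤ 1 / 2
  mesh_mul_le : 2 * (s * h) * (ξ + L) ≤ 1
  mesh_sq_le : (s * h) ^ 2 * (4 + 72 * (ξ + L) ^ 2 + 16 * T * (ξ + L)) ≤ (1 - β) / 2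
  mesh_sq_mul_le : 16 * (s * h) ^ 2 * (ξ + L) ≤ 1
  lower_order_s : 29 ≤ 2 * s * (1 - β) * ξ ^ 2
  lower_order_mesh : 16 * T ^ 2 * (ξ + L) ^ 2 * (s * h) ^ 2 ≤ 2 * (1 - β) * ξ ^ 2
  sqrt_time : 4 ≤ √s * T
  sqrt_dist : T + 1 / T ≤ √s * ξ ^ 2
  commutator_velocity : 64 * (s * h) ^ 2 * ((ξ + L) ^ 2 + T ^ 2) ≤ 1 - β
  commutator_potential : 256 * (s * h) ^ 2 * (ξ + L) ^ 2 * T ^ 2 ≤ 4 * (1 - β) * ξ ^ 2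
  potential_le : 2 * (2 * s + m) ^ 2 ≤ 4 * s ^ 3 * (1 - β) * ξ ^ 2
  final_gradient : (ξ + L) * (1 + 4 * (s * h) ^ 2 * (ξ + L) ^ 2) ≤ β * T * (1 - (s * h) ^ 2)
  final_potential : (ξ + L) ^ 2 * (1 + 2 * (s * h) ^ 2 * (ξ + L) ^ 2) ≤ β ^ 2 * T ^ 2

theorem exists_regime {ξ L β T m : ℝ} (hm : 0 ≤ m) (hξ : 0 < ξ) (hL : 0 < L) (hβ0 : 0 < β) (hβ1 : β < 1)
    (hT : 0 < T) (hβT : ξ + L < β * T) :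
    ∃ s₀ > 0, ∃ ε₀ > 0, ∀ s ≥ s₀, ∀ h > 0, s * h ≤ ε₀ → Regime ξ L β T m s h := by
  have hb : 0 < 1 - β := by linarith
  have hsev : ∀ᶠ s : ℝ in atTop, 1 ≤ s ∧ 29 ≤ 2 * s * (1 - β) * ξ ^ 2 ∧ 4 ≤ √s * T ∧
      T + 1 / T ≤ √s * ξ ^ 2 ∧ 2 * (2 + m) ^ 2 ≤ 4 * s * (1 - β) * ξ ^ 2 := by
    have h4 : Tendsto (fun s : ℝ => 4 * s * (1 - β) * ξ ^ 2) atTop atTop := by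
      have := (tendsto_id (α := ℝ) (x := atTop)).atTop_mul_const
        (show 0 < 4 * (1 - β) * ξ ^ 2 by positivity)
      refine this.congr fun s => ?_
      simp only [id]; ring
    have h1 : Tendsto (fun s : ℝ => 2 * s * (1 - β) * ξ ^ 2) atTop atTop := by
      have := (tendsto_id (α := ℝ) (x := atTop)).atTop_mul_const
        (show 0 < 2 * (1 - β) * ξ ^ 2 by positivity)
      refine this.congr fun s => ?_
      simp only [id]; ring
    have h2 := Real.tendsto_sqrt_atTop.atTop_mul_const hT
    have h3 := Real.tendsto_sqrt_atTop.atTop_mul_const (show 0 < ξ ^ 2 by positivity)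
    filter_upwards [eventually_ge_atTop 1, h1.eventually_ge_atTop 29, h2.eventually_ge_atTop 4,
      h3.eventually_ge_atTop (T + 1 / T), h4.eventually_ge_atTop (2 * (2 + m) ^ 2)]
      with s a1 a2 a3 a4 a5
    exact ⟨a1, a2, a3, a4, a5⟩
  obtain ⟨s₁, hs₁⟩ := eventually_atTop.mp hsev
  have key : ∀ {f g : ℝ → ℝ}, Continuous f → Continuous g → f 0 < g 0 →
      ∀ᶠ ρ in 𝓝 (0 : ℝ), f ρ ≤ g ρ := fun hf hg h =>
    (hf.continuousAt.eventually_lt hg.continuousAt h).mono fun _ => le_of_lt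
  have hρev : ∀ᶠ ρ : ℝ in 𝓝 0, ρ ≤ 1 / 2 ∧ 2 * ρ * (ξ + L) ≤ 1 ∧
      ρ ^ 2 * (4 + 72 * (ξ + L) ^ 2 + 16 * T * (ξ + L)) ≤ (1 - β) / 2 ∧
      16 * ρ ^ 2 * (ξ + L) ≤ 1 ∧ 16 * T ^ 2 * (ξ + L) ^ 2 * ρ ^ 2 ≤ 2 * (1 - β) * ξ ^ 2 ∧
      64 * ρ ^ 2 * ((ξ + L) ^ 2 + T ^ 2) ≤ 1 - β ∧
      256 * ρ ^ 2 * (ξ + L) ^ 2 * T ^ 2 ≤ 4 * (1 - β) * ξ ^ 2 ∧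
      (ξ + L) * (1 + 4 * ρ ^ 2 * (ξ + L) ^ 2) ≤ β * T * (1 - ρ ^ 2) ∧
      (ξ + L) ^ 2 * (1 + 2 * ρ ^ 2 * (ξ + L) ^ 2) ≤ β ^ 2 * T ^ 2 := by
    have hsq : (ξ + L) ^ 2 < β ^ 2 * T ^ 2 := by
      rw [← mul_pow]; gcongr
    refine (key (by fun_prop) (by fun_prop) (by norm_num)).and <|
      (key (by fun_prop) (by fun_prop) (by norm_num)).and <|
      (key (by fun_prop) (by fun_prop) (by norm_num; linarith)).and <|
      (key (by fun_prop) (by fun_prop) (by norm_num)).and <|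
      (key (by fun_prop) (by fun_prop) (by norm_num; positivity)).and <|
      (key (by fun_prop) (by fun_prop) (by norm_num; linarith)).and <|
      (key (by fun_prop) (by fun_prop) (by norm_num; positivity)).and <|
      (key (by fun_prop) (by fun_prop) (by norm_num; linarith)).and <|
      (key (by fun_prop) (by fun_prop) (by norm_num; linarith))
  obtain ⟨ε, hε, hball⟩ := Metric.eventually_nhds_iff.mp hρev
  refine ⟨max s₁ 1, by positivity, ε / 2, by positivity, fun s hs h hh hsh => ?_⟩
  obtain ⟨a1, a2, a3, a4, a5⟩ := hs₁ s (le_trans (le_max_left _ _) hs)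
  have hsh0 : 0 < s * h := by positivity
  obtain ⟨b1, b2, b3, b4, b5, b8, b9, b6, b7⟩ := hball (y := s * h) (by
    rw [Real.dist_eq, sub_zero, abs_of_pos hsh0]; linarith)
  have a6 : 2 * (2 * s + m) ^ 2 ≤ 4 * s ^ 3 * (1 - β) * ξ ^ 2 := by
    have h1 : 2 * s + m ≤ s * (2 + m) := by nlinarith
    calc 2 * (2 * s + m) ^ 2 ≤ 2 * (s * (2 + m)) ^ 2 := by gcongr
      _ = s ^ 2 * (2 * (2 + m) ^ 2) := by ring
      _ ≤ s ^ 2 * (4 * s * (1 - β) * ξ ^ 2) := by gcongr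
      _ = _ := by ring
  exact ⟨a1, hh, hξ, hL, hβ0, hβ1, hT, b1, b2, b3, b4, a2, b5, a3, a4, b8, b9, a6, b6, b7⟩

/-- Outside `𝒪`, where `β t ≤ x`, the leading part of the coefficient is at least
`8 s³ (1 - β) x²`; inside, it is bounded below by a negative multiple of `s³`. -/
theorem le_potCoef {ξ L β T m s h t x χ : ℝ} (hr : Regime ξ L β T m s h) (ht0 : 0 ≤ t) (htT : t ≤ T)
    (hx : ξ ≤ x) (hχ0 : 0 ≤ χ) (hχ : x < β * t → χ = 1) :
    4 * s ^ 3 * (1 - β) * ξ ^ 2 - (16 * T ^ 2 + 8 * ξ ^ 2) * s ^ 3 * χ ≤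
      potCoef s (s * h) (ξ + L) T β t x := by
  obtain ⟨hs, hh, hξ, hL, hβ0, hβ1, hT, -, -, -, -, h1, h2, -, -, -, -, -, -, -⟩ := hr
  have hs3 : 0 < s ^ 3 := by positivity
  have e1 : 29 * s ^ 2 + 16 * s ^ 3 * T ^ 2 * (ξ + L) ^ 2 * (s * h) ^ 2 ≤
      4 * s ^ 3 * (1 - β) * ξ ^ 2 := by
    have := mul_le_mul_of_nonneg_left h1 (sq_nonneg s)
    have := mul_le_mul_of_nonneg_left h2 hs3.le
    linarith
  have hβt0 : 0 ≤ β * t := by positivity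
  have e2 : 2 * s ^ 3 * (1 - β) * ξ ^ 2 - (4 * T ^ 2 + 2 * ξ ^ 2) * s ^ 3 * χ ≤
      s ^ 3 * ((3 + β) * x ^ 2 - (1 + 3 * β) * β ^ 2 * t ^ 2) := by
    rcases lt_or_ge x (β * t) with hx2 | hx2
    · rw [hχ hx2]
      have hβt : (β * t) ^ 2 ≤ T ^ 2 := by
        have : β * t ≤ T := by nlinarith only [hβ1, htT, ht0]
        gcongr
      have h3 : 2 * (1 - β) * ξ ^ 2 - (4 * T ^ 2 + 2 * ξ ^ 2) ≤
          (3 + β) * x ^ 2 - (1 + 3 * β) * β ^ 2 * t ^ 2 := by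
        have h4 : (1 + 3 * β) * (β * t) ^ 2 ≤ 4 * T ^ 2 := by gcongr; linarith
        have h5 : 0 ≤ (3 + β) * x ^ 2 := by positivity
        have h6 : 0 ≤ β * ξ ^ 2 := by positivity
        linarith
      have := mul_le_mul_of_nonneg_left h3 hs3.le
      linarith
    · have h3 : 2 * (1 - β) * ξ ^ 2 ≤ (3 + β) * x ^ 2 - (1 + 3 * β) * β ^ 2 * t ^ 2 := by
        have h4 : (1 + 3 * β) * (β * t) ^ 2 ≤ (1 + 3 * β) * x ^ 2 := by gcongr
        have h5 : 2 * (1 - β) * ξ ^ 2 ≤ 2 * (1 - β) * x ^ 2 := by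
          have : 0 ≤ 1 - β := by linarith
          gcongr
        linarith
      have := mul_le_mul_of_nonneg_left h3 hs3.le
      have : 0 ≤ (4 * T ^ 2 + 2 * ξ ^ 2) * s ^ 3 * χ := by positivity
      linarith
  unfold potCoef
  linarith

/-- **Pointwise Carleman inequality.** At a fixed time, the square of the conjugated operator
dominates the sum of an exact time derivative and of positive terms, up to the observation at the
right end point, the values in `𝒪` and a high frequency term. -/
theorem carleman_pointwise {ξ L β T m s h t : ℝ} (hr : Regime ξ L β T m s h) {N : ℕ}
    (hN : (N + 1) * h = L) (ht0 : 0 ≤ t) (htT : t ≤ T) (v u y χ : ℕ → ℝ)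
    (hv0 : v 0 = 0) (hv1 : v (N + 1) = 0) (hu0 : u 0 = 0) (hu1 : u (N + 1) = 0)
    (hχ0 : ∀ j, 0 ≤ χ j) (hχ : ∀ j < N, ξ + (j + 1 : ℕ) * h < β * t → χ j = 1) :
    2 * carlGDeriv (coefA s h ξ) (coefB s h ξ) (coefC s h ξ) h (4 * s * β * t)
        (4 * s ^ 2 * β ^ 2 * t ^ 2) (4 * s * β) (8 * s ^ 2 * β ^ 2 * t) N v u y
      - (1 - β) * √s * carlHDeriv (coefA s h ξ) (coefC s h ξ) h (1 - t / T)
        (4 * s ^ 2 * β ^ 2 * t ^ 2) (-1 / T) (8 * s ^ 2 * β ^ 2 * t) N v u y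
      + s * (1 - β) * (h * ∑ j ∈ Finset.range N, u (j + 1) ^ 2)
      + s * (1 - β) * (h * ∑ j ∈ Finset.range (N + 1), ((v (j + 1) - v j) / h) ^ 2)
      + 8 * s ^ 3 * (1 - β) * ξ ^ 2 * (h * ∑ j ∈ Finset.range N, v (j + 1) ^ 2) ≤
    h * ∑ j ∈ Finset.range N, (conjSymm (coefA s h ξ) (coefC s h ξ) h (4 * s ^ 2 * β ^ 2 * t ^ 2) v y j
        + conjSkew (coefB s h ξ) h (4 * s * β * t) v u j) ^ 2
      + (64 * T ^ 2 + 32 * ξ ^ 2) * s ^ 3 * (h * ∑ j ∈ Finset.range N, χ j * v (j + 1) ^ 2)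
      + 4 * s * h ^ 2 * (h * ∑ j ∈ Finset.range (N + 1), ((u (j + 1) - u j) / h) ^ 2)
      + 16 * s * (ξ + L) * ((v (N + 1) - v N) / h) ^ 2 := by
  have hr' := hr
  obtain ⟨hs, hh, hξ, hL, hβ0, hβ1, hT, hρ, hρR, hsm, hsmR, -, -, hsT, hsξ, -, -, -, -, -⟩ := hr'
  have hXR : ∀ j, j ≤ N → ξ + ((j : ℝ) + 1) * h ≤ ξ + L := by
    intro j hj
    have : (j : ℝ) ≤ N := by exact_mod_cast hj
    rw [← hN]; gcongr
  have hXR0 : ∀ j, j ≤ N + 1 → ξ + (j : ℝ) * h ≤ ξ + L := by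
    intro j hj
    have : (j : ℝ) ≤ N + 1 := by exact_mod_cast hj
    rw [← hN]; gcongr
  set b := 1 - β with hbdef
  have hb0 : 0 < b := by rw [hbdef]; linarith
  have hb1 : b ≤ 1 := by rw [hbdef]; linarith
  set ρ := s * h with hρdef
  set R := ξ + L with hRdef
  have hRpos : 0 < R := by positivity
  set K := 4 * s ^ 2 * β ^ 2 * t ^ 2 with hK
  have hK0 : 0 ≤ K := by positivity
  have hβt : β ^ 2 * t ^ 2 ≤ T ^ 2 := by
    rw [← mul_pow]
    have : β * t ≤ T := by nlinarith only [hβ1, htT, ht0]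
    gcongr
  have hKT : K ≤ 4 * s ^ 2 * T ^ 2 := by
    rw [hK]; nlinarith only [mul_le_mul_of_nonneg_left hβt (sq_nonneg s)]
  -- Summation by parts turns the product of the two parts, and the product of the first one with
  -- the velocity, into time derivatives of energies and quadratic forms.
  have hprod := sum_symm_mul_skew (coefA s h ξ) (coefB s h ξ) (coefC s h ξ) hh.ne'
    (4 * s * β * t) K (4 * s * β) (8 * s ^ 2 * β ^ 2 * t) N v u y hv0 hv1 hu0 hu1
  have hvel := sum_symm_mul_velocity (coefA s h ξ) (coefC s h ξ) hh.ne' (1 - t / T) K (-1 / T)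
    (8 * s ^ 2 * β ^ 2 * t) N v u y hu0 hu1
  set P1 := conjSymm (coefA s h ξ) (coefC s h ξ) h K v y with hP1
  set P2 := conjSkew (coefB s h ξ) h (4 * s * β * t) v u with hP2
  set A := coefA s h ξ with hA
  set B := coefB s h ξ with hB
  set C := coefC s h ξ with hC
  set dG := carlGDeriv A B C h (4 * s * β * t) K (4 * s * β) (8 * s ^ 2 * β ^ 2 * t) N v u y
  set dH := carlHDeriv A C h (1 - t / T) K (-1 / T) (8 * s ^ 2 * β ^ 2 * t) N v u y
  -- Every interior vertex belongs to two edges, hence the factors `2` when the lower bounds per edge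
  -- are summed.
  have hedge : s * b * (h * ∑ j ∈ Finset.range N, u (j + 1) ^ 2)
      + s * b * (h * ∑ j ∈ Finset.range (N + 1), ((v (j + 1) - v j) / h) ^ 2)
      - 2 * s * h ^ 2 * (h * ∑ j ∈ Finset.range (N + 1), ((u (j + 1) - u j) / h) ^ 2)
      + 2 * (h * ∑ j ∈ Finset.range N,
        potCoef s ρ R T β t (ξ + (j + 1 : ℕ) * h) * v (j + 1) ^ 2) ≤
      h * ∑ j ∈ Finset.range (N + 1), edgeDensity A B C h (4 * s * β * t) K (4 * s * β) v u j
      - h * ∑ j ∈ Finset.range N, (4 * s * β / 2 * u (j + 1) ^ 2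
            - 4 * s * β / 2 * (C (j + 1) - K) * v (j + 1) ^ 2
            + 4 * s * β * t / 2 * (8 * s ^ 2 * β ^ 2 * t) * v (j + 1) ^ 2) := by
    have hsum := Finset.sum_le_sum fun j (hj : j ∈ Finset.range (N + 1)) =>
      edge_lower_bound hs hh hξ hβ0 hβ1 hρ
        (hXR j (Nat.lt_succ_iff.mp (Finset.mem_range.mp hj))) hρR ht0 htT hsm v u
    have f1 := sum_edges_eq (fun j => u j ^ 2) N (by simp [hu0]) (by simp [hu1])
    have f2 := sum_edges_eq (fun j => v j ^ 2) N (by simp [hv0]) (by simp [hv1])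
    have f3 := sum_edges_eq (fun j => potCoef s ρ R T β t (ξ + (j : ℕ) * h) * v j ^ 2) N
      (by simp [hv0]) (by simp [hv1])
    have f4 := sum_edges_eq (fun j => C j * v j ^ 2) N (by simp [hv0]) (by simp [hv1])
    have g1 : ∑ j ∈ Finset.range (N + 1), (s * b / 2 * (u j ^ 2 + u (j + 1) ^ 2)
        + s * b * ((v (j + 1) - v j) / h) ^ 2 - 2 * s * h ^ 2 * ((u (j + 1) - u j) / h) ^ 2
        + potCoef s ρ R T β t (ξ + (j : ℕ) * h) * v j ^ 2
        + potCoef s ρ R T β t (ξ + (j + 1 : ℕ) * h) * v (j + 1) ^ 2) =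
      s * b / 2 * ∑ j ∈ Finset.range (N + 1), (u j ^ 2 + u (j + 1) ^ 2)
        + s * b * ∑ j ∈ Finset.range (N + 1), ((v (j + 1) - v j) / h) ^ 2
        - 2 * s * h ^ 2 * ∑ j ∈ Finset.range (N + 1), ((u (j + 1) - u j) / h) ^ 2
        + ∑ j ∈ Finset.range (N + 1), (potCoef s ρ R T β t (ξ + (j : ℕ) * h) * v j ^ 2
          + potCoef s ρ R T β t (ξ + (j + 1 : ℕ) * h) * v (j + 1) ^ 2) := by
      simp only [Finset.mul_sum, ← Finset.sum_add_distrib, ← Finset.sum_sub_distrib]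
      exact Finset.sum_congr rfl fun j _ => by ring
    have g2 : ∑ j ∈ Finset.range (N + 1), (edgeDensity A B C h (4 * s * β * t) K (4 * s * β) v u j
          - s * β * (u j ^ 2 + u (j + 1) ^ 2)
          + s * β * (C j * v j ^ 2 + C (j + 1) * v (j + 1) ^ 2)
          - 12 * s ^ 3 * β ^ 3 * t ^ 2 * (v j ^ 2 + v (j + 1) ^ 2)) =
        ∑ j ∈ Finset.range (N + 1), edgeDensity A B C h (4 * s * β * t) K (4 * s * β) v u j
          - s * β * ∑ j ∈ Finset.range (N + 1), (u j ^ 2 + u (j + 1) ^ 2)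
          + s * β * ∑ j ∈ Finset.range (N + 1), (C j * v j ^ 2 + C (j + 1) * v (j + 1) ^ 2)
          - 12 * s ^ 3 * β ^ 3 * t ^ 2 * ∑ j ∈ Finset.range (N + 1), (v j ^ 2 + v (j + 1) ^ 2) := by
      simp only [Finset.mul_sum, ← Finset.sum_add_distrib, ← Finset.sum_sub_distrib]
    have g3 : ∑ j ∈ Finset.range N, (4 * s * β / 2 * u (j + 1) ^ 2
            - 4 * s * β / 2 * (C (j + 1) - K) * v (j + 1) ^ 2
            + 4 * s * β * t / 2 * (8 * s ^ 2 * β ^ 2 * t) * v (j + 1) ^ 2) =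
        2 * s * β * ∑ j ∈ Finset.range N, u (j + 1) ^ 2
          - 2 * s * β * ∑ j ∈ Finset.range N, C (j + 1) * v (j + 1) ^ 2
          + 24 * s ^ 3 * β ^ 3 * t ^ 2 * ∑ j ∈ Finset.range N, v (j + 1) ^ 2 := by
      simp only [Finset.mul_sum, ← Finset.sum_add_distrib, ← Finset.sum_sub_distrib]
      exact Finset.sum_congr rfl fun j _ => by rw [hK]; ring
    have hsum' := hsum
    rw [g2] at hsum'
    rw [← hbdef, g1, f1, f2, f3, f4] at hsum'
    rw [g3]
    have := mul_le_mul_of_nonneg_left hsum' hh.le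
    linarith only [this]
  -- The zeroth order coefficient is negative only in `𝒪`, where `χ = 1` compensates it.
  have hpot : 4 * s ^ 3 * b * ξ ^ 2 * (h * ∑ j ∈ Finset.range N, v (j + 1) ^ 2)
      - (16 * T ^ 2 + 8 * ξ ^ 2) * s ^ 3 * (h * ∑ j ∈ Finset.range N, χ j * v (j + 1) ^ 2) ≤
      h * ∑ j ∈ Finset.range N, potCoef s ρ R T β t (ξ + (j + 1 : ℕ) * h) * v (j + 1) ^ 2 := by
    have hterm := Finset.sum_le_sum fun j (hj : j ∈ Finset.range N) =>
      mul_le_mul_of_nonneg_right (le_potCoef (x := ξ + (j + 1 : ℕ) * h) hr ht0 htT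
        (by have : 0 ≤ ((j + 1 : ℕ) : ℝ) * h := by positivity
            linarith) (hχ0 j) (hχ j (Finset.mem_range.mp hj)))
        (sq_nonneg (v (j + 1)))
    have g1 : ∑ j ∈ Finset.range N, (4 * s ^ 3 * (1 - β) * ξ ^ 2
        - (16 * T ^ 2 + 8 * ξ ^ 2) * s ^ 3 * χ j) * v (j + 1) ^ 2 =
        4 * s ^ 3 * b * ξ ^ 2 * ∑ j ∈ Finset.range N, v (j + 1) ^ 2
        - (16 * T ^ 2 + 8 * ξ ^ 2) * s ^ 3 * ∑ j ∈ Finset.range N, χ j * v (j + 1) ^ 2 := by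
      simp only [Finset.mul_sum, ← Finset.sum_sub_distrib]
      exact Finset.sum_congr rfl fun j _ => by rw [hbdef]; ring
    rw [g1] at hterm
    have := mul_le_mul_of_nonneg_left hterm hh.le
    linarith only [this]
  -- The boundary term at `x = 0` has a good sign; the one at `x = L` is observed.
  have hbd0 : 0 ≤ A 0 * B 0 * ((v 1 - v 0) / h) ^ 2 := by
    have h1 := (coefB_bounds (j := 0) hs hh hξ (by simpa using hXR0 0 (by omega)) hρR).1
    have h2 : 0 ≤ A 0 := by rw [hA]; unfold coefA; positivity
    positivity
  have hρ2R : ρ ^ 2 * (4 * R ^ 2) ≤ 1 := by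
    have h1 : 0 ≤ 2 * ρ * R := by positivity
    nlinarith only [h1, hρR]
  have hbd1 : A (N + 1) * B (N + 1) * ((v (N + 1) - v N) / h) ^ 2 ≤
      8 * s * R * ((v (N + 1) - v N) / h) ^ 2 := by
    apply mul_le_mul_of_nonneg_right _ (sq_nonneg _)
    have h1 := coefB_bounds (j := N + 1) hs hh hξ (hXR0 (N + 1) le_rfl) hρR
    have h2 := coefA_bounds (j := N + 1) hs hh hξ (hXR0 (N + 1) le_rfl) hρR
    have h3 : A (N + 1) ≤ 2 := by linarith [h2.2]
    have h4 : B (N + 1) ≤ 4 * s * R := by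
      refine h1.2.trans ?_
      have : 0 ≤ s * R := by positivity
      nlinarith only [this, hρ2R]
    have h5 : 0 ≤ B (N + 1) := h1.1
    calc _ ≤ 2 * (4 * s * R) := by gcongr
      _ = _ := by ring
  -- The derivative of the second energy, multiplied by `(1 - β) √s`, is absorbed: the product of the
  -- symmetric part with `√s u` by `P1 ^ 2` and `s u²`, all else by one half of the positive terms.
  set Su := h * ∑ j ∈ Finset.range N, u (j + 1) ^ 2 with hSu
  set Sp := h * ∑ j ∈ Finset.range (N + 1), ((v (j + 1) - v j) / h) ^ 2 with hSp
  set Sv := h * ∑ j ∈ Finset.range N, v (j + 1) ^ 2 with hSv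
  have hSu0 : 0 ≤ Su := mul_nonneg hh.le (Finset.sum_nonneg fun _ _ => sq_nonneg _)
  have hSp0 : 0 ≤ Sp := mul_nonneg hh.le (Finset.sum_nonneg fun _ _ => sq_nonneg _)
  have hSv0 : 0 ≤ Sv := mul_nonneg hh.le (Finset.sum_nonneg fun _ _ => sq_nonneg _)
  have hθ0 : 0 ≤ 1 - t / T := by rw [sub_nonneg, div_le_one hT]; exact htT
  have hθ1 : 1 - t / T ≤ 1 := by linarith [div_nonneg ht0 hT.le]
  set θ := 1 - t / T
  have hq0 : 0 < √s := Real.sqrt_pos.mpr (by linarith)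
  have hqq : √s * √s = s := Real.mul_self_sqrt (by linarith)
  have hqs : √s ≤ s := by nlinarith only [hq0, hqq, hs]
  set q := √s
  have p1 : h * ∑ j ∈ Finset.range N, (u (j + 1) ^ 2 - (C (j + 1) - K) * v (j + 1) ^ 2) ≤
      Su + (4 * s ^ 2 * T ^ 2 + 4 * s) * Sv := by
    have : ∑ j ∈ Finset.range N, (u (j + 1) ^ 2 - (C (j + 1) - K) * v (j + 1) ^ 2) ≤
        ∑ j ∈ Finset.range N, (u (j + 1) ^ 2 + (4 * s ^ 2 * T ^ 2 + 4 * s) * v (j + 1) ^ 2) := by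
      refine Finset.sum_le_sum fun j hj => ?_
      have h1 := (coefC_bounds (j := j + 1) hs hh hξ
        (hXR0 (j + 1) (by have := Finset.mem_range.mp hj; omega)) hρR).1
      have h2 : 0 ≤ 4 * s ^ 2 * (ξ + (j + 1 : ℕ) * h) ^ 2 := by positivity
      have h3 : -(4 * s ^ 2 * T ^ 2 + 4 * s) ≤ C (j + 1) - K := by linarith only [h1, h2, hKT]
      have := mul_le_mul_of_nonneg_right h3 (sq_nonneg (v (j + 1)))
      linarith only [this]
    refine (mul_le_mul_of_nonneg_left this hh.le).trans (le_of_eq ?_)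
    rw [Finset.sum_add_distrib, ← Finset.mul_sum]
    ring
  have p2 : h * ∑ j ∈ Finset.range (N + 1), (A j + A (j + 1)) / 2 * ((v (j + 1) - v j) / h) ^ 2 ≤
      2 * Sp := by
    have : ∑ j ∈ Finset.range (N + 1), (A j + A (j + 1)) / 2 * ((v (j + 1) - v j) / h) ^ 2 ≤
        ∑ j ∈ Finset.range (N + 1), 2 * ((v (j + 1) - v j) / h) ^ 2 := by
      refine Finset.sum_le_sum fun j hj => ?_
      have hjN := Finset.mem_range.mp hj
      apply mul_le_mul_of_nonneg_right _ (sq_nonneg _)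
      have h1 := (coefA_bounds hs hh hξ (hXR0 j (by omega)) hρR).2
      have h2 := (coefA_bounds hs hh hξ (hXR0 (j + 1) (by omega)) hρR).2
      linarith only [h1, h2, hρ2R]
    refine (mul_le_mul_of_nonneg_left this hh.le).trans (le_of_eq ?_)
    rw [← Finset.mul_sum]
    ring
  have p3 : -(b * q * θ) * (h * ∑ j ∈ Finset.range N, P1 j * u (j + 1)) ≤
      h * ∑ j ∈ Finset.range N, P1 j ^ 2 + b ^ 2 * s / 4 * Su := by
    have hc : (b * q * θ) ^ 2 ≤ b ^ 2 * s := by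
      calc _ = b ^ 2 * s * θ ^ 2 := by rw [← hqq]; ring
        _ ≤ b ^ 2 * s * 1 := by gcongr; exact pow_le_one₀ hθ0 hθ1
        _ = _ := by ring
    have : ∑ j ∈ Finset.range N, -(b * q * θ) * (P1 j * u (j + 1)) ≤
        ∑ j ∈ Finset.range N, (P1 j ^ 2 + b ^ 2 * s / 4 * u (j + 1) ^ 2) := by
      refine Finset.sum_le_sum fun j _ => ?_
      have h1 := mul_le_mul_of_nonneg_right hc (sq_nonneg (u (j + 1)))
      nlinarith only [h1, sq_nonneg (P1 j + b * q * θ / 2 * u (j + 1))]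
    calc _ = h * ∑ j ∈ Finset.range N, -(b * q * θ) * (P1 j * u (j + 1)) := by
          rw [← Finset.mul_sum]; ring
      _ ≤ _ := mul_le_mul_of_nonneg_left this hh.le
      _ = _ := by rw [Finset.sum_add_distrib, ← Finset.mul_sum]; ring
  have p4 : h * ∑ j ∈ Finset.range (N + 1),
          ((v (j + 1) - v j) / h) * ((A (j + 1) - A j) / h) * ((u j + u (j + 1)) / 2) ≤
      1 / 4 * (Sp + Su) := by
    have : ∑ j ∈ Finset.range (N + 1),
          ((v (j + 1) - v j) / h) * ((A (j + 1) - A j) / h) * ((u j + u (j + 1)) / 2) ≤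
        ∑ j ∈ Finset.range (N + 1), (1 / 4 * ((v (j + 1) - v j) / h) ^ 2
          + 1 / 8 * (u j ^ 2 + u (j + 1) ^ 2)) := by
      refine Finset.sum_le_sum fun j hj => ?_
      have hjN := Finset.mem_range.mp hj
      obtain ⟨a1, a2⟩ := coefA_succ_sub_bounds hs hh hξ (hXR j (by omega)) hρR
      have a3 : (A (j + 1) - A j) / h ≤ 1 / 2 := by
        rw [div_le_iff₀ hh]
        have := mul_le_mul_of_nonneg_right hsmR hh.le
        linarith only [this, a2]
      have a4 := div_nonneg a1 hh.le
      generalize (A (j + 1) - A j) / h = dA at *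
      generalize (v (j + 1) - v j) / h = p
      have h1 : p * ((u j + u (j + 1)) / 2) ≤ p ^ 2 / 2 + (u j ^ 2 + u (j + 1) ^ 2) / 4 := by
        nlinarith only [sq_nonneg (p - (u j + u (j + 1)) / 2), sq_nonneg (u j - u (j + 1))]
      have h2 := mul_le_mul_of_nonneg_left h1 a4
      have h3 := mul_le_mul_of_nonneg_right a3
        (show 0 ≤ p ^ 2 / 2 + (u j ^ 2 + u (j + 1) ^ 2) / 4 by positivity)
      linarith only [h2, h3]
    refine (mul_le_mul_of_nonneg_left this hh.le).trans (le_of_eq ?_)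
    have f1 := sum_edges_eq (fun j => u j ^ 2) N (by simp [hu0]) (by simp [hu1])
    rw [Finset.sum_add_distrib, ← Finset.mul_sum, ← Finset.mul_sum, f1]
    ring
  have p5 : 0 ≤ h * ∑ j ∈ Finset.range N, 8 * s ^ 2 * β ^ 2 * t / 2 * v (j + 1) ^ 2 :=
    mul_nonneg hh.le (Finset.sum_nonneg fun _ _ => by positivity)
  have hT1 : 1 / T ≤ q / 4 := by rw [div_le_div_iff₀ hT (by norm_num)]; linarith only [hsT]
  have hinit : -(b * q * dH) ≤ h * ∑ j ∈ Finset.range N, P1 j ^ 2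
      + s * b * Su + s * b * Sp + 8 * s ^ 3 * b * ξ ^ 2 * Sv := by
    have hbq : 0 ≤ b * q := by positivity
    have hbqT : 0 ≤ b * q * (1 / T) := by positivity
    have i1 := mul_le_mul_of_nonneg_left (add_le_add p1 p2) hbqT
    have i4 := mul_le_mul_of_nonneg_left p4 (mul_nonneg hbq hθ0)
    have i4' := mul_le_mul_of_nonneg_right (mul_le_mul_of_nonneg_left hθ1 hbq)
      (show 0 ≤ 1 / 4 * (Sp + Su) by positivity)
    have i5 := mul_nonneg (mul_nonneg hbq hθ0) p5
    have k1 : b * q * (1 / T) ≤ b * s / 4 := by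
      have := mul_le_mul_of_nonneg_left hT1 hbq
      calc _ ≤ _ := this
        _ = b * (q * q) / 4 := by ring
        _ = _ := by rw [hqq]
    have k2 : b * q ≤ b * s := by gcongr
    have k3 : b ^ 2 * s ≤ b * s := by
      have : 0 ≤ b * s := by positivity
      nlinarith only [this, hb1]
    have k4 : b * q * (1 / T) * (4 * s ^ 2 * T ^ 2 + 4 * s) ≤ 16 * s ^ 3 * b * ξ ^ 2 := by
      have e1 : b * q * (1 / T) * (4 * s ^ 2 * T ^ 2 + 4 * s) =
          4 * b * q * s ^ 2 * T + 4 * b * q * s * (1 / T) := by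
        field_simp
      have e2 : 4 * b * q * s * (1 / T) ≤ 4 * b * q * s ^ 2 * (1 / T) := by
        have : s ≤ s ^ 2 := by nlinarith only [hs]
        gcongr
      have e3 := mul_le_mul_of_nonneg_left hsξ (show 0 ≤ 4 * b * q * s ^ 2 by positivity)
      have e4 : 4 * b * q * s ^ 2 * (q * ξ ^ 2) = 4 * b * s ^ 3 * ξ ^ 2 := by
        calc _ = 4 * b * (q * q) * s ^ 2 * ξ ^ 2 := by ring
          _ = _ := by rw [hqq]; ring
      have e5 : 0 ≤ b * s ^ 3 * ξ ^ 2 := by positivity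
      linarith only [e1, e2, e3, e4, e5]
    have j1 := mul_le_mul_of_nonneg_right k1 hSu0
    have j2 := mul_le_mul_of_nonneg_right k2 hSu0
    have j3 := mul_le_mul_of_nonneg_right k3 hSu0
    have j4 := mul_le_mul_of_nonneg_right k4 hSv0
    have j5 := mul_le_mul_of_nonneg_right k1 hSp0
    have j6 := mul_le_mul_of_nonneg_right k2 hSp0
    have j7 : 0 ≤ b * s * Su := by positivity
    have j8 : 0 ≤ b * s * Sp := by positivity
    rw [hvel]
    have hdiv : -1 / T = -(1 / T) := by ring
    rw [hdiv]
    linarith only [i1, p3, i4, i4', i5, j1, j2, j3, j4, j5, j6, j7, j8]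
  have hsq : h * ∑ j ∈ Finset.range N, P1 j ^ 2
      + 2 * (h * ∑ j ∈ Finset.range N, P1 j * P2 j) ≤
      h * ∑ j ∈ Finset.range N, (P1 j + P2 j) ^ 2 := by
    have : ∑ j ∈ Finset.range N, P1 j ^ 2 + 2 * ∑ j ∈ Finset.range N, P1 j * P2 j ≤
        ∑ j ∈ Finset.range N, (P1 j + P2 j) ^ 2 := by
      rw [Finset.mul_sum, ← Finset.sum_add_distrib]
      refine Finset.sum_le_sum fun j _ => ?_
      nlinarith only [sq_nonneg (P2 j)]
    have := mul_le_mul_of_nonneg_left this hh.le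
    linarith only [this]
  linarith only [hsq, hinit, hprod, hedge, hpot, hbd0, hbd1]

/-- At the final time the energy is nonnegative, because all points of the mesh are at distance less
than `β T` from the base point. -/
theorem carlG_final_nonneg {ξ L β T m s h : ℝ} (hr : Regime ξ L β T m s h) {N : ℕ}
    (hN : (N + 1) * h = L) (v u : ℕ → ℝ) :
    0 ≤ carlG (coefA s h ξ) (coefB s h ξ) (coefC s h ξ) h (4 * s * β * T)
      (4 * s ^ 2 * β ^ 2 * T ^ 2) N v u := by
  obtain ⟨hs, hh, hξ, hL, hβ0, hβ1, hT, -, hρR, -, -, -, -, -, -, -, -, -, hG, hK⟩ := hr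
  have hXR0 : ∀ j, j ≤ N + 1 → ξ + (j : ℝ) * h ≤ ξ + L := by
    intro j hj
    have : (j : ℝ) ≤ N + 1 := by exact_mod_cast hj
    rw [← hN]; gcongr
  have hA : ∀ j, j ≤ N + 1 → 2 * s * (ξ + L) * (1 + 4 * (s * h) ^ 2 * (ξ + L) ^ 2) ≤
      2 * s * (β * T) * coefA s h ξ j := by
    intro j hj
    have h1 := (coefA_bounds hs hh hξ (hXR0 j hj) hρR).1
    calc _ = 2 * s * ((ξ + L) * (1 + 4 * (s * h) ^ 2 * (ξ + L) ^ 2)) := by ring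
      _ ≤ 2 * s * (β * T * (1 - (s * h) ^ 2)) := by gcongr
      _ ≤ 2 * s * (β * T * coefA s h ξ j) := by gcongr
      _ = _ := by ring
  set b := 2 * s * (ξ + L) * (1 + 4 * (s * h) ^ 2 * (ξ + L) ^ 2) with hb
  have hb0 : 0 ≤ b := by positivity
  have hbT : b ≤ 2 * s * (β * T) := by
    have h1 : β * T * (1 - (s * h) ^ 2) ≤ β * T := by
      have : 0 ≤ β * T * (s * h) ^ 2 := by positivity
      linarith
    calc b = 2 * s * ((ξ + L) * (1 + 4 * (s * h) ^ 2 * (ξ + L) ^ 2)) := by rw [hb]; ring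
      _ ≤ 2 * s * (β * T) := mul_le_mul_of_nonneg_left (hG.trans h1) (by positivity)
  have hvert : ∑ j ∈ Finset.range N, -(b * (((v (j + 2) - v (j + 1)) / h) ^ 2
        + ((v (j + 1) - v j) / h) ^ 2) / 2) ≤
      ∑ j ∈ Finset.range N, (4 * s * β * T / 2 * u (j + 1) ^ 2
      + coefB s h ξ (j + 1) * u (j + 1) * ((v (j + 2) - v j) / h)
      - 4 * s * β * T / 2 * ((coefC s h ξ (j + 1) - 4 * s ^ 2 * β ^ 2 * T ^ 2) * v (j + 1) ^ 2)) := by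
    refine Finset.sum_le_sum fun j hj => ?_
    have hjN := Finset.mem_range.mp hj
    have h1 := coefB_bounds hs hh hξ (hXR0 (j + 1) (by omega)) hρR
    have h2 := (coefC_bounds hs hh hξ (hXR0 (j + 1) (by omega)) hρR).2
    have h3 : coefC s h ξ (j + 1) - 4 * s ^ 2 * β ^ 2 * T ^ 2 ≤ 0 := by
      have := mul_le_mul_of_nonneg_left hK (show 0 ≤ 4 * s ^ 2 by positivity)
      linarith only [this, h2]
    have h4 : 0 ≤ 4 * s * β * T / 2 *
        (-(coefC s h ξ (j + 1) - 4 * s ^ 2 * β ^ 2 * T ^ 2) * v (j + 1) ^ 2) :=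
      mul_nonneg (by positivity) (mul_nonneg (by linarith only [h3]) (sq_nonneg _))
    have h5 : (v (j + 2) - v j) / h = (v (j + 2) - v (j + 1)) / h + (v (j + 1) - v j) / h := by
      ring
    rw [h5]
    rw [← hb] at h1
    generalize (v (j + 2) - v (j + 1)) / h = p
    generalize (v (j + 1) - v j) / h = p'
    generalize coefB s h ξ (j + 1) = B at *
    have h6 : -(u (j + 1) ^ 2 + (p ^ 2 + p' ^ 2) / 2) ≤ u (j + 1) * (p + p') := by
      nlinarith only [sq_nonneg (u (j + 1) + p), sq_nonneg (u (j + 1) + p')]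
    have h7 := mul_le_mul_of_nonneg_left h6 h1.1
    have h8 := mul_le_mul_of_nonneg_right h1.2
      (show 0 ≤ u (j + 1) ^ 2 + (p ^ 2 + p' ^ 2) / 2 by positivity)
    have h9 := mul_le_mul_of_nonneg_right hbT (sq_nonneg (u (j + 1)))
    linarith only [h4, h7, h8, h9]
  have hedge : ∑ j ∈ Finset.range (N + 1), b * ((v (j + 1) - v j) / h) ^ 2 ≤
      ∑ j ∈ Finset.range (N + 1), 4 * s * β * T / 2 *
        ((coefA s h ξ j + coefA s h ξ (j + 1)) / 2 * ((v (j + 1) - v j) / h) ^ 2) := by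
    refine Finset.sum_le_sum fun j hj => ?_
    have hjN := Finset.mem_range.mp hj
    rw [← mul_assoc]
    apply mul_le_mul_of_nonneg_right _ (sq_nonneg _)
    linarith only [hA j (by omega), hA (j + 1) (by omega)]
  have hcompare : ∑ j ∈ Finset.range N, (b * (((v (j + 2) - v (j + 1)) / h) ^ 2
        + ((v (j + 1) - v j) / h) ^ 2) / 2) ≤
      ∑ j ∈ Finset.range (N + 1), b * ((v (j + 1) - v j) / h) ^ 2 := by
    have e1 := Finset.sum_range_succ (fun j => b * ((v (j + 1) - v j) / h) ^ 2) N
    have e2 := Finset.sum_range_succ' (fun j => b * ((v (j + 1) - v j) / h) ^ 2) N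
    have e3 : ∑ j ∈ Finset.range N, (b * (((v (j + 2) - v (j + 1)) / h) ^ 2
        + ((v (j + 1) - v j) / h) ^ 2) / 2) =
        1 / 2 * ∑ j ∈ Finset.range N, b * ((v (j + 1 + 1) - v (j + 1)) / h) ^ 2
        + 1 / 2 * ∑ j ∈ Finset.range N, b * ((v (j + 1) - v j) / h) ^ 2 := by
      rw [Finset.mul_sum, Finset.mul_sum, ← Finset.sum_add_distrib]
      exact Finset.sum_congr rfl fun j _ => by ring
    have e4 : 0 ≤ b * ((v (N + 1) - v N) / h) ^ 2 := by positivity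
    have e5 : 0 ≤ b * ((v (0 + 1) - v 0) / h) ^ 2 := by positivity
    linarith only [e1, e2, e3, e4, e5]
  rw [Finset.sum_neg_distrib] at hvert
  unfold carlG
  rw [← mul_add]
  exact mul_nonneg hh.le (by linarith only [hvert, hedge, hcompare])

theorem carlG_initial (A B C : ℕ → ℝ) (h : ℝ) (N : ℕ) (v u : ℕ → ℝ) (hv : ∀ j ≤ N + 1, v j = 0) :
    carlG A B C h 0 0 N v u = 0 := by
  unfold carlG
  have h1 : ∀ j ∈ Finset.range N, (0 / 2 * u (j + 1) ^ 2
      + B (j + 1) * u (j + 1) * ((v (j + 2) - v j) / h)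
      - 0 / 2 * ((C (j + 1) - 0) * v (j + 1) ^ 2)) = 0 := by
    intro j hj
    have hjN := Finset.mem_range.mp hj
    rw [hv (j + 2) (by omega), hv j (by omega)]
    ring
  rw [Finset.sum_eq_zero h1]
  simp

theorem carlH_initial (A C : ℕ → ℝ) (h : ℝ) (N : ℕ) (v u : ℕ → ℝ) (hv : ∀ j ≤ N + 1, v j = 0) :
    carlH A C h 1 0 N v u = 1 / 2 * (h * ∑ j ∈ Finset.range N, u (j + 1) ^ 2) := by
  unfold carlH
  have h1 : ∑ j ∈ Finset.range (N + 1), (A j + A (j + 1)) / 2 * ((v (j + 1) - v j) / h) ^ 2 = 0 := by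
    apply Finset.sum_eq_zero
    intro j hj
    have hjN := Finset.mem_range.mp hj
    rw [hv (j + 1) (by omega), hv j (by omega)]
    simp
  have h2 : ∑ j ∈ Finset.range N, (u (j + 1) ^ 2 - (C (j + 1) - 0) * v (j + 1) ^ 2) =
      ∑ j ∈ Finset.range N, u (j + 1) ^ 2 := by
    refine Finset.sum_congr rfl fun j hj => ?_
    have hjN := Finset.mem_range.mp hj
    rw [hv (j + 1) (by omega)]
    simp
  rw [h1, h2]
  ring

/-! ### Calculus on the time interval -/

section TimeCalculus

variable {T : ℝ}

theorem dt_eq_deriv {f : ℝ → ℝ} {t : ℝ} (ht : t ∈ Ioo 0 T) : dt T f t = deriv f t :=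
  derivWithin_of_mem_nhds (Icc_mem_nhds ht.1 ht.2)

theorem uniqueDiffWithinAt_time (hT : 0 < T) {t : ℝ} (ht : t ∈ Icc 0 T) :
    UniqueDiffWithinAt ℝ (Icc 0 T) t := uniqueDiffOn_Icc hT t ht

theorem dt_eq_of_hasDerivWithinAt (hT : 0 < T) {f : ℝ → ℝ} {f' t : ℝ} (ht : t ∈ Icc 0 T)
    (h : HasDerivWithinAt f f' (Icc 0 T) t) : dt T f t = f' :=
  h.derivWithin (uniqueDiffWithinAt_time hT ht)

theorem dt_congr {f g : ℝ → ℝ} (h : EqOn f g (Icc 0 T)) {t : ℝ} (ht : t ∈ Icc 0 T) :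
    dt T f t = dt T g t := derivWithin_congr h (h ht)

theorem ac_congr {f g : ℝ → ℝ} (hT : 0 < T) (h : EqOn f g (Icc 0 T))
    (hf : AbsolutelyContinuousOnInterval f 0 T) : AbsolutelyContinuousOnInterval g 0 T := by
  rw [absolutelyContinuousOnInterval_iff] at hf ⊢
  intro ε hε
  obtain ⟨δ, hδ, H⟩ := hf ε hε
  refine ⟨δ, hδ, fun E hE hlt => ?_⟩
  have := H E hE hlt
  refine lt_of_eq_of_lt (Finset.sum_congr rfl fun i hi => ?_) this
  have hmem := hE.1 i hi
  rw [uIcc_of_le hT.le] at hmem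
  rw [h hmem.1, h hmem.2]

theorem memL2_congr_ae {f g : ℝ → ℝ} (h : f =ᵐ[volume.restrict (Ioo 0 T)] g) (hf : MemL2 T f) :
    MemL2 T g := (memLp_congr_ae h).mp hf

theorem ae_Ioo_of_forall {p : ℝ → Prop} (h : ∀ t ∈ Ioo 0 T, p t) :
    ∀ᵐ t ∂(volume.restrict (Ioo 0 T)), p t :=
  (ae_restrict_iff' measurableSet_Ioo).mpr (ae_of_all _ h)

theorem memL2_congr {f g : ℝ → ℝ} (h : EqOn f g (Icc 0 T)) (hf : MemL2 T f) : MemL2 T g :=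
  memL2_congr_ae (ae_Ioo_of_forall fun _ ht => h (Ioo_subset_Icc_self ht)) hf

theorem memH1_congr {f g : ℝ → ℝ} (hT : 0 < T) (h : EqOn f g (Icc 0 T)) (hf : MemH1 T f) :
    MemH1 T g :=
  ⟨ac_congr hT h hf.1, memL2_congr (fun _ => dt_congr h) hf.2⟩

theorem ac_continuousOn (hT : 0 < T) {f : ℝ → ℝ} (hf : AbsolutelyContinuousOnInterval f 0 T) :
    ContinuousOn f (Icc 0 T) := by
  have := hf.continuousOn
  rwa [uIcc_of_le hT.le] at this

theorem ac_ae_hasDerivAt (hT : 0 < T) {f : ℝ → ℝ} (hf : AbsolutelyContinuousOnInterval f 0 T) :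
    ∀ᵐ t ∂(volume.restrict (Ioo 0 T)), HasDerivAt f (dt T f t) t := by
  rw [ae_restrict_iff' measurableSet_Ioo]
  filter_upwards [hf.ae_differentiableAt] with t ht htI
  rw [uIcc_of_le hT.le] at ht
  rw [dt_eq_deriv htI]
  exact (ht (Ioo_subset_Icc_self htI)).hasDerivAt

theorem interval_eq_Ioo (hT : 0 < T) (f : ℝ → ℝ) :
    ∫ t in (0 : ℝ)..T, f t = ∫ t in Ioo 0 T, f t := by
  rw [intervalIntegral.integral_of_le hT.le, integral_Ioc_eq_integral_Ioo]

theorem intervalIntegrable_iff_Ioo (hT : 0 < T) {f : ℝ → ℝ} :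
    IntervalIntegrable f volume 0 T ↔ IntegrableOn f (Ioo 0 T) := by
  rw [intervalIntegrable_iff_integrableOn_Ioc_of_le hT.le, integrableOn_Ioc_iff_integrableOn_Ioo]

/-- The fundamental theorem of calculus for an absolutely continuous function whose derivative is
known almost everywhere. -/
theorem ac_integral_eq_sub (hT : 0 < T) {f f' : ℝ → ℝ}
    (hf : AbsolutelyContinuousOnInterval f 0 T)
    (hd : ∀ᵐ t ∂(volume.restrict (Ioo 0 T)), HasDerivAt f (f' t) t) :
    IntegrableOn f' (Ioo 0 T) ∧ ∫ t in Ioo 0 T, f' t = f T - f 0 := by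
  have he : deriv f =ᵐ[volume.restrict (Ioo 0 T)] f' := by
    filter_upwards [hd] with t ht using ht.deriv
  have hi := (intervalIntegrable_iff_Ioo hT).mp hf.intervalIntegrable_deriv
  refine ⟨hi.congr he, ?_⟩
  rw [← hf.integral_deriv_eq_sub, interval_eq_Ioo hT]
  exact integral_congr_ae he.symm

theorem ac_dt_integrable (hT : 0 < T) {f : ℝ → ℝ} (hf : AbsolutelyContinuousOnInterval f 0 T) :
    IntegrableOn (dt T f) (Ioo 0 T) := (ac_integral_eq_sub hT hf (ac_ae_hasDerivAt hT hf)).1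

theorem ac_eq_integral (hT : 0 < T) {f : ℝ → ℝ} (hf : AbsolutelyContinuousOnInterval f 0 T)
    {t : ℝ} (ht : t ∈ Icc 0 T) : f t = f 0 + ∫ τ in (0 : ℝ)..t, dt T f τ := by
  have h0 : (0 : ℝ) ∈ Icc 0 T := ⟨le_rfl, hT.le⟩
  have hft : AbsolutelyContinuousOnInterval f 0 t := hf.mono (by
    rw [uIcc_of_le ht.1, uIcc_of_le hT.le]; exact Icc_subset_Icc_right ht.2)
  have := hft.integral_deriv_eq_sub
  have h2 : ∫ τ in (0 : ℝ)..t, dt T f τ = ∫ τ in (0 : ℝ)..t, deriv f τ := by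
    rw [intervalIntegral.integral_of_le ht.1, intervalIntegral.integral_of_le ht.1,
      integral_Ioc_eq_integral_Ioo, integral_Ioc_eq_integral_Ioo]
    refine setIntegral_congr_fun measurableSet_Ioo fun τ hτ => ?_
    exact dt_eq_deriv ⟨hτ.1, hτ.2.trans_le ht.2⟩
  rw [h2, this]; ring

theorem hasDerivWithinAt_primitive {g : ℝ → ℝ} (hg : ContinuousOn g (Icc 0 T)) {t : ℝ}
    (ht : t ∈ Icc 0 T) :
    HasDerivWithinAt (fun t => ∫ τ in (0 : ℝ)..t, g τ) (g t) (Icc 0 T) t := by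
  have : Fact (t ∈ Icc 0 T) := ⟨ht⟩
  have hgi : IntervalIntegrable g volume 0 t := by
    apply ContinuousOn.intervalIntegrable
    rw [uIcc_of_le ht.1]
    exact hg.mono (Icc_subset_Icc_right ht.2)
  exact intervalIntegral.integral_hasDerivWithinAt_right hgi
    (hg.stronglyMeasurableAtFilter_nhdsWithin measurableSet_Icc t) (hg t ht)

/-- An absolutely continuous function whose derivative agrees almost everywhere with a continuous
function is continuously differentiable. -/
theorem ac_hasDerivWithinAt (hT : 0 < T) {f g : ℝ → ℝ} (hf : AbsolutelyContinuousOnInterval f 0 T)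
    (hg : ContinuousOn g (Icc 0 T)) (hfg : dt T f =ᵐ[volume.restrict (Ioo 0 T)] g) {t : ℝ}
    (ht : t ∈ Icc 0 T) : HasDerivWithinAt f (g t) (Icc 0 T) t := by
  have h1 : EqOn f (fun t => f 0 + ∫ τ in (0 : ℝ)..t, g τ) (Icc 0 T) := by
    intro r hr
    rw [ac_eq_integral hT hf hr]
    congr 1
    rw [intervalIntegral.integral_of_le hr.1, intervalIntegral.integral_of_le hr.1,
      integral_Ioc_eq_integral_Ioo, integral_Ioc_eq_integral_Ioo]
    apply integral_congr_ae
    exact ae_restrict_of_ae_restrict_of_subset (Ioo_subset_Ioo_right hr.2) hfg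
  have h2 := (hasDerivWithinAt_primitive hg ht).const_add (f 0)
  exact h2.congr h1 (h1 ht)

theorem ac_hasDerivWithinAt_dt (hT : 0 < T) {f : ℝ → ℝ} (hf : AbsolutelyContinuousOnInterval f 0 T)
    (hf' : AbsolutelyContinuousOnInterval (dt T f) 0 T) {t : ℝ} (ht : t ∈ Icc 0 T) :
    HasDerivWithinAt f (dt T f t) (Icc 0 T) t :=
  ac_hasDerivWithinAt hT hf (ac_continuousOn hT hf') EventuallyEq.rfl ht

theorem ac_of_hasDerivWithinAt (hT : 0 < T) {f g : ℝ → ℝ} (hg : ContinuousOn g (Icc 0 T))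
    (hd : ∀ t ∈ Icc 0 T, HasDerivWithinAt f (g t) (Icc 0 T) t) :
    AbsolutelyContinuousOnInterval f 0 T := by
  apply ContDiffOn.absolutelyContinuousOnInterval
  rw [uIcc_of_le hT.le]
  rw [show (1 : WithTop ℕ∞) = 0 + 1 by norm_num]
  rw [contDiffOn_succ_iff_derivWithin (uniqueDiffOn_Icc hT)]
  refine ⟨fun t ht => (hd t ht).differentiableWithinAt, by simp, ?_⟩
  rw [contDiffOn_zero]
  refine hg.congr fun t ht => dt_eq_of_hasDerivWithinAt hT ht (hd t ht)

theorem ac_const (c : ℝ) : AbsolutelyContinuousOnInterval (fun _ => c) 0 T :=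
  ContDiffOn.absolutelyContinuousOnInterval contDiffOn_const

theorem ac_of_contDiff {f : ℝ → ℝ} (hf : ContDiff ℝ 1 f) : AbsolutelyContinuousOnInterval f 0 T :=
  ContDiffOn.absolutelyContinuousOnInterval hf.contDiffOn

theorem ac_sum {ι : Type*} (s : Finset ι) {f : ι → ℝ → ℝ}
    (hf : ∀ i ∈ s, AbsolutelyContinuousOnInterval (f i) 0 T) :
    AbsolutelyContinuousOnInterval (fun t => ∑ i ∈ s, f i t) 0 T := by
  classical
  induction s using Finset.induction_on with
  | empty => simpa using ac_const 0
  | insert a s ha ih =>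
    simp only [Finset.sum_insert ha]
    exact (hf a (by simp)).fun_add (ih fun i hi => hf i (by simp [hi]))

theorem memL2_add {f g : ℝ → ℝ} (hf : MemL2 T f) (hg : MemL2 T g) :
    MemL2 T fun t => f t + g t := MemLp.add hf hg

theorem memL2_sub {f g : ℝ → ℝ} (hf : MemL2 T f) (hg : MemL2 T g) :
    MemL2 T fun t => f t - g t := MemLp.sub hf hg

theorem memL2_of_continuousOn {f : ℝ → ℝ} (hf : ContinuousOn f (Icc 0 T)) :
    MemL2 T f := by
  obtain ⟨C, hC⟩ := isCompact_Icc.exists_bound_of_continuousOn hf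
  exact MemLp.of_bound ((hf.mono Ioo_subset_Icc_self).aestronglyMeasurable measurableSet_Ioo) C
    (ae_Ioo_of_forall fun t ht => hC t (Ioo_subset_Icc_self ht))

theorem memL2_sq_integrable {f : ℝ → ℝ} (hf : MemL2 T f) :
    IntegrableOn (fun t => f t ^ 2) (Ioo 0 T) := MemLp.integrable_sq hf

theorem integrableOn_continuousOn_mul {f g : ℝ → ℝ} (hf : ContinuousOn f (Icc 0 T))
    (hg : IntegrableOn g (Ioo 0 T)) : IntegrableOn (fun t => f t * g t) (Ioo 0 T) := by
  obtain ⟨C, hC⟩ := isCompact_Icc.exists_bound_of_continuousOn hf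
  have hfm : AEStronglyMeasurable f (volume.restrict (Ioo 0 T)) :=
    (hf.mono Ioo_subset_Icc_self).aestronglyMeasurable measurableSet_Ioo
  exact Integrable.bdd_mul hg hfm
    (ae_Ioo_of_forall fun t ht => hC t (Ioo_subset_Icc_self ht))

theorem integrableOn_of_continuousOn {f : ℝ → ℝ} (hf : ContinuousOn f (Icc 0 T)) :
    IntegrableOn f (Ioo 0 T) :=
  (hf.integrableOn_compact isCompact_Icc).mono_set Ioo_subset_Icc_self

end TimeCalculus

/-! ### The Carleman inequality for trajectories -/

section Lift

variable {T : ℝ}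

theorem ac_mul_const {f : ℝ → ℝ} (hf : AbsolutelyContinuousOnInterval f 0 T) (c : ℝ) :
    AbsolutelyContinuousOnInterval (fun t => f t * c) 0 T := hf.fun_mul (ac_const c)

theorem ac_div_const {f : ℝ → ℝ} (hf : AbsolutelyContinuousOnInterval f 0 T) (c : ℝ) :
    AbsolutelyContinuousOnInterval (fun t => f t / c) 0 T := by
  simp only [div_eq_mul_inv]; exact ac_mul_const hf _

theorem ac_sq {f : ℝ → ℝ} (hf : AbsolutelyContinuousOnInterval f 0 T) :
    AbsolutelyContinuousOnInterval (fun t => f t ^ 2) 0 T := by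
  simp only [pow_two]; exact hf.fun_mul hf

theorem carlG_ac (A B C : ℕ → ℝ) (h : ℝ) (N : ℕ) {τ K : ℝ → ℝ} {v u : ℕ → ℝ → ℝ}
    (hτ : AbsolutelyContinuousOnInterval τ 0 T) (hK : AbsolutelyContinuousOnInterval K 0 T)
    (hv : ∀ j, AbsolutelyContinuousOnInterval (v j) 0 T)
    (hu : ∀ j, AbsolutelyContinuousOnInterval (u j) 0 T) :
    AbsolutelyContinuousOnInterval
      (fun t => carlG A B C h (τ t) (K t) N (fun j => v j t) (fun j => u j t)) 0 T := by
  unfold carlG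
  have hτ2 := ac_div_const hτ 2
  refine ((ac_sum _ fun j _ => ?_).const_mul h).fun_add ((ac_sum _ fun j _ => ?_).const_mul h)
  · exact ((hτ2.fun_mul (ac_sq (hu _))).fun_add (((hu _).const_mul _).fun_mul
      (ac_div_const ((hv _).fun_sub (hv _)) _))).fun_sub
      (hτ2.fun_mul (((ac_const _).fun_sub hK).fun_mul (ac_sq (hv _))))
  · exact hτ2.fun_mul ((ac_sq (ac_div_const ((hv _).fun_sub (hv _)) _)).const_mul _)

theorem carlH_ac (A C : ℕ → ℝ) (h : ℝ) (N : ℕ) {θ K : ℝ → ℝ} {v u : ℕ → ℝ → ℝ}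
    (hθ : AbsolutelyContinuousOnInterval θ 0 T) (hK : AbsolutelyContinuousOnInterval K 0 T)
    (hv : ∀ j, AbsolutelyContinuousOnInterval (v j) 0 T)
    (hu : ∀ j, AbsolutelyContinuousOnInterval (u j) 0 T) :
    AbsolutelyContinuousOnInterval
      (fun t => carlH A C h (θ t) (K t) N (fun j => v j t) (fun j => u j t)) 0 T := by
  unfold carlH
  refine (ac_div_const hθ 2).fun_mul
    (((ac_sum _ fun j _ => ?_).const_mul h).fun_add ((ac_sum _ fun j _ => ?_).const_mul h))
  · exact (ac_sq (hu _)).fun_sub (((ac_const _).fun_sub hK).fun_mul (ac_sq (hv _)))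
  · exact (ac_sq (ac_div_const ((hv _).fun_sub (hv _)) _)).const_mul _

theorem hasDerivAt_sq {f : ℝ → ℝ} {f' t : ℝ} (hf : HasDerivAt f f' t) :
    HasDerivAt (fun t => f t ^ 2) (2 * f t * f') t := by
  simpa using hf.fun_pow 2

theorem carlG_hasDerivAt (A B C : ℕ → ℝ) (h : ℝ) (N : ℕ) {τ K : ℝ → ℝ} {v u : ℕ → ℝ → ℝ}
    {τ' K' t : ℝ} {y : ℕ → ℝ} (hτ : HasDerivAt τ τ' t) (hK : HasDerivAt K K' t)
    (hv : ∀ j, HasDerivAt (v j) (u j t) t) (hu : ∀ j, HasDerivAt (u j) (y j) t) :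
    HasDerivAt (fun t => carlG A B C h (τ t) (K t) N (fun j => v j t) (fun j => u j t))
      (carlGDeriv A B C h (τ t) (K t) τ' K' N (fun j => v j t) (fun j => u j t) y) t := by
  unfold carlG carlGDeriv
  have hτ2 := hτ.div_const 2
  refine ((HasDerivAt.fun_sum fun j _ => ?_).const_mul h).fun_add
    ((HasDerivAt.fun_sum fun j _ => ?_).const_mul h)
  · refine HasDerivAt.congr_deriv (((hτ2.fun_mul (hasDerivAt_sq (hu _))).fun_add
      (((hu _).const_mul _).fun_mul (((hv _).fun_sub (hv _)).div_const _))).fun_sub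
      (hτ2.fun_mul (((hasDerivAt_const t _).fun_sub hK).fun_mul (hasDerivAt_sq (hv _))))) ?_
    ring
  · refine HasDerivAt.congr_deriv (hτ2.fun_mul
      ((hasDerivAt_sq (((hv _).fun_sub (hv _)).div_const _)).const_mul _)) ?_
    ring

theorem carlH_hasDerivAt (A C : ℕ → ℝ) (h : ℝ) (N : ℕ) {θ K : ℝ → ℝ} {v u : ℕ → ℝ → ℝ}
    {θ' K' t : ℝ} {y : ℕ → ℝ} (hθ : HasDerivAt θ θ' t) (hK : HasDerivAt K K' t)
    (hv : ∀ j, HasDerivAt (v j) (u j t) t) (hu : ∀ j, HasDerivAt (u j) (y j) t) :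
    HasDerivAt (fun t => carlH A C h (θ t) (K t) N (fun j => v j t) (fun j => u j t))
      (carlHDeriv A C h (θ t) (K t) θ' K' N (fun j => v j t) (fun j => u j t) y) t := by
  unfold carlH carlHDeriv
  have h1 : HasDerivAt (fun t => h * ∑ j ∈ Finset.range N,
      (u (j + 1) t ^ 2 - (C (j + 1) - K t) * v (j + 1) t ^ 2))
      (h * ∑ j ∈ Finset.range N, (2 * u (j + 1) t * y (j + 1)
        - (-K' * v (j + 1) t ^ 2 + (C (j + 1) - K t) * (2 * v (j + 1) t * u (j + 1) t)))) t := by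
    refine (HasDerivAt.fun_sum fun j _ => ?_).const_mul h
    refine HasDerivAt.congr_deriv ((hasDerivAt_sq (hu _)).fun_sub
      (((hasDerivAt_const t _).fun_sub hK).fun_mul (hasDerivAt_sq (hv _)))) ?_
    ring
  have h2 : HasDerivAt (fun t => h * ∑ j ∈ Finset.range (N + 1),
      (A j + A (j + 1)) / 2 * ((v (j + 1) t - v j t) / h) ^ 2)
      (h * ∑ j ∈ Finset.range (N + 1),
      (A j + A (j + 1)) / 2 * (2 * ((v (j + 1) t - v j t) / h) * ((u (j + 1) t - u j t) / h))) t := by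
    refine (HasDerivAt.fun_sum fun j _ => ?_).const_mul h
    exact (hasDerivAt_sq (((hv _).fun_sub (hv _)).div_const _)).const_mul _
  exact (hθ.div_const 2).fun_mul (h1.fun_add h2)

end Lift

/-- `e^{sφ}` at the mesh point `j`, with `φ = X_j² - β t²`. -/
noncomputable def wexp (s h ξ β : ℝ) (j : ℕ) (t : ℝ) : ℝ :=
  Real.exp (s * ((ξ + j * h) ^ 2 - β * t ^ 2))

theorem wexp_pos (s h ξ β : ℝ) (j : ℕ) (t : ℝ) : 0 < wexp s h ξ β j t := Real.exp_pos _

theorem hasDerivAt_wexp (s h ξ β : ℝ) (j : ℕ) (t : ℝ) :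
    HasDerivAt (wexp s h ξ β j) (wexp s h ξ β j t * (-(2 * s * β * t))) t := by
  unfold wexp
  have h1 : HasDerivAt (fun t : ℝ => s * ((ξ + j * h) ^ 2 - β * t ^ 2)) (-(2 * s * β * t)) t := by
    refine HasDerivAt.congr_deriv (((hasDerivAt_const t _).fun_sub
      ((hasDerivAt_sq (hasDerivAt_id t)).const_mul β)).const_mul s) ?_
    simp only [id]
    ring
  exact h1.exp

theorem contDiff_wexp (s h ξ β : ℝ) (j : ℕ) : ContDiff ℝ 1 (wexp s h ξ β j) := by
  unfold wexp; fun_prop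

/-- The conjugated function `e^{sφ} z`. -/
noncomputable def conjV (s h ξ β : ℝ) (z : ℕ → ℝ → ℝ) (j : ℕ) (t : ℝ) : ℝ := wexp s h ξ β j t * z j t

/-- The time derivative of `e^{sφ} z`, where `z1 = ∂ₜ z`. -/
noncomputable def conjU (s h ξ β : ℝ) (z z1 : ℕ → ℝ → ℝ) (j : ℕ) (t : ℝ) : ℝ :=
  wexp s h ξ β j t * (z1 j t - 2 * s * β * t * z j t)

/-- The second time derivative of `e^{sφ} z`, where `z1 = ∂ₜ z` and `z2 = ∂ₜ² z`. -/
noncomputable def conjY (s h ξ β : ℝ) (z z1 z2 : ℕ → ℝ → ℝ) (j : ℕ) (t : ℝ) : ℝ :=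
  wexp s h ξ β j t * (z2 j t - 4 * s * β * t * z1 j t
    + (4 * s ^ 2 * β ^ 2 * t ^ 2 - 2 * s * β) * z j t)

theorem hasDerivAt_conjV (s h ξ β : ℝ) {z z1 : ℕ → ℝ → ℝ} {j : ℕ} {t : ℝ}
    (hz : HasDerivAt (z j) (z1 j t) t) :
    HasDerivAt (conjV s h ξ β z j) (conjU s h ξ β z z1 j t) t := by
  refine HasDerivAt.congr_deriv ((hasDerivAt_wexp s h ξ β j t).fun_mul hz) ?_
  unfold conjU; ring

theorem hasDerivAt_conjU (s h ξ β : ℝ) {z z1 z2 : ℕ → ℝ → ℝ} {j : ℕ} {t : ℝ}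
    (hz : HasDerivAt (z j) (z1 j t) t) (hz1 : HasDerivAt (z1 j) (z2 j t) t) :
    HasDerivAt (conjU s h ξ β z z1 j) (conjY s h ξ β z z1 z2 j t) t := by
  refine HasDerivAt.congr_deriv ((hasDerivAt_wexp s h ξ β j t).fun_mul
    (hz1.fun_sub (((hasDerivAt_id t).const_mul (2 * s * β)).fun_mul hz))) ?_
  unfold conjY; simp only [id]; ring

/-- The conjugated operator: the symmetric and skew-symmetric parts reproduce `e^{sφ}(∂ₜ² - Δ_h)z`
up to the zeroth order term `2 s β v`. -/
theorem conj_operator {s h ξ β : ℝ} (hh : h ≠ 0) (z z1 z2 : ℕ → ℝ → ℝ) (j : ℕ) (t : ℝ) :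
    conjSymm (coefA s h ξ) (coefC s h ξ) h (4 * s ^ 2 * β ^ 2 * t ^ 2)
        (fun j => conjV s h ξ β z j t) (fun j => conjY s h ξ β z z1 z2 j t) j
      + conjSkew (coefB s h ξ) h (4 * s * β * t) (fun j => conjV s h ξ β z j t)
        (fun j => conjU s h ξ β z z1 j t) j =
    wexp s h ξ β (j + 1) t * (z2 (j + 1) t
        - (z (j + 2) t - 2 * z (j + 1) t + z j t) / h ^ 2)
      - 2 * s * β * conjV s h ξ β z (j + 1) t := by
  have e1 : wexp s h ξ β (j + 2) t * (Real.exp (-(s * h ^ 2)) *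
      Real.exp (-(2 * s * h * (ξ + ((j + 1 : ℕ) : ℝ) * h)))) = wexp s h ξ β (j + 1) t := by
    unfold wexp
    rw [← Real.exp_add, ← Real.exp_add]
    congr 1; push_cast; ring
  have e2 : wexp s h ξ β j t * (Real.exp (-(s * h ^ 2)) *
      Real.exp (2 * s * h * (ξ + ((j + 1 : ℕ) : ℝ) * h))) = wexp s h ξ β (j + 1) t := by
    unfold wexp
    rw [← Real.exp_add, ← Real.exp_add]
    congr 1; push_cast; ring
  unfold conjSymm conjSkew conjU conjY conjV coefC coefB coefA
  rw [Real.cosh_eq, Real.sinh_eq]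
  generalize Real.exp (2 * s * h * (ξ + ((j + 1 : ℕ) : ℝ) * h)) = X at *
  generalize Real.exp (-(2 * s * h * (ξ + ((j + 1 : ℕ) : ℝ) * h))) = Y at *
  generalize Real.exp (-(s * h ^ 2)) = E at *
  beta_reduce
  field_simp
  linear_combination -2 * z (j + 2) t * e1 - 2 * z j t * e2

/-- The velocity difference of the conjugated function in terms of that of `z`. -/
theorem conjU_diff_sq_le {ξ L β T m s h t : ℝ} (hr : Regime ξ L β T m s h) {N : ℕ}
    (hN : (N + 1) * h = L) (ht0 : 0 ≤ t) (htT : t ≤ T) (z z1 : ℕ → ℝ → ℝ) {j : ℕ} (hj : j ≤ N) :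
    ((conjU s h ξ β z z1 (j + 1) t - conjU s h ξ β z z1 j t)) ^ 2 ≤
      4 * (wexp s h ξ β j t ^ 2 * (z1 (j + 1) t - z1 j t) ^ 2)
      + 16 * (s * h) ^ 2 * (ξ + L) ^ 2 * conjU s h ξ β z z1 (j + 1) t ^ 2
      + 64 * (s * h) ^ 2 * (ξ + L) ^ 2 * s ^ 2 * T ^ 2 * conjV s h ξ β z (j + 1) t ^ 2
      + 16 * s ^ 2 * T ^ 2 * (conjV s h ξ β z (j + 1) t - conjV s h ξ β z j t) ^ 2 := by
  obtain ⟨hs, hh, hξ, hL, hβ0, hβ1, hT, -⟩ := hr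
  set R := ξ + L with hR
  have hR0 : 0 < R := by positivity
  have hX : ξ + ((j : ℝ) + 1) * h ≤ R := by
    have : (j : ℝ) ≤ N := by exact_mod_cast hj
    rw [hR, ← hN]; gcongr
  -- Neighbouring weights differ by a relative error `k` of order `s h`.
  obtain ⟨k, hk, hk0, hk1⟩ : ∃ k, wexp s h ξ β j t = (1 - k) * wexp s h ξ β (j + 1) t ∧
      0 ≤ k ∧ k ≤ 2 * (s * h) * R := by
    refine ⟨1 - Real.exp (-(s * h * (2 * (ξ + j * h) + h))), ?_, ?_, ?_⟩
    · unfold wexp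
      rw [sub_sub_cancel, ← Real.exp_add]
      congr 1; push_cast; ring
    · have : Real.exp (-(s * h * (2 * (ξ + j * h) + h))) ≤ 1 := by
        rw [Real.exp_le_one_iff, neg_nonpos]; positivity
      linarith
    · have h1 := Real.add_one_le_exp (-(s * h * (2 * (ξ + j * h) + h)))
      have h2 : s * h * (2 * (ξ + j * h) + h) ≤ s * h * (2 * R) := by
        gcongr; linarith
      linarith
  have hβt0 : 0 ≤ β * t := by positivity
  have hβt : β * t ≤ T := by nlinarith only [hβ1, htT, ht0]
  set v := conjV s h ξ β z with hv
  set u := conjU s h ξ β z z1 with hu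
  have e : u (j + 1) t - u j t = wexp s h ξ β j t * (z1 (j + 1) t - z1 j t)
      + k * u (j + 1) t + 2 * (k * s * (β * t)) * v (j + 1) t
      - 2 * (s * (β * t)) * (v (j + 1) t - v j t) := by
    simp only [hu, hv]
    unfold conjU conjV
    rw [hk]; ring
  have hkk : k ^ 2 ≤ 4 * (s * h) ^ 2 * R ^ 2 := by
    calc k ^ 2 ≤ (2 * (s * h) * R) ^ 2 := by gcongr
      _ = _ := by ring
  have hks : (k * s * (β * t)) ^ 2 ≤ 4 * (s * h) ^ 2 * R ^ 2 * s ^ 2 * T ^ 2 := by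
    calc (k * s * (β * t)) ^ 2 = k ^ 2 * s ^ 2 * (β * t) ^ 2 := by ring
      _ ≤ 4 * (s * h) ^ 2 * R ^ 2 * s ^ 2 * T ^ 2 := by gcongr
  have hss : (s * (β * t)) ^ 2 ≤ s ^ 2 * T ^ 2 := by
    calc (s * (β * t)) ^ 2 = s ^ 2 * (β * t) ^ 2 := by ring
      _ ≤ _ := by gcongr
  rw [e, ← mul_pow]
  generalize wexp s h ξ β j t * (z1 (j + 1) t - z1 j t) = a
  generalize u (j + 1) t = b at *
  generalize hd : v (j + 1) t - v j t = d at *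
  generalize v (j + 1) t = c at *
  have h1 := mul_le_mul_of_nonneg_right hkk (sq_nonneg b)
  have h2 := mul_le_mul_of_nonneg_right hks (sq_nonneg c)
  have h3 := mul_le_mul_of_nonneg_right hss (sq_nonneg d)
  have h4 : (a + k * b + 2 * (k * s * (β * t)) * c - 2 * (s * (β * t)) * d) ^ 2 ≤
      4 * (a ^ 2 + (k * b) ^ 2 + (2 * (k * s * (β * t)) * c) ^ 2 + (2 * (s * (β * t)) * d) ^ 2) := by
    generalize k * b = b
    generalize 2 * (k * s * (β * t)) * c = c
    generalize 2 * (s * (β * t)) * d = d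
    nlinarith only [sq_nonneg (a - b), sq_nonneg (a - c), sq_nonneg (a + d), sq_nonneg (b - c),
      sq_nonneg (b + d), sq_nonneg (c + d)]
  refine h4.trans ?_
  linarith only [h1, h2, h3]

/-- The pointwise inequality in the original variable: the derivative of the energies is bounded by
the terms in the functional to be minimized. -/
theorem carleman_pointwise_original {ξ L β T m s h t : ℝ} (hr : Regime ξ L β T m s h)
    {N : ℕ} (hN : (N + 1) * h = L) (ht0 : 0 ≤ t) (htT : t ≤ T) (z z1 z2 : ℕ → ℝ → ℝ) (q χ : ℕ → ℝ)
    (hz0 : z 0 t = 0) (hz1 : z (N + 1) t = 0) (hz0' : z1 0 t = 0) (hz1' : z1 (N + 1) t = 0)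
    (hq : ∀ j < N, |q j| ≤ m)
    (hχ0 : ∀ j, 0 ≤ χ j) (hχ : ∀ j < N, ξ + (j + 1 : ℕ) * h < β * t → χ j = 1) :
    2 * carlGDeriv (coefA s h ξ) (coefB s h ξ) (coefC s h ξ) h (4 * s * β * t)
        (4 * s ^ 2 * β ^ 2 * t ^ 2) (4 * s * β) (8 * s ^ 2 * β ^ 2 * t) N
        (fun j => conjV s h ξ β z j t) (fun j => conjU s h ξ β z z1 j t)
        (fun j => conjY s h ξ β z z1 z2 j t)
      - (1 - β) * √s * carlHDeriv (coefA s h ξ) (coefC s h ξ) h (1 - t / T)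
        (4 * s ^ 2 * β ^ 2 * t ^ 2) (-1 / T) (8 * s ^ 2 * β ^ 2 * t) N
        (fun j => conjV s h ξ β z j t) (fun j => conjU s h ξ β z z1 j t)
        (fun j => conjY s h ξ β z z1 z2 j t) ≤
    2 * (h * ∑ j ∈ Finset.range N, wexp s h ξ β (j + 1) t ^ 2 * (z2 (j + 1) t
        - (z (j + 2) t - 2 * z (j + 1) t + z j t) / h ^ 2 + q j * z (j + 1) t) ^ 2)
      + (64 * T ^ 2 + 32 * ξ ^ 2) * s ^ 3 * (h * ∑ j ∈ Finset.range N,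
        χ j * (wexp s h ξ β (j + 1) t ^ 2 * z (j + 1) t ^ 2))
      + 16 * s * h ^ 2 * (h * ∑ j ∈ Finset.range (N + 1),
        wexp s h ξ β j t ^ 2 * ((z1 (j + 1) t - z1 j t) / h) ^ 2)
      + 16 * s * (ξ + L) * (wexp s h ξ β (N + 1) t ^ 2 * (-z N t / h) ^ 2) := by
  set v := conjV s h ξ β z with hv
  set u := conjU s h ξ β z z1 with hu
  set y := conjY s h ξ β z z1 z2 with hy
  have hpt := carleman_pointwise hr hN ht0 htT (fun j => v j t) (fun j => u j t) (fun j => y j t) χ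
    (by simp [hv, conjV, hz0]) (by simp [hv, conjV, hz1])
    (by simp [hu, conjU, hz0, hz0']) (by simp [hu, conjU, hz1, hz1']) hχ0 hχ
  have hr' := hr
  obtain ⟨hs, hh, hξ, hL, hβ0, hβ1, hT, -, -, -, -, -, -, -, -, hc1, hc2, hc3, -, -⟩ := hr'
  simp only [hv, hu, hy, conj_operator hh.ne' z z1 z2] at hpt
  rw [← hv, ← hu, ← hy] at hpt
  have hb0 : 0 < 1 - β := by linarith
  set R := ξ + L with hR
  -- The potential and the zeroth order term `2 s β v` are absorbed by `s³ v²`.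
  have h1 : h * ∑ j ∈ Finset.range N, (wexp s h ξ β (j + 1) t * (z2 (j + 1) t
        - (z (j + 2) t - 2 * z (j + 1) t + z j t) / h ^ 2) - 2 * s * β * v (j + 1) t) ^ 2 ≤
      2 * (h * ∑ j ∈ Finset.range N, wexp s h ξ β (j + 1) t ^ 2 * (z2 (j + 1) t
        - (z (j + 2) t - 2 * z (j + 1) t + z j t) / h ^ 2 + q j * z (j + 1) t) ^ 2)
      + 4 * s ^ 3 * (1 - β) * ξ ^ 2 * (h * ∑ j ∈ Finset.range N, v (j + 1) t ^ 2) := by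
    have : ∑ j ∈ Finset.range N, (wexp s h ξ β (j + 1) t * (z2 (j + 1) t
        - (z (j + 2) t - 2 * z (j + 1) t + z j t) / h ^ 2) - 2 * s * β * v (j + 1) t) ^ 2 ≤
      ∑ j ∈ Finset.range N, (2 * (wexp s h ξ β (j + 1) t ^ 2 * (z2 (j + 1) t
        - (z (j + 2) t - 2 * z (j + 1) t + z j t) / h ^ 2 + q j * z (j + 1) t) ^ 2)
        + 4 * s ^ 3 * (1 - β) * ξ ^ 2 * v (j + 1) t ^ 2) := by
      refine Finset.sum_le_sum fun j hj => ?_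
      have hqj := hq j (Finset.mem_range.mp hj)
      have e : wexp s h ξ β (j + 1) t * (z2 (j + 1) t
        - (z (j + 2) t - 2 * z (j + 1) t + z j t) / h ^ 2) - 2 * s * β * v (j + 1) t =
        wexp s h ξ β (j + 1) t * (z2 (j + 1) t
        - (z (j + 2) t - 2 * z (j + 1) t + z j t) / h ^ 2 + q j * z (j + 1) t)
        - (2 * s * β + q j) * v (j + 1) t := by
        simp only [hv, conjV]; ring
      rw [e, ← mul_pow]
      generalize wexp s h ξ β (j + 1) t * (z2 (j + 1) t
        - (z (j + 2) t - 2 * z (j + 1) t + z j t) / h ^ 2 + q j * z (j + 1) t) = a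
      have hk : (2 * s * β + q j) ^ 2 ≤ (2 * s + m) ^ 2 := by
        apply sq_le_sq'
        · have := (abs_le.mp hqj).1
          have : 0 ≤ 2 * s * β := by positivity
          linarith
        · have := (abs_le.mp hqj).2
          have : 2 * s * β ≤ 2 * s * 1 := by gcongr
          linarith
      have hk2 := mul_le_mul_of_nonneg_right (show 2 * (2 * s * β + q j) ^ 2 ≤
        4 * s ^ 3 * (1 - β) * ξ ^ 2 by linarith only [hk, hc3]) (sq_nonneg (v (j + 1) t))
      nlinarith only [hk2, sq_nonneg (a + (2 * s * β + q j) * v (j + 1) t)]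
    refine (mul_le_mul_of_nonneg_left this hh.le).trans (le_of_eq ?_)
    rw [Finset.sum_add_distrib, ← Finset.mul_sum, ← Finset.mul_sum]
    ring
  -- The commutator of `∂ₜ∂_h^+` with the weight is of lower order since `s h` is small.
  have h2 : 4 * s * h ^ 2 * (h * ∑ j ∈ Finset.range (N + 1), ((u (j + 1) t - u j t) / h) ^ 2) ≤
      16 * s * h ^ 2 * (h * ∑ j ∈ Finset.range (N + 1),
        wexp s h ξ β j t ^ 2 * ((z1 (j + 1) t - z1 j t) / h) ^ 2)
      + s * (1 - β) * (h * ∑ j ∈ Finset.range N, u (j + 1) t ^ 2)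
      + 4 * s ^ 3 * (1 - β) * ξ ^ 2 * (h * ∑ j ∈ Finset.range N, v (j + 1) t ^ 2)
      + s * (1 - β) * (h * ∑ j ∈ Finset.range (N + 1), ((v (j + 1) t - v j t) / h) ^ 2) := by
    have hu1 : u (N + 1) t = 0 := by simp [hu, conjU, hz1, hz1']
    have hv1 : v (N + 1) t = 0 := by simp [hv, conjV, hz1]
    have e1 : ∑ j ∈ Finset.range N, u (j + 1) t ^ 2 = ∑ j ∈ Finset.range (N + 1), u (j + 1) t ^ 2 := by
      rw [Finset.sum_range_succ, hu1]; ring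
    have e2 : ∑ j ∈ Finset.range N, v (j + 1) t ^ 2 = ∑ j ∈ Finset.range (N + 1), v (j + 1) t ^ 2 := by
      rw [Finset.sum_range_succ, hv1]; ring
    rw [e1, e2]
    have : ∑ j ∈ Finset.range (N + 1), 4 * s * h ^ 2 * ((u (j + 1) t - u j t) / h) ^ 2 ≤
        ∑ j ∈ Finset.range (N + 1), (16 * s * h ^ 2 *
          (wexp s h ξ β j t ^ 2 * ((z1 (j + 1) t - z1 j t) / h) ^ 2)
          + s * (1 - β) * u (j + 1) t ^ 2 + 4 * s ^ 3 * (1 - β) * ξ ^ 2 * v (j + 1) t ^ 2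
          + s * (1 - β) * ((v (j + 1) t - v j t) / h) ^ 2) := by
      refine Finset.sum_le_sum fun j hj => ?_
      have hb := conjU_diff_sq_le hr hN ht0 htT z z1 (Nat.lt_succ_iff.mp (Finset.mem_range.mp hj))
      rw [← hu, ← hv, ← hR] at hb
      have e3 : ∀ x : ℝ, h ^ 2 * (x / h) ^ 2 = x ^ 2 := by intro x; field_simp
      have e4 := e3 (u (j + 1) t - u j t)
      have e5 := e3 (z1 (j + 1) t - z1 j t)
      have e6 := e3 (v (j + 1) t - v j t)
      have b1 : 64 * s * (s * h) ^ 2 * R ^ 2 ≤ s * (1 - β) := by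
        have h0 : 0 ≤ 64 * (s * h) ^ 2 * T ^ 2 := by positivity
        have := mul_le_mul_of_nonneg_left hc1 (show 0 ≤ s by linarith)
        have h00 : 0 ≤ s * (64 * (s * h) ^ 2 * T ^ 2) := by positivity
        linarith only [this, h00]
      have b2 : 256 * s ^ 3 * (s * h) ^ 2 * R ^ 2 * T ^ 2 ≤ 4 * s ^ 3 * (1 - β) * ξ ^ 2 := by
        have := mul_le_mul_of_nonneg_left hc2 (show 0 ≤ s ^ 3 by positivity)
        linarith only [this]
      have b3 : 64 * s * (s * h) ^ 2 * T ^ 2 ≤ s * (1 - β) := by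
        have := mul_le_mul_of_nonneg_left hc1 (show 0 ≤ s by linarith)
        have h00 : 0 ≤ s * (64 * (s * h) ^ 2 * R ^ 2) := by positivity
        linarith only [this, h00]
      have c1 := mul_le_mul_of_nonneg_right b1 (sq_nonneg (u (j + 1) t))
      have c2 := mul_le_mul_of_nonneg_right b2 (sq_nonneg (v (j + 1) t))
      have c3 := mul_le_mul_of_nonneg_right b3 (sq_nonneg ((v (j + 1) t - v j t) / h))
      have c4 := mul_le_mul_of_nonneg_left hb (show 0 ≤ 4 * s by linarith)
      calc _ = 4 * s * (u (j + 1) t - u j t) ^ 2 := by rw [← e4]; ring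
        _ ≤ _ := c4
        _ = 16 * s * (wexp s h ξ β j t ^ 2 * (h ^ 2 * ((z1 (j + 1) t - z1 j t) / h) ^ 2))
          + 64 * s * (s * h) ^ 2 * R ^ 2 * u (j + 1) t ^ 2
          + 256 * s ^ 3 * (s * h) ^ 2 * R ^ 2 * T ^ 2 * v (j + 1) t ^ 2
          + 64 * s ^ 3 * T ^ 2 * (h ^ 2 * ((v (j + 1) t - v j t) / h) ^ 2) := by
            rw [e5, e6]; ring
        _ ≤ _ := by linarith only [c1, c2, c3]
    have := mul_le_mul_of_nonneg_left this hh.le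
    simp only [Finset.sum_add_distrib, ← Finset.mul_sum] at this
    linarith only [this]
  -- Since `z` vanishes at `L`, the difference quotient only involves its value at the last interior
  -- point, and the weight is increasing in space.
  have h3 : ((v (N + 1) t - v N t) / h) ^ 2 ≤ wexp s h ξ β (N + 1) t ^ 2 * (-z N t / h) ^ 2 := by
    have hv1 : v (N + 1) t = 0 := by simp [hv, conjV, hz1]
    have e : (v (N + 1) t - v N t) / h = wexp s h ξ β N t * (-z N t / h) := by
      rw [hv1]; simp only [hv, conjV]; ring
    rw [e, mul_pow]
    have hw : wexp s h ξ β N t ≤ wexp s h ξ β (N + 1) t := by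
      unfold wexp
      gcongr
      linarith
    have := wexp_pos s h ξ β N t
    gcongr
  have h3' := mul_le_mul_of_nonneg_left h3 (show 0 ≤ 16 * s * R by positivity)
  have h4 : ∑ j ∈ Finset.range N, χ j * (wexp s h ξ β (j + 1) t ^ 2 * z (j + 1) t ^ 2) =
      ∑ j ∈ Finset.range N, χ j * v (j + 1) t ^ 2 := by
    refine Finset.sum_congr rfl fun j _ => ?_
    simp only [hv, conjV]; ring
  rw [h4]
  linarith only [hpt, h1, h2, h3']

/-! ### Trajectories on the mesh -/

theorem mesh_pos {S : Setup} (hS : S.Admissible) (N : ℕ) : 0 < mesh S N := by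
  unfold mesh; have := hS.L_pos; positivity

theorem mesh_mul {S : Setup} (N : ℕ) : ((N : ℝ) + 1) * mesh S N = S.L := by
  unfold mesh; field_simp

/-- Extension by zero of a function on the mesh to all natural indices. -/
noncomputable def natExt {N : ℕ} (v : Fin (N + 2) → ℝ) (j : ℕ) : ℝ :=
  if h : j < N + 2 then v ⟨j, h⟩ else 0

section NatExt

variable {N : ℕ} (v : Fin (N + 2) → ℝ)

theorem natExt_val (j : Fin (N + 2)) : natExt v j = v j := by
  unfold natExt; rw [dif_pos j.2]

theorem natExt_inner (i : Fin N) : natExt v (i + 1) = v (innerIdx i) := natExt_val v (innerIdx i)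

theorem natExt_left (i : Fin N) : natExt v i = v i.castSucc.castSucc :=
  natExt_val v i.castSucc.castSucc

theorem natExt_right (i : Fin N) : natExt v (i + 2) = v i.succ.succ := natExt_val v i.succ.succ

theorem natExt_castSucc (i : Fin (N + 1)) : natExt v i = v i.castSucc := natExt_val v i.castSucc

theorem natExt_succ (i : Fin (N + 1)) : natExt v (i + 1) = v i.succ := natExt_val v i.succ

theorem natExt_zero : natExt v 0 = v 0 := natExt_val v 0

theorem natExt_last : natExt v (N + 1) = v (Fin.last (N + 1)) := natExt_val v (Fin.last (N + 1))

theorem natExt_pred_last : natExt v N = v (Fin.last N).castSucc := natExt_val v (Fin.last N).castSucc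

end NatExt

theorem innerIdx_val {N : ℕ} (i : Fin N) : ((innerIdx i : Fin (N + 2)) : ℕ) = i + 1 := rfl

theorem φ_node (S : Setup) {N : ℕ} (j : Fin (N + 2)) (t : ℝ) :
    S.φ t (node S N j) = (-S.x₀ + (j : ℕ) * mesh S N) ^ 2 - S.β * t ^ 2 := by
  unfold Setup.φ node
  rw [sq_abs]; ring

theorem exp_node (S : Setup) {N : ℕ} (s : ℝ) (j : Fin (N + 2)) (t : ℝ) :
    Real.exp (2 * s * S.φ t (node S N j)) = wexp s (mesh S N) (-S.x₀) S.β j t ^ 2 := by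
  rw [φ_node]
  unfold wexp
  rw [← Real.exp_nat_mul]
  congr 1; push_cast; ring

theorem node_last (S : Setup) (N : ℕ) : node S N (Fin.last (N + 1)) = S.L := by
  unfold node
  rw [← mesh_mul (S := S) N]; simp

theorem continuous_φ (S : Setup) (x : ℝ) : Continuous fun t => S.φ t x := by
  unfold Setup.φ; fun_prop

theorem continuous_exp_φ (S : Setup) (s x : ℝ) : Continuous fun t => Real.exp (2 * s * S.φ t x) := by
  have := continuous_φ S x
  fun_prop

section Traj

variable {S : Setup} (hS : S.Admissible) {N : ℕ} {z : ℝ → Fin (N + 2) → ℝ} (hz : MemTraj S z)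
include hS hz

theorem MemTraj.hasDerivWithinAt (j : Fin (N + 2)) {t : ℝ} (ht : t ∈ Icc 0 S.T) :
    HasDerivWithinAt (fun t => z t j) (dt S.T (fun t => z t j) t) (Icc 0 S.T) t :=
  ac_hasDerivWithinAt_dt hS.T_pos (hz.h2 j).1.1 (hz.h2 j).2.1 ht

theorem MemTraj.continuousOn (j : Fin (N + 2)) : ContinuousOn (fun t => z t j) (Icc 0 S.T) :=
  ac_continuousOn hS.T_pos (hz.h2 j).1.1

theorem MemTraj.continuousOn_dt (j : Fin (N + 2)) :
    ContinuousOn (dt S.T fun t => z t j) (Icc 0 S.T) :=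
  ac_continuousOn hS.T_pos (hz.h2 j).2.1

theorem MemTraj.dt_left {t : ℝ} (ht : t ∈ Icc 0 S.T) : dt S.T (fun t => z t 0) t = 0 := by
  rw [dt_congr (g := fun _ => 0) (fun t ht => hz.left t ht) ht]
  exact dt_eq_of_hasDerivWithinAt hS.T_pos ht (hasDerivWithinAt_const _ _ _)

theorem MemTraj.dt_right {t : ℝ} (ht : t ∈ Icc 0 S.T) :
    dt S.T (fun t => z t (Fin.last (N + 1))) t = 0 := by
  rw [dt_congr (g := fun _ => 0) (fun t ht => hz.right t ht) ht]
  exact dt_eq_of_hasDerivWithinAt hS.T_pos ht (hasDerivWithinAt_const _ _ _)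

theorem MemTraj.init_all (j : Fin (N + 2)) : z 0 j = 0 := by
  have h0 : (0 : ℝ) ∈ Icc 0 S.T := ⟨le_rfl, hS.T_pos.le⟩
  refine Fin.cases (hz.left 0 h0) (fun k => ?_) j
  refine Fin.lastCases ?_ (fun i => hz.init i) k
  have := hz.right 0 h0
  rwa [← Fin.succ_last] at this

theorem MemTraj.dt_dPlus (i : Fin (N + 1)) {t : ℝ} (ht : t ∈ Icc 0 S.T) :
    dt S.T (fun τ => dPlus S (z τ) i) t =
      (dt S.T (fun t => z t i.succ) t - dt S.T (fun t => z t i.castSucc) t) / mesh S N :=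
  dt_eq_of_hasDerivWithinAt hS.T_pos ht
    (((hz.hasDerivWithinAt hS i.succ ht).fun_sub (hz.hasDerivWithinAt hS i.castSucc ht)).div_const _)

theorem MemTraj.memL2_waveOp (q : Fin N → ℝ) (i : Fin N) :
    MemL2 S.T fun t => waveOp S q z t i := by
  have h1 : ContinuousOn (fun t => lap S (z t) i) (Icc 0 S.T) := by
    unfold lap
    exact ((((hz.continuousOn hS _).sub (continuousOn_const.mul (hz.continuousOn hS _))).add
      (hz.continuousOn hS _)).div_const _)
  have h2 : ContinuousOn (fun t => q i * z t (innerIdx i)) (Icc 0 S.T) :=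
    continuousOn_const.mul (hz.continuousOn hS _)
  exact memL2_add (memL2_sub (hz.h2 _).2.2 (memL2_of_continuousOn h1)) (memL2_of_continuousOn h2)

theorem MemTraj.memL2_dt_dPlus (i : Fin (N + 1)) :
    MemL2 S.T (dt S.T fun τ => dPlus S (z τ) i) := by
  refine memL2_congr (f := fun t => (dt S.T (fun t => z t i.succ) t
    - dt S.T (fun t => z t i.castSucc) t) / mesh S N) (fun t ht => (hz.dt_dPlus hS i ht).symm) ?_
  exact memL2_of_continuousOn (((hz.continuousOn_dt hS _).sub (hz.continuousOn_dt hS _)).div_const _)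

end Traj

theorem integrableOn_sumInner {S : Setup} {N : ℕ} {F : ℝ → Fin N → ℝ}
    (hF : ∀ i, IntegrableOn (fun t => F t i) (Ioo 0 S.T)) :
    IntegrableOn (fun t => sumInner S (F t)) (Ioo 0 S.T) := by
  unfold sumInner
  exact (integrable_finsetSum _ fun i _ => hF i).const_mul _

theorem integrableOn_sumLeft {S : Setup} {N : ℕ} {F : ℝ → Fin (N + 1) → ℝ}
    (hF : ∀ i, IntegrableOn (fun t => F t i) (Ioo 0 S.T)) :
    IntegrableOn (fun t => sumLeft S (F t)) (Ioo 0 S.T) := by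
  unfold sumLeft
  exact (integrable_finsetSum _ fun i _ => hF i).const_mul _

theorem measurable_indicator_O (S : Setup) (x : ℝ) :
    Measurable fun t => S.O.indicator (1 : ℝ × ℝ → ℝ) (t, x) := by
  have h1 : MeasurableSet {p : ℝ × ℝ | p.1 ∈ Ioo 0 S.T} := measurableSet_Ioo.preimage measurable_fst
  have h2 : MeasurableSet {p : ℝ × ℝ | p.2 ∈ Ioo 0 S.L} := measurableSet_Ioo.preimage measurable_snd
  have h3 : MeasurableSet {p : ℝ × ℝ | |p.2 - S.x₀| < S.β * p.1} :=
    (isOpen_lt (by fun_prop) (by fun_prop)).measurableSet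
  have hO : MeasurableSet S.O := h1.inter (h2.inter h3)
  exact (measurable_one.indicator hO).comp (measurable_id.prodMk measurable_const)

section Integrability

variable {S : Setup} (hS : S.Admissible) {N : ℕ} {z : ℝ → Fin (N + 2) → ℝ} (hz : MemTraj S z) (s : ℝ)
include hS hz

theorem integrableOn_J_wave (q : Fin N → ℝ) {g : ℝ → Fin N → ℝ} (hg : ∀ i, MemL2 S.T fun t => g t i) :
    IntegrableOn (fun t => sumInner S fun i : Fin N =>
      Real.exp (2 * s * S.φ t (node S N (innerIdx i))) * (waveOp S q z t i - g t i) ^ 2)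
      (Ioo 0 S.T) :=
  integrableOn_sumInner fun i => integrableOn_continuousOn_mul
    (continuous_exp_φ S s _).continuousOn
    (memL2_sq_integrable (memL2_sub (hz.memL2_waveOp hS q i) (hg i)))

theorem integrableOn_J_flux {μ : ℝ → ℝ} (hμ : MemL2 S.T μ) :
    IntegrableOn (fun t =>
      Real.exp (2 * s * S.φ t S.L) * (-z t (Fin.last N).castSucc / mesh S N - μ t) ^ 2)
      (Ioo 0 S.T) :=
  integrableOn_continuousOn_mul (continuous_exp_φ S s _).continuousOn
    (memL2_sq_integrable (memL2_sub
      (memL2_of_continuousOn ((hz.continuousOn hS _).neg.div_const _)) hμ))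

theorem integrableOn_J_inner :
    IntegrableOn (fun t => sumInner S fun i : Fin N =>
      S.O.indicator 1 (t, node S N (innerIdx i)) *
        (Real.exp (2 * s * S.φ t (node S N (innerIdx i))) * z t (innerIdx i) ^ 2)) (Ioo 0 S.T) := by
  refine integrableOn_sumInner fun i => ?_
  have h1 : IntegrableOn (fun t => Real.exp (2 * s * S.φ t (node S N (innerIdx i)))
      * z t (innerIdx i) ^ 2) (Ioo 0 S.T) :=
    integrableOn_of_continuousOn ((continuous_exp_φ S s _).continuousOn.mul
      ((hz.continuousOn hS _).pow 2))
  refine Integrable.bdd_mul (c := 1) h1 (measurable_indicator_O S _).aestronglyMeasurable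
    (ae_of_all _ fun t => ?_)
  by_cases h : (t, node S N (innerIdx i)) ∈ S.O <;> simp [h]

theorem integrableOn_J_highfreq {ν : ℝ → Fin (N + 1) → ℝ} (hν : ∀ i, MemL2 S.T fun t => ν t i) :
    IntegrableOn (fun t => sumLeft S fun i : Fin (N + 1) =>
      Real.exp (2 * s * S.φ t (node S N i.castSucc)) *
        (dt S.T (fun τ => dPlus S (z τ) i) t - ν t i) ^ 2) (Ioo 0 S.T) :=
  integrableOn_sumLeft fun i => integrableOn_continuousOn_mul
    (continuous_exp_φ S s _).continuousOn
    (memL2_sq_integrable (memL2_sub (hz.memL2_dt_dPlus hS i) (hν i)))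

end Integrability

theorem memL2_zero {T : ℝ} : MemL2 T fun _ => 0 := MemLp.zero'

/-- The constant of the Carleman inequality. -/
noncomputable def carlC (S : Setup) : ℝ := 4 + 128 * S.T ^ 2 + 64 * S.x₀ ^ 2 + 32 + 32 * (S.L - S.x₀)

theorem sumInner_eq_range (S : Setup) {N : ℕ} (F : ℕ → ℝ) :
    sumInner S (fun i : Fin N => F i) = mesh S N * ∑ j ∈ Finset.range N, F j := by
  unfold sumInner; rw [Fin.sum_univ_eq_sum_range]

theorem sumLeft_eq_range (S : Setup) {N : ℕ} (F : ℕ → ℝ) :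
    sumLeft S (fun i : Fin (N + 1) => F i) = mesh S N * ∑ j ∈ Finset.range (N + 1), F j := by
  unfold sumLeft; rw [Fin.sum_univ_eq_sum_range]

theorem integral_comb_four {α : Type*} [MeasurableSpace α] {μ : Measure α} (c₁ c₂ c₃ c₄ : ℝ)
    {f₁ f₂ f₃ f₄ : α → ℝ} (h₁ : Integrable f₁ μ) (h₂ : Integrable f₂ μ) (h₃ : Integrable f₃ μ)
    (h₄ : Integrable f₄ μ) :
    Integrable (fun t => c₁ * f₁ t + c₂ * f₂ t + c₃ * f₃ t + c₄ * f₄ t) μ ∧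
    ∫ t, (c₁ * f₁ t + c₂ * f₂ t + c₃ * f₃ t + c₄ * f₄ t) ∂μ =
      c₁ * ∫ t, f₁ t ∂μ + c₂ * ∫ t, f₂ t ∂μ + c₃ * ∫ t, f₃ t ∂μ + c₄ * ∫ t, f₄ t ∂μ := by
  have i12 := (h₁.const_mul c₁).fun_add (h₂.const_mul c₂)
  have i123 := i12.fun_add (h₃.const_mul c₃)
  refine ⟨i123.fun_add (h₄.const_mul c₄), ?_⟩
  rw [integral_add i123 (h₄.const_mul c₄), integral_add i12 (h₃.const_mul c₃),
    integral_add (h₁.const_mul c₁) (h₂.const_mul c₂)]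
  simp only [integral_const_mul]

/-- **Discrete Carleman inequality.** The functional without data controls the weighted initial
velocity of every trajectory, uniformly in the mesh size. -/
theorem carleman_initial_velocity {S : Setup} (hS : S.Admissible) {m s : ℝ} {N : ℕ}
    (hr : Regime (-S.x₀) S.L S.β S.T m s (mesh S N)) {q : Fin N → ℝ} (hq : ∀ i, |q i| ≤ m)
    {z : ℝ → Fin (N + 2) → ℝ} (hz : MemTraj S z) :
    (1 - S.β) * √s / 2 * sumInner S (fun i : Fin N =>
      Real.exp (2 * s * S.φ 0 (node S N (innerIdx i))) * dt S.T (fun t => z t (innerIdx i)) 0 ^ 2) ≤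
      carlC S * J S s q 0 0 0 z := by
  have hT := hS.T_pos
  have hh := mesh_pos hS N
  set h := mesh S N with hhdef
  set ξ := -S.x₀ with hξ
  set β := S.β with hβ
  set Z : ℕ → ℝ → ℝ := fun j t => natExt (z t) j with hZ
  set Z1 : ℕ → ℝ → ℝ := fun j t => natExt (fun k => dt S.T (fun τ => z τ k) t) j with hZ1
  set Z2 : ℕ → ℝ → ℝ := fun j t => natExt (fun k => dt S.T (dt S.T (fun τ => z τ k)) t) j with hZ2
  have hZac : ∀ j, AbsolutelyContinuousOnInterval (Z j) 0 S.T := by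
    intro j
    by_cases hj : j < N + 2
    · simp only [hZ, natExt, dif_pos hj]; exact (hz.h2 _).1.1
    · simp only [hZ, natExt, dif_neg hj]; exact ac_const 0
  have hZ1ac : ∀ j, AbsolutelyContinuousOnInterval (Z1 j) 0 S.T := by
    intro j
    by_cases hj : j < N + 2
    · simp only [hZ1, natExt, dif_pos hj]; exact (hz.h2 _).2.1
    · simp only [hZ1, natExt, dif_neg hj]; exact ac_const 0
  have hder : ∀ᵐ t ∂(volume.restrict (Ioo 0 S.T)), ∀ j, HasDerivAt (Z j) (Z1 j t) t ∧
      HasDerivAt (Z1 j) (Z2 j t) t := by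
    rw [ae_all_iff]
    intro j
    by_cases hj : j < N + 2
    · simp only [hZ, hZ1, hZ2, natExt, dif_pos hj]
      filter_upwards [ac_ae_hasDerivAt hT (hz.h2 ⟨j, hj⟩).1.1,
        ac_ae_hasDerivAt hT (hz.h2 ⟨j, hj⟩).2.1] with t h1 h2 using ⟨h1, h2⟩
    · simp only [hZ, hZ1, hZ2, natExt, dif_neg hj]
      exact ae_of_all _ fun t => ⟨hasDerivAt_const _ _, hasDerivAt_const _ _⟩
  have hwac : ∀ j, AbsolutelyContinuousOnInterval (wexp s h ξ β j) 0 S.T :=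
    fun j => ac_of_contDiff (contDiff_wexp s h ξ β j)
  have hVac : ∀ j, AbsolutelyContinuousOnInterval (conjV s h ξ β Z j) 0 S.T :=
    fun j => (hwac j).fun_mul (hZac j)
  have hUac : ∀ j, AbsolutelyContinuousOnInterval (conjU s h ξ β Z Z1 j) 0 S.T :=
    fun j => (hwac j).fun_mul ((hZ1ac j).fun_sub
      ((ac_of_contDiff (f := fun t => 2 * s * β * t) (by fun_prop)).fun_mul (hZac j)))
  set A := coefA s h ξ
  set B := coefB s h ξ
  set C := coefC s h ξ
  -- The boundary values of `F` in time are `F 0 = -(1 - β) (√s / 2) h ∑ |∂ₜv(0)|²` and `F T ≥ 0`.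
  set F : ℝ → ℝ := fun t => 2 * carlG A B C h (4 * s * β * t) (4 * s ^ 2 * β ^ 2 * t ^ 2) N
      (fun j => conjV s h ξ β Z j t) (fun j => conjU s h ξ β Z Z1 j t)
    - (1 - β) * √s * carlH A C h (1 - t / S.T) (4 * s ^ 2 * β ^ 2 * t ^ 2) N
      (fun j => conjV s h ξ β Z j t) (fun j => conjU s h ξ β Z Z1 j t) with hF
  set F' : ℝ → ℝ := fun t => 2 * carlGDeriv A B C h (4 * s * β * t)
        (4 * s ^ 2 * β ^ 2 * t ^ 2) (4 * s * β) (8 * s ^ 2 * β ^ 2 * t) N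
        (fun j => conjV s h ξ β Z j t) (fun j => conjU s h ξ β Z Z1 j t)
        (fun j => conjY s h ξ β Z Z1 Z2 j t)
      - (1 - β) * √s * carlHDeriv A C h (1 - t / S.T)
        (4 * s ^ 2 * β ^ 2 * t ^ 2) (-1 / S.T) (8 * s ^ 2 * β ^ 2 * t) N
        (fun j => conjV s h ξ β Z j t) (fun j => conjU s h ξ β Z Z1 j t)
        (fun j => conjY s h ξ β Z Z1 Z2 j t) with hF'
  have hKac : AbsolutelyContinuousOnInterval (fun t => 4 * s ^ 2 * β ^ 2 * t ^ 2) 0 S.T :=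
    ac_of_contDiff (by fun_prop)
  have hFac : AbsolutelyContinuousOnInterval F 0 S.T :=
    ((carlG_ac A B C h N (ac_of_contDiff (by fun_prop)) hKac hVac hUac).const_mul 2).fun_sub
      ((carlH_ac A C h N (ac_of_contDiff (by fun_prop)) hKac hVac hUac).const_mul _)
  have hFd : ∀ᵐ t ∂(volume.restrict (Ioo 0 S.T)), HasDerivAt F (F' t) t := by
    filter_upwards [hder] with t ht
    have hv : ∀ j, HasDerivAt (conjV s h ξ β Z j) (conjU s h ξ β Z Z1 j t) t :=
      fun j => hasDerivAt_conjV s h ξ β (ht j).1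
    have hu : ∀ j, HasDerivAt (conjU s h ξ β Z Z1 j) (conjY s h ξ β Z Z1 Z2 j t) t :=
      fun j => hasDerivAt_conjU s h ξ β (ht j).1 (ht j).2
    have hK : HasDerivAt (fun t => 4 * s ^ 2 * β ^ 2 * t ^ 2) (8 * s ^ 2 * β ^ 2 * t) t :=
      ((hasDerivAt_sq (hasDerivAt_id t)).const_mul _).congr_deriv (by simp only [id]; ring)
    have hτ : HasDerivAt (fun t => 4 * s * β * t) (4 * s * β) t :=
      ((hasDerivAt_id t).const_mul _).congr_deriv (by ring)
    have hθ : HasDerivAt (fun t => 1 - t / S.T) (-1 / S.T) t :=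
      ((hasDerivAt_const t 1).fun_sub ((hasDerivAt_id t).div_const _)).congr_deriv (by ring)
    exact ((carlG_hasDerivAt A B C h N hτ hK hv hu).const_mul 2).fun_sub
      ((carlH_hasDerivAt A C h N hθ hK hv hu).const_mul _)
  obtain ⟨hFi, hFint⟩ := ac_integral_eq_sub hT hFac hFd
  have i1 := integrableOn_J_wave hS hz s q (g := 0) (fun _ => memL2_zero)
  have i2 := integrableOn_J_flux hS hz s (μ := 0) memL2_zero
  have i3 := integrableOn_J_inner hS hz s
  have i4 := integrableOn_J_highfreq hS hz s (ν := 0) (fun _ => memL2_zero)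
  have hbound : ∀ t ∈ Ioo 0 S.T, F' t ≤
      2 * (sumInner S fun i : Fin N => Real.exp (2 * s * S.φ t (node S N (innerIdx i))) *
        (waveOp S q z t i - (0 : ℝ → Fin N → ℝ) t i) ^ 2)
      + (64 * S.T ^ 2 + 32 * ξ ^ 2) * s ^ 3 * (sumInner S fun i : Fin N =>
        S.O.indicator 1 (t, node S N (innerIdx i)) *
          (Real.exp (2 * s * S.φ t (node S N (innerIdx i))) * z t (innerIdx i) ^ 2))
      + 16 * s * h ^ 2 * (sumLeft S fun i : Fin (N + 1) =>
        Real.exp (2 * s * S.φ t (node S N i.castSucc)) *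
        (dt S.T (fun τ => dPlus S (z τ) i) t - (0 : ℝ → Fin (N + 1) → ℝ) t i) ^ 2)
      + 16 * s * (ξ + S.L) * (Real.exp (2 * s * S.φ t S.L) *
        (-z t (Fin.last N).castSucc / h - (0 : ℝ → ℝ) t) ^ 2) := by
    intro t ht
    have htI := Ioo_subset_Icc_self ht
    have hpt := carleman_pointwise_original hr (N := N) (by rw [hhdef]; exact mesh_mul N) ht.1.le
      ht.2.le Z Z1 Z2 (fun j => if hj : j < N then q ⟨j, hj⟩ else 0)
      (fun j => S.O.indicator 1 (t, ((j + 1 : ℕ) : ℝ) * h))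
      (by simp only [hZ, natExt_zero]; exact hz.left t htI)
      (by simp only [hZ, natExt_last]; exact hz.right t htI)
      (by simp only [hZ1, natExt_zero]; exact hz.dt_left hS htI)
      (by simp only [hZ1, natExt_last]; exact hz.dt_right hS htI)
      (fun j hj => by simp only [dif_pos hj]; exact hq _)
      (fun j => indicator_nonneg (by simp) _)
      (fun j hj hlt => by
        have hmem : (t, ((j + 1 : ℕ) : ℝ) * h) ∈ S.O := by
          refine ⟨ht, ⟨by positivity, ?_⟩, ?_⟩
          · rw [← mesh_mul (S := S) N]
            have : ((j + 1 : ℕ) : ℝ) < N + 1 := by exact_mod_cast (by omega : j + 1 < N + 1)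
            exact mul_lt_mul_of_pos_right this hh
          · have h0 : 0 < -S.x₀ := by linarith [hS.x₀_neg]
            have h1 : 0 ≤ ((j + 1 : ℕ) : ℝ) * h := by positivity
            rw [abs_of_nonneg (by linarith)]
            show _ < β * t
            rw [hξ] at hlt
            linarith
        exact indicator_of_mem hmem _)
    refine hpt.trans (le_of_eq ?_)
    have s1 : (sumInner S fun i : Fin N => Real.exp (2 * s * S.φ t (node S N (innerIdx i))) *
        (waveOp S q z t i - (0 : ℝ → Fin N → ℝ) t i) ^ 2) =
        h * ∑ j ∈ Finset.range N, wexp s h ξ β (j + 1) t ^ 2 * (Z2 (j + 1) t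
        - (Z (j + 2) t - 2 * Z (j + 1) t + Z j t) / h ^ 2
        + (if hj : j < N then q ⟨j, hj⟩ else 0) * Z (j + 1) t) ^ 2 := by
      rw [← sumInner_eq_range S]
      unfold sumInner
      congr 1
      refine Finset.sum_congr rfl fun i _ => ?_
      beta_reduce
      rw [exp_node, innerIdx_val]
      simp only [hZ, hZ2, natExt_inner, natExt_left, natExt_right, i.2, dif_pos, Pi.zero_apply,
        sub_zero]
      rfl
    have s2 : (sumInner S fun i : Fin N => S.O.indicator 1 (t, node S N (innerIdx i)) *
          (Real.exp (2 * s * S.φ t (node S N (innerIdx i))) * z t (innerIdx i) ^ 2)) =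
        h * ∑ j ∈ Finset.range N, S.O.indicator 1 (t, ((j + 1 : ℕ) : ℝ) * h) *
          (wexp s h ξ β (j + 1) t ^ 2 * Z (j + 1) t ^ 2) := by
      rw [← sumInner_eq_range S]
      unfold sumInner
      congr 1
      refine Finset.sum_congr rfl fun i _ => ?_
      beta_reduce
      rw [exp_node, innerIdx_val]
      simp only [hZ, natExt_inner]
      rfl
    have s3 : (sumLeft S fun i : Fin (N + 1) =>
        Real.exp (2 * s * S.φ t (node S N i.castSucc)) *
        (dt S.T (fun τ => dPlus S (z τ) i) t - (0 : ℝ → Fin (N + 1) → ℝ) t i) ^ 2) =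
        h * ∑ j ∈ Finset.range (N + 1),
          wexp s h ξ β j t ^ 2 * ((Z1 (j + 1) t - Z1 j t) / h) ^ 2 := by
      rw [← sumLeft_eq_range S]
      unfold sumLeft
      congr 1
      refine Finset.sum_congr rfl fun i _ => ?_
      beta_reduce
      rw [exp_node, hz.dt_dPlus hS i htI]
      simp only [hZ1, natExt_succ, natExt_castSucc, Pi.zero_apply, sub_zero]
      rfl
    have s4 : Real.exp (2 * s * S.φ t S.L) *
        (-z t (Fin.last N).castSucc / h - (0 : ℝ → ℝ) t) ^ 2 =
        wexp s h ξ β (N + 1) t ^ 2 * (-Z N t / h) ^ 2 := by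
      rw [← node_last S N, exp_node]
      simp only [hZ, natExt_pred_last, Pi.zero_apply, sub_zero]
      rfl
    rw [s1, s2, s3, s4]
  obtain ⟨hsum_int, hsum⟩ := integral_comb_four 2 ((64 * S.T ^ 2 + 32 * ξ ^ 2) * s ^ 3)
    (16 * s * h ^ 2) (16 * s * (ξ + S.L)) i1 i3 i4 i2
  have hint := setIntegral_mono_on hFi hsum_int measurableSet_Ioo hbound
  rw [hFint, hsum] at hint
  have hs0 : 0 ≤ s := by linarith only [hr.one_le_s]
  have hFT : 0 ≤ F S.T := by
    simp only [hF]
    have hθ : 1 - S.T / S.T = 0 := by rw [div_self hT.ne']; ring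
    rw [hθ]
    have h1 := carlG_final_nonneg hr (N := N) (by rw [hhdef]; exact mesh_mul N)
      (fun j => conjV s h ξ β Z j S.T) (fun j => conjU s h ξ β Z Z1 j S.T)
    have h2 : carlH A C h 0 (4 * s ^ 2 * β ^ 2 * S.T ^ 2) N
      (fun j => conjV s h ξ β Z j S.T) (fun j => conjU s h ξ β Z Z1 j S.T) = 0 := by
      unfold carlH; simp
    rw [h2]
    linarith only [h1]
  have hV0 : ∀ j ≤ N + 1, conjV s h ξ β Z j 0 = 0 := by
    intro j hj
    simp only [conjV, hZ, natExt, dif_pos (show j < N + 2 by omega), hz.init_all hS, mul_zero]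
  have hF0 : F 0 = -((1 - β) * √s / 2 * sumInner S (fun i : Fin N =>
      Real.exp (2 * s * S.φ 0 (node S N (innerIdx i))) *
        dt S.T (fun t => z t (innerIdx i)) 0 ^ 2)) := by
    simp only [hF, mul_zero, zero_div, sub_zero, ne_eq, OfNat.ofNat_ne_zero, not_false_eq_true,
      zero_pow]
    rw [carlG_initial A B C h N _ _ hV0, carlH_initial A C h N _ _ hV0]
    have : (sumInner S fun i : Fin N => Real.exp (2 * s * S.φ 0 (node S N (innerIdx i))) *
        dt S.T (fun t => z t (innerIdx i)) 0 ^ 2) =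
        h * ∑ j ∈ Finset.range N, conjU s h ξ β Z Z1 (j + 1) 0 ^ 2 := by
      rw [← sumInner_eq_range S]
      unfold sumInner
      congr 1
      refine Finset.sum_congr rfl fun i _ => ?_
      beta_reduce
      rw [exp_node, innerIdx_val]
      simp only [conjU, hZ1, natExt_inner, mul_zero, zero_mul, sub_zero]
      ring
    rw [this]; ring
  rw [hF0] at hint
  have n1 : 0 ≤ ∫ t in Ioo 0 S.T, sumInner S fun i : Fin N =>
      Real.exp (2 * s * S.φ t (node S N (innerIdx i))) *
        (waveOp S q z t i - (0 : ℝ → Fin N → ℝ) t i) ^ 2 :=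
    integral_nonneg fun t => mul_nonneg hh.le (Finset.sum_nonneg fun i _ => by positivity)
  have n2 : 0 ≤ ∫ t in Ioo 0 S.T, Real.exp (2 * s * S.φ t S.L) *
      (-z t (Fin.last N).castSucc / h - (0 : ℝ → ℝ) t) ^ 2 :=
    integral_nonneg fun t => by positivity
  have n3 : 0 ≤ ∫ t in Ioo 0 S.T, sumInner S fun i : Fin N =>
      S.O.indicator 1 (t, node S N (innerIdx i)) *
        (Real.exp (2 * s * S.φ t (node S N (innerIdx i))) * z t (innerIdx i) ^ 2) :=
    integral_nonneg fun t => mul_nonneg hh.le (Finset.sum_nonneg fun i _ =>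
      mul_nonneg (indicator_nonneg (by simp) _) (by positivity))
  have n4 : 0 ≤ ∫ t in Ioo 0 S.T, sumLeft S fun i : Fin (N + 1) =>
      Real.exp (2 * s * S.φ t (node S N i.castSucc)) *
        (dt S.T (fun τ => dPlus S (z τ) i) t - (0 : ℝ → Fin (N + 1) → ℝ) t i) ^ 2 :=
    integral_nonneg fun t => mul_nonneg hh.le (Finset.sum_nonneg fun i _ => by positivity)
  unfold J carlC
  rw [← hhdef]
  generalize (∫ t in Ioo 0 S.T, sumInner S fun i : Fin N =>
      Real.exp (2 * s * S.φ t (node S N (innerIdx i))) *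
        (waveOp S q z t i - (0 : ℝ → Fin N → ℝ) t i) ^ 2) = T1 at *
  generalize (∫ t in Ioo 0 S.T, Real.exp (2 * s * S.φ t S.L) *
      (-z t (Fin.last N).castSucc / h - (0 : ℝ → ℝ) t) ^ 2) = T2 at *
  generalize (∫ t in Ioo 0 S.T, sumInner S fun i : Fin N =>
      S.O.indicator 1 (t, node S N (innerIdx i)) *
        (Real.exp (2 * s * S.φ t (node S N (innerIdx i))) * z t (innerIdx i) ^ 2)) = T3 at *
  generalize (∫ t in Ioo 0 S.T, sumLeft S fun i : Fin (N + 1) =>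
      Real.exp (2 * s * S.φ t (node S N i.castSucc)) *
        (dt S.T (fun τ => dPlus S (z τ) i) t - (0 : ℝ → Fin (N + 1) → ℝ) t i) ^ 2) = T4 at *
  have hξp := hr.ξ_pos
  have hLp := hr.L_pos
  have e2 : S.L - S.x₀ = ξ + S.L := by rw [hξ]; ring
  have e3 : S.x₀ ^ 2 = ξ ^ 2 := by rw [hξ]; ring
  rw [e2, e3]
  have m1 : 0 ≤ (128 * S.T ^ 2 + 64 * ξ ^ 2 + 32 + 32 * (ξ + S.L)) * T1 := by positivity
  have m2 : 0 ≤ (4 + 128 * S.T ^ 2 + 64 * ξ ^ 2 + 32) * (s * T2) := by positivity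
  have m3 : 0 ≤ (4 + 32 + 32 * (ξ + S.L)) * (s ^ 3 * T3) := by positivity
  have m4 : 0 ≤ (4 + 128 * S.T ^ 2 + 64 * ξ ^ 2 + 32 * (ξ + S.L)) * (s * h ^ 2 * T4) := by positivity
  linarith only [hint, hFT, m1, m2, m3, m4]

/-! ### Square integrable functions on the time interval -/

section L2Norm

variable {T : ℝ}

/-- The norm of `L²(0, T)`. -/
noncomputable def l2norm (T : ℝ) (f : ℝ → ℝ) : ℝ := (eLpNorm f 2 (volume.restrict (Ioo 0 T))).toReal

theorem l2norm_nonneg (f : ℝ → ℝ) : 0 ≤ l2norm T f := ENNReal.toReal_nonneg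

theorem norm_toLp_eq {f : ℝ → ℝ} (hf : MemL2 T f) : ‖MemLp.toLp f hf‖ = l2norm T f :=
  Lp.norm_toLp f hf

theorem l2norm_sq {f : ℝ → ℝ} (hf : MemL2 T f) : l2norm T f ^ 2 = ∫ t in Ioo 0 T, f t ^ 2 := by
  rw [← norm_toLp_eq hf, ← real_inner_self_eq_norm_sq, L2.inner_def]
  refine integral_congr_ae ?_
  filter_upwards [MemLp.coeFn_toLp hf] with t ht
  rw [ht]
  simp [pow_two]

theorem l2norm_congr {f g : ℝ → ℝ} (h : f =ᵐ[volume.restrict (Ioo 0 T)] g) :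
    l2norm T f = l2norm T g := by
  unfold l2norm; rw [eLpNorm_congr_ae h]

theorem l2norm_add_le {f g : ℝ → ℝ} (hf : MemL2 T f) (hg : MemL2 T g) :
    l2norm T (fun t => f t + g t) ≤ l2norm T f + l2norm T g := by
  rw [← norm_toLp_eq hf, ← norm_toLp_eq hg, ← norm_toLp_eq (memL2_add hf hg)]
  exact norm_add_le (MemLp.toLp f hf) (MemLp.toLp g hg)

theorem l2norm_le_of_abs_le_mul {C : ℝ} (hC : 0 ≤ C) {f g : ℝ → ℝ} (hg : MemL2 T g)
    (h : ∀ᵐ t ∂(volume.restrict (Ioo 0 T)), |f t| ≤ C * |g t|) : l2norm T f ≤ C * l2norm T g := by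
  have h1 := eLpNorm_le_mul_eLpNorm_of_ae_le_mul (f := f) (g := g) (c := C) h 2
  unfold l2norm
  rw [← ENNReal.toReal_ofReal hC, ← ENNReal.toReal_mul]
  exact ENNReal.toReal_mono (ENNReal.mul_ne_top ENNReal.ofReal_ne_top hg.2.ne) h1

theorem l2norm_const (hT : 0 < T) (c : ℝ) : l2norm T (fun _ => c) = √T * |c| := by
  have hc : MemL2 T fun _ => c := memL2_of_continuousOn continuousOn_const
  have h1 := l2norm_sq hc
  simp only [setIntegral_const, smul_eq_mul, measureReal_def, Real.volume_Ioo, sub_zero,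
    ENNReal.toReal_ofReal hT.le] at h1
  rw [← Real.sqrt_sq (l2norm_nonneg _), h1, Real.sqrt_mul hT.le, Real.sqrt_sq_eq_abs]

theorem l2norm_le_of_bound (hT : 0 < T) {f : ℝ → ℝ} {B : ℝ} (hB : ∀ t ∈ Ioo 0 T, |f t| ≤ B) :
    l2norm T f ≤ √T * B := by
  have hB0 : 0 ≤ B := (abs_nonneg _).trans (hB (T / 2) ⟨by linarith, by linarith⟩)
  have h1 := l2norm_le_of_abs_le_mul (T := T) (f := f) (g := fun _ => (1 : ℝ)) hB0
    (memL2_of_continuousOn continuousOn_const) (ae_Ioo_of_forall fun t ht => by simpa using hB t ht)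
  rw [l2norm_const hT] at h1
  simpa [mul_comm] using h1

theorem memL2_abs_integrable {f : ℝ → ℝ} (hf : MemL2 T f) : IntegrableOn f (Ioo 0 T) :=
  MemLp.integrable (q := 2) (by norm_num) hf

theorem integral_abs_le_l2norm (hT : 0 < T) {f : ℝ → ℝ} (hf : MemL2 T f) :
    ∫ t in Ioo 0 T, |f t| ≤ √T * l2norm T f := by
  have h1 : IntegrableOn (fun t => |f t|) (Ioo 0 T) := (memL2_abs_integrable hf).abs
  set A := ∫ t in Ioo 0 T, |f t| with hA
  have h2 := memL2_sq_integrable hf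
  have h3 : 0 ≤ ∫ t in Ioo 0 T, (|f t| - A / T) ^ 2 := integral_nonneg fun t => sq_nonneg _
  have h4 : ∫ t in Ioo 0 T, (|f t| - A / T) ^ 2 =
      ∫ t in Ioo 0 T, (f t ^ 2 - 2 * (A / T) * |f t| + (A / T) ^ 2) := by
    congr 1; ext t; rw [← sq_abs (f t)]; ring
  rw [h4, integral_add (h2.fun_sub (h1.const_mul _)) (integrable_const _),
    integral_sub h2 (h1.const_mul _), integral_const_mul, ← hA, ← l2norm_sq hf] at h3
  simp only [setIntegral_const, smul_eq_mul, measureReal_def, Real.volume_Ioo, sub_zero,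
    ENNReal.toReal_ofReal hT.le] at h3
  have h5 : A ^ 2 ≤ T * l2norm T f ^ 2 := by
    have : l2norm T f ^ 2 - 2 * (A / T) * A + T * (A / T) ^ 2 = l2norm T f ^ 2 - A ^ 2 / T := by
      field_simp; ring
    rw [this] at h3
    have := (div_le_iff₀ hT).mp (sub_nonneg.mp h3)
    linarith
  have h6 : (√T * l2norm T f) ^ 2 = T * l2norm T f ^ 2 := by rw [mul_pow, Real.sq_sqrt hT.le]
  exact abs_le_of_sq_le_sq' (by rw [h6]; exact h5)
    (mul_nonneg (Real.sqrt_nonneg _) (l2norm_nonneg _)) |>.2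

theorem abs_sub_init_le (hT : 0 < T) {f : ℝ → ℝ} (hf : MemH1 T f) {t : ℝ} (ht : t ∈ Icc 0 T) :
    |f t - f 0| ≤ √T * l2norm T (dt T f) := by
  refine le_trans ?_ (integral_abs_le_l2norm hT hf.2)
  rw [ac_eq_integral hT hf.1 ht, add_sub_cancel_left, intervalIntegral.integral_of_le ht.1,
    integral_Ioc_eq_integral_Ioo]
  refine (abs_integral_le_integral_abs).trans ?_
  exact setIntegral_mono_set (memL2_abs_integrable hf.2).abs (ae_of_all _ fun t => abs_nonneg _)
    (Ioo_subset_Ioo_right ht.2).eventuallyLE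

theorem l2norm_sub_init_le (hT : 0 < T) {f : ℝ → ℝ} (hf : MemH1 T f) :
    l2norm T (fun t => f t - f 0) ≤ T * l2norm T (dt T f) := by
  refine (l2norm_le_of_bound hT fun t ht =>
    abs_sub_init_le hT hf (Ioo_subset_Icc_self ht)).trans (le_of_eq ?_)
  rw [← mul_assoc, Real.mul_self_sqrt hT.le]

/-- The family `f` of functions on `(0, T)` is square integrable, with norms bounded by a constant
multiple of `k`. -/
def L2Dom {X : Type*} (T : ℝ) (k : X → ℝ) (f : X → ℝ → ℝ) : Prop :=
  (∀ x, MemL2 T (f x)) ∧ ∃ C, 0 ≤ C ∧ ∀ x, l2norm T (f x) ≤ C * k x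

namespace L2Dom

variable {X : Type*} {k : X → ℝ} {f g : X → ℝ → ℝ}

theorem congr (hf : L2Dom T k f) (h : ∀ x, ∀ t ∈ Icc 0 T, f x t = g x t) : L2Dom T k g := by
  obtain ⟨h1, C, hC, h2⟩ := hf
  have he : ∀ x, f x =ᵐ[volume.restrict (Ioo 0 T)] g x := fun x =>
    ae_Ioo_of_forall fun t ht => h x t (Ioo_subset_Icc_self ht)
  exact ⟨fun x => memL2_congr_ae (he x) (h1 x), C, hC, fun x => l2norm_congr (he x) ▸ h2 x⟩

theorem add (hf : L2Dom T k f) (hg : L2Dom T k g) : L2Dom T k fun x t => f x t + g x t := by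
  obtain ⟨h1, C, hC, h2⟩ := hf
  obtain ⟨h3, C', hC', h4⟩ := hg
  refine ⟨fun x => memL2_add (h1 x) (h3 x), C + C', by positivity, fun x => ?_⟩
  refine (l2norm_add_le (h1 x) (h3 x)).trans ?_
  rw [add_mul]
  exact add_le_add (h2 x) (h4 x)

theorem mul_bdd (hf : L2Dom T k f) {c : ℝ → ℝ} (hc : Measurable c) {B : ℝ}
    (hB : ∀ t ∈ Icc 0 T, |c t| ≤ B) (hB0 : 0 ≤ B) : L2Dom T k fun x t => c t * f x t := by
  obtain ⟨h1, C, hC, h2⟩ := hf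
  have hae : ∀ x, ∀ᵐ t ∂(volume.restrict (Ioo 0 T)), |c t * f x t| ≤ B * |f x t| := fun x =>
    ae_Ioo_of_forall fun t ht => by
      rw [abs_mul]
      exact mul_le_mul_of_nonneg_right (hB t (Ioo_subset_Icc_self ht)) (abs_nonneg _)
  refine ⟨fun x => MemLp.of_le_mul (c := B) (h1 x) (hc.aestronglyMeasurable.mul (h1 x).1) (hae x),
    B * C, by positivity, fun x => ?_⟩
  refine (l2norm_le_of_abs_le_mul hB0 (h1 x) (hae x)).trans ?_
  rw [mul_assoc]
  exact mul_le_mul_of_nonneg_left (h2 x) hB0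

theorem continuous_mul (hf : L2Dom T k f) {c : ℝ → ℝ} (hc : Continuous c) (hT : 0 < T) :
    L2Dom T k fun x t => c t * f x t := by
  obtain ⟨B, hB⟩ := isCompact_Icc.exists_bound_of_continuousOn (hc.continuousOn (s := Icc 0 T))
  exact hf.mul_bdd hc.measurable hB ((norm_nonneg _).trans (hB 0 ⟨le_rfl, hT.le⟩))

theorem const_mul (hf : L2Dom T k f) (c : ℝ) (hT : 0 < T) : L2Dom T k fun x t => c * f x t :=
  hf.continuous_mul (c := fun _ => c) continuous_const hT

theorem sub (hf : L2Dom T k f) (hg : L2Dom T k g) (hT : 0 < T) :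
    L2Dom T k fun x t => f x t - g x t :=
  (hf.add (hg.const_mul (-1) hT)).congr fun x t _ => by ring

theorem zero : L2Dom T k fun _ _ => 0 :=
  ⟨fun _ => memL2_zero, 0, le_rfl, fun x => by
    have : l2norm T (fun _ => (0 : ℝ)) = 0 := by simp [l2norm]
    rw [this, zero_mul]⟩

theorem const {c : X → ℝ} (hT : 0 < T) {C : ℝ} (hC : 0 ≤ C) (hc : ∀ x, |c x| ≤ C * k x) :
    L2Dom T k fun x _ => c x :=
  ⟨fun _ => memL2_of_continuousOn continuousOn_const, √T * C, by positivity, fun x => by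
    rw [l2norm_const hT, mul_assoc]
    exact mul_le_mul_of_nonneg_left (hc x) (Real.sqrt_nonneg _)⟩

theorem sub_init (hT : 0 < T) (hf : ∀ x, AbsolutelyContinuousOnInterval (f x) 0 T)
    (hd : L2Dom T k fun x => dt T (f x)) : L2Dom T k fun x t => f x t - f x 0 := by
  obtain ⟨h1, C, hC, h2⟩ := hd
  refine ⟨fun x => memL2_of_continuousOn
    ((ac_continuousOn hT (hf x)).sub continuousOn_const), T * C, by positivity, fun x => ?_⟩
  refine (l2norm_sub_init_le hT ⟨hf x, h1 x⟩).trans ?_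
  rw [mul_assoc]
  exact mul_le_mul_of_nonneg_left (h2 x) hT.le

theorem of_dt (hT : 0 < T) (hf : ∀ x, AbsolutelyContinuousOnInterval (f x) 0 T)
    (hd : L2Dom T k fun x => dt T (f x)) {C : ℝ} (hC : 0 ≤ C) (hc : ∀ x, |f x 0| ≤ C * k x) :
    L2Dom T k f :=
  ((sub_init hT hf hd).add (const hT hC hc)).congr fun x t _ => by ring

/-- The initial value is controlled by the function and its derivative. -/
theorem init_le (hT : 0 < T) (hf : ∀ x, AbsolutelyContinuousOnInterval (f x) 0 T)
    (h : L2Dom T k f) (hd : L2Dom T k fun x => dt T (f x)) :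
    ∃ C, 0 ≤ C ∧ ∀ x, |f x 0| ≤ C * k x := by
  obtain ⟨h1, C, hC, h2⟩ := (h.sub (sub_init hT hf hd) hT).congr (g := fun x _ => f x 0)
    fun x t _ => by ring
  have hs : 0 < √T := Real.sqrt_pos.mpr hT
  refine ⟨C / √T, by positivity, fun x => ?_⟩
  have := h2 x
  rw [l2norm_const hT] at this
  rw [div_mul_eq_mul_div, le_div_iff₀ hs]
  linarith

end L2Dom

end L2Norm

/-! ### Least squares problems -/

/-- A linear map that is comparable to a surjective linear map onto a complete space has closed
range. -/
theorem isClosed_range_of_comparable {V H K : Type*} [AddCommGroup V] [Module ℝ V]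
    [NormedAddCommGroup H] [NormedSpace ℝ H] [CompleteSpace H] [NormedAddCommGroup K]
    [NormedSpace ℝ K] (Φ : V →ₗ[ℝ] H) (R : V →ₗ[ℝ] K) (hΦ : Function.Surjective Φ) {c C : ℝ}
    (h1 : ∀ v, ‖Φ v‖ ≤ c * ‖R v‖) (h2 : ∀ v, ‖R v‖ ≤ C * ‖Φ v‖) :
    IsClosed (LinearMap.range R : Set K) := by
  refine isClosed_of_closure_subset fun u hu => ?_
  obtain ⟨x, hx, hxu⟩ := mem_closure_iff_seq_limit.mp hu
  choose v hv using hx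
  have hc : CauchySeq fun n => Φ (v n) := by
    rw [Metric.cauchySeq_iff']
    intro ε hε
    obtain ⟨n, hn⟩ := Metric.cauchySeq_iff'.mp hxu.cauchySeq (ε / (|c| + 1)) (by positivity)
    refine ⟨n, fun k hk => ?_⟩
    have h3 := hn k hk
    rw [dist_eq_norm, ← hv, ← hv, ← map_sub, lt_div_iff₀ (by positivity)] at h3
    rw [dist_eq_norm, ← map_sub]
    refine (h1 _).trans_lt (lt_of_le_of_lt ?_ h3)
    rw [mul_comm]
    exact mul_le_mul_of_nonneg_left (by linarith [le_abs_self c]) (norm_nonneg _)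
  obtain ⟨y, hy⟩ := cauchySeq_tendsto_of_complete hc
  obtain ⟨w, rfl⟩ := hΦ y
  refine ⟨w, tendsto_nhds_unique (f := fun n => R (v n)) (l := atTop) ?_ (by simpa only [hv] using hxu)⟩
  rw [tendsto_iff_norm_sub_tendsto_zero] at hy ⊢
  refine squeeze_zero (fun n => norm_nonneg _) (fun n => ?_) (by simpa using hy.const_mul C)
  rw [← map_sub, ← map_sub]
  exact h2 _

/-- Least squares problem for a linear map with closed range: a minimizer exists, and every
minimizer satisfies the identity of Pythagoras. -/
theorem least_squares {V K : Type*} [AddCommGroup V] [Module ℝ V] [NormedAddCommGroup K]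
    [InnerProductSpace ℝ K] [CompleteSpace K] (R : V →ₗ[ℝ] K)
    (hR : IsClosed (LinearMap.range R : Set K)) (d : K) :
    (∃ Z, ∀ z, ‖R Z - d‖ ≤ ‖R z - d‖) ∧
    ∀ Z, (∀ z, ‖R Z - d‖ ≤ ‖R z - d‖) → ∀ z, ‖R (Z - z)‖ ^ 2 + ‖R Z - d‖ ^ 2 = ‖R z - d‖ ^ 2 := by
  constructor
  · obtain ⟨_, ⟨Z, rfl⟩, hZ⟩ :=
      (LinearMap.range R).exists_norm_eq_iInf_of_complete_subspace hR.isComplete d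
    refine ⟨Z, fun z => ?_⟩
    rw [norm_sub_rev, norm_sub_rev _ d, hZ]
    exact ciInf_le ⟨0, by rintro _ ⟨w, rfl⟩; exact norm_nonneg _⟩
      (⟨R z, z, rfl⟩ : (LinearMap.range R : Set K))
  · intro Z hZ z
    have h1 : ‖d - R Z‖ = ⨅ w : (LinearMap.range R : Set K), ‖d - w‖ := by
      have : Nonempty (LinearMap.range R : Set K) := ⟨⟨R Z, Z, rfl⟩⟩
      refine le_antisymm (le_ciInf ?_) (ciInf_le ⟨0, by rintro _ ⟨w, rfl⟩; exact norm_nonneg _⟩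
        (⟨R Z, Z, rfl⟩ : (LinearMap.range R : Set K)))
      rintro ⟨_, w, rfl⟩
      rw [norm_sub_rev, norm_sub_rev d]
      exact hZ w
    have h2 := ((LinearMap.range R).norm_eq_iInf_iff_real_inner_eq_zero ⟨Z, rfl⟩).mp h1
      (R (Z - z)) ⟨_, rfl⟩
    have h3 : R z - d = -(R (Z - z)) - (d - R Z) := by rw [map_sub]; abel
    have h4 := norm_sub_sq_real (-(R (Z - z))) (d - R Z)
    rw [inner_neg_left, real_inner_comm, h2, norm_neg] at h4
    rw [h3, h4, norm_sub_rev (R Z)]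
    ring

/-! ### The trajectory space -/

/-- The function on the full mesh with interior values `v` and boundary values `l`, `r`. -/
noncomputable def bdryExt {N : ℕ} (l r : ℝ) (v : Fin N → ℝ) : Fin (N + 2) → ℝ :=
  Fin.cases l (Fin.lastCases r v)

section BdryExt

variable {N : ℕ} (l r : ℝ) (v : Fin N → ℝ)

@[simp] theorem bdryExt_zero : bdryExt l r v 0 = l := rfl

@[simp] theorem bdryExt_inner (i : Fin N) : bdryExt l r v (innerIdx i) = v i := by
  simp [bdryExt, innerIdx]

@[simp] theorem bdryExt_last : bdryExt l r v (Fin.last (N + 1)) = r := by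
  change (Fin.lastCases (motive := fun _ => ℝ) r v (Fin.last N) : ℝ) = r
  exact Fin.lastCases_last

end BdryExt

/-- Case distinction between the boundary points and the interior points of the mesh. -/
theorem mesh_cases {N : ℕ} {p : Fin (N + 2) → Prop} (h0 : p 0) (hi : ∀ i : Fin N, p (innerIdx i))
    (hl : p (Fin.last (N + 1))) (j : Fin (N + 2)) : p j := by
  refine Fin.cases h0 (fun k => ?_) j
  refine Fin.lastCases ?_ (fun i => hi i) k
  rwa [Fin.succ_last]

section TimeAlgebra

variable {T : ℝ}

theorem dt_add_ae (hT : 0 < T) {f g : ℝ → ℝ} (hf : AbsolutelyContinuousOnInterval f 0 T)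
    (hg : AbsolutelyContinuousOnInterval g 0 T) :
    dt T (fun t => f t + g t) =ᵐ[volume.restrict (Ioo 0 T)] fun t => dt T f t + dt T g t := by
  filter_upwards [ac_ae_hasDerivAt hT hf, ac_ae_hasDerivAt hT hg,
    ae_Ioo_of_forall fun t ht => ht] with t h1 h2 ht
  exact dt_eq_of_hasDerivWithinAt hT (Ioo_subset_Icc_self ht) (h1.fun_add h2).hasDerivWithinAt

theorem dt_const_mul (c : ℝ) (f : ℝ → ℝ) (t : ℝ) :
    dt T (fun t => c * f t) t = c * dt T f t := by
  unfold dt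
  exact derivWithin_const_mul_field c

theorem memH1_add (hT : 0 < T) {f g : ℝ → ℝ} (hf : MemH1 T f) (hg : MemH1 T g) :
    MemH1 T fun t => f t + g t :=
  ⟨hf.1.fun_add hg.1, memL2_congr_ae (dt_add_ae hT hf.1 hg.1).symm (memL2_add hf.2 hg.2)⟩

theorem memL2_const_mul (c : ℝ) {f : ℝ → ℝ} (hf : MemL2 T f) : MemL2 T fun t => c * f t :=
  MemLp.const_mul hf c

theorem memH1_const_mul (c : ℝ) {f : ℝ → ℝ} (hf : MemH1 T f) : MemH1 T fun t => c * f t := by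
  refine ⟨hf.1.const_mul c, ?_⟩
  have : dt T (fun t => c * f t) = fun t => c * dt T f t := funext fun t => dt_const_mul c f t
  rw [this]; exact memL2_const_mul c hf.2

theorem dt_add_of_memH2 (hT : 0 < T) {f g : ℝ → ℝ} (hf : MemH2 T f) (hg : MemH2 T g) {t : ℝ}
    (ht : t ∈ Icc 0 T) : dt T (fun t => f t + g t) t = dt T f t + dt T g t :=
  dt_eq_of_hasDerivWithinAt hT ht ((ac_hasDerivWithinAt_dt hT hf.1.1 hf.2.1 ht).fun_add
    (ac_hasDerivWithinAt_dt hT hg.1.1 hg.2.1 ht))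

theorem memH2_add (hT : 0 < T) {f g : ℝ → ℝ} (hf : MemH2 T f) (hg : MemH2 T g) :
    MemH2 T fun t => f t + g t :=
  ⟨memH1_add hT hf.1 hg.1, memH1_congr hT (fun _ ht => (dt_add_of_memH2 hT hf hg ht).symm)
    (memH1_add hT hf.2 hg.2)⟩

theorem memH2_const_mul (c : ℝ) {f : ℝ → ℝ} (hf : MemH2 T f) : MemH2 T fun t => c * f t := by
  refine ⟨memH1_const_mul c hf.1, ?_⟩
  have : dt T (fun t => c * f t) = fun t => c * dt T f t := funext fun t => dt_const_mul c f t
  rw [this]; exact memH1_const_mul c hf.2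

theorem memH2_zero : MemH2 T fun _ => 0 := by
  have h : dt T (fun _ => (0 : ℝ)) = fun _ => 0 := by ext t; simp [dt]
  have h1 : MemH1 T fun _ => 0 := ⟨ac_const 0, by rw [h]; exact memL2_zero⟩
  exact ⟨h1, by rw [h]; exact h1⟩

theorem dt_dt_add_ae (hT : 0 < T) {f g : ℝ → ℝ} (hf : MemH2 T f) (hg : MemH2 T g) :
    dt T (dt T fun t => f t + g t) =ᵐ[volume.restrict (Ioo 0 T)]
      fun t => dt T (dt T f) t + dt T (dt T g) t := by
  filter_upwards [dt_add_ae hT hf.2.1 hg.2.1, ae_Ioo_of_forall fun t ht => ht] with t h ht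
  rw [← h]
  exact dt_congr (fun _ hr => dt_add_of_memH2 hT hf hg hr) (Ioo_subset_Icc_self ht)

theorem dt_dt_const_mul (c : ℝ) (f : ℝ → ℝ) (t : ℝ) :
    dt T (dt T fun t => c * f t) t = c * dt T (dt T f) t := by
  have : dt T (fun t => c * f t) = fun t => c * dt T f t := funext fun t => dt_const_mul c f t
  rw [this, dt_const_mul]

/-- The primitive of a square integrable function. -/
theorem primitive_memH1 (hT : 0 < T) {g : ℝ → ℝ} (hg : MemL2 T g) (c : ℝ) :
    MemH1 T (fun t => c + ∫ τ in (0 : ℝ)..t, g τ) ∧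
    dt T (fun t => c + ∫ τ in (0 : ℝ)..t, g τ) =ᵐ[volume.restrict (Ioo 0 T)] g := by
  have hi : IntervalIntegrable g volume 0 T :=
    (intervalIntegrable_iff_Ioo hT).mpr (memL2_abs_integrable hg)
  have hac : AbsolutelyContinuousOnInterval (fun t => c + ∫ τ in (0 : ℝ)..t, g τ) 0 T :=
    (ac_const c).fun_add (hi.absolutelyContinuousOnInterval_intervalIntegral (by simp [hT.le]))
  have hd : dt T (fun t => c + ∫ τ in (0 : ℝ)..t, g τ) =ᵐ[volume.restrict (Ioo 0 T)] g := by
    rw [EventuallyEq, ae_restrict_iff' measurableSet_Ioo]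
    filter_upwards [hi.ae_hasDerivAt_integral] with t ht htI
    have h2 := ht (by rw [uIcc_of_le hT.le]; exact Ioo_subset_Icc_self htI) 0 (by simp [hT.le])
    exact dt_eq_of_hasDerivWithinAt hT (Ioo_subset_Icc_self htI)
      (h2.const_add c).hasDerivWithinAt
  exact ⟨⟨hac, memL2_congr_ae hd.symm hg⟩, hd⟩

end TimeAlgebra

/-- The trajectory space as a vector space. -/
noncomputable def trajSpace {S : Setup} (hS : S.Admissible) (N : ℕ) :
    Submodule ℝ (ℝ → Fin (N + 2) → ℝ) where
  carrier := {z | MemTraj S z}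
  zero_mem' := ⟨fun _ => memH2_zero, fun _ _ => rfl, fun _ _ => rfl, fun _ => rfl⟩
  add_mem' {z w} hz hw := ⟨fun j => memH2_add hS.T_pos (hz.h2 j) (hw.h2 j),
    fun t ht => by simp [hz.left t ht, hw.left t ht],
    fun t ht => by simp [hz.right t ht, hw.right t ht], fun i => by simp [hz.init i, hw.init i]⟩
  smul_mem' c z hz := ⟨fun j => memH2_const_mul c (hz.h2 j),
    fun t ht => by simp [hz.left t ht], fun t ht => by simp [hz.right t ht],
    fun i => by simp [hz.init i]⟩

theorem memTraj_coe {S : Setup} {hS : S.Admissible} {N : ℕ} (z : trajSpace hS N) :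
    MemTraj S (z : ℝ → Fin (N + 2) → ℝ) := z.2

/-! ### The functional as a least squares functional -/

/-- Indices of the terms of the functional: the equation at the interior points, the flux at the
boundary, the values at the interior points, the high frequency term. -/
abbrev ResIdx (N : ℕ) : Type := Fin N ⊕ Unit ⊕ Fin N ⊕ Fin (N + 1)

/-- The square roots of the weights of the functional. -/
noncomputable def resWeight (S : Setup) {N : ℕ} (s : ℝ) : ResIdx N → ℝ → ℝ
  | .inl i => fun t => √(mesh S N) * Real.exp (s * S.φ t (node S N (innerIdx i)))
  | .inr (.inl _) => fun t => √s * Real.exp (s * S.φ t S.L)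
  | .inr (.inr (.inl i)) => fun t => √(s ^ 3 * mesh S N) *
      (S.O.indicator 1 (t, node S N (innerIdx i)) * Real.exp (s * S.φ t (node S N (innerIdx i))))
  | .inr (.inr (.inr i)) => fun t => √(s * mesh S N ^ 3) *
      Real.exp (s * S.φ t (node S N i.castSucc))

/-- The terms of the functional, as linear expressions in the trajectory. -/
noncomputable def residual (S : Setup) {N : ℕ} (q : Fin N → ℝ) (z : ℝ → Fin (N + 2) → ℝ) :
    ResIdx N → ℝ → ℝ
  | .inl i => fun t => waveOp S q z t i
  | .inr (.inl _) => fun t => -z t (Fin.last N).castSucc / mesh S N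
  | .inr (.inr (.inl i)) => fun t => z t (innerIdx i)
  | .inr (.inr (.inr i)) => dt S.T fun τ => dPlus S (z τ) i

/-- The data of the functional. -/
noncomputable def resData {N : ℕ} (μ : ℝ → ℝ) (ν : ℝ → Fin (N + 1) → ℝ) : ResIdx N → ℝ → ℝ
  | .inl _ => 0
  | .inr (.inl _) => μ
  | .inr (.inr (.inl _)) => 0
  | .inr (.inr (.inr i)) => fun t => ν t i

section Residual

variable {S : Setup} (hS : S.Admissible) {N : ℕ} (s : ℝ) (q : Fin N → ℝ)

theorem resWeight_measurable (k : ResIdx N) : Measurable (resWeight S s k) := by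
  have h : ∀ x, Measurable fun t => Real.exp (s * S.φ t x) := fun x =>
    (by have := continuous_φ S x; fun_prop : Continuous fun t => Real.exp (s * S.φ t x)).measurable
  rcases k with i | i | i | i
  · exact (h _).const_mul _
  · exact (h _).const_mul _
  · exact ((measurable_indicator_O S _).mul (h _)).const_mul _
  · exact (h _).const_mul _

theorem resWeight_bounded (k : ResIdx N) :
    ∃ B, 0 ≤ B ∧ ∀ t ∈ Icc 0 S.T, |resWeight S s k t| ≤ B := by
  have h : ∀ c x, ∃ B, 0 ≤ B ∧ ∀ t ∈ Icc 0 S.T, |c * Real.exp (s * S.φ t x)| ≤ B := by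
    intro c x
    have hc : Continuous fun t => c * Real.exp (s * S.φ t x) := by
      have := continuous_φ S x; fun_prop
    obtain ⟨B, hB⟩ := isCompact_Icc.exists_bound_of_continuousOn (hc.continuousOn (s := Icc 0 S.T))
    exact ⟨|B|, abs_nonneg _, fun t ht => (hB t ht).trans (le_abs_self _)⟩
  rcases k with i | i | i | i
  · exact h _ _
  · exact h _ _
  · obtain ⟨B, hB0, hB⟩ := h (√(s ^ 3 * mesh S N)) (node S N (innerIdx i))
    refine ⟨B, hB0, fun t ht => le_trans ?_ (hB t ht)⟩
    simp only [resWeight, abs_mul]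
    have : |S.O.indicator (1 : ℝ × ℝ → ℝ) (t, node S N (innerIdx i))| ≤ 1 := by
      by_cases hm : (t, node S N (innerIdx i)) ∈ S.O <;> simp [hm]
    refine mul_le_mul_of_nonneg_left ?_ (abs_nonneg _)
    exact mul_le_of_le_one_left (abs_nonneg _) this
  · exact h _ _

theorem memL2_resWeight_mul (k : ResIdx N) {f : ℝ → ℝ} (hf : MemL2 S.T f) :
    MemL2 S.T fun t => resWeight S s k t * f t := by
  obtain ⟨B, -, hB⟩ := resWeight_bounded (S := S) s k
  refine MemLp.of_le_mul (c := B) hf ((resWeight_measurable s k).aestronglyMeasurable.mul hf.1) ?_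
  refine ae_Ioo_of_forall fun t ht => ?_
  rw [norm_mul]
  exact mul_le_mul_of_nonneg_right (hB t (Ioo_subset_Icc_self ht)) (norm_nonneg _)

include hS in
theorem memL2_residual {z : ℝ → Fin (N + 2) → ℝ} (hz : MemTraj S z) (k : ResIdx N) :
    MemL2 S.T (residual S q z k) := by
  rcases k with i | i | i | i
  · exact hz.memL2_waveOp hS q i
  · exact memL2_of_continuousOn ((hz.continuousOn hS _).neg.div_const _)
  · exact memL2_of_continuousOn (hz.continuousOn hS _)
  · exact hz.memL2_dt_dPlus hS i

theorem memL2_resData {μ : ℝ → ℝ} {ν : ℝ → Fin (N + 1) → ℝ} (hμ : MemL2 S.T μ)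
    (hν : ∀ i, MemL2 S.T fun t => ν t i) (k : ResIdx N) : MemL2 S.T (resData μ ν k) := by
  rcases k with i | i | i | i
  · exact memL2_zero
  · exact hμ
  · exact memL2_zero
  · exact hν i

include hS in
theorem residual_add {z w : ℝ → Fin (N + 2) → ℝ} (hz : MemTraj S z) (hw : MemTraj S w)
    (k : ResIdx N) : residual S q (z + w) k =ᵐ[volume.restrict (Ioo 0 S.T)]
      fun t => residual S q z k t + residual S q w k t := by
  have hzw : MemTraj S (z + w) := (trajSpace hS N).add_mem hz hw
  have hT := hS.T_pos
  rcases k with i | i | i | i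
  · filter_upwards [dt_dt_add_ae hT (hz.h2 (innerIdx i)) (hw.h2 (innerIdx i))] with t ht
    simp only [residual, waveOp, lap, Pi.add_apply, ht]
    ring
  · refine ae_of_all _ fun t => ?_
    simp only [residual, Pi.add_apply]; ring
  · exact ae_of_all _ fun t => rfl
  · refine ae_Ioo_of_forall fun t ht => ?_
    have htI := Ioo_subset_Icc_self ht
    change dt S.T (fun τ => dPlus S ((z + w) τ) i) t = dt S.T (fun τ => dPlus S (z τ) i) t +
      dt S.T (fun τ => dPlus S (w τ) i) t
    rw [hz.dt_dPlus hS i htI, hw.dt_dPlus hS i htI, hzw.dt_dPlus hS i htI]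
    change (dt S.T (fun t => z t i.succ + w t i.succ) t
      - dt S.T (fun t => z t i.castSucc + w t i.castSucc) t) / mesh S N = _
    rw [dt_add_of_memH2 hT (hz.h2 _) (hw.h2 _) htI, dt_add_of_memH2 hT (hz.h2 _) (hw.h2 _) htI]
    ring

theorem residual_smul (c : ℝ) (z : ℝ → Fin (N + 2) → ℝ) (k : ResIdx N) (t : ℝ) :
    residual S q (c • z) k t = c * residual S q z k t := by
  rcases k with i | i | i | i
  · simp only [residual, waveOp, lap, Pi.smul_apply, smul_eq_mul, dt_dt_const_mul]
    ring
  · simp only [residual, Pi.smul_apply, smul_eq_mul]; ring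
  · rfl
  · simp only [residual]
    rw [← dt_const_mul]
    congr 1; ext τ
    simp only [dPlus, Pi.smul_apply, smul_eq_mul]; ring

/-- The space of the weighted residuals. -/
abbrev ResSpace (T : ℝ) (N : ℕ) : Type :=
  PiLp 2 fun _ : ResIdx N => Lp ℝ 2 (volume.restrict (Ioo 0 T))

/-- One weighted residual of a trajectory. -/
noncomputable def resComp (k : ResIdx N) :
    trajSpace hS N →ₗ[ℝ] Lp ℝ 2 (volume.restrict (Ioo 0 S.T)) where
  toFun z := MemLp.toLp (fun t => resWeight S s k t * residual S q z k t)
    (memL2_resWeight_mul s k (memL2_residual hS q (memTraj_coe z) k))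
  map_add' z w := by
    refine Eq.trans ?_ (MemLp.toLp_add _ _)
    refine (MemLp.toLp_eq_toLp_iff _ _).mpr ?_
    filter_upwards [residual_add hS q z.2 w.2 k] with t ht
    simp only [Submodule.coe_add, ht, Pi.add_apply]; ring
  map_smul' c z := by
    refine Eq.trans ?_ (MemLp.toLp_const_smul _ _)
    refine (MemLp.toLp_eq_toLp_iff _ _).mpr (ae_of_all _ fun t => ?_)
    simp only [Submodule.coe_smul, residual_smul, Pi.smul_apply, smul_eq_mul, RingHom.id_apply]; ring

/-- The weighted residuals of a trajectory. -/
noncomputable def resMap : trajSpace hS N →ₗ[ℝ] ResSpace S.T N :=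
  (WithLp.linearEquiv 2 ℝ (ResIdx N → Lp ℝ 2 (volume.restrict (Ioo 0 S.T)))).symm.toLinearMap ∘ₗ
    LinearMap.pi (resComp hS s q)

theorem resMap_apply (z : trajSpace hS N) (k : ResIdx N) :
    resMap hS s q z k = MemLp.toLp (fun t => resWeight S s k t * residual S q z k t)
    (memL2_resWeight_mul s k (memL2_residual hS q (memTraj_coe z) k)) := rfl

/-- The weighted data of the functional. -/
noncomputable def resVec {μ : ℝ → ℝ} {ν : ℝ → Fin (N + 1) → ℝ} (hμ : MemL2 S.T μ)
    (hν : ∀ i, MemL2 S.T fun t => ν t i) : ResSpace S.T N :=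
  WithLp.toLp 2 fun k => MemLp.toLp (fun t => resWeight S s k t * resData μ ν k t)
    (memL2_resWeight_mul s k (memL2_resData hμ hν k))

theorem integral_sumInner {F : ℝ → Fin N → ℝ} (hF : ∀ i, IntegrableOn (fun t => F t i) (Ioo 0 S.T)) :
    ∫ t in Ioo 0 S.T, sumInner S (F t) = ∑ i, ∫ t in Ioo 0 S.T, mesh S N * F t i := by
  unfold sumInner
  rw [← integral_finsetSum _ fun i _ => (hF i).const_mul _]
  simp only [Finset.mul_sum]

theorem integral_sumLeft {F : ℝ → Fin (N + 1) → ℝ}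
    (hF : ∀ i, IntegrableOn (fun t => F t i) (Ioo 0 S.T)) :
    ∫ t in Ioo 0 S.T, sumLeft S (F t) = ∑ i, ∫ t in Ioo 0 S.T, mesh S N * F t i := by
  unfold sumLeft
  rw [← integral_finsetSum _ fun i _ => (hF i).const_mul _]
  simp only [Finset.mul_sum]

theorem exp_two_mul_eq_sq (s a : ℝ) : Real.exp (2 * s * a) = Real.exp (s * a) ^ 2 := by
  rw [← Real.exp_nat_mul]; congr 1; push_cast; ring

/-- The functional is a least squares functional. -/
theorem J_eq_norm_sq (hs : 0 ≤ s) {μ : ℝ → ℝ} {ν : ℝ → Fin (N + 1) → ℝ} (hμ : MemL2 S.T μ)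
    (hν : ∀ i, MemL2 S.T fun t => ν t i) (z : trajSpace hS N) :
    J S s q μ 0 ν z = 1 / 2 * ‖resMap hS s q z - resVec s hμ hν‖ ^ 2 := by
  have hz : MemTraj S z.1 := z.2
  have hh := (mesh_pos hS N).le
  have hk : ∀ k, ‖(resMap hS s q z - resVec s hμ hν) k‖ ^ 2 =
      ∫ t in Ioo 0 S.T, (resWeight S s k t * (residual S q z k t - resData μ ν k t)) ^ 2 := by
    intro k
    have hm := memL2_resWeight_mul (S := S) s k
      (memL2_sub (memL2_residual hS q hz k) (memL2_resData hμ hν k))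
    rw [← l2norm_sq hm, ← norm_toLp_eq hm]
    congr 2
    change resMap hS s q z k - resVec s hμ hν k = _
    rw [resMap_apply]
    refine ((MemLp.toLp_eq_toLp_iff (MemLp.sub (memL2_resWeight_mul s k (memL2_residual hS q hz k))
      (memL2_resWeight_mul s k (memL2_resData hμ hν k))) hm).mpr (ae_of_all _ fun t => ?_))
    simp only [Pi.sub_apply]; ring
  rw [PiLp.norm_sq_eq_of_L2, Fintype.sum_congr _ _ hk]
  simp only [Fintype.sum_sum_type, Finset.univ_unique, Finset.sum_singleton]
  unfold J
  have w1 : ∀ i : Fin N, IntegrableOn (fun t => Real.exp (2 * s * S.φ t (node S N (innerIdx i))) *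
      (waveOp S q z.1 t i - (0 : ℝ → Fin N → ℝ) t i) ^ 2) (Ioo 0 S.T) := fun i =>
    integrableOn_continuousOn_mul (continuous_exp_φ S s _).continuousOn
      (memL2_sq_integrable (memL2_sub (hz.memL2_waveOp hS q i) memL2_zero))
  have w3 : ∀ i : Fin N, IntegrableOn (fun t => S.O.indicator 1 (t, node S N (innerIdx i)) *
        (Real.exp (2 * s * S.φ t (node S N (innerIdx i))) * z.1 t (innerIdx i) ^ 2))
        (Ioo 0 S.T) := fun i => by
    refine Integrable.bdd_mul (c := 1) (integrableOn_of_continuousOn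
      ((continuous_exp_φ S s _).continuousOn.mul ((hz.continuousOn hS _).pow 2)))
      (measurable_indicator_O S _).aestronglyMeasurable (ae_of_all _ fun t => ?_)
    by_cases h : (t, node S N (innerIdx i)) ∈ S.O <;> simp [h]
  have w4 : ∀ i : Fin (N + 1), IntegrableOn (fun t => Real.exp (2 * s * S.φ t (node S N i.castSucc)) *
        (dt S.T (fun τ => dPlus S (z.1 τ) i) t - ν t i) ^ 2) (Ioo 0 S.T) := fun i =>
    integrableOn_continuousOn_mul (continuous_exp_φ S s _).continuousOn
      (memL2_sq_integrable (memL2_sub (hz.memL2_dt_dPlus hS i) (hν i)))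
  rw [integral_sumInner w1, integral_sumInner w3, integral_sumLeft w4]
  have e1 : ∀ i : Fin N, ∫ t in Ioo 0 S.T, (resWeight S s (.inl i) t *
      (residual S q z.1 (.inl i) t - resData μ ν (.inl i) t)) ^ 2 =
      ∫ t in Ioo 0 S.T, mesh S N * (Real.exp (2 * s * S.φ t (node S N (innerIdx i))) *
      (waveOp S q z.1 t i - (0 : ℝ → Fin N → ℝ) t i) ^ 2) := by
    intro i
    congr 1; ext t
    simp only [resWeight, residual, resData, mul_pow, Real.sq_sqrt hh, exp_two_mul_eq_sq,
      Pi.zero_apply]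
    ring
  have e2 : ∫ t in Ioo 0 S.T, (resWeight S s (N := N) (.inr (.inl default)) t *
      (residual S q z.1 (.inr (.inl default)) t - resData μ ν (.inr (.inl default)) t)) ^ 2 =
      s * ∫ t in Ioo 0 S.T, Real.exp (2 * s * S.φ t S.L) *
        (-z.1 t (Fin.last N).castSucc / mesh S N - μ t) ^ 2 := by
    rw [← integral_const_mul]
    congr 1; ext t
    simp only [resWeight, residual, resData, mul_pow, Real.sq_sqrt hs, exp_two_mul_eq_sq]
    ring
  have e3 : ∀ i : Fin N, ∫ t in Ioo 0 S.T, (resWeight S s (.inr (.inr (.inl i))) t *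
      (residual S q z.1 (.inr (.inr (.inl i))) t - resData μ ν (.inr (.inr (.inl i))) t)) ^ 2 =
      s ^ 3 * ∫ t in Ioo 0 S.T, mesh S N * (S.O.indicator 1 (t, node S N (innerIdx i)) *
        (Real.exp (2 * s * S.φ t (node S N (innerIdx i))) * z.1 t (innerIdx i) ^ 2)) := by
    intro i
    rw [← integral_const_mul]
    congr 1; ext t
    have hi : S.O.indicator (1 : ℝ × ℝ → ℝ) (t, node S N (innerIdx i)) ^ 2 =
        S.O.indicator (1 : ℝ × ℝ → ℝ) (t, node S N (innerIdx i)) := by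
      by_cases h : (t, node S N (innerIdx i)) ∈ S.O <;> simp [h]
    simp only [resWeight, residual, resData, mul_pow, Real.sq_sqrt (mul_nonneg (pow_nonneg hs 3) hh),
      exp_two_mul_eq_sq, hi, Pi.zero_apply, sub_zero]
    ring
  have e4 : ∀ i : Fin (N + 1), ∫ t in Ioo 0 S.T, (resWeight S s (.inr (.inr (.inr i))) t *
      (residual S q z.1 (.inr (.inr (.inr i))) t - resData μ ν (.inr (.inr (.inr i))) t)) ^ 2 =
      s * mesh S N ^ 2 * ∫ t in Ioo 0 S.T, mesh S N *
        (Real.exp (2 * s * S.φ t (node S N i.castSucc)) *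
        (dt S.T (fun τ => dPlus S (z.1 τ) i) t - ν t i) ^ 2) := by
    intro i
    rw [← integral_const_mul]
    congr 1; ext t
    simp only [resWeight, residual, resData, mul_pow,
      Real.sq_sqrt (mul_nonneg hs (pow_nonneg hh 3)), exp_two_mul_eq_sq]
    ring
  rw [Fintype.sum_congr _ _ e1, e2, Fintype.sum_congr _ _ e3, Fintype.sum_congr _ _ e4,
    ← Finset.mul_sum, ← Finset.mul_sum]
  ring

end Residual

section Comparability

variable {S : Setup} (hS : S.Admissible) {N : ℕ} (s : ℝ) (q : Fin N → ℝ)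

/-- The parameters of a trajectory: its initial velocity and its second time derivative at the
interior points. -/
noncomputable def trajParam : trajSpace hS N →ₗ[ℝ]
    (Fin N → ℝ) × (Fin N → Lp ℝ 2 (volume.restrict (Ioo 0 S.T))) where
  toFun z := (fun i => dt S.T (fun t => z.1 t (innerIdx i)) 0,
    fun i => MemLp.toLp (dt S.T (dt S.T fun t => z.1 t (innerIdx i)))
      ((memTraj_coe z).h2 (innerIdx i)).2.2)
  map_add' z w := by
    have hT := hS.T_pos
    refine Prod.ext (funext fun i => ?_) (funext fun i => ?_)
    · exact dt_add_of_memH2 hT ((memTraj_coe z).h2 _) ((memTraj_coe w).h2 _) ⟨le_rfl, hT.le⟩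
    · refine Eq.trans ?_ (MemLp.toLp_add ((memTraj_coe z).h2 (innerIdx i)).2.2
        ((memTraj_coe w).h2 (innerIdx i)).2.2)
      refine (MemLp.toLp_eq_toLp_iff ((memTraj_coe (z + w)).h2 (innerIdx i)).2.2 _).mpr ?_
      exact dt_dt_add_ae hT ((memTraj_coe z).h2 (innerIdx i)) ((memTraj_coe w).h2 (innerIdx i))
  map_smul' c z := by
    refine Prod.ext (funext fun i => ?_) (funext fun i => ?_)
    · exact dt_const_mul c _ 0
    · refine Eq.trans ?_ (MemLp.toLp_const_smul c ((memTraj_coe z).h2 (innerIdx i)).2.2)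
      refine (MemLp.toLp_eq_toLp_iff ((memTraj_coe (c • z)).h2 (innerIdx i)).2.2 _).mpr
        (ae_of_all _ fun t => ?_)
      exact dt_dt_const_mul c _ t

theorem trajParam_surjective : Function.Surjective (trajParam hS (N := N)) := by
  rintro ⟨a, b⟩
  have hT := hS.T_pos
  have h0 : (0 : ℝ) ∈ Icc 0 S.T := ⟨le_rfl, hT.le⟩
  have hb : ∀ i, MemL2 S.T (b i) := fun i => Lp.memLp (b i)
  set y : Fin N → ℝ → ℝ := fun i t => a i + ∫ τ in (0 : ℝ)..t, b i τ with hy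
  have hy1 : ∀ i, MemH1 S.T (y i) := fun i => (primitive_memH1 hT (hb i) (a i)).1
  have hy2 : ∀ i, dt S.T (y i) =ᵐ[volume.restrict (Ioo 0 S.T)] b i := fun i =>
    (primitive_memH1 hT (hb i) (a i)).2
  set x : Fin N → ℝ → ℝ := fun i t => ∫ τ in (0 : ℝ)..t, y i τ with hx
  have hxd : ∀ i, ∀ t ∈ Icc 0 S.T, HasDerivWithinAt (x i) (y i t) (Icc 0 S.T) t := fun i t ht =>
    hasDerivWithinAt_primitive (ac_continuousOn hT (hy1 i).1) ht
  have hxdt : ∀ i, ∀ t ∈ Icc 0 S.T, dt S.T (x i) t = y i t := fun i t ht =>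
    dt_eq_of_hasDerivWithinAt hT ht (hxd i t ht)
  have hx2 : ∀ i, MemH2 S.T (x i) := fun i =>
    ⟨⟨ac_of_hasDerivWithinAt hT (ac_continuousOn hT (hy1 i).1) (hxd i),
      memL2_congr (fun t ht => (hxdt i t ht).symm)
        (memL2_of_continuousOn (ac_continuousOn hT (hy1 i).1))⟩,
      memH1_congr hT (fun t ht => (hxdt i t ht).symm) (hy1 i)⟩
  set z : ℝ → Fin (N + 2) → ℝ := fun t => bdryExt 0 0 fun i => x i t with hz
  have hzi : ∀ i : Fin N, (fun t => z t (innerIdx i)) = x i := fun i => by ext t; simp [hz]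
  have hzm : MemTraj S z := by
    refine ⟨fun j => ?_, fun t _ => by simp [hz], fun t _ => by simp [hz], fun i => by simp [hz, hx]⟩
    refine mesh_cases (p := fun j => MemH2 S.T fun t => z t j) ?_ (fun i => ?_) ?_ j
    · simpa [hz] using memH2_zero
    · rw [hzi]; exact hx2 i
    · simpa [hz] using memH2_zero
  refine ⟨⟨z, hzm⟩, Prod.ext (funext fun i => ?_) (funext fun i => ?_)⟩
  · change dt S.T (fun t => z t (innerIdx i)) 0 = a i
    rw [hzi, hxdt i 0 h0]
    simp [hy]
  · change MemLp.toLp (dt S.T (dt S.T fun t => z t (innerIdx i))) (hzm.h2 _).2.2 = b i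
    refine Lp.ext ?_
    refine (MemLp.coeFn_toLp _).trans ?_
    refine EventuallyEq.trans (ae_Ioo_of_forall fun t ht => ?_) (hy2 i)
    rw [hzi]
    exact dt_congr (hxdt i) (Ioo_subset_Icc_self ht)

/-- The weighted residuals are controlled by the parameters of the trajectory. -/
theorem resMap_le_trajParam : ∃ C, ∀ z, ‖resMap hS s q z‖ ≤ C * ‖trajParam hS (N := N) z‖ := by
  have hT := hS.T_pos
  set k : trajSpace hS N → ℝ := fun z => ‖trajParam hS z‖ with hk
  have hk0 : ∀ z, 0 ≤ k z := fun z => norm_nonneg _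
  have hzero : ∀ z : trajSpace hS N, ∀ j, |(z : ℝ → Fin (N + 2) → ℝ) 0 j| ≤ 0 * k z := fun z j => by
    rw [(memTraj_coe z).init_all hS, abs_zero, zero_mul]
  have d2 : ∀ i, L2Dom S.T k fun z : trajSpace hS N => dt S.T (dt S.T fun t => z.1 t (innerIdx i)) :=
    fun i => ⟨fun z => ((memTraj_coe z).h2 _).2.2, 1, zero_le_one, fun z => by
      rw [one_mul, ← norm_toLp_eq ((memTraj_coe z).h2 (innerIdx i)).2.2]
      exact (norm_le_pi_norm (trajParam hS z).2 i).trans (norm_snd_le _)⟩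
  have d1i : ∀ i, L2Dom S.T k fun z : trajSpace hS N => dt S.T fun t => z.1 t (innerIdx i) :=
    fun i => L2Dom.of_dt hT (fun z => ((memTraj_coe z).h2 _).2.1) (d2 i) zero_le_one fun z => by
      rw [one_mul]
      exact (norm_le_pi_norm (trajParam hS z).1 i).trans (norm_fst_le _)
  have d1 : ∀ j, L2Dom S.T k fun z : trajSpace hS N => dt S.T fun t => z.1 t j := fun j =>
    mesh_cases (p := fun j => L2Dom S.T k fun z : trajSpace hS N => dt S.T fun t => z.1 t j)
      (L2Dom.zero.congr fun z t ht => ((memTraj_coe z).dt_left hS ht).symm) d1i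
      (L2Dom.zero.congr fun z t ht => ((memTraj_coe z).dt_right hS ht).symm) j
  have d0 : ∀ j, L2Dom S.T k fun z : trajSpace hS N => fun t => z.1 t j := fun j =>
    L2Dom.of_dt hT (fun z => ((memTraj_coe z).h2 j).1.1) (d1 j) le_rfl fun z => hzero z j
  have dr : ∀ κ, L2Dom S.T k fun z : trajSpace hS N => residual S q z.1 κ := by
    intro κ
    rcases κ with i | i | i | i
    · refine (((d2 i).sub (((d0 i.succ.succ).sub ((d0 (innerIdx i)).const_mul 2 hT) hT).add
        (d0 i.castSucc.castSucc) |>.const_mul (mesh S N ^ 2)⁻¹ hT) hT).add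
        ((d0 (innerIdx i)).const_mul (q i) hT)).congr fun z t _ => ?_
      simp only [residual, waveOp, lap]
      ring
    · refine ((d0 (Fin.last N).castSucc).const_mul (-1 / mesh S N) hT).congr fun z t _ => ?_
      simp only [residual]; ring
    · exact d0 _
    · refine (((d1 i.succ).sub (d1 i.castSucc) hT).const_mul (mesh S N)⁻¹ hT).congr fun z t ht => ?_
      simp only [residual, (memTraj_coe z).dt_dPlus hS i ht]
      ring
  have dw : ∀ κ, L2Dom S.T k fun z : trajSpace hS N => fun t =>
      resWeight S s κ t * residual S q z.1 κ t := by
    intro κ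
    obtain ⟨B, hB0, hB⟩ := resWeight_bounded (S := S) s κ
    exact (dr κ).mul_bdd (resWeight_measurable s κ) hB hB0
  choose hm C hC hCk using dw
  refine ⟨∑ κ, C κ, fun z => ?_⟩
  have h1 : ∀ κ, ‖resMap hS s q z κ‖ ≤ C κ * k z := fun κ => by
    rw [resMap_apply, norm_toLp_eq]; exact hCk κ z
  have hsum0 : 0 ≤ ∑ κ, C κ := Finset.sum_nonneg fun κ _ => hC κ
  refine abs_le_of_sq_le_sq' ?_ (mul_nonneg hsum0 (hk0 z)) |>.2
  rw [PiLp.norm_sq_eq_of_L2]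
  refine (Finset.sum_le_sum fun κ _ => pow_le_pow_left₀ (norm_nonneg _) (h1 κ) 2).trans ?_
  refine (Finset.sum_sq_le_sq_sum_of_nonneg fun κ _ => mul_nonneg (hC κ) (hk0 z)).trans ?_
  rw [← Finset.sum_mul]

/-- The parameters of a trajectory are controlled by its weighted residuals. The high frequency
term controls the velocities, since these vanish at the left end point; the equation then controls
the accelerations. -/
theorem trajParam_le_resMap (hs : 0 < s) :
    ∃ C, ∀ z, ‖trajParam hS (N := N) z‖ ≤ C * ‖resMap hS s q z‖ := by
  have hT := hS.T_pos
  have hh := mesh_pos hS N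
  set k : trajSpace hS N → ℝ := fun z => ‖resMap hS s q z‖ with hk
  have hk0 : ∀ z, 0 ≤ k z := fun z => norm_nonneg _
  have hzero : ∀ z : trajSpace hS N, ∀ j, |(z : ℝ → Fin (N + 2) → ℝ) 0 j| ≤ 0 * k z := fun z j => by
    rw [(memTraj_coe z).init_all hS, abs_zero, zero_mul]
  have dw : ∀ κ, L2Dom S.T k fun z : trajSpace hS N => fun t =>
      resWeight S s κ t * residual S q z.1 κ t := fun κ =>
    ⟨fun z => memL2_resWeight_mul s κ (memL2_residual hS q (memTraj_coe z) κ), 1, zero_le_one,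
      fun z => by
        rw [one_mul, ← norm_toLp_eq (memL2_resWeight_mul s κ (memL2_residual hS q (memTraj_coe z) κ)),
          ← resMap_apply]
        exact PiLp.norm_apply_le _ κ⟩
  have hinv : ∀ x, Continuous fun t => Real.exp (-(s * S.φ t x)) := fun x => by
    have := continuous_φ S x; fun_prop
  have dhf : ∀ i : Fin (N + 1), L2Dom S.T k fun z : trajSpace hS N =>
      dt S.T fun τ => dPlus S (z.1 τ) i := fun i => by
    have hc : √(s * mesh S N ^ 3) ≠ 0 := (Real.sqrt_pos.mpr (by positivity)).ne'
    refine (((dw (.inr (.inr (.inr i)))).continuous_mul (hinv (node S N i.castSucc)) hT).const_mul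
      (√(s * mesh S N ^ 3))⁻¹ hT).congr fun z t _ => ?_
    simp only [resWeight, residual, Real.exp_neg]
    field_simp
  have dwave : ∀ i : Fin N, L2Dom S.T k fun z : trajSpace hS N => fun t => waveOp S q z.1 t i :=
    fun i => by
    have hc : √(mesh S N) ≠ 0 := (Real.sqrt_pos.mpr hh).ne'
    refine (((dw (.inl i)).continuous_mul (hinv (node S N (innerIdx i))) hT).const_mul
      (√(mesh S N))⁻¹ hT).congr fun z t _ => ?_
    simp only [resWeight, residual, Real.exp_neg]
    field_simp
  have d1 : ∀ j, L2Dom S.T k fun z : trajSpace hS N => dt S.T fun t => z.1 t j := by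
    intro j
    induction j using Fin.induction with
    | zero => exact L2Dom.zero.congr fun z t ht => ((memTraj_coe z).dt_left hS ht).symm
    | succ i ih =>
      refine (ih.add ((dhf i).const_mul (mesh S N) hT)).congr fun z t ht => ?_
      rw [(memTraj_coe z).dt_dPlus hS i ht]
      field_simp
      ring
  have d0 : ∀ j, L2Dom S.T k fun z : trajSpace hS N => fun t => z.1 t j := fun j =>
    L2Dom.of_dt hT (fun z => ((memTraj_coe z).h2 j).1.1) (d1 j) le_rfl fun z => hzero z j
  have d2 : ∀ i, L2Dom S.T k fun z : trajSpace hS N => dt S.T (dt S.T fun t => z.1 t (innerIdx i)) := by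
    intro i
    refine (((dwave i).add (((d0 i.succ.succ).sub ((d0 (innerIdx i)).const_mul 2 hT) hT).add
        (d0 i.castSucc.castSucc) |>.const_mul (mesh S N ^ 2)⁻¹ hT)).sub
        ((d0 (innerIdx i)).const_mul (q i) hT) hT).congr fun z t _ => ?_
    simp only [waveOp, lap]
    ring
  have da : ∀ i : Fin N, ∃ C, 0 ≤ C ∧ ∀ z : trajSpace hS N,
      |dt S.T (fun t => z.1 t (innerIdx i)) 0| ≤ C * k z := fun i =>
    L2Dom.init_le hT (fun z => ((memTraj_coe z).h2 _).2.1) (d1 _) (d2 i)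
  choose A hA hAk using da
  choose hm C hC hCk using d2
  have hs1 : 0 ≤ ∑ i, A i := Finset.sum_nonneg fun i _ => hA i
  have hs2 : 0 ≤ ∑ i, C i := Finset.sum_nonneg fun i _ => hC i
  refine ⟨∑ i, A i + ∑ i, C i, fun z => ?_⟩
  refine max_le ((pi_norm_le_iff_of_nonneg (mul_nonneg (by positivity) (hk0 z))).mpr fun i => ?_)
    ((pi_norm_le_iff_of_nonneg (mul_nonneg (by positivity) (hk0 z))).mpr fun i => ?_)
  · refine (hAk i z).trans (mul_le_mul_of_nonneg_right ?_ (hk0 z))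
    linarith [Finset.single_le_sum (fun i _ => hA i) (Finset.mem_univ i)]
  · refine le_trans (le_of_eq ?_) ((hCk i z).trans (mul_le_mul_of_nonneg_right ?_ (hk0 z)))
    · exact norm_toLp_eq ((memTraj_coe z).h2 (innerIdx i)).2.2
    · linarith [Finset.single_le_sum (fun i _ => hC i) (Finset.mem_univ i)]

/-! ### Minimizers of the functional -/

theorem isClosed_range_resMap (hs : 0 < s) :
    IsClosed (LinearMap.range (resMap hS s q) : Set (ResSpace S.T N)) := by
  obtain ⟨c, hc⟩ := trajParam_le_resMap hS s q hs
  obtain ⟨C, hC⟩ := resMap_le_trajParam hS s q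
  exact isClosed_range_of_comparable _ _ (trajParam_surjective hS) hc hC

variable {s} {μ : ℝ → ℝ} {ν : ℝ → Fin (N + 1) → ℝ}

theorem isMinimizer_iff (hs : 0 < s) (hμ : MemL2 S.T μ) (hν : ∀ i, MemL2 S.T fun t => ν t i)
    (Z : trajSpace hS N) : IsMinimizer S s q μ 0 ν Z ↔
      ∀ z, ‖resMap hS s q Z - resVec s hμ hν‖ ≤ ‖resMap hS s q z - resVec s hμ hν‖ := by
  have key : ∀ z : trajSpace hS N, J S s q μ 0 ν Z ≤ J S s q μ 0 ν z ↔
      ‖resMap hS s q Z - resVec s hμ hν‖ ≤ ‖resMap hS s q z - resVec s hμ hν‖ := fun z => by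
    rw [J_eq_norm_sq hS s q hs.le hμ hν, J_eq_norm_sq hS s q hs.le hμ hν,
      mul_le_mul_iff_right₀ (by norm_num), sq_le_sq₀ (norm_nonneg _) (norm_nonneg _)]
  exact ⟨fun h z => (key z).mp (h.2 z (memTraj_coe z)),
    fun h => ⟨memTraj_coe Z, fun z hz => (key ⟨z, hz⟩).mpr (h ⟨z, hz⟩)⟩⟩

include hS

theorem exists_minimizer (hs : 0 < s) (hμ : MemL2 S.T μ) (hν : ∀ i, MemL2 S.T fun t => ν t i) :
    ∃ Z, IsMinimizer S s q μ 0 ν Z := by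
  obtain ⟨Z, hZ⟩ := (least_squares (resMap hS s q) (isClosed_range_resMap hS s q hs)
    (resVec s hμ hν)).1
  exact ⟨Z, (isMinimizer_iff hS q hs hμ hν Z).mpr hZ⟩

omit hS in
theorem resVec_apply (hμ : MemL2 S.T μ) (hν : ∀ i, MemL2 S.T fun t => ν t i) (k : ResIdx N) :
    resVec s hμ hν k = MemLp.toLp (fun t => resWeight S s k t * resData μ ν k t)
    (memL2_resWeight_mul s k (memL2_resData hμ hν k)) := rfl

omit hS in
theorem resData_zero (k : ResIdx N) (t : ℝ) : resData (fun _ => 0) (fun _ _ => 0) k t = 0 := by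
  rcases k with i | i | i | i <;> rfl

omit hS in
theorem resVec_zero (hμ : MemL2 S.T fun _ => 0) (hν : ∀ _ : Fin (N + 1), MemL2 S.T fun _ => 0) :
    resVec (S := S) (N := N) s (μ := fun _ => 0) (ν := fun _ _ => 0) hμ hν = 0 := by
  refine PiLp.ext fun k => ?_
  rw [resVec_apply, PiLp.zero_apply]
  refine (Lp.eq_zero_iff_ae_eq_zero).mpr ((MemLp.coeFn_toLp _).trans (ae_of_all _ fun t => ?_))
  beta_reduce
  rw [resData_zero, mul_zero]
  rfl

/-- The Pythagorean identity for minimizers of the functional. -/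
theorem IsMinimizer.pythagoras (hs : 0 < s) (hμ : MemL2 S.T μ)
    (hν : ∀ i, MemL2 S.T fun t => ν t i) {Z z : ℝ → Fin (N + 2) → ℝ}
    (hZ : IsMinimizer S s q μ 0 ν Z) (hz : MemTraj S z) :
    J S s q 0 0 0 (Z - z) + J S s q μ 0 ν Z = J S s q μ 0 ν z := by
  set Z' : trajSpace hS N := ⟨Z, hZ.1⟩
  set z' : trajSpace hS N := ⟨z, hz⟩
  have h1 := (least_squares (resMap hS s q) (isClosed_range_resMap hS s q hs)
    (resVec s hμ hν)).2 Z' ((isMinimizer_iff hS q hs hμ hν Z').mp hZ) z'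
  have e1 := J_eq_norm_sq hS s q hs.le hμ hν Z'
  have e2 := J_eq_norm_sq hS s q hs.le hμ hν z'
  have e3 := J_eq_norm_sq hS s q hs.le (μ := fun _ => 0) (ν := fun _ _ => 0) memL2_zero
    (fun _ => memL2_zero) (Z' - z')
  rw [resVec_zero, sub_zero] at e3
  change J S s q μ 0 ν Z = _ at e1
  change J S s q μ 0 ν z = _ at e2
  change J S s q 0 0 0 (Z - z) = _ at e3
  rw [e1, e2, e3, ← h1]
  ring

theorem eq_zero_of_J_eq_zero (hs : 0 < s) {z : ℝ → Fin (N + 2) → ℝ} (hz : MemTraj S z)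
    (h : J S s q 0 0 0 z = 0) {t : ℝ} (ht : t ∈ Icc 0 S.T) : z t = 0 := by
  have hT := hS.T_pos
  have h0 : (0 : ℝ) ∈ Icc 0 S.T := ⟨le_rfl, hT.le⟩
  set z' : trajSpace hS N := ⟨z, hz⟩
  have e := J_eq_norm_sq hS s q hs.le (μ := fun _ => 0) (ν := fun _ _ => 0) memL2_zero
    (fun _ => memL2_zero) z'
  rw [resVec_zero, sub_zero] at e
  change J S s q 0 0 0 z = _ at e
  have hR : ‖resMap hS s q z'‖ = 0 := by
    rw [h] at e
    exact pow_eq_zero_iff (two_ne_zero) |>.mp (by linarith)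
  obtain ⟨c, hc⟩ := trajParam_le_resMap hS s q hs
  have hP : trajParam hS z' = 0 := by
    have := hc z'
    rw [hR, mul_zero] at this
    exact norm_le_zero_iff.mp this
  have key : ∀ i : Fin N, z t (innerIdx i) = 0 := by
    intro i
    have ha : dt S.T (fun t => z t (innerIdx i)) 0 = 0 := congrFun (congrArg Prod.fst hP) i
    have hb : MemLp.toLp (dt S.T (dt S.T fun t => z t (innerIdx i))) (hz.h2 (innerIdx i)).2.2 = 0 :=
      congrFun (congrArg Prod.snd hP) i
    have hb0 : l2norm S.T (dt S.T (dt S.T fun t => z t (innerIdx i))) = 0 := by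
      rw [← norm_toLp_eq (hz.h2 (innerIdx i)).2.2, hb, norm_zero]
    have h1 : ∀ r ∈ Icc 0 S.T, dt S.T (fun t => z t (innerIdx i)) r = 0 := fun r hr => by
      have := abs_sub_init_le hT (hz.h2 (innerIdx i)).2 hr
      rw [hb0, mul_zero, ha, sub_zero] at this
      exact abs_nonpos_iff.mp this
    have h2 : l2norm S.T (dt S.T fun t => z t (innerIdx i)) = 0 := by
      rw [l2norm_congr (g := fun _ => 0)
        (ae_Ioo_of_forall fun r hr => h1 r (Ioo_subset_Icc_self hr)), l2norm_const hT]
      simp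
    have := abs_sub_init_le hT (hz.h2 (innerIdx i)).1 ht
    rw [h2, mul_zero, hz.init_all hS, sub_zero] at this
    exact abs_nonpos_iff.mp this
  funext j
  exact mesh_cases (p := fun j => z t j = 0) (hz.left t ht) key (hz.right t ht) j

theorem IsMinimizer.unique (hs : 0 < s) (hμ : MemL2 S.T μ) (hν : ∀ i, MemL2 S.T fun t => ν t i)
    {Z Z' : ℝ → Fin (N + 2) → ℝ} (hZ : IsMinimizer S s q μ 0 ν Z)
    (hZ' : IsMinimizer S s q μ 0 ν Z') {t : ℝ} (ht : t ∈ Icc 0 S.T) : Z t = Z' t := by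
  have h1 := IsMinimizer.pythagoras hS q hs hμ hν hZ hZ'.1
  have h2 := le_antisymm (hZ.2 Z' hZ'.1) (hZ'.2 Z hZ.1)
  have h3 := eq_zero_of_J_eq_zero hS q hs (z := Z - Z')
    ((trajSpace hS N).sub_mem (x := Z) (y := Z') hZ.1 hZ'.1) (by linarith) ht
  exact sub_eq_zero.mp h3

end Comparability

/-! ### Existence for the semi-discrete wave equation -/

/-- Variation of constants for a linear differential equation with continuous forcing. -/
theorem exists_linear_ode {E : Type*} [NormedAddCommGroup E] [NormedSpace ℝ E] [CompleteSpace E]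
    {T : ℝ} (hT : 0 < T) (B : E →L[ℝ] E) {b : ℝ → E} (hb : ContinuousOn b (Icc 0 T)) (x₀ : E) :
    ∃ y : ℝ → E, y 0 = x₀ ∧
      ∀ t ∈ Icc 0 T, HasDerivWithinAt y (B (y t) + b t) (Icc 0 T) t := by
  set b' : ℝ → E := IccExtend hT.le ((Icc 0 T).domRestrict b) with hb'
  have hb'c : Continuous b' := (continuousOn_iff_continuous_domRestrict.mp hb).Icc_extend'
  have hb'e : ∀ t ∈ Icc 0 T, b' t = b t := fun t ht => by rw [hb', IccExtend_of_mem _ _ ht]; rfl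
  have hexp : ∀ t : ℝ, HasDerivAt (fun t : ℝ => NormedSpace.exp (t • B))
      (B * NormedSpace.exp (t • B)) t := fun t => hasDerivAt_exp_smul_const' B t
  have hexpc : Continuous fun t : ℝ => NormedSpace.exp (t • B) :=
    continuous_iff_continuousAt.mpr fun t => (hexp t).continuousAt
  set c : ℝ → E := fun t => x₀ + ∫ τ in (0 : ℝ)..t, NormedSpace.exp ((-τ) • B) (b' τ) with hc
  have hint : Continuous fun τ : ℝ => NormedSpace.exp ((-τ) • B) (b' τ) :=
    (hexpc.comp continuous_neg).clm_apply hb'c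
  have hcd : ∀ t, HasDerivAt c (NormedSpace.exp ((-t) • B) (b' t)) t := fun t =>
    (intervalIntegral.integral_hasDerivAt_right (hint.intervalIntegrable _ _)
      (hint.stronglyMeasurableAtFilter _ _) hint.continuousAt).const_add x₀
  refine ⟨fun t => NormedSpace.exp (t • B) (c t), ?_, fun t ht => ?_⟩
  · simp [hc]
  · have h1 := (hexp t).clm_apply (hcd t)
    have h2 : NormedSpace.exp (t • B) (NormedSpace.exp ((-t) • B) (b' t)) = b' t := by
      let : NormedAlgebra ℚ (E →L[ℝ] E) := NormedAlgebra.restrictScalars ℚ ℝ _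
      have : NormedSpace.exp (t • B) * NormedSpace.exp ((-t) • B) = 1 := by
        rw [← NormedSpace.exp_add_of_commute, ← add_smul, add_neg_cancel, zero_smul,
          NormedSpace.exp_zero]
        exact ((Commute.refl B).smul_left t).smul_right (-t)
      have h3 := congrArg (fun A : E →L[ℝ] E => A (b' t)) this
      exact h3
    rw [h2, hb'e t ht] at h1
    exact h1.hasDerivWithinAt

section Existence

variable {S : Setup} {N : ℕ}

theorem bdryExt_add_boundary (l r : ℝ) (v : Fin N → ℝ) (j : Fin (N + 2)) :
    bdryExt l r v j = bdryExt 0 0 v j + bdryExt l r 0 j :=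
  mesh_cases (p := fun j => bdryExt l r v j = bdryExt 0 0 v j + bdryExt l r 0 j)
    (by simp) (fun i => by simp) (by simp) j

theorem lap_bdryExt (l r : ℝ) (v : Fin N → ℝ) (i : Fin N) :
    lap S (bdryExt l r v) i = lap S (bdryExt 0 0 v) i + lap S (bdryExt l r 0) i := by
  unfold lap
  rw [bdryExt_add_boundary l r v, bdryExt_add_boundary l r v (innerIdx i),
    bdryExt_add_boundary l r v i.castSucc.castSucc]
  ring

theorem bdryExt_linear (c : ℝ) (v v' : Fin N → ℝ) (j : Fin (N + 2)) :
    bdryExt 0 0 (v + v') j = bdryExt 0 0 v j + bdryExt 0 0 v' j ∧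
    bdryExt 0 0 (c • v) j = c * bdryExt 0 0 v j :=
  mesh_cases (p := fun j => bdryExt 0 0 (v + v') j = bdryExt 0 0 v j + bdryExt 0 0 v' j ∧
    bdryExt 0 0 (c • v) j = c * bdryExt 0 0 v j) (by simp) (fun i => by simp) (by simp) j

/-- The operator `Δ_h - q` with homogeneous boundary conditions. -/
noncomputable def dirichletOp (S : Setup) (q : Fin N → ℝ) : (Fin N → ℝ) →ₗ[ℝ] (Fin N → ℝ) where
  toFun v i := lap S (bdryExt 0 0 v) i - q i * v i
  map_add' v v' := by
    ext i
    simp only [lap, (bdryExt_linear 0 v v' _).1, Pi.add_apply]; ring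
  map_smul' c v := by
    ext i
    simp only [lap, (bdryExt_linear c v v _).2, Pi.smul_apply, smul_eq_mul, RingHom.id_apply]; ring

theorem primitive_ac {T : ℝ} (hT : 0 < T) {g : ℝ → ℝ} (hg : IntegrableOn g (Ioo 0 T)) :
    AbsolutelyContinuousOnInterval (fun t => ∫ τ in (0 : ℝ)..t, g τ) 0 T ∧
    ∀ᵐ t ∂(volume.restrict (Ioo 0 T)), HasDerivAt (fun t => ∫ τ in (0 : ℝ)..t, g τ) (g t) t := by
  have hi : IntervalIntegrable g volume 0 T := (intervalIntegrable_iff_Ioo hT).mpr hg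
  refine ⟨hi.absolutelyContinuousOnInterval_intervalIntegral (by simp [hT.le]), ?_⟩
  rw [ae_restrict_iff' measurableSet_Ioo]
  filter_upwards [hi.ae_hasDerivAt_integral] with t ht htI
  exact ht (by rw [uIcc_of_le hT.le]; exact Ioo_subset_Icc_self htI) 0 (by simp [hT.le])

/-- Existence of a Carathéodory solution. The primitive of the source and of the boundary
contributions is absorbed in the velocity, so that only a differential equation with continuous forcing has to be solved. -/
theorem exists_discSolution (hS : S.Admissible) {D : DiscData N} (hD : D.Regular S)
    (q : Fin N → ℝ) : ∃ w, IsDiscSolution S D q w := by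
  have hT := hS.T_pos
  have h0 : (0 : ℝ) ∈ Icc 0 S.T := ⟨le_rfl, hT.le⟩
  -- The boundary values enter as a forcing at the first and the last interior point.
  set F : Fin N → ℝ → ℝ := fun i t => D.f i t + lap S (bdryExt (D.g₀ t) (D.gL t) 0) i with hF
  have hbc : ∀ j : Fin (N + 2), ContinuousOn (fun t => bdryExt (D.g₀ t) (D.gL t) 0 j) (Icc 0 S.T) :=
    mesh_cases (by simpa using ac_continuousOn hT hD.g₀_ac)
      (fun i => by simpa using continuousOn_const) (by simpa using ac_continuousOn hT hD.gL_ac)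
  have hFi : ∀ i, IntegrableOn (F i) (Ioo 0 S.T) := fun i => by
    refine (hD.f_int i).add (integrableOn_of_continuousOn ?_)
    unfold lap
    exact ((((hbc _).sub (continuousOn_const.mul (hbc _))).add (hbc _)).div_const _)
  set G : Fin N → ℝ → ℝ := fun i t => ∫ τ in (0 : ℝ)..t, F i τ with hG
  have hGac : ∀ i, AbsolutelyContinuousOnInterval (G i) 0 S.T := fun i => (primitive_ac hT (hFi i)).1
  -- The unknowns are the interior values and the velocity minus the primitive `G` of the forcing.
  set A := LinearMap.toContinuousLinearMap (dirichletOp S q)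
  set B : ((Fin N → ℝ) × (Fin N → ℝ)) →L[ℝ] ((Fin N → ℝ) × (Fin N → ℝ)) :=
    (ContinuousLinearMap.snd ℝ _ _).prod (A.comp (ContinuousLinearMap.fst ℝ _ _)) with hB
  have hb : ContinuousOn (fun t => ((fun i => G i t, 0) : (Fin N → ℝ) × (Fin N → ℝ))) (Icc 0 S.T) :=
    (continuousOn_pi.mpr fun i => ac_continuousOn hT (hGac i)).prodMk continuousOn_const
  obtain ⟨y, hy0, hyd⟩ := exists_linear_ode hT B hb (D.w₀, D.w₁)
  have hv : ∀ i, ∀ t ∈ Icc 0 S.T, HasDerivWithinAt (fun t => (y t).1 i) ((y t).2 i + G i t)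
      (Icc 0 S.T) t := fun i t ht =>
    (hasDerivWithinAt_pi.mp ((ContinuousLinearMap.fst ℝ (Fin N → ℝ) (Fin N → ℝ)).hasFDerivAt.comp_hasDerivWithinAt
      t (hyd t ht))) i
  have hu : ∀ i, ∀ t ∈ Icc 0 S.T, HasDerivWithinAt (fun t => (y t).2 i)
      (lap S (bdryExt 0 0 (y t).1) i - q i * (y t).1 i) (Icc 0 S.T) t := fun i t ht => by
    have h2 := (hasDerivWithinAt_pi.mp ((ContinuousLinearMap.snd ℝ (Fin N → ℝ)
      (Fin N → ℝ)).hasFDerivAt.comp_hasDerivWithinAt t (hyd t ht))) i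
    refine h2.congr_deriv ?_
    change (lap S (bdryExt 0 0 (y t).1) i - q i * (y t).1 i) + 0 = _
    rw [add_zero]
  have hvc : ∀ i, ContinuousOn (fun t => (y t).1 i) (Icc 0 S.T) := fun i t ht =>
    (hv i t ht).continuousWithinAt
  have huc : ∀ i, ContinuousOn (fun t => (y t).2 i) (Icc 0 S.T) := fun i t ht =>
    (hu i t ht).continuousWithinAt
  have hec : ∀ j : Fin (N + 2), ContinuousOn (fun t => bdryExt 0 0 (y t).1 j) (Icc 0 S.T) :=
    mesh_cases (by simpa using continuousOn_const) (fun i => by simpa using hvc i)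
      (by simpa using continuousOn_const)
  have hlc : ∀ i, ContinuousOn (fun t => lap S (bdryExt 0 0 (y t).1) i - q i * (y t).1 i)
      (Icc 0 S.T) := fun i => by
    unfold lap
    exact ((((hec _).sub (continuousOn_const.mul (hec _))).add (hec _)).div_const _).sub
      (continuousOn_const.mul (hvc i))
  have hdt : ∀ i, EqOn (fun t => (y t).2 i + G i t) (dt S.T fun t => (y t).1 i) (Icc 0 S.T) :=
    fun i t ht => (dt_eq_of_hasDerivWithinAt hT ht (hv i t ht)).symm
  have huac : ∀ i, AbsolutelyContinuousOnInterval (fun t => (y t).2 i) 0 S.T := fun i =>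
    ac_of_hasDerivWithinAt hT (hlc i) (hu i)
  set w : ℝ → Fin (N + 2) → ℝ := fun t => bdryExt (D.g₀ t) (D.gL t) (y t).1 with hw
  have hwi : ∀ i, (fun t => w t (innerIdx i)) = fun t => (y t).1 i := fun i => by
    ext t; simp [hw]
  refine ⟨w, fun t _ => by simp [hw], fun t _ => by simp [hw], fun i => ?_, fun i => ?_,
    fun i => ?_, fun i => ?_, fun i => ?_⟩
  · rw [hwi]
    exact ac_of_hasDerivWithinAt hT ((huc i).add (ac_continuousOn hT (hGac i))) (hv i)
  · rw [hwi]
    exact ac_congr hT (hdt i) ((huac i).fun_add (hGac i))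
  · filter_upwards [(primitive_ac hT (hFi i)).2, ae_Ioo_of_forall fun t ht => ht] with t hGt ht
    have htI := Ioo_subset_Icc_self ht
    unfold waveOp
    rw [hwi, dt_congr (hdt i).symm htI, dt_eq_of_hasDerivWithinAt hT htI
      ((hu i t htI).fun_add hGt.hasDerivWithinAt)]
    change _ - lap S (bdryExt (D.g₀ t) (D.gL t) (y t).1) i + q i * w t (innerIdx i) = _
    rw [lap_bdryExt (D.g₀ t), show w t (innerIdx i) = (y t).1 i from congrFun (hwi i) t]
    simp only [hF]
    ring
  · have := congrFun (hwi i) 0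
    rw [this, hy0]
  · rw [hwi, ← hdt i h0]
    simp [hG, hy0]

end Existence

/-! ### The difference of two solutions and its energy -/

/-- Summation by parts for the discrete Laplacian. -/
theorem sum_mul_lap {S : Setup} (hS : S.Admissible) {N : ℕ} (v f : Fin (N + 2) → ℝ) (h0 : f 0 = 0)
    (h1 : f (Fin.last (N + 1)) = 0) :
    ∑ i, f (innerIdx i) * lap S v i = -∑ i, dPlus S v i * dPlus S f i := by
  have hh := (mesh_pos hS N).ne'
  have h2 := sum_second_diff (natExt f) (natExt v) N
  rw [natExt_last, natExt_zero, h0, h1, zero_mul, zero_mul, add_zero, sub_zero] at h2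
  have e1 : ∑ i, f (innerIdx i) * lap S v i = (∑ j ∈ Finset.range N, natExt f (j + 1) *
      (natExt v (j + 2) - 2 * natExt v (j + 1) + natExt v j)) / mesh S N ^ 2 := by
    rw [Finset.sum_div, ← Fin.sum_univ_eq_sum_range (fun j => natExt f (j + 1) *
      (natExt v (j + 2) - 2 * natExt v (j + 1) + natExt v j) / mesh S N ^ 2)]
    refine Finset.sum_congr rfl fun i _ => ?_
    rw [natExt_inner, natExt_inner, natExt_left, natExt_right]
    unfold lap; ring
  have e2 : ∑ i, dPlus S v i * dPlus S f i = (∑ j ∈ Finset.range (N + 1),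
      (natExt v (j + 1) - natExt v j) * (natExt f (j + 1) - natExt f j)) / mesh S N ^ 2 := by
    rw [Finset.sum_div, ← Fin.sum_univ_eq_sum_range (fun j =>
      (natExt v (j + 1) - natExt v j) * (natExt f (j + 1) - natExt f j) / mesh S N ^ 2)]
    refine Finset.sum_congr rfl fun i _ => ?_
    rw [natExt_succ, natExt_succ, natExt_castSucc, natExt_castSucc]
    unfold dPlus; field_simp
  rw [e1, e2, h2]; ring

/-- `z` is the time derivative of the difference of two solutions of the semi-discrete wave
equation with the same data and potentials `q` and `q + r`, `a` is its time derivative, and `X` is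
the velocity of the second solution. -/
structure DiffSystem (S : Setup) {N : ℕ} (q r w₀ : Fin N → ℝ) (X : Fin N → ℝ → ℝ)
    (z a : ℝ → Fin (N + 2) → ℝ) : Prop where
  hasDeriv : ∀ j, ∀ t ∈ Icc 0 S.T, HasDerivWithinAt (fun t => z t j) (a t j) (Icc 0 S.T) t
  hasDeriv₂ : ∀ i, ∀ t ∈ Icc 0 S.T, HasDerivWithinAt (fun t => a t (innerIdx i))
    (lap S (z t) i - q i * z t (innerIdx i) + r i * X i t) (Icc 0 S.T) t
  z_left : ∀ t ∈ Icc 0 S.T, z t 0 = 0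
  z_right : ∀ t ∈ Icc 0 S.T, z t (Fin.last (N + 1)) = 0
  a_left : ∀ t ∈ Icc 0 S.T, a t 0 = 0
  a_right : ∀ t ∈ Icc 0 S.T, a t (Fin.last (N + 1)) = 0
  X_cont : ∀ i, ContinuousOn (X i) (Icc 0 S.T)
  z_init : ∀ j, z 0 j = 0
  a_init : ∀ i, a 0 (innerIdx i) = r i * w₀ i

section Difference

variable {S : Setup} (hS : S.Admissible) {N : ℕ}
include hS

theorem IsDiscSolution.hasDerivWithinAt {D : DiscData N} {q : Fin N → ℝ}
    {w : ℝ → Fin (N + 2) → ℝ} (hw : IsDiscSolution S D q w) (i : Fin N) {t : ℝ}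
    (ht : t ∈ Icc 0 S.T) : HasDerivWithinAt (fun t => w t (innerIdx i))
      (dt S.T (fun t => w t (innerIdx i)) t) (Icc 0 S.T) t :=
  ac_hasDerivWithinAt_dt hS.T_pos (hw.ac i) (hw.ac_deriv i) ht

theorem IsDiscSolution.exists_diffSystem {D : DiscData N} {q Q : Fin N → ℝ}
    {w W : ℝ → Fin (N + 2) → ℝ} (hw : IsDiscSolution S D q w) (hW : IsDiscSolution S D Q W) :
    ∃ z a, DiffSystem S q (Q - q) D.w₀ (fun i => dt S.T fun t => W t (innerIdx i)) z a ∧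
      ∀ j, ∀ t ∈ Icc 0 S.T,
        HasDerivWithinAt (fun t => w t j - W t j) (z t j) (Icc 0 S.T) t := by
  have hT := hS.T_pos
  have h0 : (0 : ℝ) ∈ Icc 0 S.T := ⟨le_rfl, hT.le⟩
  set y : ℝ → Fin (N + 2) → ℝ := fun t j => w t j - W t j with hy
  have hyl : EqOn (fun t => y t 0) (fun _ => 0) (Icc 0 S.T) := fun t ht => by
    simp only [hy, hw.left t ht, hW.left t ht, sub_self]
  have hyr : EqOn (fun t => y t (Fin.last (N + 1))) (fun _ => 0) (Icc 0 S.T) := fun t ht => by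
    simp only [hy, hw.right t ht, hW.right t ht, sub_self]
  set v : Fin N → ℝ → ℝ := fun i t =>
    dt S.T (fun t => w t (innerIdx i)) t - dt S.T (fun t => W t (innerIdx i)) t with hv
  have hyi : ∀ i, ∀ t ∈ Icc 0 S.T, HasDerivWithinAt (fun t => y t (innerIdx i)) (v i t)
      (Icc 0 S.T) t := fun i t ht =>
    (hw.hasDerivWithinAt hS i ht).fun_sub (hW.hasDerivWithinAt hS i ht)
  set z : ℝ → Fin (N + 2) → ℝ := fun t => bdryExt 0 0 fun i => v i t with hz
  have hyd : ∀ j, ∀ t ∈ Icc 0 S.T, HasDerivWithinAt (fun t => y t j) (z t j) (Icc 0 S.T) t :=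
    mesh_cases (fun t ht => by
        simp only [hz, bdryExt_zero]
        exact (hasDerivWithinAt_const t _ (0 : ℝ)).congr hyl (hyl ht))
      (fun i t ht => by simp only [hz, bdryExt_inner]; exact hyi i t ht)
      (fun t ht => by
        simp only [hz, bdryExt_last]
        exact (hasDerivWithinAt_const t _ (0 : ℝ)).congr hyr (hyr ht))
  have hyc : ∀ j, ContinuousOn (fun t => y t j) (Icc 0 S.T) := fun j t ht =>
    (hyd j t ht).continuousWithinAt
  have hWc : ∀ i : Fin N, ContinuousOn (fun t => W t (innerIdx i)) (Icc 0 S.T) := fun i =>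
    ac_continuousOn hT (hW.ac i)
  set b : Fin N → ℝ → ℝ := fun i t =>
    lap S (y t) i - q i * y t (innerIdx i) + (Q i - q i) * W t (innerIdx i) with hb
  have hbc : ∀ i, ContinuousOn (b i) (Icc 0 S.T) := fun i => by
    simp only [hb]; unfold lap
    exact (((((hyc _).sub (continuousOn_const.mul (hyc _))).add (hyc _)).div_const _).sub
      (continuousOn_const.mul (hyc _))).add (continuousOn_const.mul (hWc i))
  -- the velocity is continuously differentiable, since the right hand side is continuous
  have hvd : ∀ i, ∀ t ∈ Icc 0 S.T, HasDerivWithinAt (v i) (b i t) (Icc 0 S.T) t := fun i t ht => by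
    refine ac_hasDerivWithinAt hT ((hw.ac_deriv i).fun_sub (hW.ac_deriv i)) (hbc i) ?_ ht
    filter_upwards [ac_ae_hasDerivAt hT (hw.ac_deriv i), ac_ae_hasDerivAt hT (hW.ac_deriv i),
      hw.eqn i, hW.eqn i, ae_Ioo_of_forall fun t ht => ht] with r h1 h2 h3 h4 hr
    rw [dt_eq_of_hasDerivWithinAt hT (Ioo_subset_Icc_self hr) (h1.fun_sub h2).hasDerivWithinAt]
    unfold waveOp at h3 h4
    simp only [hb, hy]
    unfold lap at h3 h4 ⊢
    linear_combination h3 - h4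
  set a : ℝ → Fin (N + 2) → ℝ := fun t => bdryExt 0 0 fun i => b i t with ha
  refine ⟨z, a, ⟨?_, ?_, fun t _ => by simp [hz], fun t _ => by simp [hz], fun t _ => by simp [ha],
    fun t _ => by simp [ha], fun i => ac_continuousOn hT (hW.ac_deriv i), ?_, ?_⟩, hyd⟩
  · exact mesh_cases (fun t ht => by simpa [hz, ha] using hasDerivWithinAt_const t _ (0 : ℝ))
      (fun i t ht => by simpa [hz, ha] using hvd i t ht)
      (fun t ht => by simpa [hz, ha] using hasDerivWithinAt_const t _ (0 : ℝ))
  · intro i t ht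
    simp only [ha, bdryExt_inner, hb]
    have h1 := (((((hyd i.succ.succ t ht).fun_sub ((hyd (innerIdx i) t ht).const_mul 2)).fun_add
      (hyd i.castSucc.castSucc t ht)).div_const (mesh S N ^ 2)).fun_sub
      ((hyd (innerIdx i) t ht).const_mul (q i))).fun_add
      ((hW.hasDerivWithinAt hS i ht).const_mul (Q i - q i))
    exact h1
  · refine mesh_cases (by simp [hz]) (fun i => ?_) (by simp [hz])
    simp [hz, hv, hw.init₁, hW.init₁]
  · intro i
    have h1 : ∀ j, y 0 j = 0 := mesh_cases (hyl h0)
      (fun i => by simp [hy, hw.init₀, hW.init₀]) (hyr h0)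
    simp [ha, hb, lap, h1, hW.init₀]

end Difference

/-- The discrete `H¹` energy of the values `z` and the velocities `a` on the mesh. -/
noncomputable def energy (S : Setup) {N : ℕ} (z a : Fin (N + 2) → ℝ) : ℝ :=
  sumInner S (fun i : Fin N => a (innerIdx i) ^ 2 + z (innerIdx i) ^ 2) +
    sumLeft S fun i : Fin (N + 1) => dPlus S z i ^ 2

section Energy

variable {S : Setup} (hS : S.Admissible) {N : ℕ} {q r w₀ : Fin N → ℝ} {X : Fin N → ℝ → ℝ}
  {z a : ℝ → Fin (N + 2) → ℝ}
include hS

theorem DiffSystem.hasDeriv_energy (hd : DiffSystem S q r w₀ X z a) {t : ℝ} (ht : t ∈ Icc 0 S.T) :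
    HasDerivWithinAt (fun t => energy S (z t) (a t))
      (sumInner S fun i => 2 * a t (innerIdx i) *
        ((1 - q i) * z t (innerIdx i) + r i * X i t)) (Icc 0 S.T) t := by
  have h1 : HasDerivWithinAt (fun t => sumInner S (fun i : Fin N =>
      a t (innerIdx i) ^ 2 + z t (innerIdx i) ^ 2))
      (sumInner S fun i => (2 * a t (innerIdx i) *
        (lap S (z t) i - q i * z t (innerIdx i) + r i * X i t)
        + 2 * z t (innerIdx i) * a t (innerIdx i))) (Icc 0 S.T) t := by
    unfold sumInner
    refine (HasDerivWithinAt.fun_sum fun i _ => ?_).const_mul _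
    refine (((hd.hasDeriv₂ i t ht).fun_pow 2).fun_add
      ((hd.hasDeriv (innerIdx i) t ht).fun_pow 2)).congr_deriv ?_
    norm_num
  have h2 : HasDerivWithinAt (fun t => sumLeft S fun i : Fin (N + 1) => dPlus S (z t) i ^ 2)
      (sumLeft S fun i : Fin (N + 1) => 2 * dPlus S (z t) i * dPlus S (a t) i) (Icc 0 S.T) t := by
    unfold sumLeft
    refine (HasDerivWithinAt.fun_sum fun i _ => ?_).const_mul _
    refine ((((hd.hasDeriv i.succ t ht).fun_sub (hd.hasDeriv i.castSucc t ht)).div_const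
      (mesh S N)).fun_pow 2).congr_deriv ?_
    unfold dPlus; norm_num
  refine (h1.fun_add h2).congr_deriv ?_
  have h3 := sum_mul_lap hS (z t) (a t) (hd.a_left t ht) (hd.a_right t ht)
  have e1 : (sumInner S fun i => (2 * a t (innerIdx i) *
        (lap S (z t) i - q i * z t (innerIdx i) + r i * X i t)
        + 2 * z t (innerIdx i) * a t (innerIdx i))) =
      2 * mesh S N * (∑ i, a t (innerIdx i) * lap S (z t) i) +
      sumInner S fun i => 2 * a t (innerIdx i) * ((1 - q i) * z t (innerIdx i) + r i * X i t) := by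
    unfold sumInner
    rw [Finset.mul_sum, Finset.mul_sum, Finset.mul_sum, ← Finset.sum_add_distrib]
    exact Finset.sum_congr rfl fun i _ => by ring
  have e2 : (sumLeft S fun i : Fin (N + 1) => 2 * dPlus S (z t) i * dPlus S (a t) i) =
      2 * mesh S N * ∑ i, dPlus S (z t) i * dPlus S (a t) i := by
    unfold sumLeft
    rw [Finset.mul_sum, Finset.mul_sum]
    exact Finset.sum_congr rfl fun i _ => by ring
  rw [e1, e2, h3]; ring

theorem sumInner_le {F G : Fin N → ℝ} (h : ∀ i, F i ≤ G i) : sumInner S F ≤ sumInner S G :=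
  mul_le_mul_of_nonneg_left (Finset.sum_le_sum fun i _ => h i) (mesh_pos hS N).le

theorem sumInner_nonneg {F : Fin N → ℝ} (h : ∀ i, 0 ≤ F i) : 0 ≤ sumInner S F :=
  mul_nonneg (mesh_pos hS N).le (Finset.sum_nonneg fun i _ => h i)

theorem sumLeft_le {F G : Fin (N + 1) → ℝ} (h : ∀ i, F i ≤ G i) : sumLeft S F ≤ sumLeft S G :=
  mul_le_mul_of_nonneg_left (Finset.sum_le_sum fun i _ => h i) (mesh_pos hS N).le

theorem sumLeft_nonneg {F : Fin (N + 1) → ℝ} (h : ∀ i, 0 ≤ F i) : 0 ≤ sumLeft S F :=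
  mul_nonneg (mesh_pos hS N).le (Finset.sum_nonneg fun i _ => h i)

omit hS in
theorem sumInner_mul_left (c : ℝ) (F : Fin N → ℝ) :
    sumInner S (fun i => c * F i) = c * sumInner S F := by
  unfold sumInner; rw [← Finset.mul_sum]; ring

omit hS in
theorem sumInner_add (F G : Fin N → ℝ) :
    sumInner S (fun i => F i + G i) = sumInner S F + sumInner S G := by
  unfold sumInner; rw [Finset.sum_add_distrib]; ring

omit hS in
theorem sumLeft_mul_left (c : ℝ) (F : Fin (N + 1) → ℝ) :
    sumLeft S (fun i => c * F i) = c * sumLeft S F := by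
  unfold sumLeft; rw [← Finset.mul_sum]; ring

theorem energy_nonneg (z a : Fin (N + 2) → ℝ) : 0 ≤ energy S z a :=
  add_nonneg (sumInner_nonneg hS fun i => by positivity) (sumLeft_nonneg hS fun i => by positivity)

omit hS in
theorem DiffSystem.continuousOn_z (hd : DiffSystem S q r w₀ X z a) (j : Fin (N + 2)) :
    ContinuousOn (fun t => z t j) (Icc 0 S.T) := fun t ht => (hd.hasDeriv j t ht).continuousWithinAt

omit hS in
theorem DiffSystem.continuousOn_a (hd : DiffSystem S q r w₀ X z a) (j : Fin (N + 2)) :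
    ContinuousOn (fun t => a t j) (Icc 0 S.T) :=
  mesh_cases (p := fun j => ContinuousOn (fun t => a t j) (Icc 0 S.T))
    (continuousOn_const.congr hd.a_left) (fun i t ht => (hd.hasDeriv₂ i t ht).continuousWithinAt)
    (continuousOn_const.congr hd.a_right) j

omit hS in
/-- The supremum over the mesh of a family of continuous functions is square integrable. -/
theorem integrableOn_iSup_sq (hX : ∀ i, ContinuousOn (X i) (Icc 0 S.T)) :
    IntegrableOn (fun t => (⨆ i, |X i t|) ^ 2) (Ioo 0 S.T) := by
  have h1 : IntegrableOn (fun t => ∑ i, X i t ^ 2) (Ioo 0 S.T) :=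
    integrable_finsetSum _ fun i _ => integrableOn_of_continuousOn ((hX i).pow 2)
  refine Integrable.mono' h1 ?_ (ae_of_all _ fun t => ?_)
  · refine AEMeasurable.aestronglyMeasurable (AEMeasurable.pow_const ?_ 2)
    refine AEMeasurable.iSup fun i => ?_
    exact (((hX i).mono Ioo_subset_Icc_self).aestronglyMeasurable measurableSet_Ioo).aemeasurable.abs
  · rw [Real.norm_of_nonneg (sq_nonneg _)]
    rcases isEmpty_or_nonempty (Fin N) with hN | hN
    · simp
    · obtain ⟨i, hi⟩ := exists_eq_ciSup_of_finite (f := fun i => |X i t|)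
      rw [← hi, sq_abs]
      exact Finset.single_le_sum (f := fun i => X i t ^ 2) (fun i _ => sq_nonneg _)
        (Finset.mem_univ i)

omit hS in
theorem sq_le_iSup_sq (i : Fin N) (t : ℝ) : X i t ^ 2 ≤ (⨆ i, |X i t|) ^ 2 := by
  rw [← sq_abs]
  exact pow_le_pow_left₀ (abs_nonneg _)
    (le_ciSup (f := fun i => |X i t|) (Set.finite_range _).bddAbove i) 2

/-- **Energy estimate.** The constant does not depend on the mesh: the source `r X` is estimated by
the supremum norm of `X` in space and the `ℓ²` norm of `r`. -/
theorem DiffSystem.energy_le (hd : DiffSystem S q r w₀ X z a) {m R K : ℝ} (hq : ∀ i, |q i| ≤ m)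
    (hm : 0 ≤ m) (hR : ∀ i, |w₀ i| ≤ R) (hK : ∫ t in Ioo 0 S.T, (⨆ i, |X i t|) ^ 2 ≤ K) {t : ℝ}
    (ht : t ∈ Icc 0 S.T) :
    energy S (z t) (a t) ≤
      Real.exp ((m + 2) * S.T) * (R ^ 2 + K) * sumInner S (fun i => r i ^ 2) := by
  have hT := hS.T_pos
  have h0 : (0 : ℝ) ∈ Icc 0 S.T := ⟨le_rfl, hT.le⟩
  set c := m + 2 with hc
  set ρ := sumInner S (fun i => r i ^ 2) with hρ
  have hρ0 : 0 ≤ ρ := sumInner_nonneg hS fun i => sq_nonneg _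
  set E : ℝ → ℝ := fun t => energy S (z t) (a t) with hE
  set E' : ℝ → ℝ := fun t => sumInner S fun i => 2 * a t (innerIdx i) *
        ((1 - q i) * z t (innerIdx i) + r i * X i t) with hE'
  set f : ℝ → ℝ := fun t => Real.exp (-c * t) * E t with hf
  set f' : ℝ → ℝ := fun t => Real.exp (-c * t) * (-c) * E t + Real.exp (-c * t) * E' t with hf'
  have hexp : ∀ t, HasDerivAt (fun t => Real.exp (-c * t)) (Real.exp (-c * t) * (-c)) t := fun t => by
    simpa using ((hasDerivAt_id t).const_mul (-c)).exp
  have hfd : ∀ t ∈ Icc 0 S.T, HasDerivWithinAt f (f' t) (Icc 0 S.T) t := fun t ht =>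
    (hexp t).hasDerivWithinAt.fun_mul (hd.hasDeriv_energy hS ht)
  have hzc := hd.continuousOn_z
  have hac := hd.continuousOn_a
  have hEc : ContinuousOn E (Icc 0 S.T) := fun t ht => (hd.hasDeriv_energy hS ht).continuousWithinAt
  have hE'c : ContinuousOn E' (Icc 0 S.T) := by
    simp only [hE', sumInner]
    exact continuousOn_const.mul (continuousOn_finsetSum _ fun i _ =>
      (continuousOn_const.mul (hac _)).mul ((continuousOn_const.mul (hzc _)).add
        (continuousOn_const.mul (hd.X_cont i))))
  have hf'c : ContinuousOn f' (Icc 0 S.T) := by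
    have he : Continuous fun t => Real.exp (-c * t) := by fun_prop
    exact ((he.continuousOn.mul continuousOn_const).mul hEc).add (he.continuousOn.mul hE'c)
  have hXi : IntegrableOn (fun t => ρ * (⨆ i, |X i t|) ^ 2) (Ioo 0 S.T) :=
    Integrable.const_mul (integrableOn_iSup_sq hd.X_cont) ρ
  -- By Grönwall, with the norm `⨆ i, |X i t|` integrated only in time.
  have hbound : ∀ t ∈ Icc 0 S.T, f' t ≤ ρ * (⨆ i, |X i t|) ^ 2 := by
    intro t ht
    have h1 : E' t ≤ c * E t + ρ * (⨆ i, |X i t|) ^ 2 := by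
      have h2 : E' t ≤ sumInner S (fun i : Fin N => c * (a t (innerIdx i) ^ 2 + z t (innerIdx i) ^ 2)
          + (⨆ i, |X i t|) ^ 2 * r i ^ 2) := by
        refine sumInner_le hS fun i => ?_
        have h3 : r i ^ 2 * X i t ^ 2 ≤ r i ^ 2 * (⨆ i, |X i t|) ^ 2 :=
          mul_le_mul_of_nonneg_left (sq_le_iSup_sq i t) (sq_nonneg _)
        have h4 := abs_le.mp (hq i)
        generalize a t (innerIdx i) = α at *
        generalize z t (innerIdx i) = ζ at *
        have h5 : 2 * α * (r i * X i t) ≤ α ^ 2 + r i ^ 2 * X i t ^ 2 := by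
          nlinarith only [sq_nonneg (α - r i * X i t)]
        have h6 : 2 * α * ((1 - q i) * ζ) ≤ (m + 1) * (α ^ 2 + ζ ^ 2) := by
          have e1 := mul_nonneg (by linarith only [h4.1] : 0 ≤ m + q i) (sq_nonneg (α + ζ))
          have e2 := mul_nonneg (by linarith only [h4.2] : 0 ≤ m - q i) (sq_nonneg (α - ζ))
          have e3 := sq_nonneg (α - ζ)
          linarith only [e1, e2, e3]
        have h8 : c * (α ^ 2 + ζ ^ 2) = (m + 1) * (α ^ 2 + ζ ^ 2) + α ^ 2 + ζ ^ 2 := by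
          rw [hc]; ring
        have h9 : 0 ≤ ζ ^ 2 := sq_nonneg _
        rw [h8]
        linarith only [h3, h5, h6, h9]
      rw [sumInner_add, sumInner_mul_left, sumInner_mul_left, ← hρ] at h2
      have h3 : 0 ≤ c * sumLeft S fun i : Fin (N + 1) => dPlus S (z t) i ^ 2 :=
        mul_nonneg (by rw [hc]; linarith) (sumLeft_nonneg hS fun i => sq_nonneg _)
      simp only [hE, energy]
      linarith only [h2, h3]
    have h2 : Real.exp (-c * t) ≤ 1 := Real.exp_le_one_iff.mpr (by
      have := mul_nonneg (by linarith : 0 ≤ c) ht.1; linarith)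
    have h3 : 0 ≤ ρ * (⨆ i, |X i t|) ^ 2 := mul_nonneg hρ0 (sq_nonneg _)
    have h4 : f' t = Real.exp (-c * t) * (E' t - c * E t) := by simp only [hf']; ring
    rw [h4]
    calc _ ≤ Real.exp (-c * t) * (ρ * (⨆ i, |X i t|) ^ 2) :=
          mul_le_mul_of_nonneg_left (by linarith only [h1]) (Real.exp_pos _).le
      _ ≤ _ := mul_le_of_le_one_left h3 h2
  have hfac : AbsolutelyContinuousOnInterval f 0 S.T := ac_of_hasDerivWithinAt hT hf'c hfd
  have h1 : f t ≤ f 0 + ρ * K := by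
    rw [ac_eq_integral hT hfac ht, intervalIntegral.integral_of_le ht.1,
      integral_Ioc_eq_integral_Ioo]
    have hsub : Ioo 0 t ⊆ Ioo 0 S.T := Ioo_subset_Ioo_right ht.2
    have h2 : ∫ τ in Ioo 0 t, dt S.T f τ ≤ ∫ τ in Ioo 0 t, ρ * (⨆ i, |X i τ|) ^ 2 := by
      refine setIntegral_mono_on ((ac_dt_integrable hT hfac).mono_set hsub)
        (hXi.mono_set hsub) measurableSet_Ioo fun τ hτ => ?_
      have hτI := Ioo_subset_Icc_self (hsub hτ)
      rw [dt_eq_of_hasDerivWithinAt hT hτI (hfd τ hτI)]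
      exact hbound τ hτI
    have h3 : ∫ τ in Ioo 0 t, ρ * (⨆ i, |X i τ|) ^ 2 ≤ ∫ τ in Ioo 0 S.T, ρ * (⨆ i, |X i τ|) ^ 2 :=
      setIntegral_mono_set hXi (ae_of_all _ fun τ => mul_nonneg hρ0 (sq_nonneg _))
        hsub.eventuallyLE
    simp only [integral_const_mul] at h2 h3
    have h4 := mul_le_mul_of_nonneg_left hK hρ0
    linarith only [h2, h3, h4]
  have hf0 : f 0 ≤ R ^ 2 * ρ := by
    have h2 : E 0 ≤ R ^ 2 * ρ := by
      have h3 : ∀ i, dPlus S (z 0) i = 0 := fun i => by simp [dPlus, hd.z_init]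
      simp only [hE, energy, h3, hd.z_init, hd.a_init]
      rw [hρ, ← sumInner_mul_left]
      have h4 : sumLeft S (fun _ : Fin (N + 1) => (0 : ℝ) ^ 2) = 0 := by simp [sumLeft]
      rw [h4, add_zero]
      refine sumInner_le hS fun i => ?_
      have h5 : w₀ i ^ 2 ≤ R ^ 2 := by
        rw [← sq_abs]; exact pow_le_pow_left₀ (abs_nonneg _) (hR i) 2
      have h6 := mul_le_mul_of_nonneg_right h5 (sq_nonneg (r i))
      rw [mul_pow]
      linarith only [h6]
    simpa [hf] using h2
  have h5 : E t = Real.exp (c * t) * f t := by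
    simp only [hf]; rw [← mul_assoc, ← Real.exp_add]; simp
  have hK0 : 0 ≤ K := (integral_nonneg fun _ => sq_nonneg _).trans hK
  change E t ≤ _
  rw [h5]
  calc _ ≤ Real.exp (c * t) * ((R ^ 2 + K) * ρ) :=
        mul_le_mul_of_nonneg_left (by linarith only [h1, hf0]) (Real.exp_pos _).le
    _ ≤ Real.exp (c * S.T) * ((R ^ 2 + K) * ρ) := by
        refine mul_le_mul_of_nonneg_right (Real.exp_le_exp.mpr ?_) (by positivity)
        exact mul_le_mul_of_nonneg_left ht.2 (by linarith)
    _ = _ := by ring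

end Energy

/-! ### The cut-off function -/

section Cutoff

variable {S : Setup} (hS : S.Admissible)
include hS

theorem differentiable_η : Differentiable ℝ S.η := hS.η_smooth.differentiable (by norm_num)

theorem contDiff_deriv_η : ContDiff ℝ 1 (deriv S.η) :=
  (contDiff_succ_iff_deriv (n := 1)).mp (by simpa using! hS.η_smooth) |>.2.2

theorem hasDerivAt_η (τ : ℝ) : HasDerivAt S.η (deriv S.η τ) τ :=
  (differentiable_η hS τ).hasDerivAt

theorem hasDerivAt_deriv_η (τ : ℝ) : HasDerivAt (deriv S.η) (deriv (deriv S.η) τ) τ :=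
  ((contDiff_deriv_η hS).differentiable (by norm_num) τ).hasDerivAt

theorem deriv_η_eq_zero {τ : ℝ} (h : S.x₀ ^ 2 < τ) :
    deriv S.η τ = 0 ∧ deriv (deriv S.η) τ = 0 := by
  have h1 : ∀ σ ∈ Ioi (S.x₀ ^ 2), deriv S.η σ = 0 := fun σ hσ => by
    have : S.η =ᶠ[𝓝 σ] fun _ => 1 := by
      filter_upwards [Ioi_mem_nhds hσ] with x hx using hS.η_one x (le_of_lt hx)
    rw [this.deriv_eq, deriv_const]
  refine ⟨h1 τ h, ?_⟩
  have : deriv S.η =ᶠ[𝓝 τ] fun _ => 0 := by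
    filter_upwards [Ioi_mem_nhds h] with x hx using h1 x hx
  rw [this.deriv_eq, deriv_const]

theorem deriv_η_eq_zero_of_neg {τ : ℝ} (h : τ < 0) :
    deriv S.η τ = 0 ∧ deriv (deriv S.η) τ = 0 := by
  have h1 : ∀ σ ∈ Iio (0 : ℝ), deriv S.η σ = 0 := fun σ hσ => by
    have : S.η =ᶠ[𝓝 σ] fun _ => 0 := by
      filter_upwards [Iio_mem_nhds hσ] with x hx using hS.η_zero x (le_of_lt hx)
    rw [this.deriv_eq, deriv_const]
  refine ⟨h1 τ h, ?_⟩
  have : deriv S.η =ᶠ[𝓝 τ] fun _ => 0 := by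
    filter_upwards [Iio_mem_nhds h] with x hx using h1 x hx
  rw [this.deriv_eq, deriv_const]

/-- The cut-off function has bounded derivatives, since it is constant outside `[0, x₀²]`. -/
theorem exists_cutoff_bound : ∃ H, 0 ≤ H ∧ (∀ τ, |deriv S.η τ| ≤ H) ∧
    ∀ τ, |deriv (deriv S.η) τ| ≤ H := by
  have c1 : Continuous (deriv S.η) := (contDiff_deriv_η hS).continuous
  have c2 : Continuous (deriv (deriv S.η)) := (contDiff_deriv_η hS).continuous_deriv (by norm_num)
  obtain ⟨A, hA⟩ := isCompact_Icc.exists_bound_of_continuousOn (c1.continuousOn (s := Icc 0 (S.x₀ ^ 2)))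
  obtain ⟨B, hB⟩ := isCompact_Icc.exists_bound_of_continuousOn (c2.continuousOn (s := Icc 0 (S.x₀ ^ 2)))
  have hH : 0 ≤ max A B := (norm_nonneg _).trans
    ((hA 0 ⟨le_rfl, sq_nonneg _⟩).trans (le_max_left _ _))
  refine ⟨max A B, hH, fun τ => ?_, fun τ => ?_⟩
  · rcases lt_or_ge τ 0 with h | h
    · rw [(deriv_η_eq_zero_of_neg hS h).1, abs_zero]; exact hH
    rcases lt_or_ge (S.x₀ ^ 2) τ with h' | h'
    · rw [(deriv_η_eq_zero hS h').1, abs_zero]; exact hH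
    exact (hA τ ⟨h, h'⟩).trans (le_max_left _ _)
  · rcases lt_or_ge τ 0 with h | h
    · rw [(deriv_η_eq_zero_of_neg hS h).2, abs_zero]; exact hH
    rcases lt_or_ge (S.x₀ ^ 2) τ with h' | h'
    · rw [(deriv_η_eq_zero hS h').2, abs_zero]; exact hH
    exact (hB τ ⟨h, h'⟩).trans (le_max_right _ _)

variable {H : ℝ}

theorem η_lipschitz (h1 : ∀ τ, |deriv S.η τ| ≤ H) (a b : ℝ) : |S.η a - S.η b| ≤ H * |a - b| :=
  convex_univ.norm_image_sub_le_of_norm_deriv_le (fun x _ => differentiable_η hS x)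
    (fun x _ => h1 x) (mem_univ b) (mem_univ a)

theorem deriv_η_lipschitz (h2 : ∀ τ, |deriv (deriv S.η) τ| ≤ H) (a b : ℝ) :
    |deriv S.η a - deriv S.η b| ≤ H * |a - b| :=
  convex_univ.norm_image_sub_le_of_norm_deriv_le
    (fun x _ => (hasDerivAt_deriv_η hS x).differentiableAt) (fun x _ => h2 x) (mem_univ b) (mem_univ a)

theorem η_second_diff (hH : 0 ≤ H) (h2 : ∀ τ, |deriv (deriv S.η) τ| ≤ H) (p : ℝ) {δ : ℝ} (hδ : 0 < δ) :
    |S.η (p + δ) - 2 * S.η p + S.η (p - δ)| ≤ 2 * H * δ ^ 2 := by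
  obtain ⟨c, hc, hc'⟩ := exists_deriv_eq_slope S.η (show p < p + δ by linarith)
    (differentiable_η hS).continuous.continuousOn (differentiable_η hS).differentiableOn
  obtain ⟨d, hd, hd'⟩ := exists_deriv_eq_slope S.η (show p - δ < p by linarith)
    (differentiable_η hS).continuous.continuousOn (differentiable_η hS).differentiableOn
  have e1 : S.η (p + δ) - S.η p = deriv S.η c * δ := by
    rw [hc', show p + δ - p = δ by ring]; field_simp
  have e2 : S.η p - S.η (p - δ) = deriv S.η d * δ := by
    rw [hd', show p - (p - δ) = δ by ring]; field_simp
  have e3 : S.η (p + δ) - 2 * S.η p + S.η (p - δ) = (deriv S.η c - deriv S.η d) * δ := by linarith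
  have h3 : |c - d| ≤ 2 * δ := abs_le.mpr ⟨by linarith [hc.1, hd.2], by linarith [hc.2, hd.1]⟩
  rw [e3, abs_mul, abs_of_pos hδ]
  have h4 := (deriv_η_lipschitz hS h2 c d).trans (mul_le_mul_of_nonneg_left h3 hH)
  calc _ ≤ H * (2 * δ) * δ := mul_le_mul_of_nonneg_right h4 hδ.le
    _ = _ := by ring

end Cutoff

/-- The cut-off `η(φ)`. -/
noncomputable def cut (S : Setup) (t x : ℝ) : ℝ := S.η (S.φ t x)

/-- The first time derivative of `η(φ)`. -/
noncomputable def cutDeriv (S : Setup) (t x : ℝ) : ℝ := deriv S.η (S.φ t x) * (-(2 * S.β * t))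

/-- The second time derivative of `η(φ)`. -/
noncomputable def cutDeriv₂ (S : Setup) (t x : ℝ) : ℝ :=
  deriv (deriv S.η) (S.φ t x) * (2 * S.β * t) ^ 2 - deriv S.η (S.φ t x) * (2 * S.β)

section CutDeriv

variable {S : Setup} (hS : S.Admissible)

theorem hasDerivAt_φ (t x : ℝ) : HasDerivAt (fun t => S.φ t x) (-(2 * S.β * t)) t := by
  unfold Setup.φ
  refine ((hasDerivAt_const t _).fun_sub
    ((hasDerivAt_sq (hasDerivAt_id t)).const_mul S.β)).congr_deriv ?_
  simp only [id]; ring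

include hS in
theorem hasDerivAt_cut (t x : ℝ) : HasDerivAt (fun t => cut S t x) (cutDeriv S t x) t :=
  (hasDerivAt_η hS _).comp t (hasDerivAt_φ t x)

include hS in
theorem hasDerivAt_cutDeriv (t x : ℝ) : HasDerivAt (fun t => cutDeriv S t x) (cutDeriv₂ S t x) t := by
  have h1 : HasDerivAt (fun t => deriv S.η (S.φ t x))
      (deriv (deriv S.η) (S.φ t x) * (-(2 * S.β * t))) t :=
    (hasDerivAt_deriv_η hS _).comp t (hasDerivAt_φ t x)
  have h2 : HasDerivAt (fun t : ℝ => -(2 * S.β * t)) (-(2 * S.β)) t :=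
    (((hasDerivAt_id t).const_mul (2 * S.β)).fun_neg).congr_deriv (by simp)
  refine (h1.fun_mul h2).congr_deriv ?_
  unfold cutDeriv₂; ring

include hS in
theorem cut_abs_le (t x : ℝ) : |cut S t x| ≤ 1 := by
  have := hS.η_mem (S.φ t x)
  rw [cut, abs_of_nonneg this.1]; exact this.2

theorem cut_eq_one (hS : S.Admissible) {t x : ℝ} (h : S.x₀ ^ 2 ≤ S.φ t x) : cut S t x = 1 :=
  hS.η_one _ h

end CutDeriv

theorem node_nonneg {S : Setup} (hS : S.Admissible) {N : ℕ} (j : Fin (N + 2)) : 0 ≤ node S N j := by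
  have := mesh_pos hS N
  unfold node; positivity

theorem x₀_sq_le_φ_zero {S : Setup} (hS : S.Admissible) {x : ℝ} (hx : 0 ≤ x) : S.x₀ ^ 2 ≤ S.φ 0 x := by
  unfold Setup.φ
  rw [sq_abs]
  nlinarith [hS.x₀_neg]

/-! ### The localized trajectory -/

/-- The function `η(φ) z` on the mesh. -/
noncomputable def cutTraj (S : Setup) {N : ℕ} (z : ℝ → Fin (N + 2) → ℝ) (t : ℝ) (j : Fin (N + 2)) : ℝ :=
  cut S t (node S N j) * z t j

/-- The terms of lower order in the equation for `η(φ) z`: the commutator of the wave operator with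
`η(φ)`. By the discrete product rule its first order part in space is split between the two edges at
a mesh point. -/
noncomputable def cutComm (S : Setup) {N : ℕ} (z a : ℝ → Fin (N + 2) → ℝ) (t : ℝ) (i : Fin N) : ℝ :=
  (cutDeriv₂ S t (node S N (innerIdx i)) - lap S (fun j => cut S t (node S N j)) i)
      * z t (innerIdx i)
    + 2 * cutDeriv S t (node S N (innerIdx i)) * a t (innerIdx i)
    - dPlus S (fun j => cut S t (node S N j)) i.succ * dPlus S (z t) i.succ
    - dPlus S (fun j => cut S t (node S N j)) i.castSucc * dPlus S (z t) i.castSucc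

section CutTraj

variable {S : Setup} (hS : S.Admissible) {N : ℕ} {q r w₀ : Fin N → ℝ} {X : Fin N → ℝ → ℝ}
  {z a : ℝ → Fin (N + 2) → ℝ} (hd : DiffSystem S q r w₀ X z a)
include hS hd

theorem DiffSystem.hasDeriv_cutTraj (j : Fin (N + 2)) {t : ℝ} (ht : t ∈ Icc 0 S.T) :
    HasDerivWithinAt (fun t => cutTraj S z t j)
      (cutDeriv S t (node S N j) * z t j + cut S t (node S N j) * a t j) (Icc 0 S.T) t :=
  (hasDerivAt_cut hS t _).hasDerivWithinAt.fun_mul (hd.hasDeriv j t ht)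

theorem DiffSystem.dt_cutTraj (j : Fin (N + 2)) {t : ℝ} (ht : t ∈ Icc 0 S.T) :
    dt S.T (fun t => cutTraj S z t j) t =
      cutDeriv S t (node S N j) * z t j + cut S t (node S N j) * a t j :=
  dt_eq_of_hasDerivWithinAt hS.T_pos ht (hd.hasDeriv_cutTraj hS j ht)

theorem DiffSystem.hasDeriv_dt_cutTraj (i : Fin N) {t : ℝ} (ht : t ∈ Icc 0 S.T) :
    HasDerivWithinAt (dt S.T fun t => cutTraj S z t (innerIdx i))
      (cutDeriv₂ S t (node S N (innerIdx i)) * z t (innerIdx i)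
        + 2 * cutDeriv S t (node S N (innerIdx i)) * a t (innerIdx i)
        + cut S t (node S N (innerIdx i)) *
          (lap S (z t) i - q i * z t (innerIdx i) + r i * X i t)) (Icc 0 S.T) t := by
  have h1 := ((hasDerivAt_cutDeriv hS t (node S N (innerIdx i))).hasDerivWithinAt.fun_mul
    (hd.hasDeriv (innerIdx i) t ht)).fun_add
    ((hasDerivAt_cut hS t (node S N (innerIdx i))).hasDerivWithinAt.fun_mul (hd.hasDeriv₂ i t ht))
  refine (h1.congr (fun r hr => hd.dt_cutTraj hS _ hr) (hd.dt_cutTraj hS _ ht)).congr_deriv ?_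
  ring

theorem DiffSystem.memTraj_cutTraj : MemTraj S (cutTraj S z) := by
  have hT := hS.T_pos
  have hzero : ∀ j, (∀ t ∈ Icc 0 S.T, z t j = 0) → MemH2 S.T fun t => cutTraj S z t j := by
    intro j hj
    have he : EqOn (fun _ => (0 : ℝ)) (fun t => cutTraj S z t j) (Icc 0 S.T) := fun t ht => by
      simp [cutTraj, hj t ht]
    refine ⟨memH1_congr hT he memH2_zero.1, memH1_congr hT (fun t ht => dt_congr he ht) memH2_zero.2⟩
  have hlc : ∀ i, ContinuousOn (fun t => lap S (z t) i - q i * z t (innerIdx i) + r i * X i t)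
      (Icc 0 S.T) := fun i => by
    have hzc := hd.continuousOn_z
    unfold lap
    exact ((((hzc _).sub (continuousOn_const.mul (hzc _))).add (hzc _)).div_const _).sub
      (continuousOn_const.mul (hzc _)) |>.add (continuousOn_const.mul (hd.X_cont i))
  have hφ : ∀ x, Continuous fun t => S.φ t x := continuous_φ S
  have c1 : ∀ x, Continuous fun t => cut S t x := fun x =>
    (differentiable_η hS).continuous.comp (hφ x)
  have c2 : ∀ x, Continuous fun t => cutDeriv S t x := fun x =>
    ((contDiff_deriv_η hS).continuous.comp (hφ x)).mul (by fun_prop)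
  have c3 : ∀ x, Continuous fun t => cutDeriv₂ S t x := fun x =>
    ((((contDiff_deriv_η hS).continuous_deriv (by norm_num)).comp (hφ x)).mul (by fun_prop)).sub
      (((contDiff_deriv_η hS).continuous.comp (hφ x)).mul (by fun_prop))
  refine ⟨mesh_cases (hzero _ hd.z_left) (fun i => ?_) (hzero _ hd.z_right),
    fun t ht => by simp [cutTraj, hd.z_left t ht], fun t ht => by simp [cutTraj, hd.z_right t ht],
    fun i => by simp [cutTraj, hd.z_init]⟩
  have d1 : ContinuousOn (fun t => cutDeriv S t (node S N (innerIdx i)) * z t (innerIdx i)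
      + cut S t (node S N (innerIdx i)) * a t (innerIdx i)) (Icc 0 S.T) :=
    ((c2 _).continuousOn.mul (hd.continuousOn_z _)).add
      ((c1 _).continuousOn.mul (hd.continuousOn_a _))
  have d2 : ContinuousOn (fun t => cutDeriv₂ S t (node S N (innerIdx i)) * z t (innerIdx i)
        + 2 * cutDeriv S t (node S N (innerIdx i)) * a t (innerIdx i)
        + cut S t (node S N (innerIdx i)) *
          (lap S (z t) i - q i * z t (innerIdx i) + r i * X i t)) (Icc 0 S.T) :=
    (((c3 _).continuousOn.mul (hd.continuousOn_z _)).add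
      ((continuousOn_const.mul (c2 _).continuousOn).mul (hd.continuousOn_a _))).add
      ((c1 _).continuousOn.mul (hlc i))
  have e1 : EqOn (fun t => cutDeriv S t (node S N (innerIdx i)) * z t (innerIdx i)
      + cut S t (node S N (innerIdx i)) * a t (innerIdx i))
      (dt S.T fun t => cutTraj S z t (innerIdx i)) (Icc 0 S.T) := fun t ht =>
    (hd.dt_cutTraj hS _ ht).symm
  refine ⟨⟨ac_of_hasDerivWithinAt hT d1 fun t ht => hd.hasDeriv_cutTraj hS _ ht,
    memL2_congr e1 (memL2_of_continuousOn d1)⟩,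
    ⟨ac_of_hasDerivWithinAt hT d2 fun t ht => hd.hasDeriv_dt_cutTraj hS i ht, ?_⟩⟩
  exact memL2_congr (fun t ht => (dt_eq_of_hasDerivWithinAt hT ht
    (hd.hasDeriv_dt_cutTraj hS i ht)).symm) (memL2_of_continuousOn d2)

theorem DiffSystem.waveOp_cutTraj (i : Fin N) {t : ℝ} (ht : t ∈ Icc 0 S.T) :
    waveOp S q (cutTraj S z) t i =
      cut S t (node S N (innerIdx i)) * (r i * X i t) + cutComm S z a t i := by
  have hh := (mesh_pos hS N).ne'
  unfold waveOp
  rw [dt_eq_of_hasDerivWithinAt hS.T_pos ht (hd.hasDeriv_dt_cutTraj hS i ht)]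
  unfold cutComm cutTraj lap dPlus
  have e1 : (i.succ.castSucc : Fin (N + 2)) = innerIdx i := rfl
  have e2 : (i.castSucc.succ : Fin (N + 2)) = innerIdx i := rfl
  rw [e1, e2]
  field_simp
  ring

theorem DiffSystem.dt_cutTraj_zero (i : Fin N) :
    dt S.T (fun t => cutTraj S z t (innerIdx i)) 0 = r i * w₀ i := by
  rw [hd.dt_cutTraj hS _ ⟨le_rfl, hS.T_pos.le⟩, hd.z_init, hd.a_init, mul_zero, zero_add,
    cut_eq_one hS (x₀_sq_le_φ_zero hS (node_nonneg hS _)), one_mul]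

end CutTraj

/-! ### Bounds on the commutator with the cut-off -/

section CutBounds

variable {S : Setup} (hS : S.Admissible) {H : ℝ}

theorem φ_eq (S : Setup) (t x : ℝ) : S.φ t x = (x - S.x₀) ^ 2 - S.β * t ^ 2 := by
  unfold Setup.φ; rw [sq_abs]

theorem φ_step_le {t x h : ℝ} (hh : 0 ≤ h) (hxL : x + h ≤ S.L) :
    S.φ t (x + h) ≤ S.φ t x + 2 * h * (S.L - S.x₀) := by
  rw [φ_eq, φ_eq]
  have := mul_nonneg hh (by linarith : 0 ≤ 2 * (S.L - (x + h)) + h)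
  nlinarith only [this]

include hS

theorem φ_mono {t x h : ℝ} (hh : 0 ≤ h) (hx : 0 ≤ x) : S.φ t x ≤ S.φ t (x + h) := by
  rw [φ_eq, φ_eq]
  have := mul_nonneg hh (by linarith [hS.x₀_neg] : 0 ≤ 2 * (x - S.x₀) + h)
  nlinarith only [this]

theorem cut_step_le (hH : 0 ≤ H) (h1 : ∀ τ, |deriv S.η τ| ≤ H) {t x h : ℝ} (hh : 0 ≤ h) (hx : 0 ≤ x)
    (hxL : x + h ≤ S.L) : |cut S t (x + h) - cut S t x| ≤ 2 * H * (S.L - S.x₀) * h := by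
  refine (η_lipschitz hS h1 _ _).trans ?_
  rw [abs_of_nonneg (sub_nonneg.mpr (φ_mono hS hh hx))]
  have := mul_le_mul_of_nonneg_left (sub_le_iff_le_add'.mpr (φ_step_le (S := S) (t := t) hh hxL)) hH
  linarith only [this]

theorem cut_second_diff_le (hH : 0 ≤ H) (h1 : ∀ τ, |deriv S.η τ| ≤ H)
    (h2 : ∀ τ, |deriv (deriv S.η) τ| ≤ H) {t x h : ℝ} (hh : 0 < h) (hx : 0 ≤ x)
    (hxL : x + h + h ≤ S.L) :
    |cut S t (x + h + h) - 2 * cut S t (x + h) + cut S t x| ≤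
      H * (8 * (S.L - S.x₀) ^ 2 + 2) * h ^ 2 := by
  set y := x + h - S.x₀ with hy
  have hy0 : 0 < y := by linarith [hS.x₀_neg]
  have hyL : y ≤ S.L - S.x₀ := by linarith
  set p := S.φ t (x + h) with hp
  have e1 : S.φ t (x + h + h) = p + 2 * h * y + h ^ 2 := by rw [hp, φ_eq, φ_eq, hy]; ring
  have e2 : S.φ t x = p - 2 * h * y + h ^ 2 := by rw [hp, φ_eq, φ_eq, hy]; ring
  have b1 := η_second_diff hS hH h2 p (by positivity : 0 < 2 * h * y)
  have b2 := η_lipschitz hS h1 (p + 2 * h * y + h ^ 2) (p + 2 * h * y)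
  have b3 := η_lipschitz hS h1 (p - 2 * h * y + h ^ 2) (p - 2 * h * y)
  rw [add_sub_cancel_left, abs_of_nonneg (sq_nonneg h)] at b2 b3
  unfold cut
  rw [e1, e2, ← hp]
  have b4 : y ^ 2 ≤ (S.L - S.x₀) ^ 2 := pow_le_pow_left₀ hy0.le hyL 2
  have b5 := mul_le_mul_of_nonneg_left b4 (by positivity : 0 ≤ 8 * H * h ^ 2)
  rw [abs_le] at *
  constructor <;> linarith only [b1.1, b1.2, b2.1, b2.2, b3.1, b3.2, b5]

theorem cutDeriv_abs_le (hH : 0 ≤ H) (h1 : ∀ τ, |deriv S.η τ| ≤ H) {t : ℝ} (ht : t ∈ Icc 0 S.T)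
    (x : ℝ) : |cutDeriv S t x| ≤ 2 * H * S.T := by
  unfold cutDeriv
  have hβ := hS.β_pos
  have b0 : 0 ≤ 2 * S.β * t := mul_nonneg (by positivity) ht.1
  have b1 : 2 * S.β * t ≤ 2 * S.T := by
    have := mul_le_mul hS.β_lt_one.le ht.2 ht.1 zero_le_one
    linarith
  rw [abs_mul, abs_neg, abs_of_nonneg b0]
  have b2 := mul_le_mul (h1 (S.φ t x)) b1 b0 hH
  linarith only [b2]

theorem cutDeriv₂_abs_le (hH : 0 ≤ H) (h1 : ∀ τ, |deriv S.η τ| ≤ H)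
    (h2 : ∀ τ, |deriv (deriv S.η) τ| ≤ H) {t : ℝ} (ht : t ∈ Icc 0 S.T)
    (x : ℝ) : |cutDeriv₂ S t x| ≤ H * (4 * S.T ^ 2 + 2) := by
  unfold cutDeriv₂
  have hβ := hS.β_pos
  have b1 : (2 * S.β * t) ^ 2 ≤ (2 * S.T) ^ 2 := by
    have := mul_le_mul hS.β_lt_one.le ht.2 ht.1 zero_le_one
    refine pow_le_pow_left₀ (by have := ht.1; positivity) (by linarith) 2
  refine (abs_sub _ _).trans ?_
  rw [abs_mul, abs_mul, abs_of_nonneg (sq_nonneg (2 * S.β * t)), abs_of_pos (by positivity : 0 < 2 * S.β)]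
  have b2 := mul_le_mul (h2 (S.φ t x)) b1 (sq_nonneg _) hH
  have b3 := mul_le_mul (h1 (S.φ t x)) (by linarith [hS.β_lt_one] : 2 * S.β ≤ 2) (by positivity) hH
  linarith only [b2, b3]

end CutBounds

theorem node_succ (S : Setup) {N : ℕ} (i : Fin (N + 1)) :
    node S N i.succ = node S N i.castSucc + mesh S N := by
  unfold node; simp; ring

theorem node_le (S : Setup) (hS : S.Admissible) {N : ℕ} (j : Fin (N + 2)) : node S N j ≤ S.L := by
  rw [← node_last S N]
  unfold node
  have := mesh_pos hS N
  have h2 : (j : ℕ) ≤ ((Fin.last (N + 1) : Fin (N + 2)) : ℕ) := Fin.le_last j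
  gcongr

/-- The constant in the bound of the commutator with the cut-off. -/
noncomputable def commC (S : Setup) (H : ℝ) : ℝ :=
  H * (4 * S.T ^ 2 + 4 * S.T + 8 * (S.L - S.x₀) ^ 2 + 2 * (S.L - S.x₀) + 4)

theorem four_term_sq_le {c A B C D z a p p' : ℝ} (hA : |A| ≤ c) (hB : |B| ≤ c) (hC : |C| ≤ c)
    (hD : |D| ≤ c) :
    (A * z + B * a - C * p - D * p') ^ 2 ≤ 4 * c ^ 2 * (z ^ 2 + a ^ 2 + p ^ 2 + p' ^ 2) := by
  have sq : ∀ {A : ℝ}, |A| ≤ c → ∀ z : ℝ, (A * z) ^ 2 ≤ c ^ 2 * z ^ 2 := fun hA z => by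
    rw [mul_pow, ← sq_abs]
    exact mul_le_mul_of_nonneg_right (pow_le_pow_left₀ (abs_nonneg _) hA 2) (sq_nonneg _)
  have h1 := sq hA z
  have h2 := sq hB a
  have h3 := sq hC p
  have h4 := sq hD p'
  generalize A * z = x₁ at *
  generalize B * a = x₂ at *
  generalize C * p = x₃ at *
  generalize D * p' = x₄ at *
  nlinarith only [h1, h2, h3, h4, sq_nonneg (x₁ - x₂), sq_nonneg (x₁ + x₃), sq_nonneg (x₁ + x₄),
    sq_nonneg (x₂ + x₃), sq_nonneg (x₂ + x₄), sq_nonneg (x₃ - x₄)]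

section CommBound

variable {S : Setup} (hS : S.Admissible) {H : ℝ} (hH : 0 ≤ H) (h1 : ∀ τ, |deriv S.η τ| ≤ H)
  (h2 : ∀ τ, |deriv (deriv S.η) τ| ≤ H) {N : ℕ} {s : ℝ} (hs : 0 ≤ s)
  (hsh : 2 * (s * mesh S N) * (S.L - S.x₀) ≤ 1)
include hS hH h1

include h2 in
theorem cutComm_sq_le (z a : ℝ → Fin (N + 2) → ℝ) {t : ℝ} (ht : t ∈ Icc 0 S.T) (i : Fin N) :
    cutComm S z a t i ^ 2 ≤ 4 * commC S H ^ 2 * (z t (innerIdx i) ^ 2 + a t (innerIdx i) ^ 2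
      + dPlus S (z t) i.succ ^ 2 + dPlus S (z t) i.castSucc ^ 2) := by
  have hh := mesh_pos hS N
  have hT := hS.T_pos
  have hR : 0 < S.L - S.x₀ := by linarith [hS.L_pos, hS.x₀_neg]
  have n1 : node S N i.succ.succ = node S N i.castSucc.castSucc + mesh S N + mesh S N := by
    rw [node_succ]; exact congrArg (· + mesh S N) (node_succ S i.castSucc)
  have n2 : node S N (innerIdx i) = node S N i.castSucc.castSucc + mesh S N := node_succ S i.castSucc
  have hx := node_nonneg hS (N := N) i.castSucc.castSucc
  have hL : node S N i.castSucc.castSucc + mesh S N + mesh S N ≤ S.L := n1 ▸ node_le S hS _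
  have step : ∀ e : Fin (N + 1), |dPlus S (fun j => cut S t (node S N j)) e| ≤ commC S H := fun e => by
    have b := cut_step_le hS hH h1 (t := t) hh.le (node_nonneg hS e.castSucc)
      (node_succ S e ▸ node_le S hS e.succ)
    unfold dPlus
    beta_reduce
    rw [abs_div, abs_of_pos hh, div_le_iff₀ hh, node_succ]
    refine b.trans (mul_le_mul_of_nonneg_right ?_ hh.le)
    unfold commC
    have e1 : 0 ≤ H * (4 * S.T ^ 2 + 4 * S.T + 8 * (S.L - S.x₀) ^ 2 + 4) := by positivity
    linarith only [e1]
  have c1 : |cutDeriv₂ S t (node S N (innerIdx i)) - lap S (fun j => cut S t (node S N j)) i| ≤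
      commC S H := by
    refine (abs_sub _ _).trans ?_
    have b1 := cutDeriv₂_abs_le hS hH h1 h2 ht (node S N (innerIdx i))
    have b2 := cut_second_diff_le hS hH h1 h2 (t := t) hh hx hL
    have b3 : |lap S (fun j => cut S t (node S N j)) i| ≤ H * (8 * (S.L - S.x₀) ^ 2 + 2) := by
      unfold lap
      beta_reduce
      rw [abs_div, abs_of_pos (by positivity : 0 < mesh S N ^ 2), div_le_iff₀ (by positivity), n1, n2]
      exact b2
    unfold commC
    have e1 : 0 ≤ H * (4 * S.T + 2 * (S.L - S.x₀)) := by positivity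
    linarith only [b1, b3, e1]
  have c2 : |2 * cutDeriv S t (node S N (innerIdx i))| ≤ commC S H := by
    rw [abs_mul, abs_two]
    have b1 := cutDeriv_abs_le hS hH h1 ht (node S N (innerIdx i))
    unfold commC
    have e1 : 0 ≤ H * (4 * S.T ^ 2 + 8 * (S.L - S.x₀) ^ 2 + 2 * (S.L - S.x₀) + 4) := by positivity
    linarith only [b1, e1]
  exact four_term_sq_le c1 c2 (step _) (step _)

omit hH h1 in
/-- The commutator vanishes where the cut-off is constant on the stencil. -/
theorem cutComm_eq_zero (z a : ℝ → Fin (N + 2) → ℝ) {t : ℝ} {i : Fin N}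
    (h : S.x₀ ^ 2 < S.φ t (node S N i.castSucc.castSucc)) : cutComm S z a t i = 0 := by
  have hh := mesh_pos hS N
  have n1 := node_succ S i.succ
  have n2 : node S N (innerIdx i) = node S N i.castSucc.castSucc + mesh S N := node_succ S i.castSucc
  have p1 : S.x₀ ^ 2 < S.φ t (node S N (innerIdx i)) := by
    rw [n2]; exact h.trans_le (φ_mono hS hh.le (node_nonneg hS _))
  have p2 : S.x₀ ^ 2 < S.φ t (node S N i.succ.succ) := by
    rw [n1]; exact p1.trans_le (φ_mono hS hh.le (node_nonneg hS _))
  have e0 := cut_eq_one hS h.le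
  have e1 := cut_eq_one hS p1.le
  have e2 := cut_eq_one hS p2.le
  have i1 : (i.succ.castSucc : Fin (N + 2)) = innerIdx i := rfl
  have i2 : (i.castSucc.succ : Fin (N + 2)) = innerIdx i := rfl
  unfold cutComm lap dPlus cutDeriv cutDeriv₂
  beta_reduce
  rw [i1, i2, e0, e1, e2, (deriv_η_eq_zero hS p1).1, (deriv_η_eq_zero hS p1).2]
  ring

omit hH h1 in
include hs hsh in
theorem exp_φ_step_le {t x : ℝ} (hxL : x + mesh S N ≤ S.L) (hφ : S.φ t x ≤ S.x₀ ^ 2) :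
    Real.exp (2 * s * S.φ t (x + mesh S N)) ≤ Real.exp 2 * Real.exp (2 * s * S.x₀ ^ 2) := by
  rw [← Real.exp_add]
  refine Real.exp_le_exp.mpr ?_
  have b1 := φ_step_le (S := S) (t := t) (mesh_pos hS N).le hxL
  have b2 := mul_le_mul_of_nonneg_left (b1.trans (add_le_add_left hφ _)) (by linarith : 0 ≤ 2 * s)
  linarith only [b2, hsh]

include h2 hs hsh in
/-- Where the commutator does not vanish, the weight is at most `e²` times its minimum
`e^{2 s x₀²}` at the initial time. -/
theorem exp_mul_cutComm_sq_le (z a : ℝ → Fin (N + 2) → ℝ) {t : ℝ} (ht : t ∈ Icc 0 S.T) (i : Fin N) :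
    Real.exp (2 * s * S.φ t (node S N (innerIdx i))) * cutComm S z a t i ^ 2 ≤
      Real.exp 2 * Real.exp (2 * s * S.x₀ ^ 2) * (4 * commC S H ^ 2 *
      (z t (innerIdx i) ^ 2 + a t (innerIdx i) ^ 2
      + dPlus S (z t) i.succ ^ 2 + dPlus S (z t) i.castSucc ^ 2)) := by
  have n2 : node S N (innerIdx i) = node S N i.castSucc.castSucc + mesh S N := node_succ S i.castSucc
  rcases lt_or_ge (S.x₀ ^ 2) (S.φ t (node S N i.castSucc.castSucc)) with h | h
  · rw [cutComm_eq_zero hS z a h]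
    simp only [ne_eq, OfNat.ofNat_ne_zero, not_false_eq_true, zero_pow, mul_zero]
    positivity
  · refine mul_le_mul ?_ (cutComm_sq_le hS hH h1 h2 z a ht i) (sq_nonneg _) (by positivity)
    rw [n2]
    exact exp_φ_step_le hS hs hsh (n2 ▸ node_le S hS _) h

include h2 hs hsh in
theorem sumInner_exp_mul_cutComm_sq_le (z a : ℝ → Fin (N + 2) → ℝ) {t : ℝ} (ht : t ∈ Icc 0 S.T) :
    sumInner S (fun i : Fin N => Real.exp (2 * s * S.φ t (node S N (innerIdx i)))
      * cutComm S z a t i ^ 2) ≤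
      8 * Real.exp 2 * commC S H ^ 2 * (Real.exp (2 * s * S.x₀ ^ 2) * energy S (z t) (a t)) := by
  refine (sumInner_le hS fun i => exp_mul_cutComm_sq_le hS hH h1 h2 hs hsh z a ht i).trans ?_
  have hm := (mesh_pos hS N).le
  have s1 : sumInner S (fun i : Fin N => dPlus S (z t) i.succ ^ 2) ≤
      sumLeft S fun i : Fin (N + 1) => dPlus S (z t) i ^ 2 := by
    refine mul_le_mul_of_nonneg_left ?_ hm
    rw [Fin.sum_univ_succ]
    linarith only [sq_nonneg (dPlus S (z t) 0)]
  have s2 : sumInner S (fun i : Fin N => dPlus S (z t) i.castSucc ^ 2) ≤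
      sumLeft S fun i : Fin (N + 1) => dPlus S (z t) i ^ 2 := by
    refine mul_le_mul_of_nonneg_left ?_ hm
    rw [Fin.sum_univ_castSucc]
    linarith only [sq_nonneg (dPlus S (z t) (Fin.last N))]
  have s0 : sumInner S (fun i : Fin N => z t (innerIdx i) ^ 2 + a t (innerIdx i) ^ 2
      + dPlus S (z t) i.succ ^ 2 + dPlus S (z t) i.castSucc ^ 2) ≤ 2 * energy S (z t) (a t) := by
    rw [sumInner_add, sumInner_add]
    have e1 : sumInner S (fun i : Fin N => z t (innerIdx i) ^ 2 + a t (innerIdx i) ^ 2) =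
        sumInner S (fun i : Fin N => a t (innerIdx i) ^ 2 + z t (innerIdx i) ^ 2) := by
      congr 1; ext i; ring
    have e2 : 0 ≤ sumInner S (fun i : Fin N => a t (innerIdx i) ^ 2 + z t (innerIdx i) ^ 2) :=
      sumInner_nonneg hS fun i => by positivity
    rw [e1]; unfold energy
    linarith only [s1, s2, e2]
  rw [sumInner_mul_left, sumInner_mul_left]
  have s3 := mul_le_mul_of_nonneg_left s0 (by positivity : 0 ≤ Real.exp 2 * Real.exp (2 * s * S.x₀ ^ 2)
    * (4 * commC S H ^ 2))
  linarith only [s3]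

include hs hsh in
/-- In the boundary term of the functional the cut-off is evaluated at `x = L`, and in the
localized trajectory at the last interior mesh point. -/
theorem flux_cut_error_le (z a : ℝ → Fin (N + 2) → ℝ) {t : ℝ}
    (hzr : z t (Fin.last (N + 1)) = 0) :
    Real.exp (2 * s * S.φ t S.L) * ((cut S t S.L - cut S t (node S N (Fin.last N).castSucc))
      * (z t (Fin.last N).castSucc / mesh S N)) ^ 2 ≤
      4 * Real.exp 2 * H ^ 2 * (S.L - S.x₀) ^ 2 * mesh S N *
        (Real.exp (2 * s * S.x₀ ^ 2) * energy S (z t) (a t)) := by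
  have hh := mesh_pos hS N
  have hE := energy_nonneg hS (z t) (a t)
  set x := node S N (Fin.last N).castSucc with hx
  have n1 : S.L = x + mesh S N := by
    rw [hx, ← node_succ, Fin.succ_last, node_last]
  have hx0 : 0 ≤ x := node_nonneg hS _
  rcases lt_or_ge (S.x₀ ^ 2) (S.φ t x) with h | h
  · have p1 : S.x₀ ^ 2 < S.φ t S.L := by
      rw [n1]; exact h.trans_le (φ_mono hS hh.le hx0)
    rw [cut_eq_one hS h.le, cut_eq_one hS p1.le, sub_self, zero_mul]
    simp only [ne_eq, OfNat.ofNat_ne_zero, not_false_eq_true, zero_pow, mul_zero]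
    positivity
  · have b1 : Real.exp (2 * s * S.φ t S.L) ≤ Real.exp 2 * Real.exp (2 * s * S.x₀ ^ 2) := by
      have := exp_φ_step_le hS hs hsh (t := t) (x := x) n1.ge h
      rwa [← n1] at this
    have b2 : (cut S t S.L - cut S t x) ^ 2 ≤ (2 * H * (S.L - S.x₀) * mesh S N) ^ 2 := by
      have := cut_step_le hS hH h1 (t := t) hh.le hx0 n1.ge
      rw [← n1] at this
      rw [← sq_abs]
      exact pow_le_pow_left₀ (abs_nonneg _) this 2
    have b3 : (z t (Fin.last N).castSucc / mesh S N) ^ 2 * mesh S N ≤ energy S (z t) (a t) := by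
      have e1 : (z t (Fin.last N).castSucc / mesh S N) ^ 2 = dPlus S (z t) (Fin.last N) ^ 2 := by
        unfold dPlus; rw [Fin.succ_last, hzr]; ring
      have e2 : 0 ≤ sumInner S (fun i : Fin N => a t (innerIdx i) ^ 2 + z t (innerIdx i) ^ 2) :=
        sumInner_nonneg hS fun i => by positivity
      have e3 : mesh S N * dPlus S (z t) (Fin.last N) ^ 2 ≤
          sumLeft S fun i : Fin (N + 1) => dPlus S (z t) i ^ 2 :=
        mul_le_mul_of_nonneg_left (Finset.single_le_sum (f := fun i => dPlus S (z t) i ^ 2)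
          (fun i _ => sq_nonneg _) (Finset.mem_univ _)) hh.le
      rw [e1]; unfold energy
      linarith only [e2, e3]
    rw [mul_pow]
    calc _ ≤ (Real.exp 2 * Real.exp (2 * s * S.x₀ ^ 2)) * ((2 * H * (S.L - S.x₀) * mesh S N) ^ 2 *
          (z t (Fin.last N).castSucc / mesh S N) ^ 2) :=
          mul_le_mul b1 (mul_le_mul_of_nonneg_right b2 (sq_nonneg _)) (by positivity) (by positivity)
      _ = (Real.exp 2 * Real.exp (2 * s * S.x₀ ^ 2)) * (4 * H ^ 2 * (S.L - S.x₀) ^ 2 * mesh S N) *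
          ((z t (Fin.last N).castSucc / mesh S N) ^ 2 * mesh S N) := by ring
      _ ≤ (Real.exp 2 * Real.exp (2 * s * S.x₀ ^ 2)) * (4 * H ^ 2 * (S.L - S.x₀) ^ 2 * mesh S N) *
          energy S (z t) (a t) := mul_le_mul_of_nonneg_left b3 (by positivity)
      _ = _ := by ring

end CommBound

/-- At the initial time the weight is minimal at `x = 0`. -/
theorem exp_mul_sumInner_le_wNormSq {S : Setup} (hS : S.Admissible) {N : ℕ} {s : ℝ} (hs : 0 ≤ s)
    (r : Fin N → ℝ) :
    Real.exp (2 * s * S.x₀ ^ 2) * sumInner S (fun i => r i ^ 2) ≤ wNormSq S s r := by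
  unfold wNormSq
  rw [← sumInner_mul_left]
  refine sumInner_le hS fun i => mul_le_mul_of_nonneg_right (Real.exp_le_exp.mpr ?_) (sq_nonneg _)
  exact mul_le_mul_of_nonneg_left (x₀_sq_le_φ_zero hS (node_nonneg hS _)) (by linarith)

/-! ### The data of the functional and the localized trajectory -/

section Data

variable {S : Setup} (hS : S.Admissible) {N : ℕ} {D : DiscData N} {q Q : Fin N → ℝ}
  {w W z a : ℝ → Fin (N + 2) → ℝ} {X : Fin N → ℝ → ℝ} {ηM' : ℝ → ℝ}
include hS

theorem IsDiscSolution.ac_all (hw : IsDiscSolution S D q w) (hD : D.Regular S) (j : Fin (N + 2)) :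
    AbsolutelyContinuousOnInterval (fun t => w t j) 0 S.T :=
  mesh_cases (p := fun j => AbsolutelyContinuousOnInterval (fun t => w t j) 0 S.T)
    (ac_congr hS.T_pos (fun t ht => (hw.left t ht).symm) hD.g₀_ac) hw.ac
    (ac_congr hS.T_pos (fun t ht => (hw.right t ht).symm) hD.gL_ac) j

theorem dt_solution_eq (hw : IsDiscSolution S D q w) (hW : IsDiscSolution S D Q W)
    (hd : DiffSystem S q (Q - q) D.w₀ X z a)
    (hy : ∀ j, ∀ t ∈ Icc 0 S.T, HasDerivWithinAt (fun t => w t j - W t j) (z t j) (Icc 0 S.T) t)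
    (j : Fin (N + 2)) {t : ℝ} (ht : t ∈ Icc 0 S.T) :
    dt S.T (fun t => w t j) t = dt S.T (fun t => W t j) t + z t j := by
  refine mesh_cases (p := fun j => dt S.T (fun t => w t j) t = dt S.T (fun t => W t j) t + z t j)
    ?_ (fun i => ?_) ?_ j
  · rw [hd.z_left t ht, add_zero]
    exact dt_congr (fun r hr => by rw [hw.left r hr, hW.left r hr]) ht
  · refine dt_eq_of_hasDerivWithinAt hS.T_pos ht ?_
    refine ((hW.hasDerivWithinAt hS i ht).fun_add (hy (innerIdx i) t ht)).congr
      (fun r _ => by ring) (by ring)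
  · rw [hd.z_right t ht, add_zero]
    exact dt_congr (fun r hr => by rw [hw.right r hr, hW.right r hr]) ht

theorem cutoffGrad_eq (hw : IsDiscSolution S D q w) (hW : IsDiscSolution S D Q W)
    (hd : DiffSystem S q (Q - q) D.w₀ X z a)
    (hy : ∀ j, ∀ t ∈ Icc 0 S.T, HasDerivWithinAt (fun t => w t j - W t j) (z t j) (Icc 0 S.T) t)
    (i : Fin (N + 1)) {t : ℝ} (ht : t ∈ Icc 0 S.T) :
    cutoffGrad S w i t = cutoffGrad S W i t + dPlus S (cutTraj S z t) i := by
  unfold cutoffGrad dPlus cutTraj cut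
  beta_reduce
  rw [dt_solution_eq hS hw hW hd hy _ ht, dt_solution_eq hS hw hW hd hy _ ht]
  ring

theorem memH1_dPlus {v : ℝ → Fin (N + 2) → ℝ} (hv : MemTraj S v) (i : Fin (N + 1)) :
    MemH1 S.T fun t => dPlus S (v t) i := by
  have h1 := memH1_const_mul (mesh S N)⁻¹ (memH1_add hS.T_pos (hv.h2 i.succ).1
    (memH1_const_mul (-1) (hv.h2 i.castSucc).1))
  refine memH1_congr hS.T_pos (fun t _ => ?_) h1
  simp only [dPlus]; ring

/-- The second data of the functional are square integrable for every potential, as soon as they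
are so for one potential. -/
theorem memH1_cutoffGrad (hw : IsDiscSolution S D q w) (hW : IsDiscSolution S D Q W)
    (hreg : ∀ i, MemH1 S.T (cutoffGrad S W i)) (i : Fin (N + 1)) :
    MemH1 S.T (cutoffGrad S w i) := by
  obtain ⟨z, a, hd, hy⟩ := hw.exists_diffSystem hS hW
  exact memH1_congr hS.T_pos (fun t ht => (cutoffGrad_eq hS hw hW hd hy i ht).symm)
    (memH1_add hS.T_pos (hreg i) (memH1_dPlus hS (hd.memTraj_cutTraj hS) i))

theorem nuData_eq (hw : IsDiscSolution S D q w) (hW : IsDiscSolution S D Q W)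
    (hd : DiffSystem S q (Q - q) D.w₀ X z a)
    (hy : ∀ j, ∀ t ∈ Icc 0 S.T, HasDerivWithinAt (fun t => w t j - W t j) (z t j) (Icc 0 S.T) t)
    (hreg : ∀ i, MemH1 S.T (cutoffGrad S W i)) (i : Fin (N + 1)) :
    (fun t => nuData S w t i) =ᵐ[volume.restrict (Ioo 0 S.T)]
      fun t => nuData S W t i + dt S.T (fun t => dPlus S (cutTraj S z t) i) t := by
  filter_upwards [dt_add_ae hS.T_pos (hreg i).1 (memH1_dPlus hS (hd.memTraj_cutTraj hS) i).1,
    ae_Ioo_of_forall fun t ht => ht] with t h ht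
  unfold nuData
  rw [← h]
  exact dt_congr (fun r hr => cutoffGrad_eq hS hw hW hd hy i hr) (Ioo_subset_Icc_self ht)

theorem muData_eq (hW : IsDiscSolution S D Q W) (hD : D.Regular S)
    (hd : DiffSystem S q (Q - q) D.w₀ X z a)
    (hy : ∀ j, ∀ t ∈ Icc 0 S.T, HasDerivWithinAt (fun t => w t j - W t j) (z t j) (Icc 0 S.T) t) :
    muData S ηM' w =ᵐ[volume.restrict (Ioo 0 S.T)] fun t => muData S ηM' W t
      - cut S t S.L * (z t (Fin.last N).castSucc / mesh S N) := by
  have hac : AbsolutelyContinuousOnInterval (fun τ => dPlus S (W τ) (Fin.last N)) 0 S.T :=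
    ac_div_const ((hW.ac_all hS hD _).fun_sub (hW.ac_all hS hD _)) _
  filter_upwards [ac_ae_hasDerivAt hS.T_pos hac, ae_Ioo_of_forall fun t ht => ht] with t h ht
  have htI := Ioo_subset_Icc_self ht
  have h2 := h.hasDerivWithinAt (s := Icc 0 S.T) |>.fun_add
    (((hy (Fin.last N).succ t htI).fun_sub (hy (Fin.last N).castSucc t htI)).div_const (mesh S N))
  have h3 : dt S.T (fun τ => dPlus S (w τ) (Fin.last N)) t = _ :=
    dt_eq_of_hasDerivWithinAt hS.T_pos htI (h2.congr (fun r _ => by unfold dPlus; ring)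
      (by unfold dPlus; ring))
  unfold muData cut
  rw [h3, Fin.succ_last, hd.z_right t htI]
  ring

/-- Square integrability of the first data: the cut-off flux of the boundary data is the difference
of two square integrable terms. -/
theorem memL2_muData (hN : 1 ≤ N) (hw : IsDiscSolution S D q w) (hD : D.Regular S)
    (hreg : ∀ i, MemH1 S.T (cutoffGrad S w i)) (hM : MemL2 S.T ηM') :
    MemL2 S.T (muData S ηM' w) := by
  have hT := hS.T_pos
  obtain ⟨n, rfl⟩ : ∃ n, N = n + 1 := ⟨N - 1, by omega⟩
  have hidx : (Fin.last (n + 1)).castSucc = innerIdx (Fin.last n) := rfl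
  have c1 : ∀ x, Continuous fun t => cut S t x := fun x =>
    (differentiable_η hS).continuous.comp (continuous_φ S x)
  have hc : ContinuousOn (fun t => cutoffGrad S w (Fin.last (n + 1)) t
      + (cut S t (node S (n + 1) (innerIdx (Fin.last n))) - cut S t S.L) *
        dt S.T (fun t => w t (innerIdx (Fin.last n))) t / mesh S (n + 1)) (Icc 0 S.T) :=
    (ac_continuousOn hT (hreg _).1).add ((((c1 _).sub (c1 _)).continuousOn.mul
      (ac_continuousOn hT (hw.ac_deriv _))).div_const _)
  refine memL2_congr_ae ?_ (memL2_sub (memL2_of_continuousOn hc) hM)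
  filter_upwards [ac_ae_hasDerivAt hT (hw.ac_all hS hD (Fin.last (n + 1)).succ),
    ac_ae_hasDerivAt hT (hw.ac_all hS hD (Fin.last (n + 1)).castSucc),
    ae_Ioo_of_forall fun t ht => ht] with t h1 h2 ht
  have h3 : dt S.T (fun τ => dPlus S (w τ) (Fin.last (n + 1))) t = _ :=
    dt_eq_of_hasDerivWithinAt hT (Ioo_subset_Icc_self ht)
      ((h1.fun_sub h2).div_const (mesh S (n + 1))).hasDerivWithinAt
  unfold muData
  rw [h3]
  unfold cutoffGrad dPlus cut
  beta_reduce
  rw [hidx, Fin.succ_last, node_last]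
  ring

end Data

/-- The value of the functional at the localized difference of the solutions is bounded by the
consistency errors of the reference solution `W` and by the error of the current potential, with a
constant that does not depend on `s`. -/
theorem J_cutTraj_le {S : Setup} (hS : S.Admissible) {N : ℕ} {D : DiscData N} (hD : D.Regular S)
    {q Q : Fin N → ℝ} {w W z a : ℝ → Fin (N + 2) → ℝ} {ηM' : ℝ → ℝ}
    (hw : IsDiscSolution S D q w) (hW : IsDiscSolution S D Q W)
    (hd : DiffSystem S q (Q - q) D.w₀ (fun i => dt S.T fun t => W t (innerIdx i)) z a)
    (hy : ∀ j, ∀ t ∈ Icc 0 S.T, HasDerivWithinAt (fun t => w t j - W t j) (z t j) (Icc 0 S.T) t)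
    (hreg : ∀ i, MemH1 S.T (cutoffGrad S W i)) (hμ : MemL2 S.T (muData S ηM' W))
    (hμw : MemL2 S.T (muData S ηM' w)) {s H CE K : ℝ}
    (hs : 0 ≤ s) (hsh : 2 * (s * mesh S N) * (S.L - S.x₀) ≤ 1) (hH : 0 ≤ H)
    (h1 : ∀ τ, |deriv S.η τ| ≤ H) (h2 : ∀ τ, |deriv (deriv S.η) τ| ≤ H) (hCE : 0 ≤ CE)
    (hE : ∀ t ∈ Icc 0 S.T, energy S (z t) (a t) ≤ CE * sumInner S fun i => (Q - q) i ^ 2)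
    (hK : ∫ t in Ioo 0 S.T, (⨆ i : Fin N, |dt S.T (fun τ => W τ (innerIdx i)) t|) ^ 2 ≤ K) :
    J S s q (muData S ηM' w) 0 (nuData S w) (cutTraj S z) ≤
      (K + (8 * commC S H ^ 2 + 2 * H ^ 2 * (S.L - S.x₀)) * Real.exp 2 * S.T * CE)
        * wNormSq S s (Q - q)
      + s * fluxDefect S s ηM' W + s / 2 * hfDefect S s W := by
  have hT := hS.T_pos
  have hh := mesh_pos hS N
  have hR : 0 < S.L - S.x₀ := by linarith [hS.L_pos, hS.x₀_neg]
  set r := Q - q with hr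
  set A := wNormSq S s r with hA
  set Y : ℝ → ℝ := fun t => (⨆ i : Fin N, |dt S.T (fun τ => W τ (innerIdx i)) t|) ^ 2 with hY
  have hA0 : 0 ≤ A := sumInner_nonneg hS fun i => by positivity
  have hz := hd.memTraj_cutTraj hS
  have hYi : IntegrableOn Y (Ioo 0 S.T) := integrableOn_iSup_sq hd.X_cont
  have hexpE : ∀ t ∈ Icc 0 S.T, Real.exp (2 * s * S.x₀ ^ 2) * energy S (z t) (a t) ≤ CE * A := by
    intro t ht
    have b1 := mul_le_mul_of_nonneg_left (hE t ht) (Real.exp_pos (2 * s * S.x₀ ^ 2)).le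
    have b2 := mul_le_mul_of_nonneg_left (exp_mul_sumInner_le_wNormSq hS hs r) hCE
    linarith only [b1, b2]
  have hvol : ∀ c : ℝ, ∫ _ in Ioo 0 S.T, c = S.T * c := fun c => by
    simp [measureReal_def, hT.le]
  -- The residual of the equation is `η(φ) r ∂ₜW` plus the commutator.
  have T1 : ∫ t in Ioo 0 S.T, (sumInner S fun i : Fin N =>
      Real.exp (2 * s * S.φ t (node S N (innerIdx i))) *
        (waveOp S q (cutTraj S z) t i - (0 : ℝ → Fin N → ℝ) t i) ^ 2) ≤
      2 * (K * A) + S.T * (16 * Real.exp 2 * commC S H ^ 2 * (CE * A)) := by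
    have b0 : ∫ t in Ioo 0 S.T, (sumInner S fun i : Fin N =>
        Real.exp (2 * s * S.φ t (node S N (innerIdx i))) *
        (waveOp S q (cutTraj S z) t i - (0 : ℝ → Fin N → ℝ) t i) ^ 2) ≤
        ∫ t in Ioo 0 S.T, (2 * A * Y t + 16 * Real.exp 2 * commC S H ^ 2 * (CE * A)) := by
      refine setIntegral_mono_on (integrableOn_J_wave hS hz s q (g := 0) fun _ => memL2_zero)
        ((hYi.const_mul _).add (integrable_const _)) measurableSet_Ioo fun t ht => ?_
      have htI := Ioo_subset_Icc_self ht
      have c1 : (sumInner S fun i : Fin N => Real.exp (2 * s * S.φ t (node S N (innerIdx i))) *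
          (waveOp S q (cutTraj S z) t i - (0 : ℝ → Fin N → ℝ) t i) ^ 2) ≤
          sumInner S fun i : Fin N => 2 * (Y t *
            (Real.exp (2 * s * S.φ 0 (node S N (innerIdx i))) * r i ^ 2))
            + 2 * (Real.exp (2 * s * S.φ t (node S N (innerIdx i))) * cutComm S z a t i ^ 2) := by
        refine sumInner_le hS fun i => ?_
        rw [hd.waveOp_cutTraj hS i htI]
        change _ * (_ - (0 : ℝ)) ^ 2 ≤ _
        rw [sub_zero]
        set e := Real.exp (2 * s * S.φ t (node S N (innerIdx i)))
        have he : e ≤ Real.exp (2 * s * S.φ 0 (node S N (innerIdx i))) := by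
          refine Real.exp_le_exp.mpr (mul_le_mul_of_nonneg_left ?_ (by linarith))
          rw [φ_eq, φ_eq]
          have := mul_nonneg hS.β_pos.le (sq_nonneg t)
          linarith only [this]
        have d1 : (cut S t (node S N (innerIdx i)) *
            (r i * dt S.T (fun t => W t (innerIdx i)) t)) ^ 2 ≤ r i ^ 2 * Y t := by
          rw [mul_pow, mul_pow]
          have f1 : cut S t (node S N (innerIdx i)) ^ 2 ≤ 1 := by
            rw [← sq_abs]; exact pow_le_one₀ (abs_nonneg _) (cut_abs_le hS _ _)
          have f2 : dt S.T (fun t => W t (innerIdx i)) t ^ 2 ≤ Y t :=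
            sq_le_iSup_sq (X := fun i => dt S.T fun τ => W τ (innerIdx i)) i t
          calc _ ≤ 1 * (r i ^ 2 * dt S.T (fun t => W t (innerIdx i)) t ^ 2) :=
                mul_le_mul_of_nonneg_right f1 (by positivity)
            _ ≤ _ := by rw [one_mul]; exact mul_le_mul_of_nonneg_left f2 (sq_nonneg _)
        have hY0 : 0 ≤ Y t := sq_nonneg _
        have d2 := mul_le_mul he d1 (sq_nonneg _) (Real.exp_pos _).le
        have d3 := mul_nonneg (Real.exp_pos (2 * s * S.φ t (node S N (innerIdx i)))).le
          (sq_nonneg (cut S t (node S N (innerIdx i)) *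
            (r i * dt S.T (fun t => W t (innerIdx i)) t) - cutComm S z a t i))
        change 0 ≤ e * _ at d3
        linarith only [d2, d3]
      rw [sumInner_add, sumInner_mul_left, sumInner_mul_left, sumInner_mul_left] at c1
      have c2 := sumInner_exp_mul_cutComm_sq_le hS hH h1 h2 hs hsh z a htI
      have c3 := mul_le_mul_of_nonneg_left (hexpE t htI)
        (by positivity : 0 ≤ 8 * Real.exp 2 * commC S H ^ 2)
      have c4 : sumInner S (fun i : Fin N =>
        Real.exp (2 * s * S.φ 0 (node S N (innerIdx i))) * r i ^ 2) = A := rfl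
      rw [c4] at c1
      linarith only [c1, c2, c3]
    rw [integral_add (hYi.const_mul _) (integrable_const _), integral_const_mul, hvol] at b0
    have b1 := mul_le_mul_of_nonneg_left hK (by positivity : 0 ≤ 2 * A)
    linarith only [b0, b1]
  -- The cut-off is evaluated at `L` in the data and at the last interior point in the trajectory.
  have T2 : ∫ t in Ioo 0 S.T, Real.exp (2 * s * S.φ t S.L) *
      (-cutTraj S z t (Fin.last N).castSucc / mesh S N - muData S ηM' w t) ^ 2 ≤
      2 * fluxDefect S s ηM' W +
        S.T * (8 * Real.exp 2 * H ^ 2 * (S.L - S.x₀) ^ 2 * mesh S N * (CE * A)) := by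
    have hfi : IntegrableOn (fun t => Real.exp (2 * s * S.φ t S.L) * muData S ηM' W t ^ 2)
        (Ioo 0 S.T) := integrableOn_continuousOn_mul (continuous_exp_φ S s _).continuousOn
          (memL2_sq_integrable hμ)
    have b0 : ∫ t in Ioo 0 S.T, Real.exp (2 * s * S.φ t S.L) *
        (-cutTraj S z t (Fin.last N).castSucc / mesh S N - muData S ηM' w t) ^ 2 ≤
        ∫ t in Ioo 0 S.T, (2 * (Real.exp (2 * s * S.φ t S.L) * muData S ηM' W t ^ 2) +
          8 * Real.exp 2 * H ^ 2 * (S.L - S.x₀) ^ 2 * mesh S N * (CE * A)) := by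
      refine integral_mono_ae (integrableOn_J_flux hS hz s hμw)
        ((hfi.const_mul _).add (integrable_const _)) ?_
      filter_upwards [muData_eq hS (ηM' := ηM') hW hD hd hy,
        ae_Ioo_of_forall fun t ht => ht] with t hmu ht
      have htI := Ioo_subset_Icc_self ht
      rw [hmu]
      have e1 : -cutTraj S z t (Fin.last N).castSucc / mesh S N - (muData S ηM' W t
          - cut S t S.L * (z t (Fin.last N).castSucc / mesh S N)) =
          (cut S t S.L - cut S t (node S N (Fin.last N).castSucc))
            * (z t (Fin.last N).castSucc / mesh S N) - muData S ηM' W t := by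
        unfold cutTraj; ring
      rw [e1]
      have c1 := flux_cut_error_le hS hH h1 hs hsh z a (hd.z_right t htI)
      have c2 := mul_le_mul_of_nonneg_left (hexpE t htI)
        (by positivity : 0 ≤ 8 * Real.exp 2 * H ^ 2 * (S.L - S.x₀) ^ 2 * mesh S N)
      generalize (cut S t S.L - cut S t (node S N (Fin.last N).castSucc))
            * (z t (Fin.last N).castSucc / mesh S N) = x at *
      have c3 := mul_nonneg (Real.exp_pos (2 * s * S.φ t S.L)).le
        (sq_nonneg (x + muData S ηM' W t))
      linarith only [c1, c2, c3]
    rw [integral_add (hfi.const_mul _) (integrable_const _), integral_const_mul, hvol] at b0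
    exact b0
  -- In `𝒪` one has `φ < 0`, so the cut-off vanishes.
  have T3 : ∫ t in Ioo 0 S.T, (sumInner S fun i : Fin N =>
      S.O.indicator 1 (t, node S N (innerIdx i)) *
        (Real.exp (2 * s * S.φ t (node S N (innerIdx i))) *
          cutTraj S z t (innerIdx i) ^ 2)) = 0 := by
    have e1 : ∀ t, (sumInner S fun i : Fin N => S.O.indicator (1 : ℝ × ℝ → ℝ) (t, node S N (innerIdx i)) *
        (Real.exp (2 * s * S.φ t (node S N (innerIdx i))) *
          cutTraj S z t (innerIdx i) ^ 2)) = 0 := fun t => by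
      unfold sumInner
      refine mul_eq_zero_of_right _ (Finset.sum_eq_zero fun i _ => ?_)
      by_cases hm : (t, node S N (innerIdx i)) ∈ S.O
      · have hφ : S.φ t (node S N (innerIdx i)) ≤ 0 := by
          have g1 := hm.2.2
          have g2 := hm.1.1
          simp only at g1 g2
          unfold Setup.φ
          have g3 := pow_le_pow_left₀ (abs_nonneg _) g1.le 2
          have g4 : 0 ≤ S.β * (1 - S.β) * t ^ 2 :=
            mul_nonneg (mul_nonneg hS.β_pos.le (by linarith [hS.β_lt_one])) (sq_nonneg _)
          linarith only [g3, g4]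
        have : cutTraj S z t (innerIdx i) = 0 := by
          unfold cutTraj cut; rw [hS.η_zero _ hφ, zero_mul]
        rw [this]; ring
      · rw [indicator_of_notMem hm, zero_mul]
    simp only [e1, integral_zero]
  -- The fourth residual is exactly that of the reference solution `W`.
  have T4 : mesh S N ^ 2 * ∫ t in Ioo 0 S.T, (sumLeft S fun i : Fin (N + 1) =>
      Real.exp (2 * s * S.φ t (node S N i.castSucc)) *
        (dt S.T (fun τ => dPlus S (cutTraj S z τ) i) t - nuData S w t i) ^ 2) = hfDefect S s W := by
    unfold hfDefect
    rw [← integral_const_mul]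
    refine integral_congr_ae ?_
    filter_upwards [ae_all_iff.mpr fun i => nuData_eq hS hw hW hd hy hreg i] with t ht
    rw [← sumLeft_mul_left]
    congr 1; ext i
    rw [ht i]; ring
  unfold J
  rw [T3]
  have hs2 : 0 ≤ s / 2 := by linarith
  have b2 := mul_le_mul_of_nonneg_left T2 hs2
  have b4 : s * mesh S N ^ 2 / 2 * ∫ t in Ioo 0 S.T, (sumLeft S fun i : Fin (N + 1) =>
      Real.exp (2 * s * S.φ t (node S N i.castSucc)) *
        (dt S.T (fun τ => dPlus S (cutTraj S z τ) i) t - nuData S w t i) ^ 2) =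
      s / 2 * hfDefect S s W := by rw [← T4]; ring
  have b3 := mul_le_mul_of_nonneg_left hsh
    (by positivity : 0 ≤ 2 * Real.exp 2 * H ^ 2 * (S.L - S.x₀) * S.T * (CE * A))
  rw [b4]
  linarith only [T1, b2, b3]

/-! ### Well-posedness of the algorithm -/

section Functional

variable {S : Setup} (hS : S.Admissible) {N : ℕ} {s : ℝ} {q : Fin N → ℝ}

include hS in
theorem J_nonneg (hs : 0 ≤ s) (μ : ℝ → ℝ) (g : ℝ → Fin N → ℝ) (ν : ℝ → Fin (N + 1) → ℝ)
    (z : ℝ → Fin (N + 2) → ℝ) : 0 ≤ J S s q μ g ν z := by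
  have h1 : 0 ≤ ∫ t in Ioo 0 S.T, sumInner S fun i : Fin N =>
      Real.exp (2 * s * S.φ t (node S N (innerIdx i))) * (waveOp S q z t i - g t i) ^ 2 :=
    integral_nonneg fun t => sumInner_nonneg hS fun i => by positivity
  have h2 : 0 ≤ ∫ t in Ioo 0 S.T,
      Real.exp (2 * s * S.φ t S.L) * (-z t (Fin.last N).castSucc / mesh S N - μ t) ^ 2 :=
    integral_nonneg fun t => by positivity
  have h3 : 0 ≤ ∫ t in Ioo 0 S.T, sumInner S fun i : Fin N =>
      S.O.indicator 1 (t, node S N (innerIdx i)) *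
        (Real.exp (2 * s * S.φ t (node S N (innerIdx i))) * z t (innerIdx i) ^ 2) :=
    integral_nonneg fun t => sumInner_nonneg hS fun i =>
      mul_nonneg (indicator_nonneg (by simp) _) (by positivity)
  have h4 : 0 ≤ ∫ t in Ioo 0 S.T, sumLeft S fun i : Fin (N + 1) =>
      Real.exp (2 * s * S.φ t (node S N i.castSucc)) *
        (dt S.T (fun τ => dPlus S (z τ) i) t - ν t i) ^ 2 :=
    integral_nonneg fun t => sumLeft_nonneg hS fun i => by positivity
  unfold J
  positivity

theorem J_congr {μ μ' : ℝ → ℝ} {ν ν' : ℝ → Fin (N + 1) → ℝ} (g : ℝ → Fin N → ℝ)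
    (hμ : ∀ t ∈ Ioo 0 S.T, μ t = μ' t) (hν : ∀ t ∈ Ioo 0 S.T, ν t = ν' t)
    (z : ℝ → Fin (N + 2) → ℝ) : J S s q μ g ν z = J S s q μ' g ν' z := by
  have h1 : ∫ t in Ioo 0 S.T,
      Real.exp (2 * s * S.φ t S.L) * (-z t (Fin.last N).castSucc / mesh S N - μ t) ^ 2 =
      ∫ t in Ioo 0 S.T,
      Real.exp (2 * s * S.φ t S.L) * (-z t (Fin.last N).castSucc / mesh S N - μ' t) ^ 2 :=
    setIntegral_congr_fun measurableSet_Ioo fun t ht => by rw [hμ t ht]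
  have h2 : ∫ t in Ioo 0 S.T, sumLeft S (fun i : Fin (N + 1) =>
      Real.exp (2 * s * S.φ t (node S N i.castSucc)) *
        (dt S.T (fun τ => dPlus S (z τ) i) t - ν t i) ^ 2) =
      ∫ t in Ioo 0 S.T, sumLeft S fun i : Fin (N + 1) =>
      Real.exp (2 * s * S.φ t (node S N i.castSucc)) *
        (dt S.T (fun τ => dPlus S (z τ) i) t - ν' t i) ^ 2 :=
    setIntegral_congr_fun measurableSet_Ioo fun t ht => by rw [hν t ht]
  unfold J
  rw [h1, h2]

end Functional

section Iteration

variable {S : Setup} (hS : S.Admissible) {N : ℕ} {D : DiscData N}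

include hS in
theorem IsDiscSolution.unique {q : Fin N → ℝ} {w w' : ℝ → Fin (N + 2) → ℝ}
    (hw : IsDiscSolution S D q w) (hw' : IsDiscSolution S D q w') {t : ℝ} (ht : t ∈ Icc 0 S.T) :
    w t = w' t := by
  have hT := hS.T_pos
  have hh := mesh_pos hS N
  obtain ⟨z, a, hd, hy⟩ := hw.exists_diffSystem hS hw'
  have hbd : ∀ f : Fin N → ℝ, ∀ i, |f i| ≤ ∑ i, |f i| := fun f i =>
    Finset.single_le_sum (f := fun i => |f i|) (fun i _ => abs_nonneg _) (Finset.mem_univ i)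
  have hz : ∀ i, ∀ t ∈ Icc 0 S.T, z t (innerIdx i) = 0 := fun i t ht => by
    have h1 := hd.energy_le hS (hbd q) (Finset.sum_nonneg fun i _ => abs_nonneg _) (hbd D.w₀)
      le_rfl ht
    have h2 : sumInner S (fun i => (q - q) i ^ 2) = 0 := by simp [sumInner]
    rw [h2, mul_zero] at h1
    have h3 : 0 ≤ sumLeft S fun i : Fin (N + 1) => dPlus S (z t) i ^ 2 :=
      sumLeft_nonneg hS fun i => sq_nonneg _
    have h4 : mesh S N * (a t (innerIdx i) ^ 2 + z t (innerIdx i) ^ 2) ≤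
        sumInner S fun i : Fin N => a t (innerIdx i) ^ 2 + z t (innerIdx i) ^ 2 :=
      mul_le_mul_of_nonneg_left (Finset.single_le_sum
        (f := fun i : Fin N => a t (innerIdx i) ^ 2 + z t (innerIdx i) ^ 2)
        (fun i _ => by positivity) (Finset.mem_univ i)) hh.le
    unfold energy at h1
    have h5 : a t (innerIdx i) ^ 2 + z t (innerIdx i) ^ 2 ≤ 0 := by
      by_contra! h
      have := mul_pos hh h
      linarith
    exact pow_eq_zero_iff two_ne_zero |>.mp (le_antisymm (by nlinarith [sq_nonneg (a t (innerIdx i))])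
      (sq_nonneg _))
  funext j
  refine mesh_cases (p := fun j => w t j = w' t j) ?_ (fun i => ?_) ?_ j
  · rw [hw.left t ht, hw'.left t ht]
  · have hc := (convex_Icc (0 : ℝ) S.T).norm_image_sub_le_of_norm_hasDerivWithin_le (C := 0)
      (fun t ht => hy (innerIdx i) t ht) (fun t ht => by rw [hz i t ht, norm_zero])
      (left_mem_Icc.mpr hT.le) ht
    rw [hw.init₀, hw'.init₀, zero_mul, sub_self, sub_zero] at hc
    exact sub_eq_zero.mp (norm_le_zero_iff.mp hc)
  · rw [hw.right t ht, hw'.right t ht]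

variable {ηM' : ℝ → ℝ} {s : ℝ} {Q : Fin N → ℝ} {W : ℝ → Fin (N + 2) → ℝ}

include hS in
/-- The regularity of the data of the functional transfers from the reference solution `W` to the
solution for any other potential. -/
theorem stepWellPosed (hN : 1 ≤ N) (hD : D.Regular S) (hW : IsDiscSolution S D Q W)
    (hreg : ∀ i, MemH1 S.T (cutoffGrad S W i)) (hM : MemL2 S.T ηM') (hs : 0 < s)
    (q : Fin N → ℝ) : StepWellPosed S D ηM' s q where
  exists_sol := exists_discSolution hS hD q
  unique_sol _ _ hw hw' _ ht := hw.unique hS hw' ht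
  mu_mem _ hw := memL2_muData hS hN hw hD (memH1_cutoffGrad hS hw hW hreg) hM
  nu_mem _ hw := memH1_cutoffGrad hS hw hW hreg
  exists_min _ hw := exists_minimizer hS q hs
    (memL2_muData hS hN hw hD (memH1_cutoffGrad hS hw hW hreg) hM)
    fun i => (memH1_cutoffGrad hS hw hW hreg i).2
  unique_min _ hw _ _ hZ hZ' _ ht := IsMinimizer.unique hS q hs
    (memL2_muData hS hN hw hD (memH1_cutoffGrad hS hw hW hreg) hM)
    (fun i => (memH1_cutoffGrad hS hw hW hreg i).2) hZ hZ' ht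

variable {m : ℝ}

theorem StepWellPosed.exists_isStep {q : Fin N → ℝ} (h : StepWellPosed S D ηM' s q) :
    ∃ q', IsStep S m D ηM' s q q' := by
  obtain ⟨w, hw⟩ := h.exists_sol
  obtain ⟨Z, hZ⟩ := h.exists_min w hw
  exact ⟨_, w, Z, hw, hZ, fun _ => rfl⟩

include hS in
theorem StepWellPosed.isStep_unique {q q₁ q₂ : Fin N → ℝ} (h : StepWellPosed S D ηM' s q)
    (h₁ : IsStep S m D ηM' s q q₁) (h₂ : IsStep S m D ηM' s q q₂) : q₁ = q₂ := by
  obtain ⟨w, Z, hw, hZ, e₁⟩ := h₁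
  obtain ⟨w', Z', hw', hZ', e₂⟩ := h₂
  have hww : ∀ t ∈ Icc 0 S.T, w' t = w t := h.unique_sol w' w hw' hw
  have hμ : ∀ t ∈ Ioo 0 S.T, muData S ηM' w' t = muData S ηM' w t := fun t ht => by
    unfold muData
    rw [dt_congr (g := fun τ => dPlus S (w τ) (Fin.last N)) (fun r hr => by rw [hww r hr])
      (Ioo_subset_Icc_self ht)]
  have hν : ∀ t ∈ Ioo 0 S.T, nuData S w' t = nuData S w t := fun t ht => by
    funext i
    unfold nuData
    refine dt_congr (fun r hr => ?_) (Ioo_subset_Icc_self ht)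
    unfold cutoffGrad
    congr 1
    funext j
    rw [dt_congr (g := fun τ => w τ j) (fun r hr => by rw [hww r hr]) hr]
  have hZ'' : IsMinimizer S s q (muData S ηM' w) 0 (nuData S w) Z' :=
    ⟨hZ'.1, fun z hz => by rw [← J_congr 0 hμ hν, ← J_congr 0 hμ hν]; exact hZ'.2 z hz⟩
  have hZZ := h.unique_min w hw Z Z' hZ hZ''
  funext i
  rw [e₁, e₂, dt_congr (g := fun t => Z' t (innerIdx i)) (fun r hr => by rw [hZZ r hr])
    (left_mem_Icc.mpr hS.T_pos.le)]

theorem abs_trunc_le (hm : 0 ≤ m) (x : ℝ) : |trunc m x| ≤ m := by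
  unfold trunc
  split_ifs with h
  · exact h
  · rw [abs_mul, abs_of_nonneg hm]
    refine mul_le_of_le_one_left hm ?_
    rcases Real.sign_apply_eq x with h | h | h <;> rw [h] <;> simp

theorem trunc_eq_max_min (hm : 0 ≤ m) (x : ℝ) : trunc m x = max (-m) (min m x) := by
  unfold trunc
  split_ifs with h
  · rw [abs_le] at h
    rw [min_eq_right h.2, max_eq_right h.1]
  · rw [abs_le, not_and_or, not_le, not_le] at h
    rcases h with h | h
    · rw [Real.sign_of_neg (by linarith), min_eq_right (by linarith), max_eq_left h.le]; ring
    · rw [Real.sign_of_pos (by linarith), min_eq_left h.le, max_eq_right (by linarith)]; ring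

theorem abs_trunc_sub_le (hm : 0 ≤ m) {x y : ℝ} (hy : |y| ≤ m) :
    |trunc m x - y| ≤ |x - y| := by
  have e : y = max (-m) (min m y) := by rw [← trunc_eq_max_min hm, trunc, if_pos hy]
  conv_lhs => rw [trunc_eq_max_min hm, e]
  refine (abs_max_sub_max_le_max _ _ _ _).trans (max_le (by simp) ?_)
  exact (abs_min_sub_min_le_max _ _ _ _).trans (max_le (by simp) le_rfl)

theorem IsRun.abs_le {q : ℕ → Fin N → ℝ} (hm : 0 ≤ m) (h : IsRun S m D ηM' s q) (k : ℕ)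
    (i : Fin N) : |q k i| ≤ m := by
  cases k with
  | zero => rw [h.1]; simpa using hm
  | succ k =>
    obtain ⟨w, Z, -, -, e⟩ := h.2 k
    rw [e]; exact abs_trunc_le hm _

include hS in
theorem existsUnique_isRun (h : ∀ q, StepWellPosed S D ηM' s q) :
    ∃! q : ℕ → Fin N → ℝ, IsRun S m D ηM' s q := by
  choose F hF using fun q => (h q).exists_isStep (m := m)
  refine ⟨fun k => Nat.rec 0 (fun _ => F) k, ⟨rfl, fun k => hF _⟩, fun q hq => funext fun k => ?_⟩
  induction k with
  | zero => exact hq.1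
  | succ k ih =>
    refine (h (q k)).isStep_unique hS (hq.2 k) ?_
    rw [ih]; exact hF _

end Iteration

/-! ### One step of the algorithm -/

section OneStep

variable {S : Setup} (hS : S.Admissible) {N : ℕ}
include hS

theorem dt_sub_of_memTraj {z v : ℝ → Fin (N + 2) → ℝ} (hz : MemTraj S z) (hv : MemTraj S v)
    (j : Fin (N + 2)) {t : ℝ} (ht : t ∈ Icc 0 S.T) : dt S.T (fun t => (z - v) t j) t =
      dt S.T (fun t => z t j) t - dt S.T (fun t => v t j) t :=
  dt_eq_of_hasDerivWithinAt hS.T_pos ht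
    ((hz.hasDerivWithinAt hS j ht).fun_sub (hv.hasDerivWithinAt hS j ht))

theorem hfDefect_nonneg (s : ℝ) (W : ℝ → Fin (N + 2) → ℝ) : 0 ≤ hfDefect S s W :=
  integral_nonneg fun t => sumLeft_nonneg hS fun i => by positivity

omit hS in
theorem fluxDefect_nonneg (s : ℝ) (ηM' : ℝ → ℝ) (W : ℝ → Fin (N + 2) → ℝ) :
    0 ≤ fluxDefect S s ηM' W :=
  integral_nonneg fun t => by positivity

/-- The error after one step is controlled by the value of the functional at the localized
difference `cutTraj S z` of the solutions with potentials `q` and `Q`: its initial velocity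
is `(Q - q) w₀`, so the Carleman estimate applies to its difference with the minimizer. -/
theorem wNormSq_trunc_le {D : DiscData N} {m s α : ℝ} (hm : 0 ≤ m)
    (hr : Regime (-S.x₀) S.L S.β S.T m s (mesh S N)) (hα : 0 < α) (hw₀ : ∀ i, α ≤ |D.w₀ i|)
    {q q' Q : Fin N → ℝ} (hq : ∀ i, |q i| ≤ m) (hQ : ∀ i, |Q i| ≤ m)
    {X : Fin N → ℝ → ℝ} {z a : ℝ → Fin (N + 2) → ℝ} (hd : DiffSystem S q (Q - q) D.w₀ X z a)
    {μ : ℝ → ℝ} {ν : ℝ → Fin (N + 1) → ℝ} (hμ : MemL2 S.T μ)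
    (hν : ∀ i, MemL2 S.T fun t => ν t i) {Z : ℝ → Fin (N + 2) → ℝ}
    (hZ : IsMinimizer S s q μ 0 ν Z)
    (hq' : ∀ i, q' i = trunc m (q i + dt S.T (fun t => Z t (innerIdx i)) 0 / D.w₀ i)) :
    wNormSq S s (q' - Q) ≤
      2 * carlC S / ((1 - S.β) * α ^ 2) / √s * J S s q μ 0 ν (cutTraj S z) := by
  have hs : 0 < s := zero_lt_one.trans_le hr.one_le_s
  have hsq : 0 < √s := Real.sqrt_pos.mpr hs
  have hβ : 0 < 1 - S.β := by linarith [hS.β_lt_one]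
  have h0 : (0 : ℝ) ∈ Icc 0 S.T := left_mem_Icc.mpr hS.T_pos.le
  have hc : 0 ≤ carlC S := by
    have := hS.L_pos; have := hS.x₀_neg
    have : 0 ≤ 32 * (S.L - S.x₀) := by linarith
    unfold carlC; positivity
  have hzt := hd.memTraj_cutTraj hS
  have hζ : MemTraj S (Z - cutTraj S z) := (trajSpace hS N).sub_mem hZ.1 hzt
  have hJ : J S s q 0 0 0 (Z - cutTraj S z) ≤ J S s q μ 0 ν (cutTraj S z) := by
    have := IsMinimizer.pythagoras hS q hs hμ hν hZ hzt
    linarith [J_nonneg hS (q := q) hs.le μ 0 ν Z]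
  have hcarl := carleman_initial_velocity hS hr hq hζ
  have hpt : wNormSq S s (q' - Q) ≤ 1 / α ^ 2 * sumInner S (fun i : Fin N =>
      Real.exp (2 * s * S.φ 0 (node S N (innerIdx i))) *
        dt S.T (fun t => (Z - cutTraj S z) t (innerIdx i)) 0 ^ 2) := by
    unfold wNormSq
    rw [← sumInner_mul_left]
    refine sumInner_le hS fun i => ?_
    have hw : 0 < |D.w₀ i| := hα.trans_le (hw₀ i)
    have hw' : D.w₀ i ≠ 0 := abs_pos.mp hw
    have e1 : q i + dt S.T (fun t => Z t (innerIdx i)) 0 / D.w₀ i - Q i =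
        dt S.T (fun t => (Z - cutTraj S z) t (innerIdx i)) 0 / D.w₀ i := by
      rw [dt_sub_of_memTraj hS hZ.1 hzt _ h0, hd.dt_cutTraj_zero hS, Pi.sub_apply]
      field_simp
      ring
    have e2 : (q' - Q) i ^ 2 ≤
        1 / α ^ 2 * dt S.T (fun t => (Z - cutTraj S z) t (innerIdx i)) 0 ^ 2 := by
      have h1 := abs_trunc_sub_le hm (x := q i + dt S.T (fun t => Z t (innerIdx i)) 0 / D.w₀ i)
        (hQ i)
      rw [e1, ← hq'] at h1
      have h2 := pow_le_pow_left₀ (abs_nonneg _) h1 2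
      rw [sq_abs, sq_abs, div_pow, ← sq_abs (D.w₀ i)] at h2
      refine h2.trans ?_
      rw [one_div_mul_eq_div]
      exact div_le_div_of_nonneg_left (sq_nonneg _) (by positivity)
        (pow_le_pow_left₀ hα.le (hw₀ i) 2)
    calc _ ≤ Real.exp (2 * s * S.φ 0 (node S N (innerIdx i))) *
          (1 / α ^ 2 * dt S.T (fun t => (Z - cutTraj S z) t (innerIdx i)) 0 ^ 2) :=
          mul_le_mul_of_nonneg_left e2 (Real.exp_pos _).le
      _ = _ := by ring
  set I := sumInner S (fun i : Fin N =>
      Real.exp (2 * s * S.φ 0 (node S N (innerIdx i))) *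
        dt S.T (fun t => (Z - cutTraj S z) t (innerIdx i)) 0 ^ 2)
  set E := J S s q μ 0 ν (cutTraj S z)
  have h3 : (1 - S.β) * √s / 2 * I ≤ carlC S * E :=
    hcarl.trans (mul_le_mul_of_nonneg_left hJ hc)
  have h4 : I ≤ 2 * carlC S / ((1 - S.β) * √s) * E := by
    rw [div_mul_eq_mul_div, le_div_iff₀ (by positivity)]
    linarith only [h3]
  calc wNormSq S s (q' - Q) ≤ 1 / α ^ 2 * I := hpt
    _ ≤ 1 / α ^ 2 * (2 * carlC S / ((1 - S.β) * √s) * E) :=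
        mul_le_mul_of_nonneg_left h4 (by positivity)
    _ = _ := by field_simp

omit hS in
theorem wNormSq_nonneg (hS : S.Admissible) (s : ℝ) (q : Fin N → ℝ) : 0 ≤ wNormSq S s q :=
  sumInner_nonneg hS fun i => by positivity

end OneStep

/-- A recursive inequality with contraction factor at most `1/2`. -/
theorem le_geometric_add {a : ℕ → ℝ} {c e : ℝ} (hc : c ≤ 1 / 2) (he : 0 ≤ e) (ha : ∀ k, 0 ≤ a k)
    (h : ∀ k, a (k + 1) ≤ c * a k + e) (k : ℕ) : a k ≤ 1 / 2 ^ k * a 0 + 2 * e := by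
  induction k with
  | zero => simpa using he
  | succ k ih =>
    have h1 := mul_le_mul_of_nonneg_right hc (ha k)
    calc a (k + 1) ≤ 1 / 2 * a k + e := by linarith [h k]
      _ ≤ 1 / 2 * (1 / 2 ^ k * a 0 + 2 * e) + e := by linarith
      _ = 1 / 2 ^ (k + 1) * a 0 + 2 * e := by rw [pow_succ]; field_simp; ring

/-! ### Consistency errors -/

section Consistency

variable {S : Setup} (hS : S.Admissible) {N : ℕ}
include hS

theorem exp_φ_le {s : ℝ} (hs : 0 ≤ s) (t : ℝ) {x : ℝ} (hx : 0 ≤ x) (hxL : x ≤ S.L) :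
    Real.exp (2 * s * S.φ t x) ≤ Real.exp (2 * s * (S.L - S.x₀) ^ 2) := by
  refine Real.exp_le_exp.mpr (mul_le_mul_of_nonneg_left ?_ (by linarith))
  rw [φ_eq]
  have h1 : (x - S.x₀) ^ 2 ≤ (S.L - S.x₀) ^ 2 :=
    pow_le_pow_left₀ (by linarith [hS.x₀_neg]) (by linarith) 2
  have h2 : 0 ≤ S.β * t ^ 2 := mul_nonneg hS.β_pos.le (sq_nonneg t)
  linarith

theorem fluxDefect_le {s : ℝ} (hs : 0 ≤ s) {ηM' : ℝ → ℝ} {W : ℝ → Fin (N + 2) → ℝ}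
    (hμ : MemL2 S.T (muData S ηM' W)) : fluxDefect S s ηM' W ≤
      Real.exp (2 * s * (S.L - S.x₀) ^ 2) * ∫ t in Ioo 0 S.T, muData S ηM' W t ^ 2 := by
  unfold fluxDefect
  rw [← integral_const_mul]
  refine integral_mono (integrableOn_continuousOn_mul (continuous_exp_φ S s _).continuousOn
    (memL2_sq_integrable hμ)) ((memL2_sq_integrable hμ).const_mul _) fun t => ?_
  exact mul_le_mul_of_nonneg_right (exp_φ_le hS hs t hS.L_pos.le le_rfl) (sq_nonneg _)

theorem hfDefect_le {s : ℝ} (hs : 0 ≤ s) {W : ℝ → Fin (N + 2) → ℝ}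
    (hreg : ∀ i, MemH1 S.T (cutoffGrad S W i)) : hfDefect S s W ≤
      Real.exp (2 * s * (S.L - S.x₀) ^ 2) *
        ∫ t in Ioo 0 S.T, sumLeft S fun i => (mesh S N * nuData S W t i) ^ 2 := by
  have h1 : ∀ i, IntegrableOn (fun t => (mesh S N * nuData S W t i) ^ 2) (Ioo 0 S.T) := fun i =>
    memL2_sq_integrable (memL2_const_mul (mesh S N) (hreg i).2)
  unfold hfDefect
  rw [← integral_const_mul]
  refine integral_mono (integrableOn_sumLeft fun i => integrableOn_continuousOn_mul
    (continuous_exp_φ S s _).continuousOn (h1 i)) ((integrableOn_sumLeft h1).const_mul _) fun t => ?_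
  beta_reduce
  rw [← sumLeft_mul_left]
  exact sumLeft_le hS fun i => mul_le_mul_of_nonneg_right
    (exp_φ_le hS hs t (node_nonneg hS _) (node_le S hS _)) (sq_nonneg _)

end Consistency

end WaveRecovery

theorem theorem4p2
    (S : Setup) (hS : S.Admissible) (m : ℝ) (hm : 0 < m)
    -- the continuous problem, its solution `W[Q]`, and the measured flux
    (d : ContData) (hd : d.Regular S m)
    (U Ut Ux : ℝ → Lp ℝ 2 (μΩ S.L)) (hU : IsWaveSolution S d U Ut Ux)
    (hUreg : ∫⁻ t in Ioo 0 S.T,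
      (eLpNorm (U t) ⊤ (μΩ S.L) ^ 2 + eLpNorm (Ut t) ⊤ (μΩ S.L) ^ 2) < ⊤)
    (hpos : ∃ α > 0, ∀ᵐ x ∂(μΩ S.L), α ≤ |d.w₀ x|)
    (M : ℝ → ℝ) (hM : IsFluxAtL S d U Ut Ux M)
    (ηM' : ℝ → ℝ) (hM' : IsCutoffDeriv S M ηM')
    -- the discrete data
    (D : ∀ N, DiscData N) (hD : ∀ N, (D N).Regular S)
    (hw₀ : ∃ α > 0, ∀ N, ∀ i, α ≤ |(D N).w₀ i|)
    (hw₀b : ∃ R : ℝ, ∀ N, ∀ i, |(D N).w₀ i| ≤ R)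
    -- the discrete potentials and their consistency
    (Q : ∀ N, Fin N → ℝ) (hQ : ∀ N, ∀ i, |Q N i| ≤ m)
    (hQlim : Tendsto (fun N => eLpNorm (fun x => pcExt S (Q N) x - d.Q x) 2 (μΩ S.L)) atTop (𝓝 0))
    (W : ∀ N, ℝ → Fin (N + 2) → ℝ) (hW : ∀ N, IsDiscSolution S (D N) (Q N) (W N))
    (hWbdd : ∃ K : ℝ, ∀ N,
      ∫ t in Ioo 0 S.T, (⨆ i : Fin N, |dt S.T (fun τ => W N τ (innerIdx i)) t|) ^ 2 ≤ K)
    (hWflux : Tendsto (fun N => ∫ t in Ioo 0 S.T, muData S ηM' (W N) t ^ 2) atTop (𝓝 0))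
    (hWreg : ∀ N, ∀ i, MemH1 S.T (cutoffGrad S (W N) i))
    (hWhf : Tendsto (fun N => ∫ t in Ioo 0 S.T,
      sumLeft S fun i => (mesh S N * nuData S (W N) t i) ^ 2) atTop (𝓝 0)) :
    ∃ C₀ > 0, ∃ C₁ > 0, ∃ s₀ > 0, ∃ ε₀ > 0, ∃ N₀ : ℕ,
      -- well-posedness of the algorithm
      (∀ N ≥ N₀, ∀ s > 0,
        (∀ q : Fin N → ℝ, (∀ i, |q i| ≤ m) → StepWellPosed S (D N) ηM' s q) ∧
        ∃! q : ℕ → Fin N → ℝ, IsRun S m (D N) ηM' s q) ∧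
      -- one-step estimate
      (∀ N ≥ N₀, ∀ s ≥ s₀, s * mesh S N ≤ ε₀ →
        ∀ q : ℕ → Fin N → ℝ, IsRun S m (D N) ηM' s q → ∀ k,
          wNormSq S s (q (k + 1) - Q N) ≤
            C₀ / √s * wNormSq S s (q k - Q N)
            + C₁ * √s * hfDefect S s (W N) + C₁ * √s * fluxDefect S s ηM' (W N)) ∧
      -- estimate of the iterates, which enter a neighborhood of the discrete potential
      (∀ N ≥ N₀, ∀ s ≥ 4 * C₀ ^ 2, s * mesh S N ≤ ε₀ →
        ∀ q : ℕ → Fin N → ℝ, IsRun S m (D N) ηM' s q →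
          (∀ k, wNormSq S s (q k - Q N) ≤
            1 / 2 ^ k * wNormSq S s (Q N)
            + 2 * C₁ * √s * hfDefect S s (W N) + 2 * C₁ * √s * fluxDefect S s ηM' (W N)) ∧
          ∀ r > 2 * C₁ * √s * hfDefect S s (W N) + 2 * C₁ * √s * fluxDefect S s ηM' (W N),
            ∀ᶠ k in atTop, wNormSq S s (q k - Q N) < r) ∧
      -- the size of this neighborhood goes to zero with the mesh size
      (∀ s > 0, Tendsto (fun N => 2 * C₁ * √s * hfDefect S s (W N)
        + 2 * C₁ * √s * fluxDefect S s ηM' (W N)) atTop (𝓝 0)) := by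
  obtain ⟨α, hα, hw₀⟩ := hw₀
  obtain ⟨R, hR⟩ := hw₀b
  obtain ⟨K, hK⟩ := hWbdd
  obtain ⟨H, hH, hη₁, hη₂⟩ := exists_cutoff_bound hS
  have hL := hS.L_pos
  have hx₀ := hS.x₀_neg
  have hT := hS.T_pos
  have hβ : 0 < 1 - S.β := by linarith [hS.β_lt_one]
  obtain ⟨s₀, hs₀, ε₀, hε₀, hreg⟩ := exists_regime hm.le (neg_pos.mpr hx₀) hL hS.β_pos hS.β_lt_one hT
    (by linarith [hS.time_cond] : -S.x₀ + S.L < S.β * S.T)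
  have hK0 : 0 ≤ K := (integral_nonneg fun t => sq_nonneg _).trans (hK 0)
  -- `E` is the constant of the energy estimate, `A` bounds the functional at the localized
  -- difference, and `B` comes from the Carleman estimate.
  set E := Real.exp ((m + 2) * S.T) * (R ^ 2 + K) with hE
  have hE0 : 0 ≤ E := by positivity
  set A := K + (8 * commC S H ^ 2 + 2 * H ^ 2 * (S.L - S.x₀)) * Real.exp 2 * S.T * E with hA
  have hA0 : 0 ≤ A := by
    have : 0 ≤ S.L - S.x₀ := by linarith
    positivity
  set B := 2 * carlC S / ((1 - S.β) * α ^ 2) with hB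
  have hB0 : 0 < B := by
    have : 0 ≤ 32 * (S.L - S.x₀) := by linarith
    unfold carlC at hB
    rw [hB]; positivity
  have hμ : ∀ N ≥ 1, MemL2 S.T (muData S ηM' (W N)) := fun N hN =>
    memL2_muData hS hN (hW N) (hD N) (hWreg N) hM'.1
  have hwp : ∀ N ≥ 1, ∀ s > 0, ∀ q : Fin N → ℝ, StepWellPosed S (D N) ηM' s q :=
    fun N hN s hs q => stepWellPosed hS hN (hD N) (hW N) (hWreg N) hM'.1 hs q
  have hstep : ∀ N ≥ 1, ∀ s ≥ s₀, s * mesh S N ≤ ε₀ →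
      ∀ q : ℕ → Fin N → ℝ, IsRun S m (D N) ηM' s q → ∀ k,
        wNormSq S s (q (k + 1) - Q N) ≤
          (A * B + s₀ + 1) / √s * wNormSq S s (q k - Q N)
          + B * √s * hfDefect S s (W N) + B * √s * fluxDefect S s ηM' (W N) := by
    intro N hN s hs hsh q hq k
    have hr := hreg s hs (mesh S N) (mesh_pos hS N) hsh
    have hs1 : 0 < s := zero_lt_one.trans_le hr.one_le_s
    have hsq : 0 < √s := Real.sqrt_pos.mpr hs1
    obtain ⟨w, Z, hw, hZ, hqZ⟩ := hq.2 k
    obtain ⟨z, a, hd, hy⟩ := hw.exists_diffSystem hS (hW N)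
    have hp := hwp N hN s hs1 (q k)
    have h1 := wNormSq_trunc_le hS hm.le hr hα (hw₀ N) (hq.abs_le hm.le k) (hQ N) hd
      (hp.mu_mem w hw) (fun i => (hp.nu_mem w hw i).2) hZ hqZ
    have h2 := J_cutTraj_le hS (hD N) hw (hW N) hd hy (hWreg N) (hμ N hN) (hp.mu_mem w hw)
      hs1.le (by have := hr.mesh_mul_le; linarith) hH hη₁ hη₂ hE0
      (fun t ht => hd.energy_le hS (hq.abs_le hm.le k) hm.le (hR N) (hK N) ht) (hK N)
    have h3 : wNormSq S s (Q N - q k) = wNormSq S s (q k - Q N) := by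
      unfold wNormSq
      congr 1
      funext i
      rw [Pi.sub_apply, Pi.sub_apply, ← neg_sub (q k i), neg_sq]
    rw [h3] at h2
    have hn := wNormSq_nonneg hS s (q k - Q N)
    have hf := hfDefect_nonneg hS s (W N)
    have e1 : B / √s * (A * wNormSq S s (q k - Q N) + s * fluxDefect S s ηM' (W N)
        + s / 2 * hfDefect S s (W N)) = A * B / √s * wNormSq S s (q k - Q N)
        + B * √s * fluxDefect S s ηM' (W N) + B * √s * hfDefect S s (W N) / 2 := by
      have : s = √s * √s := (Real.mul_self_sqrt hs1.le).symm
      field_simp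
      rw [Real.sq_sqrt hs1.le]
      ring
    have e2 : A * B / √s * wNormSq S s (q k - Q N) ≤
        (A * B + s₀ + 1) / √s * wNormSq S s (q k - Q N) :=
      mul_le_mul_of_nonneg_right (div_le_div_of_nonneg_right (by linarith) hsq.le) hn
    have e3 : 0 ≤ B * √s * hfDefect S s (W N) := by positivity
    have e4 := h1.trans (mul_le_mul_of_nonneg_left h2 (by positivity))
    linarith only [e1, e2, e3, e4]
  refine ⟨A * B + s₀ + 1, by positivity, B, hB0, s₀, hs₀, ε₀, hε₀, 1,
    fun N hN s hs => ⟨fun q _ => hwp N hN s hs q, existsUnique_isRun hS (hwp N hN s hs)⟩,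
    hstep, fun N hN s hs hsh q hq => ?_, fun s hs => ?_⟩
  · set C₀ := A * B + s₀ + 1 with hC₀
    have hAB : 0 ≤ A * B := by positivity
    have hC1 : s₀ + 1 ≤ C₀ := by linarith
    have hss : s₀ ≤ s := by nlinarith only [hs, hC1, hs₀]
    have hspos : 0 < s := hs₀.trans_le hss
    have hsq : 0 < √s := Real.sqrt_pos.mpr hspos
    have hc : C₀ / √s ≤ 1 / 2 := by
      have : 2 * C₀ ≤ √s := Real.le_sqrt_of_sq_le (by linarith only [hs])
      rw [div_le_iff₀ hsq]; linarith
    have he : 0 ≤ B * √s * hfDefect S s (W N) + B * √s * fluxDefect S s ηM' (W N) := by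
      have := hfDefect_nonneg hS s (W N)
      have := fluxDefect_nonneg (S := S) s ηM' (W N)
      positivity
    have main : ∀ k, wNormSq S s (q k - Q N) ≤ 1 / 2 ^ k * wNormSq S s (Q N)
        + 2 * B * √s * hfDefect S s (W N) + 2 * B * √s * fluxDefect S s ηM' (W N) := fun k => by
      have h1 := le_geometric_add (a := fun k => wNormSq S s (q k - Q N)) hc he
        (fun k => wNormSq_nonneg hS s _)
        (fun k => by linarith only [hstep N hN s hss hsh q hq k]) k
      have h2 : wNormSq S s (q 0 - Q N) = wNormSq S s (Q N) := by
        simp [wNormSq, hq.1]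
      beta_reduce at h1
      rw [h2] at h1
      linarith only [h1]
    refine ⟨main, fun r hr => ?_⟩
    have hlim : Tendsto (fun k : ℕ => 1 / 2 ^ k * wNormSq S s (Q N)
        + (2 * B * √s * hfDefect S s (W N) + 2 * B * √s * fluxDefect S s ηM' (W N))) atTop
        (𝓝 (0 * wNormSq S s (Q N)
          + (2 * B * √s * hfDefect S s (W N) + 2 * B * √s * fluxDefect S s ηM' (W N)))) := by
      refine Tendsto.add_const _ (Tendsto.mul_const _ ?_)
      simpa using tendsto_pow_atTop_nhds_zero_of_lt_one (r := (1 / 2 : ℝ)) (by norm_num) (by norm_num)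
    rw [zero_mul, zero_add] at hlim
    filter_upwards [hlim.eventually_lt_const hr] with k hk
    exact (main k).trans_lt (by linarith only [hk])
  · have hf : Tendsto (fun N => hfDefect S s (W N)) atTop (𝓝 0) := by
      have h := hWhf.const_mul (Real.exp (2 * s * (S.L - S.x₀) ^ 2))
      rw [mul_zero] at h
      exact squeeze_zero (fun N => hfDefect_nonneg hS s (W N))
        (fun N => hfDefect_le hS hs.le (hWreg N)) h
    have hg : Tendsto (fun N => fluxDefect S s ηM' (W N)) atTop (𝓝 0) := by
      have h := hWflux.const_mul (Real.exp (2 * s * (S.L - S.x₀) ^ 2))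
      rw [mul_zero] at h
      refine squeeze_zero' (Eventually.of_forall fun N => fluxDefect_nonneg s ηM' (W N)) ?_ h
      filter_upwards [eventually_ge_atTop 1] with N hN
      exact fluxDefect_le hS hs.le (hμ N hN)
    simpa using (hf.const_mul (2 * B * √s)).add (hg.const_mul (2 * B * √s))
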